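/- **Model.** Algorithms are randomized word-RAM programs with words of $O(\log n)$ bits, where $n$ is the size parameter of the input (the dimension of a matrix, the number of vertices of a graph); every instruction on words (arithmetic, bitwise operations, comparisons, indirect addressing, drawing a uniformly random word) takes one step, and time bounds hold for every outcome of the random words. **OMv conjecture.** In the problem OMv one is given a Boolean $n\times n$ matrix $M$, which may be preprocessed, and then Boolean vectors $v_1,\dots,v_n\in\{0,1\}^n$ one after the other; the Boolean product $Mv_i$ (with conjunctions and disjunctions) has to be output before $v_{i+1}$ becomes available. The conjecture says that for no constant $\delta>0$ there is an algorithm with total running time $O(n^{3-\delta})$ (preprocessing included) that on every input outputs all $n$ products correctly with error probability at most $1/3$. **Dynamic graph algorithms.** A dynamic algorithm first preprocesses a given, possibly non-empty, simple undirected initial graph $G$ on $n$ vertices, and then processes online a sequence of edge insertions, edge deletions (which change $G$) and queries about the current graph $G$. It is *incremental* if it has to support only insertions, *decremental* if it has to support only deletions, *partially dynamic* if it is incremental or decremental, and *fully dynamic* if it has to support both. Each query has to be answered with error probability at most $1/3$. Let $m$ denote the current number of edges (with $m$ replaced by $1$ if there are none). Preprocessing time is polynomial if it is bounded by a polynomial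 in $n$. Query times are worst-case. The update time is *amortized* $O(f(m))$ if there are a polynomial $p$ and a constant $C$ such that the preprocessing and all updates of any valid sequence of operations take total time at most $p(n)+\sum C f(m)$, where the sum is over the updates of the sequence. For a fixed graph $\mathcal P$ let $\mathbf c(G,\mathcal P)$ be the number of (not necessarily induced) subgraphs of $G$ that are isomorphic to $\mathcal P$, and for a vertex $s$ of $G$, fixed and given at the preprocessing, let $\mathbf c(G,\mathcal P,s)$ be the number of those that contain $s$. The *paw* is a triangle with one additional edge attached to one of its vertices, and the *diamond* is a $4$-cycle with one chord. **Theorem.** Assume the OMv conjecture. Consider any one of the following problems, in which a query asks 1. whether $\mathbf c(G,\mathcal P)>0$, where $\mathcal P$ is the paw, the diamond, the $4$-clique, or the $k$-cycle for some fixed $k\ge 3$; 2. whether $\mathbf c(G,\mathcal P,s)>0$, where $\mathcal P$ is the paw, the diamond, the $4$-clique, or the $k$-cycle for some fixed odd $k\ge 3$; 3. for the number $\mathbf c(G,\mathcal P)$, where $\mathcal P$ is the path of length $3$; 4. for the number $\mathbf c(G,\mathcal P,s)$, where $\mathcal P$ is the path of length $3$. Then for every $\delta>0$ there is no incremental and no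 decremental algorithm for the problem with polynomial preprocessing time, worst-case update time $O(m^{1/2-\delta})$ and query time $O(m^{1-\delta})$, and there is no fully dynamic algorithm for the problem with polynomial preprocessing time, amortized update time $O(m^{1/2-\delta})$ and query time $O(m^{1-\delta})$. -/

import Mathlib

/-! ### A randomized word-RAM -/

namespace WordRAM

/-- The arithmetic, bitwise and comparison instructions on words. -/
inductive BinOp
  | add | sub | mul | div | mod | and | or | xor | shl | shr | eq | lt

/-- The result of an instruction on `w`-bit words (arithmetic is modulo `2 ^ w`). -/
def BinOp.eval (w : ℕ) (o : BinOp) (a b : ℕ) : ℕ :=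
  (match o with
    | .add => a + b
    | .sub => a + (2 ^ w - b)
    | .mul => a * b
    | .div => a / b
    | .mod => a % b
    | .and => a &&& b
    | .or => a ||| b
    | .xor => a ^^^ b
    | .shl => a <<< b
    | .shr => a >>> b
    | .eq => if a = b then 1 else 0
    | .lt => if a < b then 1 else 0) % 2 ^ w

/-- Programs of the word-RAM. The letters `x y z` are (fixed) register numbers. A program is a
finite object, so that it mentions only constantly many registers and constants. -/
inductive Prog
  /-- no operation -/
  | skip
  /-- `x := k` -/
  | const (x k : ℕ)
  /-- `x := y o z` -/
  | bin (o : BinOp) (x y z : ℕ)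
  /-- `x := mem[y]` (indirect addressing) -/
  | load (x y : ℕ)
  /-- `mem[x] := y` (indirect addressing) -/
  | store (x y : ℕ)
  /-- `x := input[y]`, where the input of the current request is a read-only array -/
  | read (x y : ℕ)
  /-- `output[x] := y` -/
  | write (x y : ℕ)
  /-- `x :=` a fresh, uniformly random word -/
  | rand (x : ℕ)
  /-- run `p`, then `q` -/
  | seq (p q : Prog)
  /-- if `x ≠ 0` then `p` else `q` -/
  | ite (x : ℕ) (p q : Prog)
  /-- while `x ≠ 0` do `p` -/
  | loop (x : ℕ) (p : Prog)

/-- A memory state of the machine. `pos` is the number of random words drawn so far. -/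
structure State where
  reg : ℕ → ℕ
  mem : ℕ → ℕ
  out : ℕ → ℕ
  pos : ℕ

/-- The state in which a machine is started: everything is zero. -/
def State.zero : State := ⟨fun _ => 0, fun _ => 0, fun _ => 0, 0⟩

/-- Assign the value `a` to the register `x`. -/
def State.setReg (σ : State) (x a : ℕ) : State := { σ with reg := Function.update σ.reg x a }

/-- `Exec w ω inp p σ σ' t`: on `w`-bit words, with the sequence `ω` of random words and the
input array `inp`, the program `p` started in the state `σ` halts in the state `σ'` after exactly
`t` steps. -/
inductive Exec (w : ℕ) (ω : ℕ → Fin (2 ^ w)) (inp : ℕ → ℕ) : Prog → State → State → ℕ → Prop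
  | skip (σ : State) : Exec w ω inp .skip σ σ 1
  | const (σ : State) (x k : ℕ) : Exec w ω inp (.const x k) σ (σ.setReg x (k % 2 ^ w)) 1
  | bin (σ : State) (o : BinOp) (x y z : ℕ) :
      Exec w ω inp (.bin o x y z) σ (σ.setReg x (o.eval w (σ.reg y) (σ.reg z))) 1
  | load (σ : State) (x y : ℕ) : Exec w ω inp (.load x y) σ (σ.setReg x (σ.mem (σ.reg y))) 1
  | store (σ : State) (x y : ℕ) :
      Exec w ω inp (.store x y) σ
        { σ with mem := Function.update σ.mem (σ.reg x) (σ.reg y) } 1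
  | read (σ : State) (x y : ℕ) :
      Exec w ω inp (.read x y) σ (σ.setReg x (inp (σ.reg y) % 2 ^ w)) 1
  | write (σ : State) (x y : ℕ) :
      Exec w ω inp (.write x y) σ
        { σ with out := Function.update σ.out (σ.reg x) (σ.reg y) } 1
  | rand (σ : State) (x : ℕ) :
      Exec w ω inp (.rand x) σ { σ.setReg x (ω σ.pos : ℕ) with pos := σ.pos + 1 } 1
  | seq {p q : Prog} {σ σ' σ'' : State} {t t' : ℕ} :
      Exec w ω inp p σ σ' t → Exec w ω inp q σ' σ'' t' →
      Exec w ω inp (.seq p q) σ σ'' (t + t')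
  | ite_pos {x : ℕ} {p q : Prog} {σ σ' : State} {t : ℕ} :
      σ.reg x ≠ 0 → Exec w ω inp p σ σ' t → Exec w ω inp (.ite x p q) σ σ' (t + 1)
  | ite_neg {x : ℕ} {p q : Prog} {σ σ' : State} {t : ℕ} :
      σ.reg x = 0 → Exec w ω inp q σ σ' t → Exec w ω inp (.ite x p q) σ σ' (t + 1)
  | loop_done {x : ℕ} {p : Prog} {σ : State} :
      σ.reg x = 0 → Exec w ω inp (.loop x p) σ σ 1
  | loop_step {x : ℕ} {p : Prog} {σ σ' σ'' : State} {t t' : ℕ} :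
      σ.reg x ≠ 0 → Exec w ω inp p σ σ' t → Exec w ω inp (.loop x p) σ' σ'' t' →
      Exec w ω inp (.loop x p) σ σ'' (t + t' + 1)

/-- The word length `c * (⌊log₂ n⌋ + 1) = O(log n)` used for a problem of size `n`. -/
def wordSize (c n : ℕ) : ℕ := c * (Nat.log 2 n + 1)

/-- The distribution of a sequence of independent uniformly random `w`-bit words. -/
noncomputable def coins (w : ℕ) : MeasureTheory.Measure (ℕ → Fin (2 ^ w)) :=
  MeasureTheory.Measure.infinitePi
    fun _ : ℕ => (ProbabilityTheory.uniformOn Set.univ : MeasureTheory.Measure (Fin (2 ^ w)))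

/-- A request to an online computation: the program that serves it, and its input array. -/
abbrev Request := Prog × (ℕ → ℕ)

/-- Starting in the zero state, the machine serves the requests one after the other, all on the
same persistent memory: `σ i` is the state before request number `i`, and `t i` is the time
spent on it. Each request is served before the input of the next one becomes available. -/
def Serves (w : ℕ) (ω : ℕ → Fin (2 ^ w)) (reqs : List Request)
    (σ : ℕ → State) (t : ℕ → ℕ) : Prop :=
  σ 0 = State.zero ∧
    ∀ i (h : i < reqs.length), Exec w ω reqs[i].2 reqs[i].1 (σ i) (σ (i + 1)) (t i)

end WordRAM

/-! ### Online Boolean matrix-vector multiplication -/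

namespace OMv

open WordRAM

/-- An algorithm for the online problem: a program that receives the matrix, and a program that
receives a vector and has to output the product with the matrix. -/
structure Algorithm where
  prep : Prog
  mul : Prog

/-- The matrix as an input array: `n`, followed by the entries row by row. -/
noncomputable def matrixInput {n : ℕ} (M : Fin n → Fin n → Bool) : ℕ → ℕ := by
  classical
  exact fun a => if a = 0 then n else
    if ∃ i j : Fin n, a = 1 + i * n + j ∧ M i j = true then 1 else 0

/-- A vector as an input array. -/
def vectorInput {n : ℕ} (v : Fin n → Bool) : ℕ → ℕ :=
  fun a => if h : a < n then (v ⟨a, h⟩).toNat else 0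

/-- The Boolean matrix-vector product (conjunctions and disjunctions). -/
def boolMulVec {n : ℕ} (M : Fin n → Fin n → Bool) (v : Fin n → Bool) : Fin n → Bool :=
  fun i => decide (∃ j, M i j = true ∧ v j = true)

/-- First the matrix `M`, then the vectors `v 0, …, v (n - 1)`. -/
noncomputable def Algorithm.requests (A : Algorithm) {n : ℕ} (M : Fin n → Fin n → Bool)
    (v : Fin n → Fin n → Bool) : List Request :=
  (A.prep, matrixInput M) :: List.ofFn fun r => (A.mul, vectorInput (v r))

/-- `A` solves the problem in total time `T n` (preprocessing included) and with error probability
at most `1/3`, on words of `c * (⌊log₂ n⌋ + 1)` bits. -/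
def Algorithm.Solves (A : Algorithm) (c : ℕ) (T : ℕ → ℝ) : Prop :=
  ∀ (n : ℕ), 1 ≤ n → ∀ (M : Fin n → Fin n → Bool) (v : Fin n → Fin n → Bool),
    (∀ ω : ℕ → Fin (2 ^ wordSize c n), ∃ σ t, Serves (wordSize c n) ω (A.requests M v) σ t ∧
      ((∑ i ∈ Finset.range (n + 1), t i : ℕ) : ℝ) ≤ T n) ∧
    coins (wordSize c n) {ω | ¬ ∃ σ t, Serves (wordSize c n) ω (A.requests M v) σ t ∧
      ∀ r i : Fin n, (σ (r + 2)).out i = (boolMulVec M (v r) i).toNat} ≤ 1 / 3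

/-- The OMv conjecture: for no `δ > 0` is there an algorithm with total time `O(n ^ (3 - δ))`. -/
def Conjecture : Prop :=
  ∀ δ : ℝ, 0 < δ → ¬ ∃ (A : Algorithm) (c : ℕ) (C : ℝ),
    A.Solves c fun n => C * (n : ℝ) ^ (3 - δ)

end OMv

/-! ### Dynamic graph algorithms -/

namespace DynGraph

open WordRAM

/-- The operations on a dynamic graph with vertex set `Fin n`. -/
inductive Op (n : ℕ)
  | insert (u v : Fin n)
  | delete (u v : Fin n)
  | query

/-- The operation changes the graph. -/
def Op.IsUpdate {n : ℕ} : Op n → Prop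
  | .insert _ _ => True
  | .delete _ _ => True
  | .query => False

/-- The graph after an operation. -/
def Op.apply {n : ℕ} (G : SimpleGraph (Fin n)) : Op n → SimpleGraph (Fin n)
  | .insert u v => G ⊔ SimpleGraph.edge u v
  | .delete u v => G.deleteEdges {s(u, v)}
  | .query => G

/-- Partially dynamic means incremental (insertions only) or decremental (deletions only). -/
inductive Model
  | incremental
  | decremental
  | fullyDynamic

/-- The operation is possible in the graph `G` and permitted in the given model. -/
def Op.Valid {n : ℕ} (mode : Model) (G : SimpleGraph (Fin n)) : Op n → Prop
  | .insert u v => mode ≠ .decremental ∧ u ≠ v ∧ ¬ G.Adj u v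
  | .delete u v => mode ≠ .incremental ∧ G.Adj u v
  | .query => True

/-- The current graph after the first `i` operations. -/
def graphAt {n : ℕ} (G : SimpleGraph (Fin n)) (ops : List (Op n)) (i : ℕ) :
    SimpleGraph (Fin n) :=
  (ops.take i).foldl Op.apply G

/-- Every operation of the sequence is valid for the graph to which it is applied. -/
def ValidOps {n : ℕ} (mode : Model) (G : SimpleGraph (Fin n)) (ops : List (Op n)) : Prop :=
  ∀ i (h : i < ops.length), ops[i].Valid mode (graphAt G ops i)

/-- The current number `m` of edges after the first `i` operations, as a real number; the value
`0` is replaced by `1`, so that `O(m ^ a)` allows constant time on the empty graph. -/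
noncomputable def edgesAt {n : ℕ} (G : SimpleGraph (Fin n)) (ops : List (Op n)) (i : ℕ) : ℝ :=
  max ((graphAt G ops i).edgeSet.ncard : ℝ) 1

/-- A problem on graphs, possibly with some further data that is fixed beforehand. -/
structure Problem where
  Param : ℕ → Type
  code : ∀ {n : ℕ}, Param n → ℕ
  answer : ∀ {n : ℕ}, SimpleGraph (Fin n) → Param n → ℕ

/-- The number of subgraphs of `G` that are isomorphic to `P` and contain the vertex `s`. -/
noncomputable def copyCountAt {n k : ℕ} (G : SimpleGraph (Fin n)) (P : SimpleGraph (Fin k))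
    (s : Fin n) : ℕ :=
  {H : G.Subgraph | Nonempty (P ≃g H.coe) ∧ s ∈ H.verts}.ncard

/-- How many (non-induced) subgraphs of `G` are isomorphic to `P`? -/
noncomputable def counting {k : ℕ} (P : SimpleGraph (Fin k)) : Problem where
  Param _ := Unit
  code _ := 0
  answer G _ := G.copyCount P

/-- Does `G` have a (non-induced) subgraph isomorphic to `P`? -/
noncomputable def detection {k : ℕ} (P : SimpleGraph (Fin k)) : Problem where
  Param _ := Unit
  code _ := 0
  answer G _ := if 0 < G.copyCount P then 1 else 0

/-- How many subgraphs of `G` that contain the fixed vertex `s` are isomorphic to `P`? -/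
noncomputable def countingAt {k : ℕ} (P : SimpleGraph (Fin k)) : Problem where
  Param n := Fin n
  code s := s
  answer G s := copyCountAt G P s

/-- Is some subgraph of `G` that contains the fixed vertex `s` isomorphic to `P`? -/
noncomputable def detectionAt {k : ℕ} (P : SimpleGraph (Fin k)) : Problem where
  Param n := Fin n
  code s := s
  answer G s := if 0 < copyCountAt G P s then 1 else 0

/-- A dynamic algorithm: one program for each kind of request. A query has to leave its answer in
the first output cell. -/
structure Algorithm where
  prep : Prog
  insert : Prog
  delete : Prog
  query : Prog

/-- The input array of the preprocessing: the number of vertices, the parameter, and the adjacency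
matrix of the initial graph. -/
noncomputable def graphInput {n : ℕ} (G : SimpleGraph (Fin n)) (s : ℕ) : ℕ → ℕ := by
  classical
  exact fun a => if a = 0 then n else if a = 1 then s else
    if ∃ u v : Fin n, a = 2 + u * n + v ∧ G.Adj u v then 1 else 0

/-- The input array of an update is the pair of end vertices. -/
def edgeInput {n : ℕ} (u v : Fin n) : ℕ → ℕ :=
  fun a => if a = 0 then u else if a = 1 then v else 0

/-- The request that belongs to an operation. -/
def Algorithm.request (A : Algorithm) {n : ℕ} : Op n → Request
  | .insert u v => (A.insert, edgeInput u v)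
  | .delete u v => (A.delete, edgeInput u v)
  | .query => (A.query, fun _ => 0)

/-- Preprocessing of the initial graph `G`, followed by the operations. Thus operation number `i`
is request number `i + 1`. -/
noncomputable def Algorithm.requests (A : Algorithm) {n : ℕ} (G : SimpleGraph (Fin n)) (s : ℕ)
    (ops : List (Op n)) : List Request :=
  (A.prep, graphInput G s) :: ops.map A.request

/-- After every valid sequence of operations, every query is answered correctly with error
probability at most `1/3`. -/
def Algorithm.Correct (A : Algorithm) (Q : Problem) (mode : Model) (c : ℕ) : Prop :=
  ∀ (n : ℕ) (G : SimpleGraph (Fin n)) (s : Q.Param n) (ops : List (Op n)), ValidOps mode G ops →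
    ∀ i (h : i < ops.length), ops[i] = Op.query →
      coins (wordSize c n) {ω | ¬ ∃ σ t,
        Serves (wordSize c n) ω (A.requests G (Q.code s) ops) σ t ∧
        (σ (i + 2)).out 0 = Q.answer (graphAt G ops i) s} ≤ 1 / 3

/-- Polynomial preprocessing time, worst-case update time at most `C * m ^ a`, and (worst-case)
query time at most `C * m ^ b`. -/
def Algorithm.WorstCaseTime (A : Algorithm) (Q : Problem) (mode : Model) (c K : ℕ)
    (C a b : ℝ) : Prop :=
  ∀ (n : ℕ) (G : SimpleGraph (Fin n)) (s : Q.Param n) (ops : List (Op n)), ValidOps mode G ops →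
    ∀ ω : ℕ → Fin (2 ^ wordSize c n), ∃ σ t,
      Serves (wordSize c n) ω (A.requests G (Q.code s) ops) σ t ∧
      t 0 ≤ K * (n + 1) ^ K ∧
      ∀ i (h : i < ops.length),
        (ops[i].IsUpdate → (t (i + 1) : ℝ) ≤ C * edgesAt G ops i ^ a) ∧
        (ops[i] = Op.query → (t (i + 1) : ℝ) ≤ C * edgesAt G ops i ^ b)

open Classical in
/-- Polynomial preprocessing time, amortized update time at most `C * m ^ a`, and (worst-case)
query time at most `C * m ^ b`. Amortized means that the total time of the preprocessing and of all
updates is at most the (polynomial) bound for the preprocessing plus the sum of the bounds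
`C * m ^ a` of the single updates; so the preprocessing may pay in advance for later updates. -/
def Algorithm.AmortizedTime (A : Algorithm) (Q : Problem) (mode : Model) (c K : ℕ)
    (C a b : ℝ) : Prop :=
  ∀ (n : ℕ) (G : SimpleGraph (Fin n)) (s : Q.Param n) (ops : List (Op n)), ValidOps mode G ops →
    ∀ ω : ℕ → Fin (2 ^ wordSize c n), ∃ σ t,
      Serves (wordSize c n) ω (A.requests G (Q.code s) ops) σ t ∧
      (t 0 : ℝ) + ∑ i : Fin ops.length, (if ops[i].IsUpdate then (t (i + 1) : ℝ) else 0) ≤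
        K * ((n : ℝ) + 1) ^ K +
          ∑ i : Fin ops.length, (if ops[i].IsUpdate then C * edgesAt G ops i ^ a else 0) ∧
      ∀ i (h : i < ops.length),
        ops[i] = Op.query → (t (i + 1) : ℝ) ≤ C * edgesAt G ops i ^ b

/-- There is an algorithm for `Q` with polynomial preprocessing time, worst-case update time
`O(m ^ a)`, query time `O(m ^ b)` and error probability at most `1/3`. -/
def WorstCaseSolvable (Q : Problem) (mode : Model) (a b : ℝ) : Prop :=
  ∃ (A : Algorithm) (c K : ℕ) (C : ℝ), A.Correct Q mode c ∧ A.WorstCaseTime Q mode c K C a b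

/-- There is an algorithm for `Q` with polynomial preprocessing time, amortized update time
`O(m ^ a)`, query time `O(m ^ b)` and error probability at most `1/3`. -/
def AmortizedSolvable (Q : Problem) (mode : Model) (a b : ℝ) : Prop :=
  ∃ (A : Algorithm) (c K : ℕ) (C : ℝ), A.Correct Q mode c ∧ A.AmortizedTime Q mode c K C a b

/-- For every `δ > 0` the problem has neither a partially dynamic algorithm with polynomial
preprocessing time, worst-case update time `O(m ^ (1/2 - δ))` and query time `O(m ^ (1 - δ))`, nor
a fully dynamic algorithm with the same bounds, where the update time is amortized. -/
def Hard (Q : Problem) : Prop :=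
  ∀ δ : ℝ, 0 < δ →
    ¬ WorstCaseSolvable Q .incremental (1 / 2 - δ) (1 - δ) ∧
    ¬ WorstCaseSolvable Q .decremental (1 / 2 - δ) (1 - δ) ∧
    ¬ AmortizedSolvable Q .fullyDynamic (1 / 2 - δ) (1 - δ)

/-- The paw: a triangle `0, 1, 2` and the arm `{0, 3}`. -/
def paw : SimpleGraph (Fin 4) := SimpleGraph.fromEdgeSet {s(0, 1), s(1, 2), s(0, 2), s(0, 3)}

/-- The diamond: a 4-cycle with a chord. -/
def diamond : SimpleGraph (Fin 4) := SimpleGraph.cycleGraph 4 ⊔ SimpleGraph.edge 0 2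

/-- The 4-clique. -/
def clique4 : SimpleGraph (Fin 4) := ⊤

/-- The path of length 3, which has 4 vertices. -/
def path3 : SimpleGraph (Fin 4) := SimpleGraph.pathGraph 4

end DynGraph

/-!
A fast dynamic algorithm `A` yields a truly subcubic algorithm for OMv. The matrix is cut into
`(n / k) ^ 2` blocks of size `k`, where `k` is about `n ^ (1 / q)` for a large constant `q`, and
each block is given to copies of `A` as a graph with `O(k ^ 2)` vertices and edges. On such a graph,
`2 * k` updates and a query take `O(k * k ^ (1 - 2 * δ) + k ^ (2 - 2 * δ))` steps, which is less
than the `k ^ 2` entries of the block by a factor `k ^ ε`.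

*Gadgets.* The graph of a block (`slotGraph`) contains the block in some form, and a hub that is
joined to vertex `p` if bit `p` of a pair of vectors `(u, v)` is one; these slot edges are the only
ones that are updated. For triangles, paws, diamonds and 4-cliques, the block is a bipartite graph,
and the extra vertices that the pattern needs are fixed. For longer cycles, each pair of a row and a
column has a path of its own, so that a cycle must use a whole path and the hub. In all these cases
the pattern occurs, and occurs at the hub, if and only if `uᵀ M v = 1` (`detects_triangle`,
`detects_paw`, `detects_diamond`, `detects_clique4`, `detects_cycle`). For paths of length three,
the two vectors have different hubs, and by inclusion and exclusion over the slots that are used,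
the number `f` of paths satisfies `f(u, v) + f(0, 0) ≠ f(u, 0) + f(0, v)` if and only if some path
joins the two hubs, that is, `uᵀ M v = 1` (`path3_unbalanced`). This inequality of four answers is
the criterion in all cases (`Gadget`), since detection with a zero vector fails.

*Rounds.* After a question, the slots have to be reset. The memory of a partially dynamic algorithm
is restored by the simulation, so that worst-case bounds apply to every question
(`exists_service_partial`); a fully dynamic algorithm undoes the updates by deletions, so that all
questions form one long sequence, to which amortized bounds apply (`exists_service_full`).

*From questions to products.* For a vector and a block, the four questions are asked with the part
of the vector that belongs to the block and with the rows that are not yet known to have a one in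
the product. If the answers show a one, the block is inspected in `O(k ^ 2)` steps, which finds a
new row; this happens at most `n` times for each vector. If no new row is found, an answer was
wrong, and the rest of the vector is given up, so that the time bound holds for all random words
(`wp_block`, `wp_mul`).

*Errors.* For each block there are `120 * L` copies of the algorithm with independent random words,
where `L` is about `log n`, and the majority counts (`coins_majority`). The questions in a run
without wrong majorities are determined by the input alone. Hence it suffices to bound the
probability that some majority errs on these fixed questions by a sum over them, and no adaptivity
has to be dealt with (`Setup.hist`, `Setup.not_good`).

*The machine.* All this is a program for the word-RAM. It is written in a small structured language
with rules for correctness and time (`WP`). The copies of `A` expect shorter words, so they are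
interpreted with constant overhead in areas of the memory; the memory cells that have changed since
the last question carry a time stamp, and advancing a clock restores the old contents (`wp_sim`).
The random words are drawn in advance into a table, which separates the streams of the copies. The
preprocessing (`exec_prep`) and the products (`Setup.exists_serves`) together take
`O(log² n * n ^ 3 * k ^ (-ε))` steps (`Setup.Scale.time_le`, `exists_subcubic`), which contradicts
the conjecture (`not_conjecture`).
-/

set_option linter.constructorNameAsVariable false

namespace WordRAM

/-! ### The machine is deterministic -/

/-- All registers and memory cells hold `w`-bit words. -/
def State.Bdd (w : ℕ) (σ : State) : Prop := (∀ x, σ.reg x < 2 ^ w) ∧ ∀ a, σ.mem a < 2 ^ w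

lemma BinOp.eval_lt (w : ℕ) (o : BinOp) (a b : ℕ) : o.eval w a b < 2 ^ w :=
  Nat.mod_lt _ (by positivity)

lemma State.Bdd.setReg {w : ℕ} {σ : State} (h : σ.Bdd w) {x a : ℕ} (ha : a < 2 ^ w) :
    (σ.setReg x a).Bdd w := by
  refine ⟨fun y => ?_, h.2⟩
  by_cases hy : y = x
  · simp [State.setReg, hy, ha]
  · simpa [State.setReg, hy] using h.1 y

lemma Exec.bdd {w : ℕ} {ω : ℕ → Fin (2 ^ w)} {inp : ℕ → ℕ} {p : Prog} {σ σ' : State} {t : ℕ}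
    (h : Exec w ω inp p σ σ' t) (hσ : σ.Bdd w) : σ'.Bdd w := by
  have pw : 0 < 2 ^ w := by positivity
  induction h with
  | skip => exact hσ
  | const => exact hσ.setReg (Nat.mod_lt _ pw)
  | bin => exact hσ.setReg (BinOp.eval_lt _ _ _ _)
  | load => exact hσ.setReg (hσ.2 _)
  | store σ x y =>
    refine ⟨hσ.1, fun a => ?_⟩
    by_cases ha : a = σ.reg x
    · simp [ha, hσ.1]
    · simpa [ha] using hσ.2 a
  | read => exact hσ.setReg (Nat.mod_lt _ pw)
  | write => exact hσ
  | rand σ x => exact hσ.setReg (ω σ.pos).2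
  | seq _ _ ih ih' => exact ih' (ih hσ)
  | ite_pos _ _ ih => exact ih hσ
  | ite_neg _ _ ih => exact ih hσ
  | loop_done => exact hσ
  | loop_step _ _ _ ih ih' => exact ih' (ih hσ)

lemma Exec.pos_le {w : ℕ} {ω : ℕ → Fin (2 ^ w)} {inp : ℕ → ℕ} {p : Prog} {σ σ' : State} {t : ℕ}
    (h : Exec w ω inp p σ σ' t) : σ'.pos ≤ σ.pos + t := by
  induction h <;> (try simp only [State.setReg]) <;> omega

/-- The final state and the running time are functions of the random words. -/
lemma Exec.det {w : ℕ} {ω : ℕ → Fin (2 ^ w)} {inp : ℕ → ℕ} {p : Prog} {σ σ₁ σ₂ : State}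
    {t₁ t₂ : ℕ} (h : Exec w ω inp p σ σ₁ t₁) (h' : Exec w ω inp p σ σ₂ t₂) :
    σ₁ = σ₂ ∧ t₁ = t₂ := by
  induction h generalizing σ₂ t₂ with
  | seq _ _ ih ih' =>
    cases h' with
    | seq a b =>
      obtain ⟨rfl, rfl⟩ := ih a
      obtain ⟨rfl, rfl⟩ := ih' b
      exact ⟨rfl, rfl⟩
  | ite_pos hx _ ih =>
    cases h' with
    | ite_pos _ a => obtain ⟨rfl, rfl⟩ := ih a; exact ⟨rfl, rfl⟩
    | ite_neg hx' _ => exact absurd hx' hx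
  | ite_neg hx _ ih =>
    cases h' with
    | ite_neg _ a => obtain ⟨rfl, rfl⟩ := ih a; exact ⟨rfl, rfl⟩
    | ite_pos hx' _ => exact absurd hx hx'
  | loop_done hx =>
    cases h' with
    | loop_done => exact ⟨rfl, rfl⟩
    | loop_step hx' _ _ => exact absurd hx hx'
  | loop_step hx _ _ ih ih' =>
    cases h' with
    | loop_done hx' => exact absurd hx' hx
    | loop_step _ a b =>
      obtain ⟨rfl, rfl⟩ := ih a
      obtain ⟨rfl, rfl⟩ := ih' b
      exact ⟨rfl, rfl⟩
  | _ => cases h'; exact ⟨rfl, rfl⟩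

/-! ### A structured layer over the word-RAM -/

/-- Names of the variables of structured programs. The parameters of the reduction are in `n` to
`W`; `PH` is the clock of the simulated machines, and `dead` is set when a wrong answer has been
noticed. The variables `i`, `x`, `y` hold the number of a block and its position, `j` the number of
a copy of the machine, `Z` the memory area of this copy, and `inA` the area of its input. -/
inductive Var
  | n | L | kap | k | B | H | N | msk | r | T | W
  | PH | dead
  | i | x | y
  | j | j' | cnt | fl | ans0 | ans1 | ans2
  | Z | inA | p | a | b
  | t1 | t2
  deriving DecidableEq

/-- Variables are layered: a routine of level `l` only changes variables of level at least `l`. -/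
def Var.lev : Var → ℕ
  | n | L | kap | k | B | H | N | msk | r | T | W => 0
  | i => 1
  | x | y => 2
  | dead | fl | ans1 | ans2 => 3
  | a | b | j | j' | cnt | ans0 => 4
  | PH | Z | inA | p => 5
  | t1 | t2 => 6

/-- The state seen by structured programs: named variables, and a memory that is divided into
areas, so that `mem z a` is cell `a` of area `z`. -/
structure HS where
  var : Var → ℕ
  mem : ℕ → ℕ → ℕ
  out : ℕ → ℕ
  pos : ℕ

/-- The state after the assignment of `v` to the variable `x`. -/
def HS.set (h : HS) (x : Var) (v : ℕ) : HS := { h with var := Function.update h.var x v }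

/-- The state after `v` has been written to cell `a` of area `z`. -/
def HS.put (h : HS) (z a v : ℕ) : HS :=
  { h with mem := Function.update h.mem z (Function.update (h.mem z) a v) }

@[simp] lemma HS.set_var (h : HS) (x y : Var) (v : ℕ) :
    (h.set x v).var y = if y = x then v else h.var y := by
  simp [HS.set, Function.update_apply]
@[simp] lemma HS.set_mem (h : HS) (x : Var) (v : ℕ) : (h.set x v).mem = h.mem := rfl
@[simp] lemma HS.set_out (h : HS) (x : Var) (v : ℕ) : (h.set x v).out = h.out := rfl
@[simp] lemma HS.set_pos (h : HS) (x : Var) (v : ℕ) : (h.set x v).pos = h.pos := rfl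
@[simp] lemma HS.put_var (h : HS) (z a v : ℕ) : (h.put z a v).var = h.var := rfl
@[simp] lemma HS.put_out (h : HS) (z a v : ℕ) : (h.put z a v).out = h.out := rfl
@[simp] lemma HS.put_pos (h : HS) (z a v : ℕ) : (h.put z a v).pos = h.pos := rfl
@[simp] lemma HS.put_mem (h : HS) (z a v z' a' : ℕ) :
    (h.put z a v).mem z' a' = if z' = z ∧ a' = a then v else h.mem z' a' := by
  by_cases hz : z' = z
  · subst hz; by_cases ha : a' = a <;> simp [HS.put, ha]
  · simp [HS.put, hz]
lemma HS.put_mem_ne (h : HS) {z a v z' : ℕ} (hz : z' ≠ z) : (h.put z a v).mem z' = h.mem z' := by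
  simp [HS.put, hz]

/-- The environment of a run: word length, size of a memory area, random words, input array. -/
structure Env where
  w : ℕ
  W : ℕ
  ω : ℕ → Fin (2 ^ w)
  inp : ℕ → ℕ

/-- The machine state `σ` implements the structured state `h`: variables are kept in the even
registers, register `1` holds the size of an area, and the other odd registers are scratch. -/
structure Rel (E : Env) (σ : State) (h : HS) : Prop where
  two : 1 < 2 ^ E.w
  bdd : σ.Bdd E.w
  var : ∀ x : Var, σ.reg (2 * x.ctorIdx) = h.var x
  W : σ.reg 1 = E.W
  mem : ∀ z a, a < E.W → σ.mem (z * E.W + a) = h.mem z a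
  out : σ.out = h.out
  pos : σ.pos = h.pos

/-- The value of an instruction in the natural numbers, without reduction modulo `2 ^ w`. -/
def BinOp.nat (w : ℕ) : BinOp → ℕ → ℕ → ℕ
  | .add, a, b => a + b
  | .sub, a, b => a - b
  | .mul, a, b => a * b
  | .div, a, b => a / b
  | .mod, a, b => a % b
  | .shl, a, b => a * 2 ^ b
  | .eq, a, b => if a = b then 1 else 0
  | .lt, a, b => if a < b then 1 else 0
  | o, a, b => o.eval w a b

/-- No overflow and no underflow occurs. -/
def BinOp.ok (w : ℕ) : BinOp → ℕ → ℕ → Prop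
  | .add, a, b => a + b < 2 ^ w
  | .sub, a, b => b ≤ a
  | .mul, a, b => a * b < 2 ^ w
  | .shl, a, b => a * 2 ^ b < 2 ^ w
  | _, _, _ => True

lemma BinOp.eval_eq {w : ℕ} (o : BinOp) {a b : ℕ} (h : o.ok w a b) (ha : a < 2 ^ w)
    (hb : b < 2 ^ w) (h1 : 1 < 2 ^ w) : o.eval w a b = o.nat w a b := by
  have e : ∀ m, m < 2 ^ w → m % 2 ^ w = m := fun m hm => Nat.mod_eq_of_lt hm
  cases o <;> simp only [BinOp.nat, BinOp.ok] at h ⊢ <;> try (simp only [BinOp.eval])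
  · exact e _ h
  · rw [show a + (2 ^ w - b) = (a - b) + 2 ^ w by omega, Nat.add_mod_right, e _ (by omega)]
  · exact e _ h
  · exact e _ (lt_of_le_of_lt (Nat.div_le_self _ _) ha)
  · exact e _ (lt_of_le_of_lt (Nat.mod_le _ _) ha)
  · rw [Nat.shiftLeft_eq]; exact e _ h
  · split_ifs <;> exact e _ (by omega)
  · split_ifs <;> exact e _ (by omega)

/-- Expressions over variables, memory and input; `raw` computes modulo `2 ^ w`, while `bin` is
meant to be used where no overflow occurs. -/
inductive Expr
  | v (x : Var)
  | lit (k : ℕ)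
  | bin (o : BinOp) (a b : Expr)
  | raw (o : BinOp) (a b : Expr)
  | ld (z a : Expr)
  | inp (a : Expr)
  | ite (c a b : Expr)

namespace Expr

instance : Add Expr := ⟨bin .add⟩
instance : Sub Expr := ⟨bin .sub⟩
instance : Mul Expr := ⟨bin .mul⟩
instance : Div Expr := ⟨bin .div⟩
instance : Mod Expr := ⟨bin .mod⟩
instance (k : ℕ) : OfNat Expr k := ⟨lit k⟩

/-- The value is one if `a` and `b` have equal values, and zero otherwise. -/
def eq' (a b : Expr) : Expr := bin .eq a b
/-- The value is one if `a` has a smaller value than `b`, and zero otherwise. -/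
def lt' (a b : Expr) : Expr := bin .lt a b
/-- The value of `a`, shifted to the left by the value of `b`. -/
def shl (a b : Expr) : Expr := bin .shl a b

/-- The value of an expression, as a natural number. It is the value that the machine computes only
if the evaluation is `ok`. -/
def val (E : Env) (h : HS) : Expr → ℕ
  | v x => h.var x
  | lit k => k
  | bin o a b => o.nat E.w (a.val E h) (b.val E h)
  | raw o a b => o.eval E.w (a.val E h) (b.val E h)
  | ld z a => h.mem (z.val E h) (a.val E h)
  | inp a => E.inp (a.val E h) % 2 ^ E.w
  | ite c a b => if c.val E h ≠ 0 then a.val E h else b.val E h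

/-- The evaluation meets no overflow and no access beyond the end of a memory area. -/
def ok (E : Env) (h : HS) : Expr → Prop
  | v _ => True
  | lit k => k < 2 ^ E.w
  | bin o a b => a.ok E h ∧ b.ok E h ∧ o.ok E.w (a.val E h) (b.val E h)
  | raw _ a b => a.ok E h ∧ b.ok E h
  | ld z a => z.ok E h ∧ a.ok E h ∧ a.val E h < E.W ∧ z.val E h * E.W + a.val E h < 2 ^ E.w
  | inp a => a.ok E h
  | ite c a b => c.ok E h ∧ (c.val E h ≠ 0 → a.ok E h) ∧ (c.val E h = 0 → b.ok E h)

/-- An upper bound on the number of steps of the compiled expression. -/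
def cost : Expr → ℕ
  | v _ => 1
  | lit _ => 1
  | bin _ a b => a.cost + b.cost + 1
  | raw _ a b => a.cost + b.cost + 1
  | ld z a => z.cost + a.cost + 3
  | inp a => a.cost + 1
  | ite c a b => c.cost + a.cost + b.cost + 1

section
variable (E : Env) (h : HS) (a b c : Expr) (x : Var) (k : ℕ)
@[simp] lemma val_v : (v x).val E h = h.var x := rfl
@[simp] lemma val_lit : (lit k).val E h = k := rfl
@[simp] lemma val_ofNat : (no_index (OfNat.ofNat k) : Expr).val E h = k := rfl
@[simp] lemma val_add : (a + b).val E h = a.val E h + b.val E h := rfl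
@[simp] lemma val_sub : (a - b).val E h = a.val E h - b.val E h := rfl
@[simp] lemma val_mul : (a * b).val E h = a.val E h * b.val E h := rfl
@[simp] lemma val_div : (a / b).val E h = a.val E h / b.val E h := rfl
@[simp] lemma val_mod : (a % b).val E h = a.val E h % b.val E h := rfl
@[simp] lemma val_eq : (eq' a b).val E h = if a.val E h = b.val E h then 1 else 0 := rfl
@[simp] lemma val_lt : (lt' a b).val E h = if a.val E h < b.val E h then 1 else 0 := rfl
@[simp] lemma val_shl : (shl a b).val E h = a.val E h * 2 ^ b.val E h := rfl
@[simp] lemma val_ld : (ld a b).val E h = h.mem (a.val E h) (b.val E h) := rfl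
@[simp] lemma val_inp : (inp a).val E h = E.inp (a.val E h) % 2 ^ E.w := rfl
@[simp] lemma val_raw (o : BinOp) :
    (raw o a b).val E h = o.eval E.w (a.val E h) (b.val E h) := rfl
@[simp] lemma val_ite :
    (ite c a b).val E h = if c.val E h ≠ 0 then a.val E h else b.val E h := rfl
@[simp] lemma ok_v : (v x).ok E h := trivial
@[simp] lemma ok_lit : (lit k).ok E h ↔ k < 2 ^ E.w := Iff.rfl
@[simp] lemma ok_ofNat : (no_index (OfNat.ofNat k) : Expr).ok E h ↔ k < 2 ^ E.w := Iff.rfl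
@[simp] lemma ok_add :
    (a + b).ok E h ↔ a.ok E h ∧ b.ok E h ∧ a.val E h + b.val E h < 2 ^ E.w := Iff.rfl
@[simp] lemma ok_sub : (a - b).ok E h ↔ a.ok E h ∧ b.ok E h ∧ b.val E h ≤ a.val E h := Iff.rfl
@[simp] lemma ok_mul :
    (a * b).ok E h ↔ a.ok E h ∧ b.ok E h ∧ a.val E h * b.val E h < 2 ^ E.w := Iff.rfl
@[simp] lemma ok_div : (a / b).ok E h ↔ a.ok E h ∧ b.ok E h :=
  ⟨fun h => ⟨h.1, h.2.1⟩, fun h => ⟨h.1, h.2, trivial⟩⟩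
@[simp] lemma ok_mod : (a % b).ok E h ↔ a.ok E h ∧ b.ok E h :=
  ⟨fun h => ⟨h.1, h.2.1⟩, fun h => ⟨h.1, h.2, trivial⟩⟩
@[simp] lemma ok_eq : (eq' a b).ok E h ↔ a.ok E h ∧ b.ok E h :=
  ⟨fun h => ⟨h.1, h.2.1⟩, fun h => ⟨h.1, h.2, trivial⟩⟩
@[simp] lemma ok_lt : (lt' a b).ok E h ↔ a.ok E h ∧ b.ok E h :=
  ⟨fun h => ⟨h.1, h.2.1⟩, fun h => ⟨h.1, h.2, trivial⟩⟩
@[simp] lemma ok_shl :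
    (shl a b).ok E h ↔ a.ok E h ∧ b.ok E h ∧ a.val E h * 2 ^ b.val E h < 2 ^ E.w := Iff.rfl
@[simp] lemma ok_raw (o : BinOp) : (raw o a b).ok E h ↔ a.ok E h ∧ b.ok E h := Iff.rfl
@[simp] lemma ok_ld : (ld a b).ok E h ↔ a.ok E h ∧ b.ok E h ∧ b.val E h < E.W ∧
    a.val E h * E.W + b.val E h < 2 ^ E.w := Iff.rfl
@[simp] lemma ok_inp : (inp a).ok E h ↔ a.ok E h := Iff.rfl
@[simp] lemma ok_ite : (ite c a b).ok E h ↔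
    c.ok E h ∧ (c.val E h ≠ 0 → a.ok E h) ∧ (c.val E h = 0 → b.ok E h) := Iff.rfl
@[simp] lemma cost_v : (v x).cost = 1 := rfl
@[simp] lemma cost_lit : (lit k).cost = 1 := rfl
@[simp] lemma cost_ofNat : (no_index (OfNat.ofNat k) : Expr).cost = 1 := rfl
@[simp] lemma cost_add : (a + b).cost = a.cost + b.cost + 1 := rfl
@[simp] lemma cost_sub : (a - b).cost = a.cost + b.cost + 1 := rfl
@[simp] lemma cost_mul : (a * b).cost = a.cost + b.cost + 1 := rfl
@[simp] lemma cost_div : (a / b).cost = a.cost + b.cost + 1 := rfl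
@[simp] lemma cost_mod : (a % b).cost = a.cost + b.cost + 1 := rfl
@[simp] lemma cost_eq : (eq' a b).cost = a.cost + b.cost + 1 := rfl
@[simp] lemma cost_lt : (lt' a b).cost = a.cost + b.cost + 1 := rfl
@[simp] lemma cost_shl : (shl a b).cost = a.cost + b.cost + 1 := rfl
@[simp] lemma cost_raw (o : BinOp) : (raw o a b).cost = a.cost + b.cost + 1 := rfl
@[simp] lemma cost_ld : (ld a b).cost = a.cost + b.cost + 3 := rfl
@[simp] lemma cost_inp : (inp a).cost = a.cost + 1 := rfl
@[simp] lemma cost_ite : (ite c a b).cost = c.cost + a.cost + b.cost + 1 := rfl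
end

/-- Evaluation of an expression into register `2 * d + 3`, with the odd registers above as
scratch. -/
def comp : Expr → ℕ → Prog
  | v x, d => .bin .or (2 * d + 3) (2 * x.ctorIdx) (2 * x.ctorIdx)
  | lit k, d => .const (2 * d + 3) k
  | bin o a b, d =>
    .seq (a.comp d) (.seq (b.comp (d + 1)) (.bin o (2 * d + 3) (2 * d + 3) (2 * d + 5)))
  | raw o a b, d =>
    .seq (a.comp d) (.seq (b.comp (d + 1)) (.bin o (2 * d + 3) (2 * d + 3) (2 * d + 5)))
  | ld z a, d =>
    .seq (z.comp d) (.seq (a.comp (d + 1)) (.seq (.bin .mul (2 * d + 3) (2 * d + 3) 1)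
      (.seq (.bin .add (2 * d + 3) (2 * d + 3) (2 * d + 5)) (.load (2 * d + 3) (2 * d + 3)))))
  | inp a, d => .seq (a.comp d) (.read (2 * d + 3) (2 * d + 3))
  | ite c a b, d => .seq (c.comp d) (.ite (2 * d + 3) (a.comp d) (b.comp d))

end Expr

/-- `σ'` differs from `σ` only in odd registers from `2 * d + 3` on. -/
structure Scratch (d : ℕ) (σ σ' : State) : Prop where
  reg : ∀ x, (x % 2 = 0 ∨ x < 2 * d + 3) → σ'.reg x = σ.reg x
  mem : σ'.mem = σ.mem
  out : σ'.out = σ.out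
  pos : σ'.pos = σ.pos

lemma Scratch.trans {d d' : ℕ} {σ σ' σ'' : State} (h : Scratch d σ σ') (h' : Scratch d' σ' σ'')
    (hd : d ≤ d') : Scratch d σ σ'' :=
  ⟨fun x hx => by rw [h'.reg x (by omega), h.reg x hx], h'.mem.trans h.mem, h'.out.trans h.out,
    h'.pos.trans h.pos⟩

lemma Scratch.setReg (d : ℕ) (σ : State) (v : ℕ) : Scratch d σ (σ.setReg (2 * d + 3) v) :=
  ⟨fun x hx => by
    have : x ≠ 2 * d + 3 := by omega
    simp [State.setReg, this], rfl, rfl, rfl⟩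

lemma Scratch.rel {d : ℕ} {σ σ' : State} {E : Env} {h : HS} (s : Scratch d σ σ')
    (r : Rel E σ h) (b : σ'.Bdd E.w) : Rel E σ' h :=
  ⟨r.two, b, fun x => by rw [s.reg _ (by omega), r.var], by rw [s.reg 1 (by omega), r.W],
    by rw [s.mem]; exact r.mem, s.out.trans r.out, s.pos.trans r.pos⟩

/-- The compiled expression computes the value into its register and changes only scratch registers,
so that values of other subexpressions in lower registers survive. -/
lemma Expr.comp_spec {E : Env} {h : HS} (e : Expr) :
    ∀ (d : ℕ) (σ : State), Rel E σ h → e.ok E h → ∃ σ' t, Exec E.w E.ω E.inp (e.comp d) σ σ' t ∧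
      t ≤ e.cost ∧ σ'.reg (2 * d + 3) = e.val E h ∧ Scratch d σ σ' := by
  have bin_case : ∀ (o : BinOp) (a b : Expr),
      (∀ (d : ℕ) (σ : State), Rel E σ h → a.ok E h → ∃ σ' t,
        Exec E.w E.ω E.inp (a.comp d) σ σ' t ∧
        t ≤ a.cost ∧ σ'.reg (2 * d + 3) = a.val E h ∧ Scratch d σ σ') →
      (∀ (d : ℕ) (σ : State), Rel E σ h → b.ok E h → ∃ σ' t,
        Exec E.w E.ω E.inp (b.comp d) σ σ' t ∧
        t ≤ b.cost ∧ σ'.reg (2 * d + 3) = b.val E h ∧ Scratch d σ σ') →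
      ∀ (d : ℕ) (σ : State), Rel E σ h → a.ok E h → b.ok E h → ∃ σ' t,
        Exec E.w E.ω E.inp (.seq (a.comp d) (.seq (b.comp (d + 1))
          (.bin o (2 * d + 3) (2 * d + 3) (2 * d + 5)))) σ σ' t ∧
        t ≤ a.cost + b.cost + 1 ∧ σ'.reg (2 * d + 3) = o.eval E.w (a.val E h) (b.val E h) ∧
        a.val E h < 2 ^ E.w ∧ b.val E h < 2 ^ E.w ∧ Scratch d σ σ' := by
    intro o a b iha ihb d σ r oa ob
    obtain ⟨σ₁, t₁, e₁, l₁, v₁, s₁⟩ := iha d σ r oa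
    have b₁ := e₁.bdd r.bdd
    obtain ⟨σ₂, t₂, e₂, l₂, v₂, s₂⟩ := ihb (d + 1) σ₁ (s₁.rel r b₁) ob
    have v₁' : σ₂.reg (2 * d + 3) = a.val E h := by rw [s₂.reg _ (by omega), v₁]
    have b₂ := e₂.bdd b₁
    refine ⟨_, _, .seq e₁ (.seq e₂ (.bin _ _ _ _ _)), by omega, ?_, ?_, ?_,
      s₁.trans (s₂.trans (d' := d + 1) ⟨fun x hx => rfl, rfl, rfl, rfl⟩ le_rfl) (by omega) |>.trans
        (Scratch.setReg d _ _) le_rfl⟩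
    · simp only [State.setReg, Function.update_self]
      rw [v₁', show 2 * d + 5 = 2 * (d + 1) + 3 by ring, v₂]
    · rw [← v₁']; exact b₂.1 _
    · rw [← v₂]; exact b₂.1 _
  induction e with
  | v x =>
    intro d σ r _
    refine ⟨_, _, .bin _ _ _ _ _, le_rfl, ?_, Scratch.setReg d _ _⟩
    have := Nat.mod_eq_of_lt (r.bdd.1 (2 * x.ctorIdx))
    rw [r.var] at this
    simp [State.setReg, BinOp.eval, r.var, this]
  | lit k =>
    intro d σ r hk
    refine ⟨_, _, .const _ _ _, le_rfl, ?_, Scratch.setReg d _ _⟩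
    simp only [State.setReg, Function.update_self]
    exact Nat.mod_eq_of_lt hk
  | bin o a b iha ihb =>
    intro d σ r ⟨oa, ob, oo⟩
    obtain ⟨σ', t, e, l, v, la, lb, s⟩ := bin_case o a b iha ihb d σ r oa ob
    refine ⟨σ', t, e, l, ?_, s⟩
    rw [v, BinOp.eval_eq o oo la lb r.two]; rfl
  | raw o a b iha ihb =>
    intro d σ r ⟨oa, ob⟩
    obtain ⟨σ', t, e, l, v, la, lb, s⟩ := bin_case o a b iha ihb d σ r oa ob
    exact ⟨σ', t, e, l, v, s⟩
  | ld z a ihz iha =>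
    intro d σ r ⟨oz, oa, hW, hw⟩
    obtain ⟨σ₁, t₁, e₁, l₁, v₁, s₁⟩ := ihz d σ r oz
    have b₁ := e₁.bdd r.bdd
    obtain ⟨σ₂, t₂, e₂, l₂, v₂, s₂⟩ := iha (d + 1) σ₁ (s₁.rel r b₁) oa
    have v₁' : σ₂.reg (2 * d + 3) = z.val E h := by rw [s₂.reg _ (by omega), v₁]
    have b₂ := e₂.bdd b₁
    have v₂' : σ₂.reg (2 * d + 5) = a.val E h := v₂
    have w₂ : σ₂.reg 1 = E.W := by rw [s₂.reg _ (by omega), s₁.reg _ (by omega), r.W]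
    refine ⟨_, _, .seq e₁ (.seq e₂ (.seq (.bin _ _ _ _ _) (.seq (.bin _ _ _ _ _)
      (.load _ _ _)))), by simp only [Expr.cost]; omega, ?_,
      (s₁.trans s₂ (by omega)).trans ((Scratch.setReg d _ _).trans ((Scratch.setReg d _ _).trans
        (Scratch.setReg d _ _) le_rfl) le_rfl) le_rfl⟩
    have hm : z.val E h * E.W % 2 ^ E.w = z.val E h * E.W := Nat.mod_eq_of_lt (by omega)
    simp only [State.setReg, Function.update_self, BinOp.eval, v₁', w₂, hm]
    rw [Function.update_of_ne (by omega), v₂', Nat.mod_eq_of_lt hw, s₂.mem, s₁.mem, r.mem _ _ hW]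
    rfl
  | inp a iha =>
    intro d σ r oa
    obtain ⟨σ₁, t₁, e₁, l₁, v₁, s₁⟩ := iha d σ r oa
    refine ⟨_, _, .seq e₁ (.read _ _ _), by simp only [Expr.cost]; omega, ?_,
      s₁.trans (Scratch.setReg d _ _) le_rfl⟩
    simp [State.setReg, v₁]
  | ite c a b ihc iha ihb =>
    intro d σ r ⟨oc, oa, ob⟩
    obtain ⟨σ₁, t₁, e₁, l₁, v₁, s₁⟩ := ihc d σ r oc
    have r₁ := s₁.rel r (e₁.bdd r.bdd)
    by_cases hc : c.val E h = 0
    · obtain ⟨σ₂, t₂, e₂, l₂, v₂, s₂⟩ := ihb d σ₁ r₁ (ob hc)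
      exact ⟨σ₂, _, .seq e₁ (.ite_neg (by rw [v₁, hc]) e₂), by simp only [Expr.cost]; omega,
        by simp [v₂, hc], s₁.trans s₂ le_rfl⟩
    · obtain ⟨σ₂, t₂, e₂, l₂, v₂, s₂⟩ := iha d σ₁ r₁ (oa hc)
      exact ⟨σ₂, _, .seq e₁ (.ite_pos (by rwa [v₁]) e₂), by simp only [Expr.cost]; omega,
        by simp [v₂, hc], s₁.trans s₂ le_rfl⟩

/-! ### Structured programs and their correctness with time bounds -/

/-- The program `p`, started in an implementation of `h`, halts in an implementation of some `h'`
within `t` steps, where `Q h' t`. -/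
def WP (E : Env) (p : Prog) (h : HS) (Q : HS → ℕ → Prop) : Prop :=
  ∀ σ, Rel E σ h → ∃ σ' h' t t', Exec E.w E.ω E.inp p σ σ' t' ∧ t' ≤ t ∧ Rel E σ' h' ∧ Q h' t

/-- Assignment to a variable. -/
def asg (x : Var) (e : Expr) : Prog :=
  .seq (e.comp 0) (.bin .or (2 * x.ctorIdx) 3 3)
/-- Assignment of the value of `e` to cell `a` of area `z`. -/
def sto (z a e : Expr) : Prog :=
  .seq (z.comp 0) (.seq (a.comp 1) (.seq (e.comp 2)
    (.seq (.bin .mul 3 3 1) (.seq (.bin .add 3 3 5) (.store 3 7)))))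
/-- Assignment of the value of `e` to output cell `a`. -/
def outp (a e : Expr) : Prog := .seq (a.comp 0) (.seq (e.comp 1) (.write 3 5))
/-- Drawing a random word. -/
def rnd (x : Var) : Prog := .rand (2 * x.ctorIdx)
/-- The program `p` if the value of `e` is not zero, and `q` otherwise. -/
def iff (e : Expr) (p q : Prog) : Prog := .seq (e.comp 0) (.ite 3 p q)
/-- Repetition of `p` as long as the value of `e` is not zero. -/
def whl (e : Expr) (p : Prog) : Prog := .seq (e.comp 0) (.loop 3 (.seq p (e.comp 0)))
/-- A loop with counter `x`, running through all numbers below the value of `e`. -/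
def for' (x : Var) (e : Expr) (p : Prog) : Prog :=
  .seq (asg x (.lit 0)) (whl (.lt' (.v x) e) (.seq p (asg x (.v x + .lit 1))))

infixr:60 " ;; " => Prog.seq

lemma Var.ctorIdx_inj {x y : Var} (h : x.ctorIdx = y.ctorIdx) : x = y := by
  rw [← Var.ofNat_ctorIdx x, h, Var.ofNat_ctorIdx]

namespace WP
variable {E : Env} {h : HS} {p q : Prog} {Q Q' : HS → ℕ → Prop}

lemma mono (hp : WP E p h Q) (hQ : ∀ h' t, Q h' t → Q' h' t) : WP E p h Q' := by
  intro σ r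
  obtain ⟨σ', h', t, t', e, l, r', q⟩ := hp σ r
  exact ⟨σ', h', t, t', e, l, r', hQ _ _ q⟩

lemma seq (hp : WP E p h fun h₁ t₁ => WP E q h₁ fun h₂ t₂ => Q h₂ (t₁ + t₂)) :
    WP E (p ;; q) h Q := by
  intro σ r
  obtain ⟨σ₁, h₁, t₁, t₁', e₁, l₁, r₁, k₁⟩ := hp σ r
  obtain ⟨σ₂, h₂, t₂, t₂', e₂, l₂, r₂, k₂⟩ := k₁ σ₁ r₁
  exact ⟨σ₂, h₂, _, _, .seq e₁ e₂, by omega, r₂, k₂⟩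

lemma skip (hQ : Q h 1) : WP E .skip h Q :=
  fun σ r => ⟨σ, h, 1, 1, .skip σ, le_rfl, r, hQ⟩

lemma asg {x : Var} {e : Expr} (ho : e.ok E h) (hQ : Q (h.set x (e.val E h)) (e.cost + 1)) :
    WP E (asg x e) h Q := by
  intro σ r
  obtain ⟨σ₁, t₁, e₁, l₁, v₁, s₁⟩ := e.comp_spec 0 σ r ho
  have b₁ := e₁.bdd r.bdd
  have r₁ := s₁.rel r b₁
  have hv : BinOp.or.eval E.w (σ₁.reg 3) (σ₁.reg 3) = e.val E h := by
    simp only [BinOp.eval, Nat.or_self]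
    rw [Nat.mod_eq_of_lt (b₁.1 _)]; exact v₁
  refine ⟨_, _, _, _, .seq e₁ (.bin σ₁ .or _ 3 3), by omega, ?_, hQ⟩
  rw [hv]
  refine ⟨r.two, b₁.setReg (by rw [← hv]; exact BinOp.eval_lt _ _ _ _), fun y => ?_, ?_, ?_,
    r₁.out, r₁.pos⟩
  · by_cases hy : y = x
    · simp [State.setReg, hy]
    · have : y.ctorIdx ≠ x.ctorIdx := fun h => hy (Var.ctorIdx_inj h)
      simp [State.setReg, hy, this, r₁.var]
  · have : 1 ≠ 2 * x.ctorIdx := by omega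
    simp [State.setReg, this, r₁.W]
  · exact r₁.mem

lemma rnd {x : Var} (hQ : Q { h.set x (E.ω h.pos) with pos := h.pos + 1 } 1) :
    WP E (rnd x) h Q := by
  intro σ r
  refine ⟨_, _, _, _, .rand σ _, le_rfl, ?_, hQ⟩
  rw [r.pos]
  refine ⟨r.two, r.bdd.setReg (E.ω h.pos).2, fun y => ?_, ?_, r.mem, r.out, rfl⟩
  · by_cases hy : y = x
    · simp [State.setReg, hy]
    · have : y.ctorIdx ≠ x.ctorIdx := fun h => hy (Var.ctorIdx_inj h)
      simp [State.setReg, HS.set, hy, this, r.var]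
  · have : 1 ≠ 2 * x.ctorIdx := by omega
    simp [State.setReg, this, r.W]

lemma sto {z a e : Expr} (hz : z.ok E h) (ha : a.ok E h) (he : e.ok E h)
    (hW : a.val E h < E.W) (hw : z.val E h * E.W + a.val E h < 2 ^ E.w)
    (hQ : Q (h.put (z.val E h) (a.val E h) (e.val E h)) (z.cost + a.cost + e.cost + 3)) :
    WP E (sto z a e) h Q := by
  intro σ r
  obtain ⟨σ₁, t₁, e₁, l₁, v₁, s₁⟩ := z.comp_spec 0 σ r hz
  have b₁ := e₁.bdd r.bdd
  have r₁ := s₁.rel r b₁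
  obtain ⟨σ₂, t₂, e₂, l₂, v₂, s₂⟩ := a.comp_spec 1 σ₁ r₁ ha
  have b₂ := e₂.bdd b₁
  have r₂ := s₂.rel r₁ b₂
  obtain ⟨σ₃, t₃, e₃, l₃, v₃, s₃⟩ := e.comp_spec 2 σ₂ r₂ he
  have b₃ := e₃.bdd b₂
  have r₃ := s₃.rel r₂ b₃
  have v₁' : σ₃.reg 3 = z.val E h := by
    rw [s₃.reg _ (by omega), s₂.reg _ (by omega)]; exact v₁
  have v₂' : σ₃.reg 5 = a.val E h := by rw [s₃.reg _ (by omega)]; exact v₂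
  have v₃' : σ₃.reg 7 = e.val E h := v₃
  have hm : z.val E h * E.W % 2 ^ E.w = z.val E h * E.W := Nat.mod_eq_of_lt (by omega)
  have ex := Exec.seq e₁ (.seq e₂ (.seq e₃ (.seq (.bin σ₃ .mul 3 3 1) (.seq (.bin _ .add 3 3 5)
    (.store _ 3 7)))))
  refine ⟨_, _, _, _, ex, by omega, ?_, hQ⟩
  have bb := ex.bdd r.bdd
  have key : BinOp.eval E.w .add ((σ₃.setReg 3 (BinOp.eval E.w .mul (σ₃.reg 3) (σ₃.reg 1))).reg 3)
    ((σ₃.setReg 3 (BinOp.eval E.w .mul (σ₃.reg 3) (σ₃.reg 1))).reg 5)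
      = z.val E h * E.W + a.val E h := by
    simp [State.setReg, BinOp.eval, v₁', r₃.W, v₂', hm, Nat.mod_eq_of_lt hw]
  refine ⟨r.two, bb, fun y => ?_, ?_, ?_, r₃.out, r₃.pos⟩
  · have : 2 * y.ctorIdx ≠ 3 := by omega
    simp [State.setReg, this, r₃.var]
  · simp [State.setReg, r₃.W]
  · intro z' a' ha'
    rw [key]
    have k7 : ∀ u v, ((σ₃.setReg 3 u).setReg 3 v).reg 7 = e.val E h := by
      intro u v; simp [State.setReg, v₃']
    have k3 : ∀ u v, ((σ₃.setReg 3 u).setReg 3 v).reg 3 = v := by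
      intro u v; simp [State.setReg]
    simp only [HS.put_mem, k7, k3]
    show Function.update σ₃.mem _ _ _ = _
    by_cases hc : z' = z.val E h ∧ a' = a.val E h
    · rw [if_pos hc, hc.1, hc.2, Function.update_self]
    · rw [if_neg hc, Function.update_of_ne, r₃.mem _ _ ha']
      intro heq
      apply hc
      have h1 := congrArg (· / E.W) heq
      have h2 := congrArg (· % E.W) heq
      have pW : 0 < E.W := by omega
      simp only [Nat.mul_comm _ E.W, Nat.mul_add_div pW,
        Nat.mul_add_mod, Nat.div_eq_of_lt ha', Nat.div_eq_of_lt hW, Nat.mod_eq_of_lt ha',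
        Nat.mod_eq_of_lt hW] at h1 h2
      exact ⟨by omega, h2⟩

lemma outp {a e : Expr} (ha : a.ok E h) (he : e.ok E h)
    (hQ : Q { h with out := Function.update h.out (a.val E h) (e.val E h) }
      (a.cost + e.cost + 1)) : WP E (outp a e) h Q := by
  intro σ r
  obtain ⟨σ₁, t₁, e₁, l₁, v₁, s₁⟩ := a.comp_spec 0 σ r ha
  have b₁ := e₁.bdd r.bdd
  have r₁ := s₁.rel r b₁
  obtain ⟨σ₂, t₂, e₂, l₂, v₂, s₂⟩ := e.comp_spec 1 σ₁ r₁ he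
  have b₂ := e₂.bdd b₁
  have r₂ := s₂.rel r₁ b₂
  have v₁' : σ₂.reg 3 = a.val E h := by rw [s₂.reg _ (by omega)]; exact v₁
  have v₂' : σ₂.reg 5 = e.val E h := v₂
  refine ⟨_, _, _, _, .seq e₁ (.seq e₂ (.write _ 3 5)), by omega, ?_, hQ⟩
  exact ⟨r.two, b₂, r₂.var, r₂.W, r₂.mem, by simp only [v₁', v₂', r₂.out], r₂.pos⟩

lemma iff {e : Expr} (ho : e.ok E h)
    (hp : e.val E h ≠ 0 → WP E p h fun h' t => Q h' (t + e.cost + 1))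
    (hq : e.val E h = 0 → WP E q h fun h' t => Q h' (t + e.cost + 1)) :
    WP E (iff e p q) h Q := by
  intro σ r
  obtain ⟨σ₁, t₁, e₁, l₁, v₁, s₁⟩ := e.comp_spec 0 σ r ho
  have r₁ := s₁.rel r (e₁.bdd r.bdd)
  by_cases hc : e.val E h = 0
  · obtain ⟨σ₂, h₂, t₂, t₂', e₂, l₂, r₂, k₂⟩ := hq hc σ₁ r₁
    exact ⟨σ₂, h₂, _, _, .seq e₁ (.ite_neg (by rw [← hc]; exact v₁) e₂), by omega, r₂, k₂⟩
  · obtain ⟨σ₂, h₂, t₂, t₂', e₂, l₂, r₂, k₂⟩ := hp hc σ₁ r₁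
    exact ⟨σ₂, h₂, _, _, .seq e₁ (.ite_pos (by intro h0; exact hc (v₁ ▸ h0)) e₂), by omega, r₂,
      k₂⟩

lemma whl_done {e : Expr} (ho : e.ok E h) (hv : e.val E h = 0) (hQ : Q h (e.cost + 1)) :
    WP E (whl e p) h Q := by
  intro σ r
  obtain ⟨σ₁, t₁, e₁, l₁, v₁, s₁⟩ := e.comp_spec 0 σ r ho
  exact ⟨σ₁, h, _, _, .seq e₁ (.loop_done (by rw [← hv]; exact v₁)), by omega,
    s₁.rel r (e₁.bdd r.bdd), hQ⟩

lemma whl_step {e : Expr} (ho : e.ok E h) (hv : e.val E h ≠ 0)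
    (hp : WP E p h fun h₁ t₁ => WP E (whl e p) h₁ fun h₂ t₂ => Q h₂ (t₁ + t₂ + e.cost + 1)) :
    WP E (whl e p) h Q := by
  intro σ r
  obtain ⟨σ₁, t₁, e₁, l₁, v₁, s₁⟩ := e.comp_spec 0 σ r ho
  obtain ⟨σ₂, h₂, t₂, t₂', e₂, l₂, r₂, k₂⟩ := hp σ₁ (s₁.rel r (e₁.bdd r.bdd))
  obtain ⟨σ₃, h₃, t₃, t₃', e₃, l₃, r₃, k₃⟩ := k₂ σ₂ r₂
  cases e₃ with
  | seq a b =>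
    exact ⟨σ₃, h₃, _, _, .seq e₁ (.loop_step (fun h0 => hv (v₁ ▸ h0)) (.seq e₂ a) b), by omega, r₃,
      k₃⟩

/-- The rule for loops whose number of iterations `N - i` is known. -/
lemma loop_aux {e : Expr} {N : ℕ} (I : ℕ → HS → ℕ → Prop)
    (hI : ∀ i h t, I i h t → i ≤ N ∧ e.ok E h ∧ (e.val E h ≠ 0 ↔ i < N))
    (step : ∀ i < N, ∀ h t, I i h t →
      WP E p h fun h' t' => I (i + 1) h' (t + t' + e.cost + 1)) :
    ∀ (m i : ℕ) (h : HS) (t : ℕ), m + i = N → I i h t → ∀ σ, Rel E σ h → σ.reg 3 = e.val E h →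
      ∃ σ' h' t' s, Exec E.w E.ω E.inp (.loop 3 (.seq p (e.comp 0))) σ σ' s ∧ s + t ≤ t' + 1 ∧
        Rel E σ' h' ∧ I N h' t' := by
  intro m
  induction m with
  | zero =>
    intro i h t hi hh σ r h3
    obtain ⟨_, ho, hv⟩ := hI i h t hh
    have : e.val E h = 0 := by by_contra hc; have := hv.1 hc; omega
    exact ⟨σ, h, t, 1, .loop_done (by rw [h3, this]), by omega, r,
      by rwa [show N = i by omega]⟩
  | succ m ih =>
    intro i h t hi hh σ r h3
    obtain ⟨_, ho, hv⟩ := hI i h t hh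
    obtain ⟨σ₁, h₁, t₁, t₁', e₁, l₁, r₁, k₁⟩ := step i (by omega) h t hh σ r
    obtain ⟨_, ho₁, _⟩ := hI _ _ _ k₁
    obtain ⟨σ₂, t₂, e₂, l₂, v₂, s₂⟩ := e.comp_spec 0 σ₁ r₁ ho₁
    obtain ⟨σ₃, h₃, t₃, s₃, e₃, l₃, r₃, k₃⟩ := ih (i + 1) h₁ _ (by omega) k₁ σ₂
      (s₂.rel r₁ (e₂.bdd r₁.bdd)) v₂
    exact ⟨σ₃, h₃, t₃, _, .loop_step (by rw [h3]; exact hv.2 (by omega)) (.seq e₁ e₂) e₃,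
      by omega, r₃, k₃⟩

/-- The rule for loops with `N` iterations: the invariant `I i h t` speaks about the state `h`
before iteration number `i` and the time `t` spent so far, including the last test. -/
lemma whl {e : Expr} {N : ℕ} (I : ℕ → HS → ℕ → Prop) (h0 : I 0 h (e.cost + 1))
    (hI : ∀ i h t, I i h t → i ≤ N ∧ e.ok E h ∧ (e.val E h ≠ 0 ↔ i < N))
    (step : ∀ i < N, ∀ h t, I i h t →
      WP E p h fun h' t' => I (i + 1) h' (t + t' + e.cost + 1))
    (done : ∀ h t, I N h t → Q h t) : WP E (whl e p) h Q := by
  intro σ r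
  obtain ⟨_, ho, hv⟩ := hI 0 h _ h0
  obtain ⟨σ₁, t₁, e₁, l₁, v₁, s₁⟩ := e.comp_spec 0 σ r ho
  obtain ⟨σ₂, h₂, t₂, s, e₂, l₂, r₂, k₂⟩ := loop_aux I hI step N 0 h _ (by omega) h0 σ₁
    (s₁.rel r (e₁.bdd r.bdd)) v₁
  exact ⟨σ₂, h₂, _, _, .seq e₁ e₂, by omega, r₂, done _ _ k₂⟩

/-- The rule for counting loops: the invariant `I i h t` speaks about the state `h` before
iteration number `i` and the time `t` spent so far. -/
lemma for' {x : Var} {e : Expr} {N : ℕ} (I : ℕ → HS → ℕ → Prop)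
    (h0 : I 0 (h.set x 0) (e.cost + 5))
    (hI : ∀ i h t, I i h t → h.var x = i ∧ i ≤ N ∧ e.ok E h ∧ e.val E h = N)
    (step : ∀ i < N, ∀ h t, I i h t → WP E p h fun h' t' =>
      h'.var x = i ∧ I (i + 1) (h'.set x (i + 1)) (t + t' + e.cost + 7))
    (done : ∀ h t, I N h t → Q h t) : WP E (for' x e p) h Q := by
  have key : ∀ σ h, Rel E σ h → e.ok E h → e.val E h < 2 ^ E.w := by
    intro σ h r ho
    obtain ⟨σ₁, t₁, e₁, l₁, v₁, s₁⟩ := e.comp_spec 0 σ r ho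
    rw [← v₁]; exact (e₁.bdd r.bdd).1 _
  intro σ r
  have h1 : 1 < 2 ^ E.w := r.two
  have hN : N < 2 ^ E.w := by
    obtain ⟨-, -, ho, hv⟩ := hI _ _ _ h0
    have r1 : WP E (WordRAM.asg x (.lit 0)) h fun h' _ => h' = h.set x 0 :=
      WP.asg (by simp only [Expr.ok_lit]; omega) rfl
    obtain ⟨σ', h', _, _, _, _, r', rfl⟩ := r1 σ r
    have := key _ _ r' ho
    omega
  revert σ
  refine WP.seq (WP.asg (by simp only [Expr.ok_lit]; omega) ?_)
  refine WP.whl (N := N) (fun i h t => I i h (t + 2)) (by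
      simp only [Expr.cost_lt, Expr.cost_v, Expr.val_lit]; convert h0 using 1; omega) ?_ ?_ ?_
  · intro i h t hi
    obtain ⟨hx, hi, ho, hv⟩ := hI _ _ _ hi
    simp [hx, hi, ho, hv]
  · intro i hi h t hh
    refine WP.seq (WP.mono (step i hi h _ hh) ?_)
    rintro h' t' ⟨hx, hn⟩
    refine WP.asg (by simp [hx, h1]; omega) ?_
    convert hn using 1
    · simp [hx]
    · simp; omega
  · intro h t hh
    have := done _ _ hh
    simp only [Expr.cost_lit]
    convert this using 1
    omega

end WP

/-! ### Frames -/

/-- From `h` to `h'`, variables of level below `l`, memory areas outside `S`, the output and the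
position in the random sequence are unchanged. -/
structure Frame (l : ℕ) (S : Set ℕ) (h h' : HS) : Prop where
  var : ∀ v : Var, v.lev < l → h'.var v = h.var v
  mem : ∀ z, z ∉ S → h'.mem z = h.mem z
  out : h'.out = h.out
  pos : h'.pos = h.pos

namespace Frame
variable {l l' : ℕ} {S S' : Set ℕ} {h h' h'' : HS}

lemma refl : Frame l S h h := ⟨fun _ _ => rfl, fun _ _ => rfl, rfl, rfl⟩

lemma trans (a : Frame l S h h') (b : Frame l S h' h'') : Frame l S h h'' :=
  ⟨fun v hv => (b.var v hv).trans (a.var v hv), fun z hz => (b.mem z hz).trans (a.mem z hz),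
    b.out.trans a.out, b.pos.trans a.pos⟩

lemma weaken (a : Frame l S h h') (hl : l' ≤ l) (hS : S ⊆ S') : Frame l' S' h h' :=
  ⟨fun v hv => a.var v (by omega), fun z hz => a.mem z fun hc => hz (hS hc), a.out, a.pos⟩

lemma set {x : Var} (hx : l ≤ x.lev) (v : ℕ) : Frame l S h (h.set x v) :=
  ⟨fun y hy => by
    have : y ≠ x := by rintro rfl; omega
    simp [this], fun _ _ => rfl, rfl, rfl⟩

lemma put {z a v : ℕ} (hz : z ∈ S) : Frame l S h (h.put z a v) :=
  ⟨fun _ _ => rfl, fun z' hz' => h.put_mem_ne (by rintro rfl; exact hz' hz), rfl, rfl⟩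

end Frame

/-! ### Simulation of a program on shorter words, in an area of the memory -/

/-- All register numbers and constants of the program are below `R`. -/
def Prog.Below (R : ℕ) : Prog → Prop
  | skip => True
  | const x k => x < R ∧ k < R
  | bin _ x y z => x < R ∧ y < R ∧ z < R
  | load x y => x < R ∧ y < R
  | store x y => x < R ∧ y < R
  | read x y => x < R ∧ y < R
  | write x y => x < R ∧ y < R
  | rand x => x < R
  | seq p q => p.Below R ∧ q.Below R
  | ite x p q => x < R ∧ p.Below R ∧ q.Below R
  | loop x p => x < R ∧ p.Below R

lemma Prog.Below.mono {R R' : ℕ} (hR : R ≤ R') : ∀ {p : Prog}, p.Below R → p.Below R'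
  | skip, _ => trivial
  | const _ _, h => ⟨h.1.trans_le hR, h.2.trans_le hR⟩
  | bin _ _ _ _, h => ⟨h.1.trans_le hR, h.2.1.trans_le hR, h.2.2.trans_le hR⟩
  | load _ _, h => ⟨h.1.trans_le hR, h.2.trans_le hR⟩
  | store _ _, h => ⟨h.1.trans_le hR, h.2.trans_le hR⟩
  | read _ _, h => ⟨h.1.trans_le hR, h.2.trans_le hR⟩
  | write _ _, h => ⟨h.1.trans_le hR, h.2.trans_le hR⟩
  | rand _, h => Nat.lt_of_lt_of_le h hR
  | seq _ _, h => ⟨h.1.mono hR, h.2.mono hR⟩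
  | ite _ _ _, h => ⟨h.1.trans_le hR, h.2.1.mono hR, h.2.2.mono hR⟩
  | loop _ _, h => ⟨h.1.trans_le hR, h.2.mono hR⟩

lemma Prog.exists_below (p : Prog) : ∃ R, p.Below R := by
  induction p with
  | skip => exact ⟨0, trivial⟩
  | const x k => exact ⟨x + k + 1, by simp only [Below]; omega⟩
  | bin _ x y z => exact ⟨x + y + z + 1, by simp only [Below]; omega⟩
  | load x y | store x y | read x y | write x y =>
    exact ⟨x + y + 1, by simp only [Below]; omega⟩
  | rand x => exact ⟨x + 1, by simp only [Below]; omega⟩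
  | seq p q ihp ihq =>
    obtain ⟨a, ha⟩ := ihp; obtain ⟨b, hb⟩ := ihq
    exact ⟨a + b, ha.mono (by omega), hb.mono (by omega)⟩
  | ite x p q ihp ihq =>
    obtain ⟨a, ha⟩ := ihp; obtain ⟨b, hb⟩ := ihq
    exact ⟨x + 1 + a + b, by omega, ha.mono (by omega), hb.mono (by omega)⟩
  | loop x p ih =>
    obtain ⟨a, ha⟩ := ih
    exact ⟨x + 1 + a, by omega, ha.mono (by omega)⟩

/-- The memory cells of a simulated machine: its `R` registers, output cell `0`, the number of
random words drawn so far, and its memory. -/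
def State.enc (R : ℕ) (s : State) (q : ℕ) : ℕ :=
  if q < R then s.reg q else if q = R then s.out 0 else if q = R + 1 then s.pos
    else s.mem (q - (R + 2))

/-- The content of cell `q` of the simulated machine at area `Z`. The areas `Z`, `Z + 1`, `Z + 2`
hold a permanent value, a temporary value and a time stamp for each cell; the temporary value counts
if the time stamp is current. Advancing the clock `PH` thus undoes all temporary changes. -/
def view (h : HS) (q : ℕ) : ℕ :=
  if h.mem (h.var .Z + 2) q = h.var .PH then h.mem (h.var .Z + 1) q else h.mem (h.var .Z) q

open WordRAM.Expr in
/-- The expression for the content of a simulated cell. -/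
def rd (q : Expr) : Expr :=
  .ite (eq' (ld (v .Z + 2) q) (v .PH)) (ld (v .Z + 1) q) (ld (v .Z) q)

open WordRAM.Expr in
/-- Assignment to a simulated cell, permanently if `dir` and temporarily otherwise. -/
def wr (dir : Bool) (q e : Expr) : Prog :=
  if dir then sto (v .Z) q e else sto (v .Z + 1) q e ;; sto (v .Z + 2) q (v .PH)

open WordRAM.Expr in
/-- The simulation of a program for shorter words. The input array is in area `inA`, and random
word number `i` of copy `j` is in cell `i * r + j` of area `0`. -/
def sim (dir : Bool) (R : ℕ) : Prog → Prog
  | .skip => .skip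
  | .const x k => wr dir (lit x) (lit k % v .msk)
  | .bin o x y z => asg .t1 (rd (lit y)) ;; asg .t2 (rd (lit z)) ;;
      wr dir (lit x) (raw o (v .t1) (v .t2) % v .msk)
  | .load x y => asg .t1 (rd (lit y)) ;; asg .t2 (rd (lit (R + 2) + v .t1)) ;;
      wr dir (lit x) (v .t2)
  | .store x y => asg .t1 (rd (lit x)) ;; asg .t2 (rd (lit y)) ;;
      wr dir (lit (R + 2) + v .t1) (v .t2)
  | .read x y => asg .t1 (rd (lit y)) ;; wr dir (lit x) (ld (v .inA) (v .t1) % v .msk)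
  | .write x y => asg .t1 (rd (lit x)) ;; asg .t2 (rd (lit y)) ;;
      iff (v .t1) .skip (wr dir (lit R) (v .t2))
  | .rand x => asg .t1 (rd (lit (R + 1))) ;;
      wr dir (lit x) (ld 0 (v .t1 * v .r + v .j)) ;; wr dir (lit (R + 1)) (v .t1 + 1)
  | .seq p q => sim dir R p ;; sim dir R q
  | .ite x p q => iff (rd (lit x)) (sim dir R p) (sim dir R q)
  | .loop x p => whl (rd (lit x)) (sim dir R p)

/-- What the simulation needs of its surroundings: `w'` is the length of the simulated words, `ω'`
are the first `T` random words, and `inp'` is the simulated input array. -/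
structure SimCtx (E : Env) (R w' T : ℕ) (ω' : ℕ → Fin (2 ^ w')) (inp' : ℕ → ℕ) (h : HS) :
    Prop where
  msk : h.var .msk = 2 ^ w'
  hw : w' < E.w
  size : R + 2 + 2 ^ w' ≤ E.W
  hT : T * h.var .r ≤ E.W
  hj : h.var .j < h.var .r
  coin : ∀ i < T, h.mem 0 (i * h.var .r + h.var .j) = ω' i
  inp : ∀ a < 2 ^ w', h.mem (h.var .inA) a % 2 ^ w' = inp' a % 2 ^ w'
  inA : h.var .inA < 9
  Z : 9 ≤ h.var .Z
  addr : (h.var .Z + 3) * E.W ≤ 2 ^ E.w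

/-- The simulated machine at area `Z` is in the state `s`. -/
structure SimRep (dir : Bool) (R w' : ℕ) (h : HS) (s : State) : Prop where
  rep : ∀ q < R + 2 + 2 ^ w', view h q = s.enc R q
  bdd : s.Bdd w'
  stamp : dir → ∀ q, h.mem (h.var .Z + 2) q ≠ h.var .PH

/-- The changes that a simulation may make. -/
structure SimFrame (dir : Bool) (h h' : HS) : Prop extends
    Frame 6 {h.var .Z, h.var .Z + 1, h.var .Z + 2} h h' where
  direct : dir → h'.mem (h.var .Z + 1) = h.mem (h.var .Z + 1) ∧
    h'.mem (h.var .Z + 2) = h.mem (h.var .Z + 2)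
  stamped : dir = false → h'.mem (h.var .Z) = h.mem (h.var .Z) ∧
    ∀ q, h'.mem (h.var .Z + 2) q = h.mem (h.var .Z + 2) q ∨
      h'.mem (h.var .Z + 2) q = h.var .PH

section
variable {E : Env} {dir : Bool} {R w' T : ℕ} {ω' : ℕ → Fin (2 ^ w')} {inp' : ℕ → ℕ}
  {h h' h'' : HS} {s s' : State}

lemma SimFrame.refl : SimFrame dir h h :=
  ⟨.refl, fun _ => ⟨rfl, rfl⟩, fun _ => ⟨rfl, fun _ => .inl rfl⟩⟩

lemma SimFrame.trans (a : SimFrame dir h h') (b : SimFrame dir h' h'') : SimFrame dir h h'' := by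
  have hZ := a.var .Z (by decide)
  have hP := a.var .PH (by decide)
  have bd := b.direct
  have bs := b.stamped
  have bf := b.toFrame
  rw [hZ] at bd bs bf
  rw [hP] at bs
  refine ⟨a.toFrame.trans bf, fun hd => ⟨(bd hd).1.trans (a.direct hd).1,
    (bd hd).2.trans (a.direct hd).2⟩, fun hd => ⟨(bs hd).1.trans (a.stamped hd).1, fun q => ?_⟩⟩
  rcases (bs hd).2 q with h1 | h1
  · rw [h1]; exact (a.stamped hd).2 q
  · exact .inr h1

lemma SimFrame.set {x : Var} (hx : 6 ≤ x.lev) (v : ℕ) : SimFrame dir h (h.set x v) :=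
  ⟨.set hx v, fun _ => ⟨rfl, rfl⟩, fun _ => ⟨rfl, fun _ => .inl rfl⟩⟩

lemma SimCtx.frame (c : SimCtx E R w' T ω' inp' h) (f : SimFrame dir h h') :
    SimCtx E R w' T ω' inp' h' := by
  have hv := f.var
  have m0 : h'.mem 0 = h.mem 0 := f.mem 0 (by have := c.Z; simp; omega)
  have mi : h'.mem (h.var .inA) = h.mem (h.var .inA) :=
    f.mem _ (by have := c.Z; have := c.inA; simp; omega)
  refine ⟨?_, c.hw, c.size, ?_, ?_, ?_, ?_, ?_, ?_, ?_⟩ <;>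
    simp only [hv .msk (by decide), hv .r (by decide), hv .j (by decide), hv .inA (by decide),
      hv .Z (by decide), m0, mi]
  exacts [c.msk, c.hT, c.hj, c.coin, c.inp, c.inA, c.Z, c.addr]

lemma view_set {x : Var} (hx : 6 ≤ x.lev) (v : ℕ) : view (h.set x v) = view h := by
  have h1 : Var.Z ≠ x := by rintro rfl; revert hx; decide
  have h2 : Var.PH ≠ x := by rintro rfl; revert hx; decide
  funext q; simp [view, h1, h2]

lemma SimRep.set (hr : SimRep dir R w' h s) {x : Var} (hx : 6 ≤ x.lev) (v : ℕ) :
    SimRep dir R w' (h.set x v) s := by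
  refine ⟨by rw [view_set hx]; exact hr.rep, hr.bdd, ?_⟩
  have h1 : Var.Z ≠ x := by rintro rfl; revert hx; decide
  have h2 : Var.PH ≠ x := by rintro rfl; revert hx; decide
  simpa [h1, h2] using hr.stamp

/-- Simulated cells have valid addresses. -/
lemma SimCtx.addr_lt (c : SimCtx E R w' T ω' inp' h) {q z : ℕ} (hq : q < R + 2 + 2 ^ w')
    (hz : z ≤ h.var .Z + 2) : q < E.W ∧ z * E.W + q < 2 ^ E.w := by
  have h1 := c.size
  have h2 := c.addr
  refine ⟨by omega, lt_of_lt_of_le ?_ h2⟩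
  calc z * E.W + q < z * E.W + E.W := by omega
    _ = (z + 1) * E.W := by ring
    _ ≤ (h.var .Z + 3) * E.W := Nat.mul_le_mul_right _ (by omega)

lemma SimCtx.lit_ok (c : SimCtx E R w' T ω' inp' h) {q : ℕ} (hq : q < R + 2 + 2 ^ w') :
    q < 2 ^ E.w ∧ h.var .Z + 2 < 2 ^ E.w := by
  obtain ⟨h1, h2⟩ := c.addr_lt hq le_rfl
  have : h.var .Z + 2 ≤ (h.var .Z + 2) * E.W := Nat.le_mul_of_pos_right _ (by omega)
  omega

lemma rd_ok (c : SimCtx E R w' T ω' inp' h) {q : Expr} (hq : q.val E h < R + 2 + 2 ^ w')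
    (ho : q.ok E h) : (rd q).ok E h := by
  have h0 := c.addr_lt hq le_rfl
  have h1 := c.addr_lt hq (z := h.var .Z + 1) (by omega)
  have h2 := c.addr_lt hq (z := h.var .Z) (by omega)
  have h3 := c.lit_ok hq
  have := c.Z
  simp only [rd, Expr.ok_ite, Expr.ok_eq, Expr.ok_ld, Expr.ok_add, Expr.ok_v, Expr.ok_ofNat,
    Expr.val_add, Expr.val_v, Expr.val_ofNat, ho, h0, h1, h2, h3, true_and, and_true]
  exact ⟨by omega, fun _ => ⟨by omega, by omega⟩, fun _ => trivial⟩

lemma rd_val (q : Expr) : (rd q).val E h = view h (q.val E h) := by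
  simp only [rd, view, Expr.val_ite, Expr.val_eq, Expr.val_ld, Expr.val_add, Expr.val_v,
    Expr.val_ofNat]
  split_ifs <;> simp_all

lemma rd_cost (q : Expr) : (rd q).cost = 3 * q.cost + 19 := by
  simp [rd]; omega

lemma rd_lit_ok (c : SimCtx E R w' T ω' inp' h) {x : ℕ} (hx : x < R + 2) :
    (rd (.lit x)).ok E h :=
  have : 0 < 2 ^ w' := by positivity
  rd_ok c (by simp; omega) (c.lit_ok (by omega)).1

lemma SimRep.rd_lit (hr : SimRep dir R w' h s) {x : ℕ} (hx : x < R + 2) :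
    (rd (.lit x)).val E h = s.enc R x := by
  have : 0 < 2 ^ w' := by positivity
  rw [rd_val, hr.rep _ (by simp; omega)]; rfl

lemma enc_reg {x : ℕ} (hx : x < R) : s.enc R x = s.reg x := by simp [State.enc, hx]

/-- A write turns the representation of one simulated state into that of another one that differs in
a single cell. -/
lemma wp_wr (c : SimCtx E R w' T ω' inp' h) (hr : SimRep dir R w' h s) {q e : Expr}
    (hq : q.val E h < R + 2 + 2 ^ w') (ho : q.ok E h) (he : e.ok E h)
    (hqv : ∀ a b, q.val E (h.put a b (e.val E h)) = q.val E h)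
    (hqo : ∀ a b, q.ok E (h.put a b (e.val E h)))
    (hs : ∀ q' < R + 2 + 2 ^ w', s'.enc R q' = if q' = q.val E h then e.val E h else s.enc R q')
    (hb : s'.Bdd w') :
    WP E (wr dir q e) h fun h' t => t ≤ 2 * q.cost + e.cost + 20 ∧ h'.var = h.var ∧
      SimFrame dir h h' ∧ SimRep dir R w' h' s' := by
  have h0 := c.addr_lt hq le_rfl
  have h1 := c.addr_lt hq (z := h.var .Z + 1) (by omega)
  have h2 := c.addr_lt hq (z := h.var .Z) (by omega)
  have h3 := c.lit_ok hq
  have := c.Z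
  cases dir with
  | true =>
    simp only [wr, if_true]
    refine WP.sto (by simp) ho he h2.1 h2.2 ⟨by simp; omega, by simp, ⟨.put (by simp), ?_, by simp⟩,
      fun q' hq' => ?_, hb, ?_⟩
    · intro _
      exact ⟨h.put_mem_ne (by simp), h.put_mem_ne (by simp)⟩
    · have hst := hr.stamp rfl q'
      have := hr.rep q' hq'
      rw [hs q' hq']
      simp only [view, hst, if_false] at this
      simp [view, hst, this]
    · simpa using hr.stamp
  | false =>
    simp only [wr]
    refine WP.seq (WP.sto (by
      simp only [Expr.ok_add, Expr.ok_v, Expr.ok_ofNat, Expr.val_v, Expr.val_ofNat, true_and]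
      omega) ho he h1.1 (by simpa using h1.2) ?_)
    refine WP.sto (by
      simp only [Expr.ok_add, Expr.ok_v, Expr.ok_ofNat, Expr.val_v, Expr.val_ofNat, HS.put_var,
        true_and]
      omega) (hqo _ _) (by simp) (by rw [hqv]; exact h0.1)
      (by rw [hqv]; simpa using h0.2) ?_
    simp only [hqv, Expr.val_add, Expr.val_v, Expr.val_ofNat, HS.put_var]
    refine ⟨by simp; omega, by simp, ⟨(Frame.put (by simp)).trans (.put (by simp)), by simp, ?_⟩,
      fun q' hq' => ?_, hb, by simp⟩
    · intro _
      refine ⟨by rw [HS.put_mem_ne _ (by simp), HS.put_mem_ne _ (by simp)], fun q' => ?_⟩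
      by_cases hq' : q' = q.val E h <;> simp [hq']
    · have := hr.rep q' hq'
      rw [hs q' hq']
      simp only [view] at this
      by_cases hq'' : q' = q.val E h
      · simp [view, hq'']
      · simp [view, hq'', this]

lemma wp_wr_reg (c : SimCtx E R w' T ω' inp' h) (hr : SimRep dir R w' h s) {x u : ℕ} {e : Expr}
    (hx : x < R) (he : e.ok E h) (hv : e.val E h = u) (hu : u < 2 ^ w') :
    WP E (wr dir (.lit x) e) h fun h' t => t ≤ e.cost + 22 ∧ h'.var = h.var ∧
      SimFrame dir h h' ∧ SimRep dir R w' h' (s.setReg x u) := by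
  have : 0 < 2 ^ w' := by positivity
  have hl := (c.lit_ok (q := x) (by omega)).1
  refine (wp_wr c hr (q := .lit x) (s' := s.setReg x u) (by simp; omega) hl he (fun _ _ => rfl)
    (fun _ _ => hl) (fun q' _ => ?_) (hr.bdd.setReg hu)).mono fun h' t hh =>
      ⟨by have := hh.1; simp at this; omega, hh.2⟩
  simp only [Expr.val_lit, hv]
  by_cases hq : q' = x
  · simp [State.enc, State.setReg, hq, hx]
  · simp [State.enc, State.setReg, hq]

/-- Operations on short words are carried out on long words, and the result is truncated. For the
subtraction, this uses that `2 ^ w'` divides `2 ^ w`. -/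
lemma eval_mod (hw : w' ≤ E.w) (o : BinOp) {a b : ℕ} (hb : b ≤ 2 ^ w') :
    o.eval E.w a b % 2 ^ w' = o.eval w' a b := by
  have hd : 2 ^ w' ∣ 2 ^ E.w := pow_dvd_pow _ hw
  have hle : 2 ^ w' ≤ 2 ^ E.w := Nat.pow_le_pow_right (by norm_num) hw
  cases o <;> simp only [BinOp.eval, Nat.mod_mod_of_dvd _ hd]
  obtain ⟨d, hd⟩ := hd
  rw [show a + (2 ^ E.w - b) = a + (2 ^ w' - b) + (2 ^ E.w - 2 ^ w') by omega, hd,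
    show 2 ^ w' * d - 2 ^ w' = 2 ^ w' * (d - 1) by rw [Nat.mul_sub, mul_one],
    Nat.add_mul_mod_self_left]

/-- The simulation of a run of `t` steps takes `O(t)` steps. This makes the bounds for a dynamic
algorithm, whose words are shorter because its graph is small, available on the larger machine. -/
theorem wp_sim {p : Prog} {t : ℕ} (hp : p.Below R) (ex : Exec w' ω' inp' p s s' t)
    (hT : s.pos + t ≤ T) (c : SimCtx E R w' T ω' inp' h) (hr : SimRep dir R w' h s) :
    WP E (sim dir R p) h fun h' t' => t' ≤ 200 * t ∧ SimFrame dir h h' ∧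
      SimRep dir R w' h' s' := by
  have hp2 : 0 < 2 ^ w' := by positivity
  induction ex generalizing h with
  | skip σ => exact WP.skip ⟨by omega, .refl, hr⟩
  | const σ x k =>
    have hk := (c.lit_ok (q := k) (by have := hp.2; omega)).1
    refine (wp_wr_reg c hr hp.1 (u := k % 2 ^ w') (by simp [hk]) (by simp [c.msk])
      (Nat.mod_lt _ (by positivity))).mono fun h' t hh =>
        ⟨by have := hh.1; simp at this; omega, hh.2.2⟩
  | bin σ o x y z =>
    obtain ⟨hx, hy, hz⟩ := hp
    refine WP.seq (WP.asg (rd_lit_ok c (by omega)) ?_)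
    rw [hr.rd_lit (by omega), enc_reg hy]
    set h₁ := h.set .t1 (σ.reg y) with e₁
    have f₁ : SimFrame dir h h₁ := .set (by decide) _
    have c₁ := c.frame f₁
    have r₁ : SimRep dir R w' h₁ σ := hr.set (by decide) _
    refine WP.seq (WP.asg (rd_lit_ok c₁ (by omega)) ?_)
    rw [r₁.rd_lit (by omega), enc_reg hz]
    set h₂ := h₁.set .t2 (σ.reg z) with e₂
    have f₂ : SimFrame dir h₁ h₂ := .set (by decide) _
    have c₂ := c₁.frame f₂
    have r₂ : SimRep dir R w' h₂ σ := r₁.set (by decide) _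
    refine (wp_wr_reg c₂ r₂ hx (u := o.eval w' (σ.reg y) (σ.reg z)) (by simp) ?_
      (BinOp.eval_lt _ _ _ _)).mono fun h' t hh => ⟨?_, (f₁.trans f₂).trans hh.2.2.1, hh.2.2.2⟩
    · rw [← eval_mod c.hw.le o (hr.bdd.1 _).le]
      simp only [Expr.val_mod, Expr.val_raw, Expr.val_v, c₂.msk]
      simp [e₂, e₁]
    · have := hh.1; simp [rd_cost] at this ⊢; omega
  | load σ x y =>
    obtain ⟨hx, hy⟩ := hp
    refine WP.seq (WP.asg (rd_lit_ok c (by omega)) ?_)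
    rw [hr.rd_lit (by omega), enc_reg hy]
    set h₁ := h.set .t1 (σ.reg y) with e₁
    have f₁ : SimFrame dir h h₁ := .set (by decide) _
    have c₁ := c.frame f₁
    have r₁ : SimRep dir R w' h₁ σ := hr.set (by decide) _
    have hb := hr.bdd.1 y
    have v₁ : (Expr.lit (R + 2) + Expr.v .t1).val E h₁ = R + 2 + σ.reg y := by simp [e₁]
    have hl := (c.lit_ok (q := R + 2 + σ.reg y) (by omega)).1
    refine WP.seq (WP.asg (rd_ok c₁ (by rw [v₁]; omega) (by
      simp only [Expr.ok_add, Expr.ok_lit, Expr.ok_v, Expr.val_lit, true_and]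
      simp only [Expr.val_add, Expr.val_lit] at v₁; omega)) ?_)
    rw [rd_val, v₁, r₁.rep _ (by omega)]
    have hm : σ.enc R (R + 2 + σ.reg y) = σ.mem (σ.reg y) := by
      simp only [State.enc]
      rw [if_neg (by omega), if_neg (by omega), if_neg (by omega)]
      congr 1; omega
    rw [hm]
    set h₂ := h₁.set .t2 (σ.mem (σ.reg y)) with e₂
    have f₂ : SimFrame dir h₁ h₂ := .set (by decide) _
    have c₂ := c₁.frame f₂
    have r₂ : SimRep dir R w' h₂ σ := r₁.set (by decide) _
    refine (wp_wr_reg c₂ r₂ hx (u := σ.mem (σ.reg y)) (by simp) (by simp [e₂])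
      (hr.bdd.2 _)).mono fun h' t hh => ⟨?_, (f₁.trans f₂).trans hh.2.2.1, hh.2.2.2⟩
    have := hh.1; simp [rd_cost] at this ⊢; omega
  | store σ x y =>
    obtain ⟨hx, hy⟩ := hp
    refine WP.seq (WP.asg (rd_lit_ok c (by omega)) ?_)
    rw [hr.rd_lit (by omega), enc_reg hx]
    set h₁ := h.set .t1 (σ.reg x) with e₁
    have f₁ : SimFrame dir h h₁ := .set (by decide) _
    have c₁ := c.frame f₁
    have r₁ : SimRep dir R w' h₁ σ := hr.set (by decide) _
    refine WP.seq (WP.asg (rd_lit_ok c₁ (by omega)) ?_)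
    rw [r₁.rd_lit (by omega), enc_reg hy]
    set h₂ := h₁.set .t2 (σ.reg y) with e₂
    have f₂ : SimFrame dir h₁ h₂ := .set (by decide) _
    have c₂ := c₁.frame f₂
    have r₂ : SimRep dir R w' h₂ σ := r₁.set (by decide) _
    have hb := hr.bdd.1 x
    have hl := (c.lit_ok (q := R + 2 + σ.reg x) (by omega)).1
    have v₂ : (Expr.lit (R + 2) + Expr.v .t1).val E h₂ = R + 2 + σ.reg x := by simp [e₂, e₁]
    have o₂ : ∀ a b, (Expr.lit (R + 2) + Expr.v .t1).ok E (h₂.put a b (σ.reg y)) := by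
      intro a b; simp [e₂, e₁]; omega
    refine (wp_wr c₂ r₂ (s' := { σ with mem := Function.update σ.mem (σ.reg x) (σ.reg y) })
      (by rw [v₂]; omega) (by simp [e₂, e₁]; omega) (by simp) (fun _ _ => rfl)
      (by simpa [e₂] using o₂)
      (fun q' hq' => ?_) ⟨hr.bdd.1, fun a => ?_⟩).mono fun h' t hh =>
        ⟨?_, (f₁.trans f₂).trans hh.2.2.1, hh.2.2.2⟩
    · rw [v₂, show (Expr.v .t2).val E h₂ = σ.reg y by simp [e₂]]
      simp only [State.enc]
      by_cases hc : q' = R + 2 + σ.reg x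
      · rw [if_neg (by omega), if_neg (by omega), if_neg (by omega), if_pos hc,
          show q' - (R + 2) = σ.reg x by omega, Function.update_self]
      · rw [if_neg hc]
        split_ifs <;> try rfl
        rw [Function.update_of_ne (by omega)]
    · by_cases ha : a = σ.reg x
      · simp [ha, hr.bdd.1]
      · simpa [ha] using hr.bdd.2 a
    · have := hh.1; simp [rd_cost] at this ⊢; omega
  | read σ x y =>
    obtain ⟨hx, hy⟩ := hp
    refine WP.seq (WP.asg (rd_lit_ok c (by omega)) ?_)
    rw [hr.rd_lit (by omega), enc_reg hy]
    set h₁ := h.set .t1 (σ.reg y) with e₁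
    have f₁ : SimFrame dir h h₁ := .set (by decide) _
    have c₁ := c.frame f₁
    have r₁ : SimRep dir R w' h₁ σ := hr.set (by decide) _
    have hb := hr.bdd.1 y
    have ha := c₁.addr_lt (q := σ.reg y) (z := h₁.var .inA) (by omega)
      (by have := c₁.Z; have := c₁.inA; omega)
    refine (wp_wr_reg c₁ r₁ hx (u := inp' (σ.reg y) % 2 ^ w') ?_ ?_
      (Nat.mod_lt _ (by positivity))).mono fun h' t hh => ⟨?_, f₁.trans hh.2.2.1, hh.2.2.2⟩
    · have : h₁.var .t1 = σ.reg y := by simp [e₁]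
      simp only [Expr.ok_mod, Expr.ok_ld, Expr.ok_v, Expr.val_v, this, ha, and_self]
    · have := c₁.inp _ hb
      simp only [Expr.val_mod, Expr.val_ld, Expr.val_v, c₁.msk]
      rw [show h₁.var .t1 = σ.reg y by simp [e₁], this]
    · have := hh.1; simp [rd_cost] at this ⊢; omega
  | write σ x y =>
    obtain ⟨hx, hy⟩ := hp
    refine WP.seq (WP.asg (rd_lit_ok c (by omega)) ?_)
    rw [hr.rd_lit (by omega), enc_reg hx]
    set h₁ := h.set .t1 (σ.reg x) with e₁
    have f₁ : SimFrame dir h h₁ := .set (by decide) _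
    have c₁ := c.frame f₁
    have r₁ : SimRep dir R w' h₁ σ := hr.set (by decide) _
    refine WP.seq (WP.asg (rd_lit_ok c₁ (by omega)) ?_)
    rw [r₁.rd_lit (by omega), enc_reg hy]
    set h₂ := h₁.set .t2 (σ.reg y) with e₂
    have f₂ : SimFrame dir h₁ h₂ := .set (by decide) _
    have c₂ := c₁.frame f₂
    have r₂ : SimRep dir R w' h₂ σ := r₁.set (by decide) _
    have h1v : (Expr.v .t1).val E h₂ = σ.reg x := by simp [e₂, e₁]
    refine WP.iff (by simp) (fun h0 => WP.skip ⟨by simp [rd_cost], f₁.trans f₂, ?_⟩) (fun h0 => ?_)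
    · rw [h1v] at h0
      refine ⟨fun q hq => ?_, hr.bdd, r₂.stamp⟩
      rw [r₂.rep q hq]
      simp only [State.enc]
      rw [Function.update_of_ne (Ne.symm h0)]
    · have hl := (c.lit_ok (q := R) (by omega)).1
      refine (wp_wr c₂ r₂ (s' := { σ with out := Function.update σ.out (σ.reg x) (σ.reg y) })
        (by simp; omega) (by simpa using hl) (by simp) (fun _ _ => rfl)
        (fun _ _ => by simpa using hl) (fun q' hq' => ?_) hr.bdd).mono fun h' t hh =>
          ⟨?_, (f₁.trans f₂).trans hh.2.2.1, hh.2.2.2⟩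
      · rw [h1v] at h0
        simp only [State.enc, h0, Expr.val_lit, Expr.val_v]
        by_cases hc : q' = R
        · simp [hc, e₂]
        · simp [hc]
      · have := hh.1; simp [rd_cost] at this ⊢; omega
  | rand σ x =>
    have hx : x < R := hp
    refine WP.seq (WP.asg (rd_lit_ok c (by omega)) ?_)
    rw [hr.rd_lit (by omega), show σ.enc R (R + 1) = σ.pos by simp [State.enc]]
    set h₁ := h.set .t1 σ.pos with e₁
    have f₁ : SimFrame dir h h₁ := .set (by decide) _
    have c₁ := c.frame f₁
    have r₁ : SimRep dir R w' h₁ σ := hr.set (by decide) _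
    have ht1 : h₁.var .t1 = σ.pos := by simp [e₁]
    have hcoin := c₁.coin σ.pos (by omega)
    have hidx : σ.pos * h₁.var .r + h₁.var .j < E.W := by
      refine lt_of_lt_of_le ?_ c₁.hT
      calc σ.pos * h₁.var .r + h₁.var .j < (σ.pos + 1) * h₁.var .r := by
            have := c₁.hj; rw [add_one_mul]; omega
        _ ≤ _ := Nat.mul_le_mul_right _ (by omega)
    have hWw : E.W ≤ 2 ^ E.w := le_trans (Nat.le_mul_of_pos_left _ (by omega)) c₁.addr
    have he : (Expr.ld 0 (Expr.v .t1 * Expr.v .r + Expr.v .j)).val E h₁ = ω' σ.pos := by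
      simp [ht1, hcoin]
    refine WP.seq ((wp_wr_reg c₁ r₁ hx (u := ω' σ.pos) ?_ he (ω' σ.pos).2).mono ?_)
    · simp only [Expr.ok_ld, Expr.ok_ofNat, Expr.ok_add, Expr.ok_mul, Expr.ok_v, Expr.val_add,
        Expr.val_mul, Expr.val_v, Expr.val_ofNat, ht1]
      have : 0 < 2 ^ E.w := by positivity
      simp only [true_and, zero_mul, zero_add]
      omega
    · rintro h₂ t ⟨ht, hv₂, f₂, r₂⟩
      have c₂ := c₁.frame f₂
      have ht2 : h₂.var .t1 = σ.pos := by rw [hv₂, ht1]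
      have hl := (c.lit_ok (q := R + 1) (by omega)).1
      have hr0 : 1 ≤ h₁.var .r := by have := c₁.hj; omega
      have hTW : T ≤ E.W := le_trans (Nat.le_mul_of_pos_right _ hr0) c₁.hT
      have h1l : 1 < 2 ^ E.w := by have := c.size; have : 0 < 2 ^ w' := by positivity
                                   omega
      by_cases hlast : σ.pos + 1 < 2 ^ E.w
      swap
      · exfalso
        have := c₁.addr
        have := c₁.Z
        have : 3 * E.W ≤ (h₁.var .Z + 3) * E.W := Nat.mul_le_mul_right _ (by omega)
        have := c.size
        omega
      refine (wp_wr c₂ r₂ (q := .lit (R + 1))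
        (s' := { σ.setReg x (ω' σ.pos) with pos := σ.pos + 1 })
        (by simp; omega) hl ?_ (fun _ _ => rfl)
        (fun _ _ => hl) (fun q' hq' => ?_) r₂.bdd).mono fun h' t hh =>
          ⟨?_, (f₁.trans f₂).trans hh.2.2.1, hh.2.2.2⟩
      · simp only [Expr.ok_add, Expr.ok_v, Expr.ok_ofNat, Expr.val_v, Expr.val_ofNat, ht2]
        exact ⟨trivial, h1l, hlast⟩
      · simp only [State.enc, Expr.val_lit, Expr.val_add, Expr.val_v, Expr.val_ofNat, ht2,
          State.setReg]
        by_cases hc : q' = R + 1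
        · simp [hc]
        · simp [hc]
      · have := hh.1; simp [rd_cost] at this ht ⊢; omega
  | @seq p q σ σ₁ σ₂ t t' e₁ e₂ ih₁ ih₂ =>
    refine WP.seq ((ih₁ hp.1 (by omega) c hr).mono ?_)
    rintro h₁ t₁ ⟨l₁, f₁, r₁⟩
    have := e₁.pos_le
    refine (ih₂ hp.2 (by omega) (c.frame f₁) r₁).mono ?_
    rintro h₂ t₂ ⟨l₂, f₂, r₂⟩
    exact ⟨by omega, f₁.trans f₂, r₂⟩
  | @ite_pos x p q σ σ' t hx e ih =>
    have hxR := hp.1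
    have hv := hr.rd_lit (E := E) (x := x) (by omega)
    rw [enc_reg hxR] at hv
    refine WP.iff (rd_lit_ok c (by omega)) (fun _ => ?_) (fun h0 => absurd (hv ▸ h0) hx)
    refine (ih hp.2.1 (by omega) c hr).mono ?_
    rintro h₁ t₁ ⟨l₁, f₁, r₁⟩
    exact ⟨by simp [rd_cost]; omega, f₁, r₁⟩
  | @ite_neg x p q σ σ' t hx e ih =>
    have hxR := hp.1
    have hv := hr.rd_lit (E := E) (x := x) (by omega)
    rw [enc_reg hxR] at hv
    refine WP.iff (rd_lit_ok c (by omega)) (fun h0 => absurd (hv ▸ hx) h0) (fun _ => ?_)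
    refine (ih hp.2.2 (by omega) c hr).mono ?_
    rintro h₁ t₁ ⟨l₁, f₁, r₁⟩
    exact ⟨by simp [rd_cost]; omega, f₁, r₁⟩
  | @loop_done x p σ hx =>
    have hxR := hp.1
    refine WP.whl_done (rd_lit_ok c (by omega)) ?_ ⟨by simp [rd_cost], .refl, hr⟩
    rw [hr.rd_lit (by omega), enc_reg hxR, hx]
  | @loop_step x p σ σ₁ σ₂ t t' hx e₁ e₂ ih₁ ih₂ =>
    have hxR := hp.1
    refine WP.whl_step (rd_lit_ok c (by omega)) ?_ ?_
    · rw [hr.rd_lit (by omega), enc_reg hxR]; exact hx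
    refine (ih₁ hp.2 (by omega) c hr).mono ?_
    rintro h₁ t₁ ⟨l₁, f₁, r₁⟩
    have := e₁.pos_le
    refine (ih₂ hp (by omega) (c.frame f₁) r₁).mono ?_
    rintro h₂ t₂ ⟨l₂, f₂, r₂⟩
    exact ⟨by simp [rd_cost]; omega, f₁.trans f₂, r₂⟩

end

/-! ### Independent streams of random words and majority votes -/

open MeasureTheory ProbabilityTheory
open scoped ENNReal

/-- Stream number `j` of `r` interleaved streams of random words, with words shortened to `w'`
bits. -/
def stream {w : ℕ} (w' r : ℕ) (ω : ℕ → Fin (2 ^ w)) (j : ℕ) : ℕ → Fin (2 ^ w') :=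
  fun i => ⟨(ω (i * r + j) : ℕ) % 2 ^ w', Nat.mod_lt _ (by positivity)⟩

instance (w : ℕ) : IsProbabilityMeasure (coins w) := by
  unfold coins; infer_instance

/-- The last `w'` bits of a uniformly distributed word are uniformly distributed. -/
lemma uniformOn_map_mod {w w' : ℕ} (hw : w' ≤ w) :
    (uniformOn Set.univ : Measure (Fin (2 ^ w))).map
      (fun x : Fin (2 ^ w) =>
        (⟨(x : ℕ) % 2 ^ w', Nat.mod_lt _ (by positivity)⟩ : Fin (2 ^ w')))
      = uniformOn Set.univ := by
  obtain ⟨d, rfl⟩ := Nat.exists_eq_add_of_le hw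
  refine Measure.ext_of_singleton fun a => ?_
  rw [Measure.map_apply (measurable_of_finite _) (measurableSet_singleton _), uniformOn_univ,
    uniformOn_univ, Measure.count_singleton]
  have hcard : (Finset.univ.filter fun x : Fin (2 ^ (w' + d)) => (x : ℕ) % 2 ^ w' = a).card
      = 2 ^ d := by
    have hp : 0 < 2 ^ w' := by positivity
    have hb : ∀ i < 2 ^ d, (a : ℕ) + 2 ^ w' * i < 2 ^ (w' + d) := by
      intro i hi
      rw [pow_add]
      calc (a : ℕ) + 2 ^ w' * i < 2 ^ w' + 2 ^ w' * i := by have := a.2; omega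
        _ = 2 ^ w' * (i + 1) := by ring
        _ ≤ _ := Nat.mul_le_mul_left _ hi
    rw [← Finset.card_range (2 ^ d)]
    symm
    refine Finset.card_bij' (fun i hi => ⟨a + 2 ^ w' * i, hb i (Finset.mem_range.1 hi)⟩)
      (fun x _ => (x : ℕ) / 2 ^ w') ?_ ?_ ?_ ?_
    · intro i hi
      simp [Nat.add_mul_mod_self_left, Nat.mod_eq_of_lt a.2]
    · intro x hx
      rw [Finset.mem_range, Nat.div_lt_iff_lt_mul hp, mul_comm, ← pow_add]
      exact x.2
    · intro i hi
      simp only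
      rw [Nat.add_mul_div_left _ _ hp, Nat.div_eq_of_lt a.2, zero_add]
    · intro x hx
      simp only [Finset.mem_filter, Finset.mem_univ, true_and] at hx
      apply Fin.ext
      simp only
      rw [← hx]
      exact Nat.mod_add_div _ _
  have hset : (fun x : Fin (2 ^ (w' + d)) =>
      (⟨(x : ℕ) % 2 ^ w', Nat.mod_lt _ (by positivity)⟩ : Fin (2 ^ w'))) ⁻¹' {a}
      = ↑(Finset.univ.filter fun x : Fin (2 ^ (w' + d)) => (x : ℕ) % 2 ^ w' = a) := by
    ext x; simp [Fin.ext_iff]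
  rw [hset, Measure.count_apply_finset, hcard]
  simp only [Fintype.card_fin, Nat.cast_pow, pow_add]
  push_cast
  nth_rewrite 1 [← one_mul ((2 : ℝ≥0∞) ^ d)]
  exact ENNReal.mul_div_mul_right _ _ (by simp) (by simp)

/-- The streams are independent and uniformly distributed. -/
lemma map_stream {w w' : ℕ} (hw : w' ≤ w) (r : ℕ) :
    (coins w).map (fun ω (j : Fin r) => stream w' r ω j)
      = Measure.infinitePi fun _ : Fin r => coins w' := by
  have hinj : Function.Injective fun p : Fin r × ℕ => p.2 * r + (p.1 : ℕ) := by
    rintro ⟨⟨a, ha⟩, i⟩ ⟨⟨b, hb⟩, j⟩ h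
    simp only at h
    have pr : 0 < r := by omega
    have h1 := congrArg (· / r) h
    have h2 := congrArg (· % r) h
    simp only [Nat.mul_comm _ r, Nat.mul_add_div pr, Nat.mul_add_mod, Nat.div_eq_of_lt ha,
      Nat.div_eq_of_lt hb, Nat.mod_eq_of_lt ha, Nat.mod_eq_of_lt hb] at h1 h2
    simp; omega
  let f : Fin (2 ^ w) → Fin (2 ^ w') := fun x => ⟨(x : ℕ) % 2 ^ w', Nat.mod_lt _ (by positivity)⟩
  have hf : Measurable f := measurable_of_finite _
  have e1 : (coins w).map (fun ω (p : Fin r × ℕ) => ω (p.2 * r + (p.1 : ℕ)))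
      = Measure.infinitePi fun _ : Fin r × ℕ => uniformOn Set.univ :=
    Measure.map_infinitePi_infinitePi_of_inj
      (P := fun _ : ℕ => (uniformOn Set.univ : Measure (Fin (2 ^ w)))) hinj
  have e2 : (Measure.infinitePi fun _ : Fin r × ℕ =>
      (uniformOn Set.univ : Measure (Fin (2 ^ w)))).map (fun x p => f (x p))
      = Measure.infinitePi fun _ : Fin r × ℕ => (uniformOn Set.univ : Measure (Fin (2 ^ w'))) := by
    rw [Measure.infinitePi_map_pi (f := fun _ => f) _ (fun _ => hf)]
    congr! 2
    exact uniformOn_map_mod hw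
  have e3 := Measure.infinitePi_map_curry
    (fun (_ : Fin r) (_ : ℕ) => (uniformOn Set.univ : Measure (Fin (2 ^ w'))))
  rw [← e2, ← e1, Measure.map_map (by fun_prop) (by fun_prop),
    Measure.map_map (by fun_prop) (by fun_prop)] at e3
  exact e3

/-- If one run errs with probability at most `1/3`, then at least half of `2 * s` independent runs
err with probability at most `(8/9) ^ s`. -/
theorem coins_majority {w w' : ℕ} (hw : w' ≤ w) (s : ℕ) (B : Set (ℕ → Fin (2 ^ w')))
    (hB : coins w' B ≤ 1 / 3) :
    coins w {ω | ∃ J : Finset ℕ, (∀ j ∈ J, j < 2 * s ∧ stream w' (2 * s) ω j ∈ B) ∧ s ≤ J.card}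
      ≤ ENNReal.ofReal ((8 / 9) ^ s) := by
  classical
  set r := 2 * s with hr
  set μ := coins w
  -- the outer measure of `B` is attained by a measurable superset
  set B' := toMeasurable (coins w') B with hB'
  have mB' : MeasurableSet B' := measurableSet_toMeasurable _ _
  have hB'3 : coins w' B' ≤ 1 / 3 := by rw [hB', measure_toMeasurable]; exact hB
  have mst : ∀ j : Fin r, Measurable fun ω : ℕ → Fin (2 ^ w) => stream w' r ω j := by
    intro j
    refine measurable_pi_lambda _ fun i => ?_
    exact (measurable_of_finite fun x : Fin (2 ^ w) =>
      (⟨(x : ℕ) % 2 ^ w', Nat.mod_lt _ (by positivity)⟩ : Fin (2 ^ w'))).comp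
        (measurable_pi_apply _)
  have hmapj : ∀ j : Fin r, μ.map (fun ω => stream w' r ω j) = coins w' := by
    intro j
    have := congrArg (fun ν => ν.map fun x => x j) (map_stream hw r)
    rw [Measure.map_map (by fun_prop) (by fun_prop), Measure.infinitePi_map_eval] at this
    exact this
  have hind : iIndepFun (fun (j : Fin r) ω => stream w' r ω j) μ := by
    rw [iIndepFun_iff_map_fun_eq_infinitePi_map mst, map_stream hw r]
    simp only [hmapj]
  -- the exponential moment of the number of errors: one error doubles the product of the `g`
  let g : (ℕ → Fin (2 ^ w')) → ℝ≥0∞ := fun x => if x ∈ B' then 2 else 1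
  have mg : Measurable g := Measurable.ite mB' measurable_const measurable_const
  have hind' : iIndepFun (fun (j : Fin r) ω => g (stream w' r ω j)) μ :=
    hind.comp (fun _ => g) fun _ => mg
  have hint := lintegral_prod_eq_prod_lintegral_of_indepFun Finset.univ _ hind'
    (fun j => mg.comp (mst j))
  have hone : ∀ j : Fin r, ∫⁻ ω, g (stream w' r ω j) ∂μ ≤ 4 / 3 := by
    intro j
    have : ∫⁻ ω, g (stream w' r ω j) ∂μ = ∫⁻ x, g x ∂(coins w') := by
      rw [← hmapj j, lintegral_map mg (mst j)]
    rw [this]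
    have hg : g = fun x => 1 + B'.indicator (fun _ => 1) x := by
      funext x
      by_cases hx : x ∈ B' <;> simp [g, hx]; norm_num
    rw [hg, lintegral_add_left measurable_const, lintegral_indicator mB']
    simp only [lintegral_const, measure_univ, mul_one, Measure.restrict_apply, MeasurableSet.univ,
      Set.univ_inter, one_mul]
    calc 1 + coins w' B' ≤ 1 + 1 / 3 := by gcongr
      _ = 4 / 3 := by
        have h3 : (1 : ℝ≥0∞) = 3 / 3 := (ENNReal.div_self (by norm_num) (by norm_num)).symm
        nth_rewrite 1 [h3]
        rw [ENNReal.div_add_div_same]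
        norm_num
  have htot : ∫⁻ ω, ∏ j : Fin r, g (stream w' r ω j) ∂μ ≤ (4 / 3) ^ r := by
    rw [hint]
    refine (Finset.prod_le_prod' fun j _ => hone j).trans ?_
    simp
  -- Markov's inequality, where `s` errors make the product at least `2 ^ s`
  have hmk := mul_meas_ge_le_lintegral
    (Finset.measurable_fun_prod Finset.univ fun (j : Fin r) _ => mg.comp (mst j)) (2 ^ s) (μ := μ)
  have hsub : {ω : ℕ → Fin (2 ^ w) | ∃ J : Finset ℕ, (∀ j ∈ J, j < r ∧ stream w' r ω j ∈ B) ∧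
      s ≤ J.card} ⊆ {ω | 2 ^ s ≤ ∏ j : Fin r, (g ∘ fun ω => stream w' r ω j) ω} := by
    rintro ω ⟨J, hJ, hs⟩
    simp only [Set.mem_ofPred_eq, Function.comp]
    have hc : J.card ≤ (Finset.univ.filter fun j : Fin r => stream w' r ω j ∈ B').card := by
      rw [← Finset.card_map Fin.valEmbedding]
      refine Finset.card_le_card fun j hj => ?_
      simp only [Finset.mem_map, Finset.mem_filter, Finset.mem_univ, true_and]
      exact ⟨⟨j, (hJ j hj).1⟩, subset_toMeasurable _ _ (hJ j hj).2, rfl⟩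
    calc (2 : ℝ≥0∞) ^ s ≤ 2 ^ (Finset.univ.filter fun j : Fin r => stream w' r ω j ∈ B').card :=
          pow_le_pow_right₀ (by norm_num) (hs.trans hc)
      _ = _ := by rw [Finset.prod_ite]; simp
  have h2 : (2 : ℝ≥0∞) ^ s * μ {ω | ∃ J : Finset ℕ,
      (∀ j ∈ J, j < r ∧ stream w' r ω j ∈ B) ∧ s ≤ J.card} ≤ (4 / 3) ^ r := by
    refine le_trans ?_ (hmk.trans htot)
    gcongr
  rw [mul_comm] at h2
  refine (ENNReal.le_div_iff_mul_le (by simp) (by simp)).2 h2 |>.trans (le_of_eq ?_)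
  have e43 : (4 / 3 : ℝ≥0∞) = ENNReal.ofReal (4 / 3) := by
    rw [ENNReal.ofReal_div_of_pos (by norm_num)]; norm_num
  have e2 : (2 : ℝ≥0∞) = ENNReal.ofReal 2 := by norm_num
  rw [e43, e2, ← ENNReal.ofReal_pow (by norm_num), ← ENNReal.ofReal_pow (by norm_num),
    ← ENNReal.ofReal_div_of_pos (by positivity), hr, pow_mul, ← div_pow]
  norm_num

end WordRAM

namespace DynGraph

/-! ### Graphs that encode a vector-matrix-vector product -/

/-- The vertex to which slot `u` is attached. -/
def hub (k τ u : ℕ) : ℕ := if u < k then 2 * k else 2 * k + τ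

/-- The graph on `N` vertices with the edges `rel` and the slot edges: for each of the `2 * k`
slots `u` with `b u`, the vertex `u` is joined to its hub. The slots below `k` hold the left
vector, the others hold the right vector. -/
def slotGraph (N k τ : ℕ) (rel : ℕ → ℕ → Prop) (b : ℕ → Bool) : SimpleGraph (Fin N) :=
  SimpleGraph.fromRel fun u v : Fin N => rel u v ∨ ((u : ℕ) < 2 * k ∧ b u = true ∧ v = hub k τ u)

lemma slotGraph_adj {N k τ : ℕ} {rel : ℕ → ℕ → Prop} {b : ℕ → Bool} {u v : Fin N} :
    (slotGraph N k τ rel b).Adj u v ↔ u ≠ v ∧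
      ((rel u v ∨ ((u : ℕ) < 2 * k ∧ b u = true ∧ (v : ℕ) = hub k τ u)) ∨
        (rel v u ∨ ((v : ℕ) < 2 * k ∧ b v = true ∧ (u : ℕ) = hub k τ v))) := by
  simp [slotGraph]

/-- The vector-matrix-vector product is one. -/
def Hit (k : ℕ) (m : ℕ → ℕ → Bool) (b : ℕ → Bool) : Prop :=
  ∃ i < k, ∃ j < k, b i = true ∧ m i j = true ∧ b (k + j) = true

/-- A bipartite graph given by the matrix, with some extra edges `ext`. -/
def directRel (ext : ℕ → ℕ → ℕ → Prop) (k : ℕ) (m : ℕ → ℕ → Bool) (u v : ℕ) : Prop :=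
  (u < k ∧ k ≤ v ∧ v < 2 * k ∧ m u (v - k) = true) ∨ ext k u v

/-- A triangle in the bipartite graph with one hub shows that the product is one. -/
lemma hit_of_triangle {k : ℕ} {m : ℕ → ℕ → Bool} {b : ℕ → Bool} {x y z : ℕ}
    (ad : ∀ u v, (u = x ∧ v = y) ∨ (u = x ∧ v = z) ∨ (u = y ∧ v = z) →
      ((u < k ∧ k ≤ v ∧ v < 2 * k ∧ m u (v - k) = true) ∨ (u < 2 * k ∧ b u = true ∧ v = 2 * k)) ∨
      ((v < k ∧ k ≤ u ∧ u < 2 * k ∧ m v (u - k) = true) ∨ (v < 2 * k ∧ b v = true ∧ u = 2 * k))) :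
    Hit k m b := by
  have key : ∀ i w, i < k → k ≤ w → w < 2 * k → b i = true → m i (w - k) = true → b w = true →
      Hit k m b := by
    intro i w h1 h2 h3 h4 h5 h6
    exact ⟨i, h1, w - k, by omega, h4, h5, by rwa [show k + (w - k) = w by omega]⟩
  have h1 := ad x y (by simp)
  have h2 := ad x z (by simp)
  have h3 := ad y z (by simp)
  rcases h1 with (h1 | h1) | (h1 | h1) <;> rcases h2 with (h2 | h2) | (h2 | h2) <;>
    rcases h3 with (h3 | h3) | (h3 | h3) <;>
    first
      | (exfalso; omega)
      | exact key x y (by omega) (by omega) (by omega) (by tauto) (by tauto) (by tauto)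
      | exact key y x (by omega) (by omega) (by omega) (by tauto) (by tauto) (by tauto)
      | exact key x z (by omega) (by omega) (by omega) (by tauto) (by tauto) (by tauto)
      | exact key z x (by omega) (by omega) (by omega) (by tauto) (by tauto) (by tauto)
      | exact key y z (by omega) (by omega) (by omega) (by tauto) (by tauto) (by tauto)
      | exact key z y (by omega) (by omega) (by omega) (by tauto) (by tauto) (by tauto)

lemma drop_ext {A A' B B' C C' : Prop} (h : ((A ∨ C) ∨ B) ∨ ((A' ∨ C') ∨ B')) (hC : ¬ C)
    (hC' : ¬ C') : (A ∨ B) ∨ (A' ∨ B') := by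
  tauto

lemma hub_zero (k u : ℕ) : hub k 0 u = 2 * k := by simp [hub]

/-- The graphs of a family detect the product by the pattern `P`, in such a way that every copy
that is needed can be chosen to contain the hub. -/
def Detects {c : ℕ} (P : SimpleGraph (Fin c)) (e : ℕ)
    (rel : ℕ → (ℕ → ℕ → Bool) → ℕ → ℕ → Prop) : Prop :=
  ∀ k N m b, 1 ≤ k → N = 2 ^ e * k ^ 2 →
    (P.IsContained (slotGraph N k 0 (rel k m) b) → Hit k m b) ∧
    (Hit k m b → ∃ f : SimpleGraph.Copy P (slotGraph N k 0 (rel k m) b),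
      ∃ x, ((f x : Fin N) : ℕ) = 2 * k)

/-- A copy from an injective map on numbers. -/
lemma exists_copy {c N s : ℕ} {P : SimpleGraph (Fin c)} {G : SimpleGraph (Fin N)} (g : Fin c → ℕ)
    (hg : ∀ x, g x < N) (inj : Function.Injective g)
    (ad : ∀ x y, x < y → P.Adj x y → G.Adj ⟨g x, hg x⟩ ⟨g y, hg y⟩) {x₀ : Fin c} (hs : g x₀ = s) :
    ∃ f : SimpleGraph.Copy P G, ∃ x, ((f x : Fin N) : ℕ) = s := by
  have inj' : Function.Injective fun x => (⟨g x, hg x⟩ : Fin N) :=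
    fun x y h => inj (congrArg Fin.val h)
  refine ⟨⟨⟨fun x => ⟨g x, hg x⟩, fun {x y} h => ?_⟩, inj'⟩, x₀, hs⟩
  rcases lt_trichotomy x y with hxy | hxy | hxy
  · exact ad x y hxy h
  · exact absurd hxy h.ne
  · exact (ad y x hxy h.symm).symm

/-- No extra edges. -/
def noExt (_ _ _ : ℕ) : Prop := False
/-- A pendant edge at the hub. -/
def pawExt (k u v : ℕ) : Prop := u = 2 * k ∧ v = 2 * k + 1
/-- Every left vertex `u` has a twin that is adjacent to `u` and to the hub. -/
def diamondExt (k u v : ℕ) : Prop :=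
  (u < k ∧ v = 2 * k + 1 + u) ∨ (2 * k + 1 ≤ u ∧ u < 3 * k + 1 ∧ v = 2 * k)
/-- A vertex that is adjacent to all others. -/
def cliqueExt (k u v : ℕ) : Prop := u ≤ 2 * k ∧ v = 2 * k + 1

lemma size_aux {k N : ℕ} (hk : 1 ≤ k) (hN : N = 2 ^ 2 * k ^ 2) : 3 * k + 1 ≤ N := by
  subst hN; nlinarith

/-- A common one of row `i` and column `j` is a triangle of `i`, `j` and the hub. -/
theorem detects_triangle : Detects (SimpleGraph.cycleGraph 3) 2 (directRel noExt) := by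
  intro k N m b hk hN
  have hs := size_aux hk hN
  refine ⟨fun ⟨f⟩ => ?_, fun ⟨i, hi, j, hj, bi, mij, bj⟩ => ?_⟩
  · have ad : ∀ x y : Fin 3, x ≠ y → _ := fun x y h =>
      f.toHom.map_adj (v := x) (w := y) (by revert x y; decide)
    refine hit_of_triangle (x := f 0) (y := f 1) (z := f 2) fun u v h => ?_
    have a01 := ad 0 1 (by decide)
    have a02 := ad 0 2 (by decide)
    have a12 := ad 1 2 (by decide)
    simp only [slotGraph_adj, hub_zero, directRel, noExt, or_false,
      SimpleGraph.Copy.toHom_apply] at a01 a02 a12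
    rcases h with ⟨rfl, rfl⟩ | ⟨rfl, rfl⟩ | ⟨rfl, rfl⟩
    exacts [a01.2, a02.2, a12.2]
  · refine exists_copy ![i, k + j, 2 * k] (fun x => by fin_cases x <;> simp <;> omega) ?_ ?_
      (x₀ := 2) rfl
    · intro x y h
      fin_cases x <;> fin_cases y <;> simp at h <;> first | rfl | omega
    · intro x y hxy _
      rw [slotGraph_adj, hub_zero, hub_zero]
      fin_cases x <;> fin_cases y <;> simp at hxy <;> simp [directRel, *] <;> omega

/-- The pendant edge at the hub completes a triangle to a paw. -/
theorem detects_paw : Detects paw 2 (directRel pawExt) := by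
  intro k N m b hk hN
  have hs := size_aux hk hN
  refine ⟨fun ⟨f⟩ => ?_, fun ⟨i, hi, j, hj, bi, mij, bj⟩ => ?_⟩
  · have ad : ∀ x y : Fin 4, x ≠ y → x ≠ 3 → y ≠ 3 → _ := fun x y h hx hy =>
      f.toHom.map_adj (v := x) (w := y) (by
        simp only [paw, SimpleGraph.fromEdgeSet_adj]
        revert x y; decide)
    have a01 := ad 0 1 (by decide) (by decide) (by decide)
    have a02 := ad 0 2 (by decide) (by decide) (by decide)
    have a12 := ad 1 2 (by decide) (by decide) (by decide)
    simp only [slotGraph_adj, hub_zero, directRel, pawExt,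
      SimpleGraph.Copy.toHom_apply, ne_eq, Fin.ext_iff] at a01 a02 a12
    have h0 : ((f 0 : Fin N) : ℕ) ≤ 2 * k := by omega
    have h1 : ((f 1 : Fin N) : ℕ) ≤ 2 * k := by omega
    have h2 : ((f 2 : Fin N) : ℕ) ≤ 2 * k := by omega
    refine hit_of_triangle (x := f 0) (y := f 1) (z := f 2) fun u v h => ?_
    rcases h with ⟨rfl, rfl⟩ | ⟨rfl, rfl⟩ | ⟨rfl, rfl⟩
    exacts [drop_ext a01.2 (by omega) (by omega), drop_ext a02.2 (by omega) (by omega),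
      drop_ext a12.2 (by omega) (by omega)]
  · refine exists_copy ![2 * k, i, k + j, 2 * k + 1]
      (fun x => by fin_cases x <;> simp <;> omega) ?_ ?_ (x₀ := 0) rfl
    · intro x y h
      fin_cases x <;> fin_cases y <;> simp at h <;> first | rfl | omega
    · intro x y hxy hp
      rw [slotGraph_adj, hub_zero, hub_zero]
      fin_cases x <;> fin_cases y <;> simp at hxy <;>
        simp [directRel, pawExt, paw, *] at hp ⊢ <;> omega

/-- A triangle and the twin of its left vertex form a diamond. Conversely, twins have degree two, so
they are no ends of a chord, and distinct twins have distinct neighbours, so one of the two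
triangles of a diamond contains no twin. -/
theorem detects_diamond : Detects diamond 2 (directRel diamondExt) := by
  intro k N m b hk hN
  have hs := size_aux hk hN
  refine ⟨fun ⟨f⟩ => ?_, fun ⟨i, hi, j, hj, bi, mij, bj⟩ => ?_⟩
  · have ad : ∀ x y : Fin 4, x ≠ y → ({x, y} : Finset (Fin 4)) ≠ {1, 3} → _ := fun x y h h' =>
      f.toHom.map_adj (v := x) (w := y) (by
        simp only [diamond, SimpleGraph.sup_adj, SimpleGraph.cycleGraph_adj, SimpleGraph.edge_adj]
        revert x y; decide)
    have a01 := ad 0 1 (by decide) (by decide)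
    have a02 := ad 0 2 (by decide) (by decide)
    have a12 := ad 1 2 (by decide) (by decide)
    have a03 := ad 0 3 (by decide) (by decide)
    have a23 := ad 2 3 (by decide) (by decide)
    have n13 : ((f 1 : Fin N) : ℕ) ≠ f 3 := fun h =>
      absurd (f.injective (Fin.ext h)) (by decide)
    simp only [slotGraph_adj, hub_zero, directRel, diamondExt,
      SimpleGraph.Copy.toHom_apply, ne_eq, Fin.ext_iff] at a01 a02 a12 a03 a23
    have n01 : ((f 0 : Fin N) : ℕ) ≠ f 1 := fun h =>
      absurd (f.injective (Fin.ext h)) (by decide)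
    have n12 : ((f 1 : Fin N) : ℕ) ≠ f 2 := fun h =>
      absurd (f.injective (Fin.ext h)) (by decide)
    have n23 : ((f 2 : Fin N) : ℕ) ≠ f 3 := fun h =>
      absurd (f.injective (Fin.ext h)) (by decide)
    have n03 : ((f 0 : Fin N) : ℕ) ≠ f 3 := fun h =>
      absurd (f.injective (Fin.ext h)) (by decide)
    have n02 : ((f 0 : Fin N) : ℕ) ≠ f 2 := fun h =>
      absurd (f.injective (Fin.ext h)) (by decide)
    -- the vertices of the chord have degree at least three, so they are no twins
    have h0 : ((f 0 : Fin N) : ℕ) ≤ 2 * k := by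
      by_contra hc
      have h1 : ((f 1 : Fin N) : ℕ) = 2 * k ∨ ((f 0 : Fin N) : ℕ) = 2 * k + 1 + f 1 := by omega
      have h2 : ((f 2 : Fin N) : ℕ) = 2 * k ∨ ((f 0 : Fin N) : ℕ) = 2 * k + 1 + f 2 := by omega
      have h3 : ((f 3 : Fin N) : ℕ) = 2 * k ∨ ((f 0 : Fin N) : ℕ) = 2 * k + 1 + f 3 := by omega
      clear a01 a02 a12 a03 a23
      omega
    have h2 : ((f 2 : Fin N) : ℕ) ≤ 2 * k := by
      by_contra hc
      have h1 : ((f 1 : Fin N) : ℕ) = 2 * k ∨ ((f 2 : Fin N) : ℕ) = 2 * k + 1 + f 1 := by omega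
      have h2 : ((f 0 : Fin N) : ℕ) = 2 * k ∨ ((f 2 : Fin N) : ℕ) = 2 * k + 1 + f 0 := by omega
      have h3 : ((f 3 : Fin N) : ℕ) = 2 * k ∨ ((f 2 : Fin N) : ℕ) = 2 * k + 1 + f 3 := by omega
      clear a01 a02 a12 a03 a23
      omega
    -- a twin lies in one triangle only
    have h13 : ((f 1 : Fin N) : ℕ) ≤ 2 * k ∨ ((f 3 : Fin N) : ℕ) ≤ 2 * k := by
      by_contra hc
      have h1 : ((f 0 : Fin N) : ℕ) = 2 * k ∨ ((f 1 : Fin N) : ℕ) = 2 * k + 1 + f 0 := by omega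
      have h2 : ((f 2 : Fin N) : ℕ) = 2 * k ∨ ((f 1 : Fin N) : ℕ) = 2 * k + 1 + f 2 := by omega
      have h3 : ((f 0 : Fin N) : ℕ) = 2 * k ∨ ((f 3 : Fin N) : ℕ) = 2 * k + 1 + f 0 := by omega
      have h4 : ((f 2 : Fin N) : ℕ) = 2 * k ∨ ((f 3 : Fin N) : ℕ) = 2 * k + 1 + f 2 := by omega
      clear a01 a02 a12 a03 a23
      omega
    rcases h13 with h1 | h3
    · refine hit_of_triangle (x := f 0) (y := f 1) (z := f 2) fun u v h => ?_
      rcases h with ⟨rfl, rfl⟩ | ⟨rfl, rfl⟩ | ⟨rfl, rfl⟩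
      exacts [drop_ext a01.2 (by omega) (by omega), drop_ext a02.2 (by omega) (by omega),
        drop_ext a12.2 (by omega) (by omega)]
    · refine hit_of_triangle (x := f 0) (y := f 2) (z := f 3) fun u v h => ?_
      rcases h with ⟨rfl, rfl⟩ | ⟨rfl, rfl⟩ | ⟨rfl, rfl⟩
      exacts [drop_ext a02.2 (by omega) (by omega), drop_ext a03.2 (by omega) (by omega),
        drop_ext a23.2 (by omega) (by omega)]
  · refine exists_copy ![i, k + j, 2 * k, 2 * k + 1 + i]
      (fun x => by fin_cases x <;> simp <;> omega) ?_ ?_ (x₀ := 2) rfl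
    · intro x y h
      fin_cases x <;> fin_cases y <;> simp at h <;> first | rfl | omega
    · intro x y hxy hp
      rw [slotGraph_adj, hub_zero, hub_zero]
      simp only [diamond, SimpleGraph.sup_adj, SimpleGraph.cycleGraph_adj,
        SimpleGraph.edge_adj] at hp
      fin_cases x <;> fin_cases y <;> simp at hxy <;>
        simp [directRel, diamondExt, *] at hp ⊢ <;> omega

/-- Removing the vertex that is adjacent to all others turns a clique into a triangle. -/
theorem detects_clique4 : Detects clique4 2 (directRel cliqueExt) := by
  intro k N m b hk hN
  have hs := size_aux hk hN
  refine ⟨fun ⟨f⟩ => ?_, fun ⟨i, hi, j, hj, bi, mij, bj⟩ => ?_⟩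
  · have ad : ∀ x y : Fin 4, x ≠ y → _ := fun x y h =>
      f.toHom.map_adj (v := x) (w := y) h
    simp only [slotGraph_adj, hub_zero, directRel, cliqueExt,
      SimpleGraph.Copy.toHom_apply, ne_eq, Fin.ext_iff] at ad
    have tri : ∀ x y z : Fin 4, x ≠ y → x ≠ z → y ≠ z → ((f x : Fin N) : ℕ) ≤ 2 * k →
        ((f y : Fin N) : ℕ) ≤ 2 * k → ((f z : Fin N) : ℕ) ≤ 2 * k → Hit k m b := by
      intro x y z hxy hxz hyz hx hy hz
      have axy := ad x y (by simpa [Fin.ext_iff] using hxy)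
      have axz := ad x z (by simpa [Fin.ext_iff] using hxz)
      have ayz := ad y z (by simpa [Fin.ext_iff] using hyz)
      refine hit_of_triangle (x := f x) (y := f y) (z := f z) fun u v h => ?_
      rcases h with ⟨rfl, rfl⟩ | ⟨rfl, rfl⟩ | ⟨rfl, rfl⟩
      exacts [drop_ext axy.2 (by omega) (by omega), drop_ext axz.2 (by omega) (by omega),
        drop_ext ayz.2 (by omega) (by omega)]
    have big : ∀ x : Fin 4, ((f x : Fin N) : ℕ) ≤ 2 * k + 1 := by
      intro x
      have := ad x (x + 1) (by fin_cases x <;> decide)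
      omega
    have one : ∀ x y : Fin 4, x ≠ y → ¬ (((f x : Fin N) : ℕ) = 2 * k + 1 ∧
        ((f y : Fin N) : ℕ) = 2 * k + 1) := by
      intro x y hxy h
      exact hxy (f.injective (Fin.ext (h.1.trans h.2.symm)))
    by_cases h0 : ((f 0 : Fin N) : ℕ) = 2 * k + 1
    · refine tri 1 2 3 (by decide) (by decide) (by decide) ?_ ?_ ?_
      · have := one 0 1 (by decide); have := big 1; omega
      · have := one 0 2 (by decide); have := big 2; omega
      · have := one 0 3 (by decide); have := big 3; omega
    by_cases h1 : ((f 1 : Fin N) : ℕ) = 2 * k + 1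
    · refine tri 0 2 3 (by decide) (by decide) (by decide) ?_ ?_ ?_
      · have := big 0; omega
      · have := one 1 2 (by decide); have := big 2; omega
      · have := one 1 3 (by decide); have := big 3; omega
    by_cases h2 : ((f 2 : Fin N) : ℕ) = 2 * k + 1
    · refine tri 0 1 3 (by decide) (by decide) (by decide) ?_ ?_ ?_
      · have := big 0; omega
      · have := big 1; omega
      · have := one 2 3 (by decide); have := big 3; omega
    · refine tri 0 1 2 (by decide) (by decide) (by decide) ?_ ?_ ?_
      · have := big 0; omega
      · have := big 1; omega
      · have := big 2; omega
  · refine exists_copy ![i, k + j, 2 * k, 2 * k + 1]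
      (fun x => by fin_cases x <;> simp <;> omega) ?_ ?_ (x₀ := 2) rfl
    · intro x y h
      fin_cases x <;> fin_cases y <;> simp at h <;> first | rfl | omega
    · intro x y hxy hp
      rw [slotGraph_adj, hub_zero, hub_zero]
      fin_cases x <;> fin_cases y <;> simp at hxy <;>
        simp [directRel, cliqueExt, *] <;> omega

/-! ### Long cycles -/

/-- Each pair `(i, j)` of a left and a right vertex has its own path with `d` edges, of which the
last one is present if the matrix entry is one. Vertex `a` of the path, for `1 ≤ a < d`, is
`2 * k + 1 + (a - 1) * k ^ 2 + (i * k + j)`. -/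
def pathRel (d k : ℕ) (m : ℕ → ℕ → Bool) (u v : ℕ) : Prop :=
  (2 * k + 1 ≤ v ∧ v < 2 * k + 1 + k ^ 2 ∧ u = (v - (2 * k + 1)) / k) ∨
  (2 * k + 1 ≤ u ∧ v = u + k ^ 2 ∧ v < 2 * k + 1 + (d - 1) * k ^ 2) ∨
  (2 * k + 1 + (d - 2) * k ^ 2 ≤ u ∧ u < 2 * k + 1 + (d - 1) * k ^ 2 ∧
    v = k + (u - (2 * k + 1 + (d - 2) * k ^ 2)) % k ∧
    m ((u - (2 * k + 1 + (d - 2) * k ^ 2)) / k) ((u - (2 * k + 1 + (d - 2) * k ^ 2)) % k) = true)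

/-- Vertex `a` of the path of the pair with number `p = i * k + j`. -/
def chain (d k a p : ℕ) : ℕ :=
  if a = 0 then p / k else if a = d then k + p % k else 2 * k + 1 + (a - 1) * k ^ 2 + p

section
variable {d k : ℕ} {m : ℕ → ℕ → Bool} {b : ℕ → Bool} {a p v : ℕ}

/-- Adjacency in the graph of long cycles, on numbers. -/
def PathAdj (d k : ℕ) (m : ℕ → ℕ → Bool) (b : ℕ → Bool) (u v : ℕ) : Prop :=
  (pathRel d k m u v ∨ (u < 2 * k ∧ b u = true ∧ v = 2 * k)) ∨
    (pathRel d k m v u ∨ (v < 2 * k ∧ b v = true ∧ u = 2 * k))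

lemma PathAdj.symm {u v : ℕ} (h : PathAdj d k m b u v) : PathAdj d k m b v u := Or.symm h

/-- Level and pair are determined by the number of a vertex. -/
lemma level_unique {K a a' p p' : ℕ} (hp : p < K) (hp' : p' < K)
    (h : a * K + p = a' * K + p') : a = a' ∧ p = p' := by
  have pK : 0 < K := by omega
  have h1 := congrArg (· / K) h
  have h2 := congrArg (· % K) h
  simp only [Nat.mul_comm _ K, Nat.mul_add_div pK, Nat.mul_add_mod, Nat.div_eq_of_lt hp,
    Nat.div_eq_of_lt hp', Nat.mod_eq_of_lt hp, Nat.mod_eq_of_lt hp'] at h1 h2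
  exact ⟨by omega, h2⟩

/-- An inner vertex of a path has only two neighbours. -/
lemma PathAdj.chain_cases (hk : 1 ≤ k) (h1 : 1 ≤ a) (hd : a < d) (hp : p < k ^ 2)
    (h : PathAdj d k m b (chain d k a p) v) :
    v = chain d k (a - 1) p ∨
      (v = chain d k (a + 1) p ∧ (a + 1 = d → m (p / k) (p % k) = true)) := by
  have hc : chain d k a p = 2 * k + 1 + (a - 1) * k ^ 2 + p := by
    unfold chain; rw [if_neg (by omega), if_neg (by omega)]
  rw [hc] at h
  obtain ⟨a, rfl⟩ := Nat.exists_eq_add_of_le' h1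
  obtain ⟨d, rfl⟩ := Nat.exists_eq_add_of_le' (show 2 ≤ d by omega)
  have hpk : p / k < k := by rw [Nat.div_lt_iff_lt_mul (by omega)]; nlinarith
  simp only [PathAdj, pathRel, Nat.add_sub_cancel, show d + 2 - 1 = d + 1 by omega] at h ⊢
  have hmono : ∀ {x y : ℕ}, x < y → x * k ^ 2 + k ^ 2 ≤ y * k ^ 2 := by
    intro x y hxy
    calc x * k ^ 2 + k ^ 2 = (x + 1) * k ^ 2 := by ring
      _ ≤ _ := Nat.mul_le_mul_right _ hxy
  have ha0 : a = 0 ∨ k ^ 2 ≤ a * k ^ 2 := by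
    rcases Nat.eq_zero_or_pos a with h0 | h0
    · exact .inl h0
    · right; simpa using hmono h0
  rcases h with (h | h) | (h | h)
  · rcases h with h | h | h
    · exfalso
      have := h.2.2
      have : (v - (2 * k + 1)) / k < k := by
        rw [Nat.div_lt_iff_lt_mul (by omega), ← pow_two]; omega
      omega
    · right
      have hlt : a < d := by
        by_contra hc
        have : d * k ^ 2 ≤ a * k ^ 2 := Nat.mul_le_mul_right _ (by omega)
        have := h.2.2
        rw [add_one_mul] at this
        omega
      refine ⟨?_, fun he => by omega⟩
      unfold chain
      rw [if_neg (by omega), if_neg (by omega), h.2.1]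
      simp only [Nat.add_sub_cancel]
      ring
    · right
      have hle : a = d := by
        by_contra hc
        have := hmono (show a < d by omega)
        omega
      subst hle
      rw [show 2 * k + 1 + a * k ^ 2 + p - (2 * k + 1 + a * k ^ 2) = p by omega] at h
      refine ⟨?_, fun _ => h.2.2.2⟩
      unfold chain
      rw [if_neg (by omega), if_pos rfl]
      exact h.2.2.1
  · omega
  · rcases h with h | h | h
    · left
      have : a = 0 := by rcases ha0 with h0 | h0 <;> omega
      subst this
      unfold chain
      rw [if_pos rfl, h.2.2]
      congr 1; omega
    · left
      have : a ≠ 0 := by rintro rfl; omega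
      obtain ⟨a, rfl⟩ := Nat.exists_eq_add_of_le' (show 1 ≤ a by omega)
      unfold chain
      rw [if_neg (by omega), if_neg (by omega)]
      have := h.2.1
      rw [add_one_mul] at this
      simp only [Nat.add_sub_cancel]
      omega
    · exfalso
      have := h.2.2.1
      have := Nat.mod_lt (v - (2 * k + 1 + d * k ^ 2)) (show k > 0 by omega)
      omega
  · omega

/-- A cycle of length `d + 2`, given as a periodic sequence of vertices. -/
structure IsCyc (d k : ℕ) (m : ℕ → ℕ → Bool) (b : ℕ → Bool) (g : ℤ → ℕ) : Prop where
  adj : ∀ t, PathAdj d k m b (g t) (g (t + 1))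
  inj : ∀ s t, g s = g t → ((d + 2 : ℕ) : ℤ) ∣ s - t
  per : ∀ t, g (t + (d + 2 : ℕ)) = g t

lemma IsCyc.rev {g : ℤ → ℕ} (h : IsCyc d k m b g) : IsCyc d k m b fun t => g (-t) where
  adj t := by
    have := (h.adj (-(t + 1))).symm
    rwa [show -(t + 1) + 1 = -t by ring] at this
  inj s t hst := by
    have := h.inj _ _ hst
    rwa [show -s - -t = -(s - t) by ring, dvd_neg] at this
  per t := by
    have := h.per (-(t + (d + 2 : ℕ)))
    rw [← this]; congr 1; ring

lemma not_dvd_small {c : ℕ} {z : ℤ} (h0 : 0 < z) (h1 : z < c) : ¬ (c : ℤ) ∣ z := fun h =>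
  absurd (Int.le_of_dvd h0 h) (by omega)

/-- A cycle that climbs a path contains the whole path, and closes through the hub. -/
lemma IsCyc.hit_of_up {g : ℤ → ℕ} (h : IsCyc d k m b g) (hd : 2 ≤ d) (hk : 1 ≤ k) {t : ℤ}
    (h1 : 1 ≤ a) (ha : a < d) (hp : p < k ^ 2) (hg : g t = chain d k a p)
    (hg' : g (t + 1) = chain d k (a + 1) p) : Hit k m b := by
  have hup : ∀ i, a + i + 1 ≤ d → g (t + i) = chain d k (a + i) p ∧
      g (t + i + 1) = chain d k (a + i + 1) p := by
    intro i
    induction i with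
    | zero => intro _; simpa using ⟨hg, hg'⟩
    | succ i ih =>
      intro hi
      obtain ⟨e1, e2⟩ := ih (by omega)
      have hadj := h.adj (t + i + 1)
      rw [e2] at hadj
      have := hadj.chain_cases hk (by omega) (by omega) hp
      refine ⟨by rw [Nat.cast_succ, ← add_assoc, e2]; rfl, ?_⟩
      rcases this with hc | hc
      · exfalso
        rw [Nat.add_sub_cancel, ← e1] at hc
        have := h.inj _ _ hc
        rw [show t + i + 1 + 1 - (t + i) = 2 by ring] at this
        exact not_dvd_small (by omega) (by omega) this
      · rw [Nat.cast_succ, ← add_assoc, hc.1]; rfl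
  have hdn : ∀ i, i ≤ a → g (t - i) = chain d k (a - i) p ∧
      (i < a → g (t - i + 1) = chain d k (a - i + 1) p) := by
    intro i
    induction i with
    | zero => intro _; simpa using ⟨hg, fun _ => hg'⟩
    | succ i ih =>
      intro hi
      obtain ⟨e1, e2⟩ := ih (by omega)
      have e2 := e2 (by omega)
      have hadj := (h.adj (t - (i + 1 : ℕ))).symm
      have ei : t - (i + 1 : ℕ) + 1 = t - i := by push_cast; ring
      rw [ei, e1] at hadj
      have := hadj.chain_cases hk (by omega) (by omega) hp
      rw [ei]
      refine ⟨?_, fun _ => by rw [e1]; congr 1; omega⟩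
      rcases this with hc | hc
      · rw [hc, show a - (i + 1) = a - i - 1 by omega]
      · exfalso
        rw [← e2] at hc
        have := h.inj _ _ hc.1.symm
        rw [show t - i + 1 - (t - (i + 1 : ℕ)) = 2 by push_cast; ring] at this
        exact not_dvd_small (by omega) (by omega) this
  obtain ⟨e, he⟩ := Nat.exists_eq_add_of_le (show a + 1 ≤ d by omega)
  have hpk : p / k < k := by rw [Nat.div_lt_iff_lt_mul (by omega)]; nlinarith
  have hpm : p % k < k := Nat.mod_lt _ (by omega)
  obtain ⟨u1, u2⟩ := hup e (by omega)
  rw [show a + e + 1 = d by omega] at u2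
  have hL := (hdn a le_rfl).1
  rw [Nat.sub_self] at hL
  -- the last edge of the path is present
  have hm : m (p / k) (p % k) = true := by
    have hadj := h.adj (t + e)
    rw [u1] at hadj
    rcases hadj.chain_cases hk (by omega) (by omega) hp with hc | hc
    · exfalso
      have hR : g (t + e + 1) = k + p % k := by
        rw [u2]; unfold chain; rw [if_neg (by omega), if_pos rfl]
      rw [hR] at hc
      simp only [chain] at hc
      split_ifs at hc <;> omega
    · exact hc.2 (by omega)
  have hL' : g (t - a) = p / k := by rw [hL]; simp [chain]
  have hR' : g (t + e + 1) = k + p % k := by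
    rw [u2]; unfold chain; rw [if_neg (by omega), if_pos rfl]
  -- the remaining vertex is adjacent to both ends of the path
  set x := g (t - a - 1) with hx
  have ax : PathAdj d k m b x (p / k) := by
    have := h.adj (t - a - 1)
    rwa [show t - a - 1 + 1 = t - a by ring, hL'] at this
  have ax' : PathAdj d k m b (k + p % k) x := by
    have := h.adj (t + e + 1)
    rw [hR', show t + e + 1 + 1 = t - a - 1 + (d + 2 : ℕ) by rw [he]; push_cast; ring,
      h.per] at this
    exact this
  have hneq : x ≠ chain d k 1 p := by
    intro hc
    have h1' : g (t - a + 1) = chain d k 1 p := by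
      have := (hdn (a - 1) (by omega)).1
      rw [show a - (a - 1) = 1 by omega, Nat.cast_sub h1] at this
      rw [← this]; congr 1; push_cast; ring
    rw [← h1'] at hc
    have := h.inj _ _ hc.symm
    rw [show t - a + 1 - (t - a - 1) = 2 by ring] at this
    exact not_dvd_small (by omega) (by omega) this
  have hxs : x = 2 * k := by
    by_contra hxs
    -- otherwise it would be the inner vertex of a second path with two edges and the same ends
    have hxr : 2 * k + 1 ≤ x ∧ x < 2 * k + 1 + k ^ 2 ∧ p / k = (x - (2 * k + 1)) / k := by
      rcases ax with (h' | h') | (h' | h')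
      · rcases h' with h' | h' | h' <;> omega
      · omega
      · rcases h' with h' | h' | h'
        · exact h'
        · omega
        · omega
      · omega
    have hxr' : p % k = (x - (2 * k + 1)) % k := by
      rcases ax' with (h' | h') | (h' | h')
      · rcases h' with h' | h' | h'
        · exfalso
          have := h'.2.2
          have : (x - (2 * k + 1)) / k < k := by
            rw [Nat.div_lt_iff_lt_mul (by omega), ← pow_two]; omega
          omega
        · omega
        · omega
      · omega
      · rcases h' with h' | h' | h'
        · omega
        · omega
        · have hd2 : (d - 2) * k ^ 2 = 0 := by
            rcases Nat.eq_zero_or_pos (d - 2) with h0 | h0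
            · rw [h0, zero_mul]
            · have := Nat.le_mul_of_pos_left (k ^ 2) h0
              omega
          rw [hd2, add_zero] at h'
          omega
      · omega
    apply hneq
    unfold chain
    rw [if_neg (by omega), if_neg (by omega)]
    have e1 := Nat.div_add_mod p k
    have e2 := Nat.div_add_mod (x - (2 * k + 1)) k
    rw [← hxr.2.2, ← hxr'] at e2
    simp only [Nat.sub_self, zero_mul]
    omega
  refine ⟨p / k, hpk, p % k, hpm, ?_, hm, ?_⟩
  · rcases ax with (h' | h') | (h' | h')
    · rcases h' with h' | h' | h' <;> omega
    · omega
    · rcases h' with h' | h' | h' <;> omega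
    · exact h'.2.1
  · rcases ax' with (h' | h') | (h' | h')
    · rcases h' with h' | h' | h' <;> omega
    · exact h'.2.1
    · rcases h' with h' | h' | h' <;> omega
    · omega

/-- A cycle passes an inner vertex of some path, and climbs this path in one of its directions. -/
lemma IsCyc.hit {g : ℤ → ℕ} (h : IsCyc d k m b g) (hd : 2 ≤ d) (hk : 1 ≤ k) : Hit k m b := by
  -- some vertex is an inner vertex of a path, since the other ones form a star
  have hin : ∃ t a p, 1 ≤ a ∧ a < d ∧ p < k ^ 2 ∧ g t = chain d k a p := by
    have hbig : ∃ t, 2 * k + 1 ≤ g t ∧ g t < 2 * k + 1 + (d - 1) * k ^ 2 := by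
      by_contra hc
      push Not at hc
      have hK : k ^ 2 ≤ (d - 1) * k ^ 2 := Nat.le_mul_of_pos_left _ (by omega)
      have hstar : ∀ t, g t = 2 * k ∨ g (t + 1) = 2 * k := by
        intro t
        have c1 := hc t
        have c2 := hc (t + 1)
        have hdm : (d - 2) * k ^ 2 ≤ (d - 1) * k ^ 2 := Nat.mul_le_mul_right _ (by omega)
        rcases h.adj t with (h' | h') | (h' | h')
        · rcases h' with h' | h' | h' <;> omega
        · omega
        · rcases h' with h' | h' | h' <;> omega
        · omega
      have key : ∀ s t : ℤ, 0 < t - s → t - s < (d + 2 : ℕ) → g s ≠ g t := by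
        intro s t h0 h1 he
        exact not_dvd_small h0 h1 (h.inj t s he.symm)
      have k02 := key 0 2 (by omega) (by omega)
      have k03 := key 0 3 (by omega) (by omega)
      have k12 := key 1 2 (by omega) (by omega)
      have k13 := key 1 3 (by omega) (by omega)
      have s0 := hstar 0
      have s2 := hstar 2
      norm_num at s0 s2
      omega
    obtain ⟨t, ht1, ht2⟩ := hbig
    have pK : 0 < k ^ 2 := by positivity
    refine ⟨t, (g t - (2 * k + 1)) / k ^ 2 + 1, (g t - (2 * k + 1)) % k ^ 2,
      Nat.le_add_left _ _, ?_,
      Nat.mod_lt _ pK, ?_⟩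
    · have : (g t - (2 * k + 1)) / k ^ 2 < d - 1 := by
        rw [Nat.div_lt_iff_lt_mul pK]; omega
      omega
    · have h1 : (g t - (2 * k + 1)) / k ^ 2 < d - 1 := by
        rw [Nat.div_lt_iff_lt_mul pK]; omega
      unfold chain
      rw [if_neg (Nat.succ_ne_zero _), if_neg (by rw [Nat.lt_sub_iff_add_lt] at h1; exact h1.ne),
        Nat.add_sub_cancel]
      have := Nat.div_add_mod (g t - (2 * k + 1)) (k ^ 2)
      rw [mul_comm] at this
      omega
  obtain ⟨t, a, p, h1, ha, hp, hg⟩ := hin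
  have hn : g (t + 1) ≠ g (t - 1) := by
    intro he
    have := h.inj _ _ he
    rw [show t + 1 - (t - 1) = 2 by ring] at this
    exact not_dvd_small (by omega) (by omega) this
  have a1 := h.adj t
  have a2 := (h.adj (t - 1)).symm
  rw [hg] at a1
  rw [show t - 1 + 1 = t by ring, hg] at a2
  rcases a1.chain_cases hk h1 ha hp with c1 | c1
  · rcases a2.chain_cases hk h1 ha hp with c2 | c2
    · exact absurd (c1.trans c2.symm) hn
    · refine h.rev.hit_of_up hd hk (t := -t) h1 ha hp (by simpa using hg) ?_
      rw [show -(-t + 1) = t - 1 by ring]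
      exact c2.1
  · exact h.hit_of_up hd hk h1 ha hp hg c1.1

end

lemma chain_adj {d k : ℕ} {m : ℕ → ℕ → Bool} {b : ℕ → Bool} {i j a : ℕ} (hd : 2 ≤ d)
    (hi : i < k) (hj : j < k) (hm : m i j = true) (ha : a < d) :
    PathAdj d k m b (chain d k a (i * k + j)) (chain d k (a + 1) (i * k + j)) := by
  have hk : 0 < k := by omega
  have hp : i * k + j < k ^ 2 := by nlinarith
  have e1 : (i * k + j) / k = i := by
    rw [mul_comm, Nat.mul_add_div hk, Nat.div_eq_of_lt hj, add_zero]
  have e2 : (i * k + j) % k = j := by rw [mul_comm, Nat.mul_add_mod, Nat.mod_eq_of_lt hj]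
  obtain ⟨d, rfl⟩ := Nat.exists_eq_add_of_le' hd
  left; left
  simp only [pathRel, show d + 2 - 1 = d + 1 by omega, Nat.add_sub_cancel]
  rcases Nat.eq_zero_or_pos a with rfl | h0
  · left
    unfold chain
    rw [if_pos rfl, if_neg (by omega), if_neg (by omega)]
    simp only [zero_add, Nat.sub_self, zero_mul, add_zero]
    refine ⟨by omega, by omega, ?_⟩
    congr 1; omega
  · obtain ⟨a, rfl⟩ := Nat.exists_eq_add_of_le' (show 1 ≤ a by omega)
    right
    by_cases had : a = d
    · subst had
      right
      unfold chain
      rw [if_neg (by omega), if_neg (by omega), if_neg (by omega), if_pos rfl, Nat.add_sub_cancel,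
        show 2 * k + 1 + a * k ^ 2 + (i * k + j) - (2 * k + 1 + a * k ^ 2) = i * k + j by omega,
        e1, e2]
      exact ⟨by omega, by rw [add_one_mul]; omega, rfl, hm⟩
    · left
      unfold chain
      rw [if_neg (by omega), if_neg (by omega), if_neg (by omega), if_neg (by omega)]
      simp only [Nat.add_sub_cancel]
      have : a * k ^ 2 + k ^ 2 ≤ d * k ^ 2 := by
        calc a * k ^ 2 + k ^ 2 = (a + 1) * k ^ 2 := by ring
          _ ≤ _ := Nat.mul_le_mul_right _ (by omega)
      refine ⟨by omega, by ring, ?_⟩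
      rw [add_one_mul, add_one_mul]
      omega

lemma chain_inj {d k : ℕ} {i j a a' : ℕ} (hi : i < k) (hj : j < k)
    (ha : a ≤ d) (ha' : a' ≤ d) (h : chain d k a (i * k + j) = chain d k a' (i * k + j)) :
    a = a' := by
  have hk : 0 < k := by omega
  have e1 : (i * k + j) / k = i := by
    rw [mul_comm, Nat.mul_add_div hk, Nat.div_eq_of_lt hj, add_zero]
  have e2 : (i * k + j) % k = j := by rw [mul_comm, Nat.mul_add_mod, Nat.mod_eq_of_lt hj]
  have hp : i * k + j < k ^ 2 := by nlinarith
  simp only [chain, e1, e2] at h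
  split_ifs at h <;> try omega
  have := level_unique (K := k ^ 2) (a := a - 1) (a' := a' - 1) hp hp (by omega)
  omega

lemma chain_lt {d k a p : ℕ} (hk : 1 ≤ k) (ha : a ≤ d) (hp : p < k ^ 2) :
    chain d k a p < 2 * k + 1 + d * k ^ 2 ∧ chain d k a p ≠ 2 * k := by
  have hpk : p / k < k := by rw [Nat.div_lt_iff_lt_mul (by omega)]; nlinarith
  have hpm : p % k < k := Nat.mod_lt _ (by omega)
  unfold chain
  split_ifs with h1 h2
  · omega
  · omega
  · have : (a - 1) * k ^ 2 + k ^ 2 ≤ d * k ^ 2 := by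
      calc (a - 1) * k ^ 2 + k ^ 2 = (a - 1 + 1) * k ^ 2 := by ring
        _ ≤ _ := Nat.mul_le_mul_right _ (by omega)
    omega

/-- A path with `d` edges and the hub form a cycle of length `d + 2`. The argument for the converse
does not depend on the parity of the length. -/
theorem detects_cycle (d : ℕ) (hd : 2 ≤ d) :
    Detects (SimpleGraph.cycleGraph (d + 2)) (d + 3) (pathRel d) := by
  intro k N m b hk hN
  have hs : 2 * k + 1 + d * k ^ 2 ≤ N := by
    have h1 : d + 3 < 2 ^ (d + 3) := Nat.lt_two_pow_self
    have h2 : (d + 3) * k ^ 2 ≤ N := by rw [hN]; exact Nat.mul_le_mul_right _ h1.le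
    nlinarith
  refine ⟨fun ⟨f⟩ => ?_, fun ⟨i, hi, j, hj, bi, mij, bj⟩ => ?_⟩
  · let r : ℤ → Fin (d + 2) := fun t => ⟨(t % (d + 2 : ℕ)).toNat, by
      have := Int.emod_nonneg t (show ((d + 2 : ℕ) : ℤ) ≠ 0 by omega)
      have := Int.emod_lt_of_pos t (show (0 : ℤ) < (d + 2 : ℕ) by omega)
      omega⟩
    have hr : ∀ t, ((r t : ℕ) : ℤ) = t % (d + 2 : ℕ) := fun t =>
      Int.toNat_of_nonneg (Int.emod_nonneg t (by omega))
    refine IsCyc.hit (d := d) (g := fun t => ((f (r t) : Fin N) : ℕ)) ⟨fun t => ?_, fun s t h => ?_,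
      fun t => ?_⟩ hd hk
    · have hadj : (SimpleGraph.cycleGraph (d + 2)).Adj (r t) (r (t + 1)) := by
        rw [SimpleGraph.cycleGraph_adj]
        right
        rw [sub_eq_iff_eq_add]
        apply Fin.ext
        have h1 := hr t
        have h2 := hr (t + 1)
        rw [Fin.val_add]
        zify
        rw [h1, h2, Fin.val_one]
        push_cast
        rw [Int.add_emod_emod, add_comm]
      have := f.toHom.map_adj hadj
      rw [slotGraph_adj, hub_zero, hub_zero] at this
      exact this.2
    · have := f.injective (Fin.ext h)
      have h1 := hr s
      have h2 := hr t
      rw [this, h2] at h1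
      exact Int.ModEq.dvd h1
    · have : r (t + (d + 2 : ℕ)) = r t := by
        apply Fin.ext
        zify
        rw [hr, hr]
        push_cast
        rw [Int.add_emod_right]
      simp only [this]
  · have hp : i * k + j < k ^ 2 := by nlinarith
    have e1 : (i * k + j) / k = i := by
      rw [mul_comm, Nat.mul_add_div (by omega), Nat.div_eq_of_lt hj, add_zero]
    have e2 : (i * k + j) % k = j := by rw [mul_comm, Nat.mul_add_mod, Nat.mod_eq_of_lt hj]
    refine exists_copy (fun x : Fin (d + 2) => if (x : ℕ) = d + 1 then 2 * k
      else chain d k x (i * k + j)) (fun x => ?_) (fun x y h => ?_) (fun x y hxy ha => ?_)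
      (x₀ := Fin.last (d + 1)) (by simp)
    · split_ifs with hx
      · omega
      · exact lt_of_lt_of_le (chain_lt hk (by omega) hp).1 hs
    · dsimp only at h
      have hx := x.2
      have hy := y.2
      split_ifs at h with h1 h2 h2
      · exact Fin.ext (by omega)
      · exact absurd h.symm (chain_lt hk (by omega) hp).2
      · exact absurd h (chain_lt hk (by omega) hp).2
      · exact Fin.ext (chain_inj hi hj (by omega) (by omega) h)
    · rw [slotGraph_adj, hub_zero, hub_zero]
      have hx := x.2
      have hy := y.2
      have hxy' : (x : ℕ) < y := hxy
      have hc : (y : ℕ) = x + 1 ∨ ((x : ℕ) = 0 ∧ (y : ℕ) = d + 1) := by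
        rw [SimpleGraph.cycleGraph_adj'] at ha
        rw [Fin.sub_val_of_le hxy.le, Fin.val_sub] at ha
        rcases ha with ha | ha
        · right
          rw [Nat.mod_eq_of_lt (by omega)] at ha
          omega
        · left; omega
      simp only [ne_eq, Fin.mk.injEq]
      rw [if_neg (show (x : ℕ) ≠ d + 1 by omega)]
      rcases hc with hc | ⟨hc1, hc2⟩
      · by_cases hyd : (y : ℕ) = d + 1
        · rw [if_pos hyd]
          refine ⟨(chain_lt hk (by omega) hp).2, .inl (.inr ?_)⟩
          have : (x : ℕ) = d := by omega
          rw [this]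
          unfold chain
          rw [if_neg (by omega), if_pos rfl, e2]
          exact ⟨by omega, bj, rfl⟩
        · rw [if_neg hyd]
          refine ⟨fun he => ?_, ?_⟩
          · have := chain_inj hi hj (by omega) (by omega) he
            omega
          · rw [hc]
            exact chain_adj hd hi hj mij (by omega)
      · rw [if_pos hc2, hc1]
        refine ⟨(chain_lt hk (by omega) hp).2, .inl (.inr ?_)⟩
        unfold chain
        rw [if_pos rfl, e1]
        exact ⟨by omega, bi, rfl⟩

/-! ### Counting paths of length three -/

/-- The left or the right vector is replaced by zero. -/
def mask (k : ℕ) (α β : Bool) (b : ℕ → Bool) (p : ℕ) : Bool :=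
  if p < k then α && b p else β && b p

/-- The copies of `P` in `G` with a given property of the vertex set, as pairs of a vertex set and
an adjacency relation. -/
def copySet {V : Type*} {c : ℕ} (P : SimpleGraph (Fin c)) (pr : Set V → Prop)
    (G : SimpleGraph V) : Set (Set V × (V → V → Prop)) :=
  {x | (∃ f : Fin c → V, Function.Injective f ∧ pr (Set.range f) ∧
    x = (Set.range f, fun u v => ∃ a b, P.Adj a b ∧ f a = u ∧ f b = v)) ∧
    ∀ u v, x.2 u v → G.Adj u v}

/-- Subgraphs that are isomorphic to `P` are counted by their vertex sets and adjacency relations,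
which makes the counts in different graphs comparable. -/
lemma ncard_subgraph_eq {V : Type*} {c : ℕ} (P : SimpleGraph (Fin c))
    (pr : Set V → Prop) (G : SimpleGraph V) :
    {H : G.Subgraph | Nonempty (P ≃g H.coe) ∧ pr H.verts}.ncard = (copySet P pr G).ncard := by
  have inj : Function.Injective fun H : G.Subgraph => (H.verts, H.Adj) := by
    intro H H' h
    exact SimpleGraph.Subgraph.ext (congrArg Prod.fst h) (congrArg Prod.snd h)
  rw [← Set.ncard_image_of_injective _ inj]
  congr 1
  ext x
  simp only [Set.mem_image, Set.mem_ofPred_eq, copySet]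
  constructor
  · rintro ⟨H, ⟨⟨φ⟩, hp⟩, rfl⟩
    have hr : Set.range (fun a => (φ a : V)) = H.verts := by
      ext v
      constructor
      · rintro ⟨a, rfl⟩; exact (φ a).2
      · intro hv; exact ⟨φ.symm ⟨v, hv⟩, by simp⟩
    refine ⟨⟨fun a => φ a, fun a b h => φ.injective (Subtype.ext h), by rwa [hr], ?_⟩,
      fun u v h => H.adj_sub h⟩
    rw [hr]
    congr 1
    funext u v
    apply propext
    constructor
    · intro h
      refine ⟨φ.symm ⟨u, H.edge_vert h⟩, φ.symm ⟨v, H.edge_vert h.symm⟩, ?_, by simp, by simp⟩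
      rw [← φ.map_adj_iff]
      simpa using h
    · rintro ⟨a, b, hab, rfl, rfl⟩
      exact φ.map_adj_iff.mpr hab
  · rintro ⟨⟨f, hf, hp, rfl⟩, h⟩
    let H : G.Subgraph :=
      { verts := Set.range f
        Adj := fun u v => ∃ a b, P.Adj a b ∧ f a = u ∧ f b = v
        adj_sub := fun {u v} huv => h u v huv
        edge_vert := by rintro u v ⟨a, b, -, rfl, -⟩; exact ⟨a, rfl⟩
        symm := ⟨by rintro u v ⟨a, b, hab, rfl, rfl⟩; exact ⟨b, a, hab.symm, rfl, rfl⟩⟩ }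
    refine ⟨H, ⟨⟨⟨Equiv.ofInjective f hf, ?_⟩⟩, hp⟩, rfl⟩
    intro a b
    constructor
    · rintro ⟨a', b', hab, ha, hb⟩
      have ha := hf ha
      have hb := hf hb
      subst ha hb
      exact hab
    · intro hab
      exact ⟨a, b, hab, rfl, rfl⟩

lemma copyCount_eq_ncard {n c : ℕ} (P : SimpleGraph (Fin c)) (G : SimpleGraph (Fin n)) :
    G.copyCount P = (copySet P (fun _ => True) G).ncard := by
  rw [← ncard_subgraph_eq]
  unfold SimpleGraph.copyCount
  classical
  rw [Set.ncard_eq_toFinset_card']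
  congr 1
  ext H
  simp

lemma copyCountAt_eq_ncard {n c : ℕ} (P : SimpleGraph (Fin c)) (G : SimpleGraph (Fin n))
    (s : Fin n) : copyCountAt G P s = (copySet P (fun S => s ∈ S) G).ncard :=
  ncard_subgraph_eq P (fun S => s ∈ S) G

/-- Inclusion-exclusion: the four counts are unbalanced if and only if some copy uses edges of both
groups of slots. -/
lemma copySet_unbalanced {V : Type*} [Finite V] {c : ℕ} (P : SimpleGraph (Fin c))
    (pr : Set V → Prop) {G G₁ G₂ G₀ : SimpleGraph V} (h1 : G₁ ≤ G) (h2 : G₂ ≤ G)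
    (h0 : ∀ u v, G₀.Adj u v ↔ G₁.Adj u v ∧ G₂.Adj u v) :
    (copySet P pr G).ncard + (copySet P pr G₀).ncard ≠
      (copySet P pr G₁).ncard + (copySet P pr G₂).ncard ↔
    ∃ f : Fin c → V, Function.Injective f ∧ pr (Set.range f) ∧
      (∀ a b, P.Adj a b → G.Adj (f a) (f b)) ∧
      (∃ a b, P.Adj a b ∧ ¬ G₁.Adj (f a) (f b)) ∧ (∃ a b, P.Adj a b ∧ ¬ G₂.Adj (f a) (f b)) := by
  have hi : copySet P pr G₀ = copySet P pr G₁ ∩ copySet P pr G₂ := by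
    ext x
    simp only [copySet, Set.mem_inter_iff, Set.mem_ofPred_eq]
    constructor
    · rintro ⟨h, h'⟩
      exact ⟨⟨h, fun u v e => ((h0 u v).1 (h' u v e)).1⟩,
        ⟨h, fun u v e => ((h0 u v).1 (h' u v e)).2⟩⟩
    · rintro ⟨⟨h, h'⟩, ⟨-, h''⟩⟩
      exact ⟨h, fun u v e => (h0 u v).2 ⟨h' u v e, h'' u v e⟩⟩
  have hs : copySet P pr G₁ ∪ copySet P pr G₂ ⊆ copySet P pr G := by
    rintro x (⟨h, h'⟩ | ⟨h, h'⟩)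
    · exact ⟨h, fun u v e => h1 (h' u v e)⟩
    · exact ⟨h, fun u v e => h2 (h' u v e)⟩
  rw [hi, ← Set.ncard_union_add_ncard_inter (copySet P pr G₁) (copySet P pr G₂)]
  have hne : (copySet P pr G).ncard + (copySet P pr G₁ ∩ copySet P pr G₂).ncard ≠
      (copySet P pr G₁ ∪ copySet P pr G₂).ncard + (copySet P pr G₁ ∩ copySet P pr G₂).ncard ↔
      ¬ copySet P pr G ⊆ copySet P pr G₁ ∪ copySet P pr G₂ := by
    rw [ne_eq, Nat.add_right_cancel_iff, not_iff_not]
    constructor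
    · intro h
      exact (Set.eq_of_subset_of_ncard_le hs h.le).ge
    · intro h
      rw [h.antisymm hs]
  rw [hne, Set.not_subset]
  constructor
  · rintro ⟨x, ⟨⟨f, hf, hp, rfl⟩, h⟩, hx⟩
    refine ⟨f, hf, hp, fun a b hab => h _ _ ⟨a, b, hab, rfl, rfl⟩, ?_, ?_⟩
    · by_contra hc
      push Not at hc
      exact hx (.inl ⟨⟨f, hf, hp, rfl⟩, by rintro u v ⟨a, b, hab, rfl, rfl⟩; exact hc a b hab⟩)
    · by_contra hc
      push Not at hc
      exact hx (.inr ⟨⟨f, hf, hp, rfl⟩, by rintro u v ⟨a, b, hab, rfl, rfl⟩; exact hc a b hab⟩)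
  · rintro ⟨f, hf, hp, h, ⟨a, b, hab, h1⟩, ⟨a', b', hab', h2⟩⟩
    refine ⟨_, ⟨⟨f, hf, hp, rfl⟩, by rintro u v ⟨a, b, hab, rfl, rfl⟩; exact h a b hab⟩, ?_⟩
    rintro (⟨-, h'⟩ | ⟨-, h'⟩)
    · exact h1 (h' _ _ ⟨a, b, hab, rfl, rfl⟩)
    · exact h2 (h' _ _ ⟨a', b', hab', rfl, rfl⟩)

section
variable {k u v : ℕ} {m : ℕ → ℕ → Bool} {b : ℕ → Bool} {R : ℕ → ℕ → Prop}

/-- An edge that disappears with the right vector is a slot edge of the right vector. -/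
lemma slot_right
    (h : (R u v ∨ (u < 2 * k ∧ b u = true ∧ v = hub k 1 u)) ∨
      (R v u ∨ (v < 2 * k ∧ b v = true ∧ u = hub k 1 v)))
    (h' : ¬ ((R u v ∨ (u < 2 * k ∧ mask k true false b u = true ∧ v = hub k 1 u)) ∨
      (R v u ∨ (v < 2 * k ∧ mask k true false b v = true ∧ u = hub k 1 v)))) :
    (k ≤ u ∧ u < 2 * k ∧ b u = true ∧ v = 2 * k + 1) ∨
      (k ≤ v ∧ v < 2 * k ∧ b v = true ∧ u = 2 * k + 1) := by
  by_cases hu : u < k <;> by_cases hv : v < k <;> simp [mask, hub, hu, hv] at h h' ⊢ <;> grind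

/-- An edge that disappears with the left vector is a slot edge of the left vector. -/
lemma slot_left
    (h : (R u v ∨ (u < 2 * k ∧ b u = true ∧ v = hub k 1 u)) ∨
      (R v u ∨ (v < 2 * k ∧ b v = true ∧ u = hub k 1 v)))
    (h' : ¬ ((R u v ∨ (u < 2 * k ∧ mask k false true b u = true ∧ v = hub k 1 u)) ∨
      (R v u ∨ (v < 2 * k ∧ mask k false true b v = true ∧ u = hub k 1 v)))) :
    (u < k ∧ b u = true ∧ v = 2 * k) ∨ (v < k ∧ b v = true ∧ u = 2 * k) := by
  by_cases hu : u < k <;> by_cases hv : v < k <;> simp [mask, hub, hu, hv] at h h' ⊢ <;> grind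

set_option synthInstance.maxHeartbeats 200000 in
set_option synthInstance.maxSize 1000 in
set_option maxRecDepth 4000 in
/-- The positions of two disjoint edges of a path of length three, oriented in any way: they are the
two end edges, and the middle edge joins one end of each. -/
lemma path_ends : ∀ r t l s : Fin 4, (r.val + 1 = t.val ∨ t.val + 1 = r.val) →
    (l.val + 1 = s.val ∨ s.val + 1 = l.val) → l ≠ r → l ≠ t → s ≠ r → s ≠ t →
    (l = 1 ∧ r = 2 ∨ l = 2 ∧ r = 1) ∨ (s = 1 ∧ t = 2) ∨ (s = 1 ∧ r = 2) ∨
      (s = 2 ∧ t = 1) ∨ (s = 2 ∧ r = 1) ∨ (t = 1 ∧ l = 2) ∨ (t = 2 ∧ l = 1) := by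
  decide

/-- A path of length three that has a slot edge of either vector at its ends. -/
lemma hit_of_ends (f : Fin 4 → ℕ)
    (h12 : (directRel noExt k m (f 1) (f 2) ∨
      (f 1 < 2 * k ∧ b (f 1) = true ∧ f 2 = hub k 1 (f 1))) ∨
      (directRel noExt k m (f 2) (f 1) ∨ (f 2 < 2 * k ∧ b (f 2) = true ∧ f 1 = hub k 1 (f 2))))
    (r t l s : Fin 4) (hrt : r.val + 1 = t.val ∨ t.val + 1 = r.val)
    (hls : l.val + 1 = s.val ∨ s.val + 1 = l.val) (r1 : k ≤ f r) (r2 : f r < 2 * k)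
    (r3 : b (f r) = true) (t1 : f t = 2 * k + 1) (l1 : f l < k) (l2 : b (f l) = true)
    (s1 : f s = 2 * k) : Hit k m b := by
  have n1 : l ≠ r := by rintro rfl; omega
  have n2 : l ≠ t := by rintro rfl; omega
  have n3 : s ≠ r := by rintro rfl; omega
  have n4 : s ≠ t := by rintro rfl; omega
  simp only [directRel, noExt, hub, or_false] at h12
  rcases path_ends _ _ _ _ hrt hls n1 n2 n3 n4 with hpos | hpos
  · have hml : m (f l) (f r - k) = true := by
      rcases hpos with ⟨rfl, rfl⟩ | ⟨rfl, rfl⟩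
      · rcases h12 with (h | h) | (h | h)
        · exact h.2.2.2
        · split_ifs at h; omega
        · omega
        · split_ifs at h <;> omega
      · rcases h12 with (h | h) | (h | h)
        · omega
        · split_ifs at h <;> omega
        · exact h.2.2.2
        · split_ifs at h; omega
    exact ⟨_, l1, f r - k, by omega, l2, hml, by rwa [Nat.add_sub_cancel' r1]⟩
  · exfalso
    rcases hpos with ⟨rfl, rfl⟩ | ⟨rfl, rfl⟩ | ⟨rfl, rfl⟩ | ⟨rfl, rfl⟩ | ⟨rfl, rfl⟩ |
      ⟨rfl, rfl⟩ <;> split_ifs at h12 <;> omega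

end

/-- The bipartite graph with two hubs. The copies of the path of length three that use slots of
both vectors join the two hubs. -/
lemma path3_unbalanced {k N : ℕ} (hk : 1 ≤ k) (hN : N = 2 ^ 2 * k ^ 2) (m : ℕ → ℕ → Bool)
    (b : ℕ → Bool) (pr : Set (Fin N) → Prop)
    (hpr : ∀ S, (∃ s : Fin N, s ∈ S ∧ (s : ℕ) = 2 * k) → pr S) :
    (copySet path3 pr (slotGraph N k 1 (directRel noExt k m) b)).ncard +
      (copySet path3 pr (slotGraph N k 1 (directRel noExt k m) (mask k false false b))).ncard ≠
    (copySet path3 pr (slotGraph N k 1 (directRel noExt k m) (mask k true false b))).ncard +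
      (copySet path3 pr (slotGraph N k 1 (directRel noExt k m) (mask k false true b))).ncard ↔
    Hit k m b := by
  have hs : 2 * k + 2 ≤ N := by subst hN; nlinarith
  have hh : ∀ u, hub k 1 u = if u < k then 2 * k else 2 * k + 1 := fun u => by
    unfold hub; rfl
  have hm : ∀ α β u, mask k α β b u = true ↔ (u < k ∧ α = true ∧ b u = true) ∨
      (k ≤ u ∧ β = true ∧ b u = true) := by
    intro α β u
    unfold mask
    split_ifs with h
    · simp [h, Nat.not_le.2 h]
    · simp [h, Nat.not_lt.1 h]
  rw [copySet_unbalanced]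
  · constructor
    · rintro ⟨f, hf, -, h, ⟨a, c, hac, h1⟩, ⟨a', c', hac', h2⟩⟩
      -- an edge of each group of slots; being disjoint, they are the two end edges of the path
      have hab := slotGraph_adj.1 (h a c hac)
      have hab' := slotGraph_adj.1 (h a' c' hac')
      have e1 := slot_right hab.2 (fun h' => h1 (slotGraph_adj.2 ⟨hab.1, h'⟩))
      have e2 := slot_left hab'.2 (fun h' => h2 (slotGraph_adj.2 ⟨hab'.1, h'⟩))
      have h12 := (slotGraph_adj.1 (h 1 2 (by simp [path3, SimpleGraph.pathGraph_adj]))).2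
      have key := hit_of_ends (fun x : Fin 4 => ((f x : Fin N) : ℕ)) h12
      clear h h1 h2 hab hab'
      rw [path3, SimpleGraph.pathGraph_adj] at hac hac'
      rcases e1 with e1 | e1 <;> rcases e2 with e2 | e2
      · exact key a c a' c' hac hac' e1.1 e1.2.1 e1.2.2.1 e1.2.2.2 e2.1 e2.2.1 e2.2.2
      · exact key a c c' a' hac hac'.symm e1.1 e1.2.1 e1.2.2.1 e1.2.2.2 e2.1 e2.2.1 e2.2.2
      · exact key c a a' c' hac.symm hac' e1.1 e1.2.1 e1.2.2.1 e1.2.2.2 e2.1 e2.2.1 e2.2.2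
      · exact key c a c' a' hac.symm hac'.symm e1.1 e1.2.1 e1.2.2.1 e1.2.2.2 e2.1 e2.2.1 e2.2.2
    · rintro ⟨i, hi, j, hj, bi, mij, bj⟩
      refine ⟨![⟨2 * k, by omega⟩, ⟨i, by omega⟩, ⟨k + j, by omega⟩, ⟨2 * k + 1, by omega⟩],
        ?_, ?_, ?_, ?_, ?_⟩
      · intro x y h
        fin_cases x <;> fin_cases y <;> simp at h <;> first | rfl | omega
      · exact hpr _ ⟨⟨2 * k, by omega⟩, ⟨0, rfl⟩, rfl⟩
      · intro x y h
        rw [path3, SimpleGraph.pathGraph_adj] at h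
        rw [slotGraph_adj]
        fin_cases x <;> fin_cases y <;> simp at h <;> simp [directRel, hub, *] <;> omega
      · refine ⟨2, 3, by simp [path3, SimpleGraph.pathGraph_adj], ?_⟩
        rw [slotGraph_adj]
        simp [directRel, hub, hm, noExt]
        omega
      · refine ⟨0, 1, by simp [path3, SimpleGraph.pathGraph_adj], ?_⟩
        rw [slotGraph_adj]
        simp [directRel, hub, hm, noExt]
        omega
  · intro u v h
    simp only [slotGraph_adj, hm, reduceCtorEq, false_and, and_false, true_and] at h ⊢
    tauto
  · intro u v h
    simp only [slotGraph_adj, hm, reduceCtorEq, false_and, and_false, true_and] at h ⊢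
    tauto
  · intro u v
    simp only [slotGraph_adj, hh, hm]
    by_cases h1 : directRel noExt k m u v
    · simp [h1]
    by_cases h2 : directRel noExt k m v u
    · simp [h2]
    refine ⟨fun h => absurd h (by simp [h1, h2]), fun ⟨h, h'⟩ => ?_⟩
    exfalso
    have h := h.2
    have h' := h'.2
    simp only [h1, h2, false_or, reduceCtorEq, false_and, and_false, or_false, true_and] at h h'
    split_ifs at h h' <;> omega

end DynGraph

namespace WordRAM

/-! ### Sequences of requests -/

/-- Serving the requests one after the other leads from the first state to the second one and takes
the given total time. -/
def Steps (w : ℕ) (ω : ℕ → Fin (2 ^ w)) : List Request → State → State → ℕ → Prop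
  | [], s, s', t => s' = s ∧ t = 0
  | q :: l, s, s', t => ∃ s₁ t₁ t₂, Exec w ω q.2 q.1 s s₁ t₁ ∧ Steps w ω l s₁ s' t₂ ∧ t = t₁ + t₂

namespace Steps
variable {w : ℕ} {ω : ℕ → Fin (2 ^ w)} {l l' : List Request} {q : Request} {s s' s'' : State}
  {t t' : ℕ}

lemma append_iff : Steps w ω (l ++ l') s s' t ↔
    ∃ s₁ t₁ t₂, Steps w ω l s s₁ t₁ ∧ Steps w ω l' s₁ s' t₂ ∧ t = t₁ + t₂ := by
  induction l generalizing s t with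
  | nil =>
    constructor
    · intro h; exact ⟨s, 0, t, ⟨rfl, rfl⟩, h, by omega⟩
    · rintro ⟨s₁, t₁, t₂, ⟨rfl, rfl⟩, h, rfl⟩; simpa using h
  | cons q l ih =>
    constructor
    · rintro ⟨s₁, t₁, t₂, e, h, rfl⟩
      obtain ⟨s₂, t₃, t₄, h1, h2, rfl⟩ := ih.1 h
      exact ⟨s₂, t₁ + t₃, t₄, ⟨s₁, t₁, t₃, e, h1, rfl⟩, h2, by omega⟩
    · rintro ⟨s₂, t₁, t₂, ⟨s₁, t₃, t₄, e, h1, rfl⟩, h2, rfl⟩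
      exact ⟨s₁, t₃, t₄ + t₂, e, ih.2 ⟨s₂, t₄, t₂, h1, h2, rfl⟩, by omega⟩

lemma append (h : Steps w ω l s s' t) (h' : Steps w ω l' s' s'' t') :
    Steps w ω (l ++ l') s s'' (t + t') := append_iff.2 ⟨_, _, _, h, h', rfl⟩

lemma single_iff : Steps w ω [q] s s' t ↔ Exec w ω q.2 q.1 s s' t := by
  constructor
  · rintro ⟨s₁, t₁, t₂, e, ⟨rfl, rfl⟩, rfl⟩; exact e
  · intro e; exact ⟨s', t, 0, e, ⟨rfl, rfl⟩, rfl⟩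

lemma det (h : Steps w ω l s s' t) (h' : Steps w ω l s s'' t') : s' = s'' ∧ t = t' := by
  induction l generalizing s t t' with
  | nil => exact ⟨h.1.trans h'.1.symm, h.2.trans h'.2.symm⟩
  | cons q l ih =>
    obtain ⟨s₁, t₁, t₂, e, h1, rfl⟩ := h
    obtain ⟨s₂, t₃, t₄, e', h2, rfl⟩ := h'
    obtain ⟨rfl, rfl⟩ := e.det e'
    obtain ⟨rfl, rfl⟩ := ih h1 h2
    exact ⟨rfl, rfl⟩

lemma bdd (h : Steps w ω l s s' t) (hs : s.Bdd w) : s'.Bdd w := by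
  induction l generalizing s t with
  | nil => rw [h.1]; exact hs
  | cons q l ih =>
    obtain ⟨s₁, t₁, t₂, e, h1, rfl⟩ := h
    exact ih h1 (e.bdd hs)

lemma pos_le (h : Steps w ω l s s' t) : s'.pos ≤ s.pos + t := by
  induction l generalizing s t with
  | nil => rw [h.1]; omega
  | cons q l ih =>
    obtain ⟨s₁, t₁, t₂, e, h1, rfl⟩ := h
    have := ih h1
    have := e.pos_le
    omega

lemma of_serves {σ : ℕ → State} {τ : ℕ → ℕ} (h : Serves w ω l σ τ) (i : ℕ) (hi : i ≤ l.length) :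
    Steps w ω (l.take i) State.zero (σ i) (∑ j ∈ Finset.range i, τ j) := by
  induction i with
  | zero => simp [Steps, h.1]
  | succ i ih =>
    rw [List.take_succ_eq_append_getElem (by omega), Finset.sum_range_succ]
    exact (ih (by omega)).append (single_iff.2 (h.2 i (by omega)))

end Steps

/-- The input array of a pair of numbers. -/
def pairInp (a b : ℕ) : ℕ → ℕ := fun x => if x = 0 then a else if x = 1 then b else 0

/-- The programs of a dynamic algorithm, as they are used for a sequence of questions. A question
consists of bits; the update `upd` is carried out for each bit that equals `pol`, followed by the
query. After that, either the updates are undone by the program `und` (if `dir`), or the state of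
the memory from before the updates is restored. -/
structure Machine where
  prep : Prog
  upd : Prog
  qry : Prog
  und : Prog
  dir : Bool
  pol : Bool

/-- The requests of one program for all bits below `n` that equal `pol`. The input for bit `p` is
the pair of `hub p` and `p`. -/
def bitReqs (P : Prog) (pol : Bool) (hub : ℕ → ℕ) (b : ℕ → Bool) (n : ℕ) : List Request :=
  (List.range n).flatMap fun p => if b p = pol then [(P, pairInp (hub p) p)] else []

lemma bitReqs_succ (P : Prog) (pol : Bool) (hub : ℕ → ℕ) (b : ℕ → Bool) (n : ℕ) :
    bitReqs P pol hub b (n + 1) =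
      bitReqs P pol hub b n ++ if b n = pol then [(P, pairInp (hub n) n)] else [] := by
  simp [bitReqs, List.range_succ]

/-- The behaviour of a machine on sequences of questions about `2 * k` bits: with the random words
`ω` it is in the state `S ω bs` after the questions `bs`, and in the state `ask ω bs b` when it has
answered the further question `b`. The correct answer is `f b`. -/
structure Service (M : Machine) (w k : ℕ) (hub : ℕ → ℕ) (inp : ℕ → ℕ) (f : (ℕ → Bool) → ℕ)
    (P E : ℕ) where
  S : (ℕ → Fin (2 ^ w)) → List (ℕ → Bool) → State
  ask : (ℕ → Fin (2 ^ w)) → List (ℕ → Bool) → (ℕ → Bool) → State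
  tm : (ℕ → Fin (2 ^ w)) → List (ℕ → Bool) → ℕ
  prep : ∀ ω, Exec w ω inp M.prep State.zero (S ω []) (tm ω [])
  round : ∀ ω bs b, ∃ t₁ t₂,
    Steps w ω (bitReqs M.upd M.pol hub b (2 * k) ++ [(M.qry, fun _ => 0)]) (S ω bs) (ask ω bs b)
      t₁ ∧
    (M.dir = true → Steps w ω (bitReqs M.und M.pol hub b (2 * k)) (ask ω bs b) (S ω (bs ++ [b]))
      t₂) ∧
    (M.dir = false → S ω (bs ++ [b]) = S ω bs ∧ t₂ = 0) ∧
    tm ω (bs ++ [b]) = tm ω bs + t₁ + t₂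
  time : ∀ ω bs, tm ω bs ≤ P + E * bs.length
  correct : ∀ bs b, coins w {ω | (ask ω bs b).out 0 ≠ f b} ≤ 1 / 3

end WordRAM

namespace DynGraph

open WordRAM

/-! ### Sequences of slot updates -/

/-- The vertex with number `u`, reduced modulo `N`. -/
def vtx {N : ℕ} (hN : 0 < N) (u : ℕ) : Fin N := ⟨u % N, Nat.mod_lt _ hN⟩

lemma vtx_val {N : ℕ} (hN : 0 < N) {u : ℕ} (hu : u < N) : (vtx hN u : ℕ) = u :=
  Nat.mod_eq_of_lt hu

section
variable {N k τ : ℕ} {R : ℕ → ℕ → Prop} {mode : Model}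

lemma hub_bounds (hτ : τ ≤ 1) (u : ℕ) : 2 * k ≤ hub k τ u ∧ hub k τ u ≤ 2 * k + 1 := by
  unfold hub; split_ifs <;> omega

lemma slotGraph_congr {b b' : ℕ → Bool} (h : ∀ p < 2 * k, b p = b' p) :
    slotGraph N k τ R b = slotGraph N k τ R b' := by
  ext u v
  simp only [slotGraph_adj]
  have e : ∀ w : Fin N, ∀ x : ℕ, (((w : ℕ) < 2 * k ∧ b w = true ∧ x = hub k τ w) ↔
      ((w : ℕ) < 2 * k ∧ b' w = true ∧ x = hub k τ w)) := by
    intro w x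
    constructor
    · rintro ⟨h1, h2, h3⟩; exact ⟨h1, (h _ h1) ▸ h2, h3⟩
    · rintro ⟨h1, h2, h3⟩; exact ⟨h1, (h _ h1).symm ▸ h2, h3⟩
  rw [e, e]

/-- No slot is an edge of the underlying graph. -/
def SlotFree (k τ : ℕ) (R : ℕ → ℕ → Prop) : Prop :=
  ∀ p < 2 * k, ¬ R (hub k τ p) p ∧ ¬ R p (hub k τ p)

/-- The vertices of slot `p` are adjacent if and only if the slot is occupied. -/
lemma slot_adj (hτ : τ ≤ 1) (hs : 2 * k + 1 < N) (hf : SlotFree k τ R) {b : ℕ → Bool} {p : ℕ}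
    (hp : p < 2 * k) (h0 : 0 < N) :
    (slotGraph N k τ R b).Adj (vtx h0 (hub k τ p)) (vtx h0 p) ↔ b p = true := by
  have hb := hub_bounds (k := k) hτ p
  rw [slotGraph_adj, vtx_val h0 (by omega), vtx_val h0 (by omega)]
  constructor
  · rintro ⟨-, (h | h) | (h | h)⟩
    · exact absurd h (hf p hp).1
    · omega
    · exact absurd h (hf p hp).2
    · exact h.2.1
  · intro h
    refine ⟨fun he => ?_, .inr (.inr ⟨hp, h, rfl⟩)⟩
    have := congrArg Fin.val he
    rw [vtx_val h0 (by omega), vtx_val h0 (by omega)] at this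
    omega

lemma slotGraph_insert (hτ : τ ≤ 1) (hs : 2 * k + 1 < N) {b : ℕ → Bool} {p : ℕ}
    (hp : p < 2 * k) (h0 : 0 < N) :
    slotGraph N k τ R b ⊔ SimpleGraph.edge (vtx h0 (hub k τ p)) (vtx h0 p) =
      slotGraph N k τ R (Function.update b p true) := by
  have hb := hub_bounds (k := k) hτ p
  have v1 := vtx_val h0 (show hub k τ p < N by omega)
  have v2 := vtx_val h0 (show p < N by omega)
  ext u v
  rw [SimpleGraph.sup_adj, SimpleGraph.edge_adj, slotGraph_adj, slotGraph_adj]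
  simp only [Fin.ext_iff, v1, v2, ne_eq]
  by_cases hu : (u : ℕ) = p <;> by_cases hv : (v : ℕ) = p
  · simp [hu, hv]
  · simp only [hu, hv, Function.update_self, ne_eq, not_false_eq_true, Function.update_of_ne]
    grind
  · simp only [hu, hv, Function.update_self, ne_eq, not_false_eq_true, Function.update_of_ne]
    grind
  · simp only [hu, hv, ne_eq, not_false_eq_true, Function.update_of_ne]
    grind

lemma slotGraph_delete (hτ : τ ≤ 1) (hs : 2 * k + 1 < N) (hf : SlotFree k τ R) {b : ℕ → Bool}
    {p : ℕ} (hp : p < 2 * k) (h0 : 0 < N) :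
    (slotGraph N k τ R b).deleteEdges {s(vtx h0 (hub k τ p), vtx h0 p)} =
      slotGraph N k τ R (Function.update b p false) := by
  have hb := hub_bounds (k := k) hτ p
  have v1 := vtx_val h0 (show hub k τ p < N by omega)
  have v2 := vtx_val h0 (show p < N by omega)
  have hf := hf p hp
  ext u v
  rw [SimpleGraph.deleteEdges_adj, slotGraph_adj, slotGraph_adj]
  simp only [Fin.ext_iff, v1, v2, ne_eq, Set.mem_singleton_iff, Sym2.eq_iff]
  by_cases hu : (u : ℕ) = p <;> by_cases hv : (v : ℕ) = p
  · simp [hu, hv]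
  · simp only [hu, hv, Function.update_self, ne_eq, not_false_eq_true, Function.update_of_ne]
    grind
  · simp only [hu, hv, Function.update_self, ne_eq, not_false_eq_true, Function.update_of_ne]
    grind
  · simp only [hu, hv, ne_eq, not_false_eq_true, Function.update_of_ne]
    grind

/-- The operations lead from the graph with the slots `b` to the graph with the slots `b'`; they
are queries and permitted updates of slots. -/
inductive Run (mode : Model) (k τ : ℕ) {N : ℕ} (h0 : 0 < N) :
    (ℕ → Bool) → List (Op N) → (ℕ → Bool) → Prop
  | nil (b) : Run mode k τ h0 b [] b
  | query {b l b'} : Run mode k τ h0 b l b' → Run mode k τ h0 b (.query :: l) b'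
  | insert {b l b'} (p : ℕ) : p < 2 * k → b p = false → mode ≠ .decremental →
      Run mode k τ h0 (Function.update b p true) l b' →
      Run mode k τ h0 b (.insert (vtx h0 (hub k τ p)) (vtx h0 p) :: l) b'
  | delete {b l b'} (p : ℕ) : p < 2 * k → b p = true → mode ≠ .incremental →
      Run mode k τ h0 (Function.update b p false) l b' →
      Run mode k τ h0 b (.delete (vtx h0 (hub k τ p)) (vtx h0 p) :: l) b'

namespace Run
variable {h0 : 0 < N} {b b' b'' : ℕ → Bool} {l l' : List (Op N)}

lemma append (h : Run mode k τ h0 b l b') (h' : Run mode k τ h0 b' l' b'') :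
    Run mode k τ h0 b (l ++ l') b'' := by
  induction h with
  | nil => exact h'
  | query _ ih => exact .query (ih h')
  | insert p hp hb hm _ ih => exact .insert p hp hb hm (ih h')
  | delete p hp hb hm _ ih => exact .delete p hp hb hm (ih h')

lemma validOps_cons {n : ℕ} {G : SimpleGraph (Fin n)} {op : Op n} {l : List (Op n)}
    (h : op.Valid mode G) (h' : ValidOps mode (op.apply G) l) : ValidOps mode G (op :: l) := by
  intro i hi
  cases i with
  | zero => exact h
  | succ i => exact h' i (by simpa using hi)

/-- The operations are valid, and all graphs on the way are graphs with slots. -/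
lemma spec (hτ : τ ≤ 1) (hs : 2 * k + 1 < N) (hf : SlotFree k τ R)
    (h : Run mode k τ h0 b l b') : ValidOps mode (slotGraph N k τ R b) l ∧
      (∀ i, ∃ c, graphAt (slotGraph N k τ R b) l i = slotGraph N k τ R c) ∧
      graphAt (slotGraph N k τ R b) l l.length = slotGraph N k τ R b' := by
  have step : ∀ {G : SimpleGraph (Fin N)} {op : Op N} {l : List (Op N)},
      (∃ c, G = slotGraph N k τ R c) →
      (∀ i, ∃ c, graphAt (op.apply G) l i = slotGraph N k τ R c) →
      ∀ i, ∃ c, graphAt G (op :: l) i = slotGraph N k τ R c := by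
    intro G op l hG h i
    cases i with
    | zero => exact hG
    | succ i => exact h i
  induction h with
  | nil b => exact ⟨fun i hi => absurd hi (by simp), fun i => ⟨b, by simp [graphAt]⟩, rfl⟩
  | @query b l b' _ ih => exact ⟨validOps_cons trivial ih.1, step ⟨b, rfl⟩ ih.2.1, ih.2.2⟩
  | @insert b l b' p hp hb hm _ ih =>
    rw [← slotGraph_insert hτ hs hp h0] at ih
    have hadj : ¬ (slotGraph N k τ R b).Adj (vtx h0 (hub k τ p)) (vtx h0 p) := by
      rw [slot_adj hτ hs hf hp, hb]; simp
    have hne : vtx h0 (hub k τ p) ≠ vtx h0 p := by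
      intro he
      have hb := hub_bounds (k := k) hτ p
      have := congrArg Fin.val he
      rw [vtx_val h0 (by omega), vtx_val h0 (by omega)] at this
      omega
    exact ⟨validOps_cons ⟨hm, hne, hadj⟩ ih.1, step ⟨b, rfl⟩ ih.2.1, ih.2.2⟩
  | @delete b l b' p hp hb hm _ ih =>
    rw [← slotGraph_delete hτ hs hf hp h0] at ih
    have hadj : (slotGraph N k τ R b).Adj (vtx h0 (hub k τ p)) (vtx h0 p) := by
      rw [slot_adj hτ hs hf hp, hb]
    exact ⟨validOps_cons ⟨hm, hadj⟩ ih.1, step ⟨b, rfl⟩ ih.2.1, ih.2.2⟩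

end Run

/-- The operation that gives slot `p` the value `nv`. -/
def slotOp (k τ : ℕ) {N : ℕ} (h0 : 0 < N) (nv : Bool) (p : ℕ) : Op N :=
  if nv then .insert (vtx h0 (hub k τ p)) (vtx h0 p) else .delete (vtx h0 (hub k τ p)) (vtx h0 p)

/-- The operations that give the value `nv` to all slots below `n` with `b p = pol`. -/
def slotOps (k τ : ℕ) {N : ℕ} (h0 : 0 < N) (nv pol : Bool) (b : ℕ → Bool) (n : ℕ) :
    List (Op N) :=
  (List.range n).flatMap fun p => if b p = pol then [slotOp k τ h0 nv p] else []

/-- The new bits are `nv` in the chosen slots, where the bits were `!nv` before, and the old bits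
elsewhere. -/
lemma slotOps_run {h0 : 0 < N} {nv pol : Bool} {b c : ℕ → Bool}
    (hm : if nv then mode ≠ .decremental else mode ≠ .incremental)
    (hc : ∀ p, b p = pol → c p = !nv) (n : ℕ) (hn : n ≤ 2 * k) :
    Run mode k τ h0 c (slotOps k τ h0 nv pol b n)
      (fun p => if p < n ∧ b p = pol then nv else c p) := by
  induction n with
  | zero => simpa [slotOps] using Run.nil c
  | succ n ih =>
    rw [slotOps, List.range_succ, List.flatMap_append]
    refine (ih (by omega)).append ?_
    simp only [List.flatMap_singleton]
    by_cases hb : b n = pol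
    · have e : (fun p => if p < n + 1 ∧ b p = pol then nv else c p) =
          Function.update (fun p => if p < n ∧ b p = pol then nv else c p) n nv := by
        funext p
        by_cases hp : p = n
        · subst hp; simp [hb]
        · rw [Function.update_of_ne hp]
          have : p < n + 1 ↔ p < n := by omega
          simp only [this]
      rw [if_pos hb, e, slotOp]
      cases nv with
      | true =>
        exact .insert n (by omega) (by simp [hc n hb]) (by simpa using hm) (.nil _)
      | false =>
        exact .delete n (by omega) (by simp [hc n hb]) (by simpa using hm) (.nil _)
    · have e : (fun p => if p < n + 1 ∧ b p = pol then nv else c p) =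
          (fun p => if p < n ∧ b p = pol then nv else c p) := by
        funext p
        by_cases hp : p = n
        · subst hp; simp [hb]
        · have : p < n + 1 ↔ p < n := by omega
          simp only [this]
      rw [if_neg hb, e]
      exact .nil _

lemma slotOps_length (h0 : 0 < N) (nv pol : Bool) (b : ℕ → Bool) (n : ℕ) :
    (slotOps k τ h0 nv pol b n).length ≤ n ∧ ∀ op ∈ slotOps k τ h0 nv pol b n, op.IsUpdate := by
  induction n with
  | zero => simp [slotOps]
  | succ n ih =>
    have e : slotOps k τ h0 nv pol b (n + 1) = slotOps k τ h0 nv pol b n ++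
        if b n = pol then [slotOp k τ h0 nv n] else [] := by
      simp [slotOps, List.range_succ]
    rw [e]
    constructor
    · rw [List.length_append]
      split_ifs <;> simp <;> omega
    · intro op hop
      rw [List.mem_append] at hop
      rcases hop with hop | hop
      · exact ih.2 _ hop
      · split_ifs at hop
        · rw [List.mem_singleton.1 hop, slotOp]
          split_ifs <;> exact trivial
        · simp at hop

lemma request_slotOps (A : Algorithm) (hτ : τ ≤ 1) (hs : 2 * k + 1 < N) (h0 : 0 < N)
    (nv pol : Bool) (b : ℕ → Bool) (n : ℕ) (hn : n ≤ 2 * k) :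
    (slotOps k τ h0 nv pol b n).map A.request =
      bitReqs (if nv then A.insert else A.delete) pol (hub k τ) b n := by
  induction n with
  | zero => simp [slotOps, bitReqs]
  | succ n ih =>
    have e : slotOps k τ h0 nv pol b (n + 1) = slotOps k τ h0 nv pol b n ++
        if b n = pol then [slotOp k τ h0 nv n] else [] := by
      simp [slotOps, List.range_succ]
    rw [e, List.map_append, ih (by omega), bitReqs_succ]
    congr 1
    have hb := hub_bounds (k := k) hτ n
    have hi : edgeInput (vtx h0 (hub k τ n)) (vtx h0 n) = pairInp (hub k τ n) n := by
      funext a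
      simp only [edgeInput, pairInp]
      rw [vtx_val h0 (by omega), vtx_val h0 (by omega)]
    split_ifs with h1 h2
    · simp [slotOp, h2, Algorithm.request, hi]
    · simp [slotOp, h2, Algorithm.request, hi]
    · rfl

end

/-! ### Gadgets -/

/-- A family of graphs with slots for which the problem `Q` yields vector-matrix-vector products:
for bits `b`, the answers for the four combinations of the vectors with zero vectors are unbalanced
if and only if the product is one. There are `2 ^ e * k ^ 2` vertices, the hub of the right vector
is `2 * k + τ`, and the number of the distinguished vertex, if there is one, is `cm * k`. By
`cover`, the edges lie within the first `D * k` vertices or on the graphs of three functions, so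
that there are `O(k ^ 2)` edges. -/
structure Gadget (Q : Problem) where
  e : ℕ
  τ : ℕ
  cm : ℕ
  D : ℕ
  rel : ℕ → (ℕ → ℕ → Bool) → ℕ → ℕ → Prop
  param : ∀ k N, 1 ≤ k → N = 2 ^ e * k ^ 2 → Q.Param N
  param_code : ∀ k N h h', Q.code (param k N h h') = cm * k
  e_ge : 2 ≤ e
  τ_le : τ ≤ 1
  free : ∀ k m, SlotFree k τ (rel k m)
  D_ge : 4 ≤ D
  cover : ∀ k, 1 ≤ k → ∃ f₁ f₂ g : ℕ → ℕ, ∀ m u v, rel k m u v →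
    (u < D * k ∧ v < D * k) ∨ v = f₁ u ∨ v = f₂ u ∨ u = g v
  spec : ∀ k N m b (h : 1 ≤ k) (h' : N = 2 ^ e * k ^ 2),
    Q.answer (slotGraph N k τ (rel k m) b) (param k N h h') +
        Q.answer (slotGraph N k τ (rel k m) (mask k false false b)) (param k N h h') ≠
      Q.answer (slotGraph N k τ (rel k m) (mask k true false b)) (param k N h h') +
        Q.answer (slotGraph N k τ (rel k m) (mask k false true b)) (param k N h h') ↔ Hit k m b

namespace Gadget
variable {Q : Problem} (g : Gadget Q)

lemma size {k N : ℕ} (hk : 1 ≤ k) (hN : N = 2 ^ g.e * k ^ 2) : 2 * k + 1 < N := by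
  have h1 : 2 ^ 2 ≤ 2 ^ g.e := Nat.pow_le_pow_right (by norm_num) g.e_ge
  subst hN
  nlinarith [Nat.mul_le_mul_right (k ^ 2) h1]

/-- All graphs of the family have `O(k ^ 2)` edges, so that an operation on them costs what the
algorithm needs for `m = O(k ^ 2)`. -/
lemma edges_le {k N : ℕ} (hk : 1 ≤ k) (hN : N = 2 ^ g.e * k ^ 2) (m : ℕ → ℕ → Bool)
    (b : ℕ → Bool) : (slotGraph N k g.τ (g.rel k m) b).edgeSet.ncard ≤
      (g.D ^ 2 + 3 * 2 ^ g.e) * k ^ 2 := by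
  obtain ⟨f₁, f₂, f₃, hc⟩ := g.cover k hk
  have hs := g.size hk hN
  have h0 : 0 < N := by omega
  let S : Finset (ℕ × ℕ) := (Finset.range (g.D * k) ×ˢ Finset.range (g.D * k)) ∪
    (Finset.range N).image (fun u => (u, f₁ u)) ∪ (Finset.range N).image (fun u => (u, f₂ u)) ∪
    (Finset.range N).image (fun v => (f₃ v, v))
  have hS : S.card ≤ (g.D ^ 2 + 3 * 2 ^ g.e) * k ^ 2 := by
    calc S.card ≤ (g.D * k) * (g.D * k) + N + N + N := by
          refine (Finset.card_union_le _ _).trans (Nat.add_le_add ((Finset.card_union_le _ _).trans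
            (Nat.add_le_add ((Finset.card_union_le _ _).trans (Nat.add_le_add ?_ ?_)) ?_)) ?_)
          · simp
          all_goals exact Finset.card_image_le.trans (by simp)
      _ = _ := by subst hN; ring
  have key : ∀ u v : Fin N, (g.rel k m u v ∨ ((u : ℕ) < 2 * k ∧ b u = true ∧
      (v : ℕ) = hub k g.τ u)) → ((u : ℕ), (v : ℕ)) ∈ S := by
    intro u v h
    simp only [S, Finset.mem_union, Finset.mem_product, Finset.mem_range, Finset.mem_image,
      Prod.mk.injEq]
    rcases h with h | h
    · rcases hc m u v h with h | h | h | h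
      · exact .inl (.inl (.inl h))
      · exact .inl (.inl (.inr ⟨u, u.2, rfl, h.symm⟩))
      · exact .inl (.inr ⟨u, u.2, rfl, h.symm⟩)
      · exact .inr ⟨v, v.2, h.symm, rfl⟩
    · have hb := hub_bounds (k := k) g.τ_le u
      have := Nat.mul_le_mul_right k g.D_ge
      exact .inl (.inl (.inl ⟨by omega, by omega⟩))
  have hsub : (slotGraph N k g.τ (g.rel k m) b).edgeSet ⊆
      (S.image fun p => s(vtx h0 p.1, vtx h0 p.2) : Finset (Sym2 (Fin N))) := by
    intro z hz
    induction z with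
    | _ u v =>
      rw [SimpleGraph.mem_edgeSet, slotGraph_adj] at hz
      have hu : vtx h0 u = u := Fin.ext (vtx_val h0 u.2)
      have hv : vtx h0 v = v := Fin.ext (vtx_val h0 v.2)
      rw [Finset.mem_coe, Finset.mem_image]
      rcases hz.2 with h | h
      · exact ⟨_, key u v h, by rw [hu, hv]⟩
      · exact ⟨_, key v u h, by rw [hu, hv, Sym2.eq_swap]⟩
  calc _ ≤ ((S.image fun p => s(vtx h0 p.1, vtx h0 p.2) : Finset (Sym2 (Fin N))) :
        Set (Sym2 (Fin N))).ncard := Set.ncard_le_ncard hsub (Finset.finite_toSet _)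
    _ ≤ S.card := by rw [Set.ncard_coe_finset]; exact Finset.card_image_le
    _ ≤ _ := hS

end Gadget

/-! ### From dynamic algorithms to answering questions -/

/-- The time bound for an operation. -/
def Op.cost {n : ℕ} (U V : ℕ) : Op n → ℕ
  | .query => V
  | _ => U

lemma sum_le_sum_map {α : Type*} (c : α → ℕ) (l : List α) (F : ℕ → ℕ)
    (h : ∀ i (hi : i < l.length), F i ≤ c l[i]) :
    ∑ i ∈ Finset.range l.length, F i ≤ (l.map c).sum := by
  induction l generalizing F with
  | nil => simp
  | cons a l ih =>
    rw [List.length_cons, Finset.sum_range_succ', List.map_cons, List.sum_cons, add_comm]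
    exact Nat.add_le_add (h 0 (by simp))
      (ih (fun i => F (i + 1)) fun i hi => h (i + 1) (by simpa using hi))

section
variable {Q : Problem} (g : Gadget Q) {A : Algorithm} {mode : Model} {c K : ℕ} {C α β : ℝ}
  {k N : ℕ} {m : ℕ → ℕ → Bool} {U V : ℕ} {h0 : 0 < N} {b b' : ℕ → Bool} {l : List (Op N)}

/-- The bounds `U` and `V` hold for all graphs with at most `M` edges. -/
structure Bounds (C α β : ℝ) (M U V : ℕ) : Prop where
  upd : ∀ x : ℝ, 1 ≤ x → x ≤ M → C * x ^ α ≤ U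
  qry : ∀ x : ℝ, 1 ≤ x → x ≤ M → C * x ^ β ≤ V

lemma edgesAt_bounds (hk : 1 ≤ k) (hN : N = 2 ^ g.e * k ^ 2)
    (hr : Run mode k g.τ h0 b l b') (i : ℕ) :
    1 ≤ edgesAt (slotGraph N k g.τ (g.rel k m) b) l i ∧
      edgesAt (slotGraph N k g.τ (g.rel k m) b) l i ≤
        ((g.D ^ 2 + 3 * 2 ^ g.e) * k ^ 2 : ℕ) := by
  obtain ⟨d, hd⟩ := (hr.spec g.τ_le (g.size hk hN) (g.free k m)).2.1 i
  refine ⟨le_max_right _ _, ?_⟩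
  rw [edgesAt, hd]
  refine max_le (Nat.cast_le.2 (g.edges_le hk hN m d)) ?_
  have : 1 ≤ (g.D ^ 2 + 3 * 2 ^ g.e) * k ^ 2 := Nat.one_le_iff_ne_zero.2 (by positivity)
  exact_mod_cast this

lemma steps_of_serves {w : ℕ} {ω : ℕ → Fin (2 ^ w)} {G : SimpleGraph (Fin N)} {s : ℕ}
    {σ : ℕ → State} {t : ℕ → ℕ} (h : Serves w ω (A.requests G s l) σ t) :
    Exec w ω (graphInput G s) A.prep State.zero (σ 1) (t 0) ∧
      Steps w ω (l.map A.request) (σ 1) (σ (l.length + 1))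
        (∑ i ∈ Finset.range l.length, t (i + 1)) := by
  have hs := Steps.of_serves h (l.length + 1) (by simp [Algorithm.requests])
  have e0 := h.2 0 (by simp [Algorithm.requests])
  rw [h.1] at e0
  refine ⟨e0, ?_⟩
  rw [List.take_of_length_le (by simp [Algorithm.requests]), Algorithm.requests] at hs
  obtain ⟨s₁, t₁, t₂, e, hs, ht⟩ := hs
  obtain ⟨rfl, rfl⟩ := e.det e0
  rw [Finset.sum_range_succ', add_comm] at ht
  rwa [Nat.add_left_cancel ht]

/-- An algorithm with worst-case bounds performs a run of slot updates and queries at the given cost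
of each operation. -/
lemma worstCase_steps (hA : A.WorstCaseTime Q mode c K C α β) (hk : 1 ≤ k)
    (hN : N = 2 ^ g.e * k ^ 2) (hB : Bounds C α β ((g.D ^ 2 + 3 * 2 ^ g.e) * k ^ 2) U V)
    (hr : Run mode k g.τ h0 b l b') (ω : ℕ → Fin (2 ^ wordSize c N)) :
    ∃ s₀ t₀ s t, Exec (wordSize c N) ω
        (graphInput (slotGraph N k g.τ (g.rel k m) b) (g.cm * k)) A.prep State.zero s₀ t₀ ∧
      Steps (wordSize c N) ω (l.map A.request) s₀ s t ∧ t₀ ≤ K * (N + 1) ^ K ∧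
      t ≤ (l.map (Op.cost U V)).sum := by
  obtain ⟨σ, t, hs, h1, h2⟩ := hA N (slotGraph N k g.τ (g.rel k m) b) (g.param k N hk hN) l
    (hr.spec g.τ_le (g.size hk hN) (g.free k m)).1 ω
  rw [g.param_code] at hs
  obtain ⟨e0, e1⟩ := steps_of_serves hs
  refine ⟨_, _, _, _, e0, e1, h1, sum_le_sum_map _ _ _ fun i hi => ?_⟩
  obtain ⟨b1, b2⟩ := edgesAt_bounds g (m := m) hk hN hr i
  obtain ⟨h3, h4⟩ := h2 i hi
  have : (t (i + 1) : ℝ) ≤ (Op.cost U V l[i] : ℕ) := by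
    rcases hop : l[i] with ⟨u, v⟩ | ⟨u, v⟩ | _
    · exact (h3 (by rw [hop]; trivial)).trans (hB.upd _ b1 b2)
    · exact (h3 (by rw [hop]; trivial)).trans (hB.upd _ b1 b2)
    · exact (h4 hop).trans (hB.qry _ b1 b2)
  exact_mod_cast this

/-- An algorithm with amortized bounds performs a run of slot updates and queries at the given cost
of each operation, where the preprocessing is paid for in advance. -/
lemma amortized_steps (hA : A.AmortizedTime Q mode c K C α β) (hk : 1 ≤ k)
    (hN : N = 2 ^ g.e * k ^ 2) (hB : Bounds C α β ((g.D ^ 2 + 3 * 2 ^ g.e) * k ^ 2) U V)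
    (hr : Run mode k g.τ h0 b l b') (ω : ℕ → Fin (2 ^ wordSize c N)) :
    ∃ s₀ t₀ s t, Exec (wordSize c N) ω
        (graphInput (slotGraph N k g.τ (g.rel k m) b) (g.cm * k)) A.prep State.zero s₀ t₀ ∧
      Steps (wordSize c N) ω (l.map A.request) s₀ s t ∧
      t₀ + t ≤ K * (N + 1) ^ K + (l.map (Op.cost U V)).sum := by
  classical
  obtain ⟨σ, t, hs, h1, h2⟩ := hA N (slotGraph N k g.τ (g.rel k m) b) (g.param k N hk hN) l
    (hr.spec g.τ_le (g.size hk hN) (g.free k m)).1 ω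
  rw [g.param_code] at hs
  obtain ⟨e0, e1⟩ := steps_of_serves hs
  refine ⟨_, _, _, _, e0, e1, ?_⟩
  have hsum : (l.map (Op.cost U V)).sum = ∑ i : Fin l.length, Op.cost U V l[i] := by
    rw [← List.sum_ofFn]
    congr 1
    apply List.ext_getElem <;> simp
  have hsplit : ∑ i ∈ Finset.range l.length, (t (i + 1) : ℝ) =
      (∑ i : Fin l.length, if l[i].IsUpdate then (t (i + 1) : ℝ) else 0) +
        ∑ i : Fin l.length, if l[i].IsUpdate then 0 else (t (i + 1) : ℝ) := by
    rw [← Finset.sum_add_distrib, Finset.sum_range]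
    refine Finset.sum_congr rfl fun i _ => ?_
    split_ifs <;> simp
  have hle : (∑ i : Fin l.length,
      if l[i].IsUpdate then C * edgesAt (slotGraph N k g.τ (g.rel k m) b) l i ^ α else 0) +
      (∑ i : Fin l.length, if l[i].IsUpdate then 0 else (t (i + 1) : ℝ)) ≤
      ∑ i : Fin l.length, ((Op.cost U V l[i] : ℕ) : ℝ) := by
    rw [← Finset.sum_add_distrib]
    refine Finset.sum_le_sum fun i _ => ?_
    obtain ⟨b1, b2⟩ := edgesAt_bounds g (m := m) hk hN hr i
    have h4 := h2 i i.2
    rcases hop : l[i] with ⟨u, v⟩ | ⟨u, v⟩ | _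
    · simpa [Op.IsUpdate, Op.cost] using hB.upd _ b1 b2
    · simpa [Op.IsUpdate, Op.cost] using hB.upd _ b1 b2
    · simpa [Op.IsUpdate, Op.cost] using (h4 hop).trans (hB.qry _ b1 b2)
  have : ((t 0 + ∑ i ∈ Finset.range l.length, t (i + 1) : ℕ) : ℝ) ≤
      ((K * (N + 1) ^ K + (l.map (Op.cost U V)).sum : ℕ) : ℝ) := by
    rw [hsum]
    push_cast
    rw [hsplit]
    linarith
  exact_mod_cast this

/-- The answer to a query at the end of a run is wrong with probability at most `1/3`. -/
lemma correct_steps (hA : A.Correct Q mode c) (hk : 1 ≤ k) (hN : N = 2 ^ g.e * k ^ 2)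
    (hr : Run mode k g.τ h0 b l b') :
    coins (wordSize c N) {ω | ¬ ∃ s₀ t₀ s t, Exec (wordSize c N) ω
        (graphInput (slotGraph N k g.τ (g.rel k m) b) (g.cm * k)) A.prep State.zero s₀ t₀ ∧
      Steps (wordSize c N) ω (l.map A.request ++ [(A.query, fun _ => 0)]) s₀ s t ∧
      s.out 0 = Q.answer (slotGraph N k g.τ (g.rel k m) b') (g.param k N hk hN)} ≤ 1 / 3 := by
  have hr' := hr.append (.query (.nil b'))
  have hs := hr.spec g.τ_le (g.size hk hN) (g.free k m)
  have h := hA N (slotGraph N k g.τ (g.rel k m) b) (g.param k N hk hN) (l ++ [.query])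
    (hr'.spec g.τ_le (g.size hk hN) (g.free k m)).1 l.length (by simp) (by simp)
  refine (MeasureTheory.measure_mono ?_).trans h
  intro ω hω hc
  apply hω
  obtain ⟨σ, t, hs', ho⟩ := hc
  rw [g.param_code] at hs'
  obtain ⟨e0, e1⟩ := steps_of_serves hs'
  refine ⟨_, _, _, _, e0, by simpa [Algorithm.request] using e1, ?_⟩
  have hg : graphAt (slotGraph N k g.τ (g.rel k m) b) (l ++ [.query]) l.length =
      slotGraph N k g.τ (g.rel k m) b' := by
    rw [← hs.2.2]
    simp [graphAt]
  rw [hg] at ho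
  simpa using ho

/-- All slots get their bits, and the query is asked. -/
def askOps (k τ : ℕ) (h0 : 0 < N) (pol : Bool) (b : ℕ → Bool) : List (Op N) :=
  slotOps k τ h0 pol pol b (2 * k) ++ [.query]

lemma cost_slotOps (nv pol : Bool) (b : ℕ → Bool) (n : ℕ) :
    ((slotOps k g.τ h0 nv pol b n).map (Op.cost U V)).sum ≤ n * U := by
  obtain ⟨h1, h2⟩ := slotOps_length (k := k) (τ := g.τ) h0 nv pol b n
  refine (List.sum_le_card_nsmul _ U ?_).trans ?_
  · intro x hx
    obtain ⟨op, hop, rfl⟩ := List.mem_map.1 hx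
    have := h2 op hop
    cases op <;> simp_all [Op.cost, Op.IsUpdate]
  · rw [List.length_map, smul_eq_mul]
    exact Nat.mul_le_mul_right _ h1

/-- The bits after the updates agree with the wanted ones. -/
lemma ask_run (pol : Bool) (hm : if pol then mode ≠ .decremental else mode ≠ .incremental)
    (h0 : 0 < N) (b : ℕ → Bool) : ∃ b', Run mode k g.τ h0 (fun _ => !pol)
      (slotOps k g.τ h0 pol pol b (2 * k)) b' ∧ (∀ p < 2 * k, b' p = b p) ∧
      ∀ p, b' p = if p < 2 * k ∧ b p = pol then pol else !pol := by
  refine ⟨_, slotOps_run hm (fun _ _ => rfl) _ le_rfl, fun p hp => ?_, fun _ => rfl⟩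
  by_cases h : b p = pol
  · simp [hp, h]
  · simp only [hp, h, and_false, if_false]
    cases hb : b p <;> cases pol <;> simp_all

/-- A partially dynamic algorithm answers questions: after each question, the memory is reset. Hence
the state between questions does not depend on the questions, and worst-case bounds are needed. An
incremental algorithm starts with empty slots, a decremental one with occupied slots. -/
theorem exists_service_partial (pol : Bool) (hm : if pol then mode ≠ .decremental else
      mode ≠ .incremental) (hC : A.Correct Q mode c) (hA : A.WorstCaseTime Q mode c K C α β)
    (hk : 1 ≤ k) (hN : N = 2 ^ g.e * k ^ 2)
    (hB : Bounds C α β ((g.D ^ 2 + 3 * 2 ^ g.e) * k ^ 2) U V) (m : ℕ → ℕ → Bool) :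
    Nonempty (Service ⟨A.prep, if pol then A.insert else A.delete, A.query, .skip, false, pol⟩
      (wordSize c N) k (hub k g.τ)
      (graphInput (slotGraph N k g.τ (g.rel k m) fun _ => !pol) (g.cm * k))
      (fun b => Q.answer (slotGraph N k g.τ (g.rel k m) b) (g.param k N hk hN))
      (K * (N + 1) ^ K) (4 * k * U + V)) := by
  have hs := g.size hk hN
  have h0 : 0 < N := by omega
  have req : ∀ b, (askOps k g.τ h0 pol b).map A.request =
      bitReqs (if pol then A.insert else A.delete) pol (hub k g.τ) b (2 * k) ++
        [(A.query, fun _ => 0)] := by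
    intro b
    rw [askOps, List.map_append, request_slotOps A g.τ_le hs h0 _ _ _ _ le_rfl]
    rfl
  have hrun : ∀ b, ∃ b', Run mode k g.τ h0 (fun _ => !pol) (askOps k g.τ h0 pol b) b' := by
    intro b
    obtain ⟨b', h1, -, -⟩ := ask_run g (mode := mode) (k := k) pol hm h0 b
    exact ⟨b', h1.append (.query (.nil _))⟩
  -- one run for each question, always from the initial state
  have hT : ∀ ω : ℕ → Fin (2 ^ wordSize c N), ∀ b, ∃ s₀ t₀ s t, Exec (wordSize c N) ω
        (graphInput (slotGraph N k g.τ (g.rel k m) fun _ => !pol) (g.cm * k)) A.prep State.zero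
          s₀ t₀ ∧
      Steps (wordSize c N) ω (bitReqs (if pol then A.insert else A.delete) pol (hub k g.τ) b
        (2 * k) ++ [(A.query, fun _ => 0)]) s₀ s t ∧ t₀ ≤ K * (N + 1) ^ K ∧
      t ≤ 4 * k * U + V := by
    intro ω b
    obtain ⟨b', hr⟩ := hrun b
    obtain ⟨s₀, t₀, s, t, e0, e1, l0, l1⟩ := worstCase_steps g (m := m) hA hk hN hB hr ω
    refine ⟨s₀, t₀, s, t, e0, by rwa [← req], l0, l1.trans ?_⟩
    rw [askOps, List.map_append, List.sum_append]
    have := cost_slotOps g (h0 := h0) (U := U) (V := V) (k := k) pol pol b (2 * k)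
    have h2 : ([Op.query].map (Op.cost (n := N) U V)).sum = V := by simp [Op.cost]
    nlinarith
  choose S₀ T₀ ask tt e0 e1 l0 l1 using hT
  have hS : ∀ ω b b', S₀ ω b = S₀ ω b' ∧ T₀ ω b = T₀ ω b' := fun ω b b' => (e0 ω b).det (e0 ω b')
  let z : ℕ → Bool := fun _ => false
  refine ⟨⟨fun ω _ => S₀ ω z, fun ω _ b => ask ω b, fun ω bs => T₀ ω z + (bs.map (tt ω)).sum,
    fun ω => by simpa using e0 ω z, fun ω bs b => ⟨tt ω b, 0, ?_, by simp, by simp, by simp; ring⟩,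
    fun ω bs => ?_, fun bs b => ?_⟩⟩
  · rw [(hS ω z b).1]
    exact e1 ω b
  · refine Nat.add_le_add (l0 ω z) ?_
    refine (List.sum_le_card_nsmul _ (4 * k * U + V) ?_).trans ?_
    · intro x hx
      obtain ⟨b, -, rfl⟩ := List.mem_map.1 hx
      exact l1 ω b
    · simp [mul_comm]
  · obtain ⟨b', h1, h2, -⟩ := ask_run g (mode := mode) (k := k) pol hm h0 b
    refine (MeasureTheory.measure_mono ?_).trans (correct_steps g (m := m) hC hk hN h1)
    rintro ω hω ⟨s₀, t₀, s, t, x0, x1, ho⟩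
    apply hω
    rw [request_slotOps A g.τ_le hs h0 _ _ _ _ le_rfl] at x1
    obtain ⟨rfl, rfl⟩ := x0.det (e0 ω b)
    obtain ⟨rfl, rfl⟩ := x1.det (e1 ω b)
    rw [ho, slotGraph_congr h2]

/-- The operations of one round of a fully dynamic algorithm. -/
def roundOps (k τ : ℕ) (h0 : 0 < N) (b : ℕ → Bool) : List (Op N) :=
  askOps k τ h0 true b ++ slotOps k τ h0 false true b (2 * k)

/-- A fully dynamic algorithm answers questions: after each question, the updates are undone. The
questions form one sequence of valid operations, to which the amortized bound applies. -/
theorem exists_service_full (hC : A.Correct Q .fullyDynamic c)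
    (hA : A.AmortizedTime Q .fullyDynamic c K C α β) (hk : 1 ≤ k) (hN : N = 2 ^ g.e * k ^ 2)
    (hB : Bounds C α β ((g.D ^ 2 + 3 * 2 ^ g.e) * k ^ 2) U V) (m : ℕ → ℕ → Bool) :
    Nonempty (Service ⟨A.prep, A.insert, A.query, A.delete, true, true⟩
      (wordSize c N) k (hub k g.τ)
      (graphInput (slotGraph N k g.τ (g.rel k m) fun _ => !true) (g.cm * k))
      (fun b => Q.answer (slotGraph N k g.τ (g.rel k m) b) (g.param k N hk hN))
      (K * (N + 1) ^ K) (4 * k * U + V)) := by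
  have hs := g.size hk hN
  have h0 : 0 < N := by omega
  have req : ∀ b, (askOps k g.τ h0 true b).map A.request =
      bitReqs A.insert true (hub k g.τ) b (2 * k) ++ [(A.query, fun _ => 0)] := by
    intro b
    rw [askOps, List.map_append, request_slotOps A g.τ_le hs h0 _ _ _ _ le_rfl]
    rfl
  have req' : ∀ b, (slotOps k g.τ h0 false true b (2 * k)).map A.request =
      bitReqs A.delete true (hub k g.τ) b (2 * k) := by
    intro b
    rw [request_slotOps A g.τ_le hs h0 _ _ _ _ le_rfl]
    rfl
  have run1 : ∀ b, Run .fullyDynamic k g.τ h0 (fun _ => !true) (roundOps k g.τ h0 b)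
      (fun _ => !true) := by
    intro b
    obtain ⟨b', h1, -, h3⟩ := ask_run g (mode := .fullyDynamic) (k := k) true (by simp) h0 b
    have h4 := slotOps_run (mode := .fullyDynamic) (k := k) (τ := g.τ) (h0 := h0) (nv := false)
      (pol := true) (b := fun p => decide (p < 2 * k) && b p) (c := b') (by simp)
      (by intro p hp; rw [h3]; simpa using hp) (2 * k) le_rfl
    have e1 : slotOps k g.τ h0 false true (fun p => decide (p < 2 * k) && b p) (2 * k) =
        slotOps k g.τ h0 false true b (2 * k) := by
      unfold slotOps
      refine List.flatMap_congr fun p hp => ?_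
      simp [List.mem_range.1 hp]
    rw [e1] at h4
    have e2 : (fun p => if p < 2 * k ∧ (decide (p < 2 * k) && b p) = true then false else b' p) =
        fun _ => !true := by
      funext p
      rw [h3]
      by_cases hp : p < 2 * k <;> cases b p <;> simp [hp]
    rw [e2] at h4
    rw [roundOps, askOps, List.append_assoc]
    exact h1.append (.query h4)
  have runH : ∀ bs : List (ℕ → Bool), Run .fullyDynamic k g.τ h0 (fun _ => !true)
      (bs.flatMap (roundOps k g.τ h0)) (fun _ => !true) := by
    intro bs
    induction bs with
    | nil => exact .nil _
    | cons b bs ih => exact (run1 b).append ih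
  -- one run for each sequence of questions; runs of an initial segment agree with it
  have hT := fun (ω : ℕ → Fin (2 ^ wordSize c N)) (bs : List (ℕ → Bool)) =>
    amortized_steps g (m := m) hA hk hN hB (runH bs) ω
  choose S₀ T₀ S T e0 e1 l1 using hT
  have hS : ∀ ω bs bs', S₀ ω bs = S₀ ω bs' ∧ T₀ ω bs = T₀ ω bs' :=
    fun ω b b' => (e0 ω b).det (e0 ω b')
  have hround : ∀ ω bs b, ∃ s t₁ t₂, Steps (wordSize c N) ω
      (bitReqs A.insert true (hub k g.τ) b (2 * k) ++ [(A.query, fun _ => 0)]) (S ω bs) s t₁ ∧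
      Steps (wordSize c N) ω (bitReqs A.delete true (hub k g.τ) b (2 * k)) s (S ω (bs ++ [b])) t₂ ∧
      T₀ ω (bs ++ [b]) + T ω (bs ++ [b]) = T₀ ω bs + T ω bs + t₁ + t₂ := by
    intro ω bs b
    have h := e1 ω (bs ++ [b])
    rw [List.flatMap_append, List.flatMap_singleton, List.map_append, Steps.append_iff] at h
    obtain ⟨s₁, t₁, t₂, h1, h2, h3⟩ := h
    rw [(hS ω (bs ++ [b]) bs).1] at h1
    obtain ⟨rfl, rfl⟩ := h1.det (e1 ω bs)
    rw [roundOps, List.map_append, req, req', Steps.append_iff] at h2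
    obtain ⟨s₂, t₃, t₄, h4, h5, h6⟩ := h2
    exact ⟨s₂, t₃, t₄, h4, h5, by rw [(hS ω (bs ++ [b]) bs).2]; omega⟩
  choose ask t₁ t₂ a1 a2 a3 using hround
  refine ⟨⟨S, ask, fun ω bs => T₀ ω bs + T ω bs, fun ω => ?_, fun ω bs b =>
    ⟨_, _, a1 ω bs b, fun _ => a2 ω bs b, by simp, a3 ω bs b⟩, fun ω bs => ?_, fun bs b => ?_⟩⟩
  · have h := e1 ω []
    have h1 : S ω [] = S₀ ω [] := h.1
    have h2 : T ω [] = 0 := h.2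
    rw [h1, h2]
    exact e0 ω []
  · refine (l1 ω bs).trans (Nat.add_le_add_left ?_ _)
    clear l1 a1 a2 a3 e0 e1
    induction bs with
    | nil => simp
    | cons b bs ih =>
      rw [List.flatMap_cons, List.map_append, List.sum_append, List.length_cons, mul_add_one,
        add_comm]
      refine Nat.add_le_add ih ?_
      rw [roundOps, askOps, List.map_append, List.map_append, List.sum_append, List.sum_append]
      have h1 := cost_slotOps g (h0 := h0) (U := U) (V := V) (k := k) true true b (2 * k)
      have h2 := cost_slotOps g (h0 := h0) (U := U) (V := V) (k := k) false true b (2 * k)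
      have h3 : ([Op.query].map (Op.cost (n := N) U V)).sum = V := by simp [Op.cost]
      rw [h3]
      nlinarith
  · obtain ⟨b', h1, h2, -⟩ := ask_run g (mode := .fullyDynamic) (k := k) true (by simp) h0 b
    refine (MeasureTheory.measure_mono ?_).trans
      (correct_steps g (m := m) hC hk hN ((runH bs).append h1))
    rintro ω hω ⟨s₀, u₀, s, u, x0, x1, ho⟩
    apply hω
    obtain ⟨rfl, rfl⟩ := x0.det (e0 ω bs)
    rw [List.map_append, List.append_assoc, Steps.append_iff] at x1
    obtain ⟨s₁, u₁, u₂, y1, y2, -⟩ := x1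
    obtain ⟨rfl, rfl⟩ := y1.det (e1 ω bs)
    rw [request_slotOps A g.τ_le hs h0 _ _ _ _ le_rfl] at y2
    obtain ⟨rfl, rfl⟩ := y2.det (a1 ω bs b)
    rw [ho, slotGraph_congr h2]

end

end DynGraph

namespace WordRAM

/-! ### Computing the edges of a gadget -/

/-- The expression can be evaluated, and it decides `p`. -/
def Is (E : Env) (h : HS) (e : Expr) (p : Prop) : Prop := e.ok E h ∧ (e.val E h ≠ 0 ↔ p)

/-- The expression can be evaluated, and its value is `u`. -/
def Num (E : Env) (h : HS) (e : Expr) (u : ℕ) : Prop := e.ok E h ∧ e.val E h = u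

open WordRAM.Expr

/-- Conjunction; `b` is evaluated only if `a` holds. -/
def and' (a b : Expr) : Expr := .ite a b 0
/-- Disjunction; `b` is evaluated only if `a` fails. -/
def or' (a b : Expr) : Expr := .ite a 1 b
/-- Comparison, as the negation of the reversed strict one. -/
def le' (a b : Expr) : Expr := .ite (lt' b a) 0 1

section
variable {E : Env} {h : HS} {a b : Expr} {u v : ℕ} {p q : Prop}

lemma Is.and (ha : Is E h a p) (hb : p → Is E h b q) : Is E h (and' a b) (p ∧ q) := by
  have h0 : 0 < 2 ^ E.w := by positivity
  unfold Is and' at *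
  simp only [ok_ite, val_ite, ok_ofNat, val_ofNat, ha.2, ha.1, true_and]
  refine ⟨⟨fun hp => (hb hp).1, fun _ => h0⟩, ?_⟩
  by_cases hp : p
  · rw [if_pos (ha.2.2 hp)]
    simpa [hp] using (hb hp).2
  · rw [if_neg (fun hc => hp (ha.2.1 hc))]
    simp [hp]

lemma Is.or (h1 : 1 < 2 ^ E.w) (ha : Is E h a p) (hb : ¬ p → Is E h b q) :
    Is E h (or' a b) (p ∨ q) := by
  unfold Is or' at *
  simp only [ok_ite, val_ite, ok_ofNat, val_ofNat, ha.2, ha.1, true_and]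
  refine ⟨⟨fun _ => h1, fun hp => (hb fun hc => ha.2.2 hc hp).1⟩, ?_⟩
  by_cases hp : p
  · rw [if_pos (ha.2.2 hp)]
    simp [hp]
  · rw [if_neg (fun hc => hp (ha.2.1 hc))]
    simpa [hp] using (hb hp).2

lemma Is.le (h1 : 1 < 2 ^ E.w) (ha : Num E h a u) (hb : Num E h b v) :
    Is E h (le' a b) (u ≤ v) := by
  have h0 : 0 < 2 ^ E.w := by positivity
  unfold Is Num le' at *
  simp only [ok_ite, val_ite, ok_ofNat, val_ofNat, ok_lt, val_lt, ha, hb, h0, h1]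
  by_cases h : v < u <;> simp [h]; omega

lemma Is.lt (ha : Num E h a u) (hb : Num E h b v) : Is E h (lt' a b) (u < v) := by
  unfold Is Num at *
  simp only [ok_lt, val_lt, ha, hb]
  by_cases h : u < v <;> simp [h]

lemma Is.eq (ha : Num E h a u) (hb : Num E h b v) : Is E h (eq' a b) (u = v) := by
  unfold Is Num at *
  simp only [ok_eq, val_eq, ha, hb]
  by_cases h : u = v <;> simp [h]

lemma Num.add (ha : Num E h a u) (hb : Num E h b v) (hw : u + v < 2 ^ E.w) :
    Num E h (a + b) (u + v) := by
  unfold Num at *; simp [ha, hb, hw]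
lemma Num.sub (ha : Num E h a u) (hb : Num E h b v) (hw : v ≤ u) :
    Num E h (a - b) (u - v) := by
  unfold Num at *; simp [ha, hb, hw]
lemma Num.mul (ha : Num E h a u) (hb : Num E h b v) (hw : u * v < 2 ^ E.w) :
    Num E h (a * b) (u * v) := by
  unfold Num at *; simp [ha, hb, hw]
lemma Num.div (ha : Num E h a u) (hb : Num E h b v) : Num E h (a / b) (u / v) := by
  unfold Num at *; simp [ha, hb]
lemma Num.mod (ha : Num E h a u) (hb : Num E h b v) : Num E h (a % b) (u % v) := by
  unfold Num at *; simp [ha, hb]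
lemma Num.var (x : Var) : Num E h (.v x) (h.var x) := ⟨trivial, rfl⟩
lemma Num.lit (hu : u < 2 ^ E.w) : Num E h (lit u) u := ⟨hu, rfl⟩

end

/-- The block `(x, y)` of the matrix, in area `1`, has the entries `m`. -/
structure MatCtx (E : Env) (k : ℕ) (m : ℕ → ℕ → Bool) (h : HS) : Prop where
  hk : h.var .k = k
  mem : ∀ i < k, ∀ j < k,
    h.mem 1 ((h.var .x * k + i) * h.var .H + (h.var .y * k + j)) = (m i j).toNat
  bound : ∀ i < k, ∀ j < k, (h.var .x * k + i) * h.var .H + (h.var .y * k + j) < E.W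
  hH : 0 < h.var .H
  addr : 2 * E.W ≤ 2 ^ E.w

/-- The matrix entry of the current block in row `i` and column `j`. -/
def entry (i j : Expr) : Expr := ld 1 ((v .x * v .k + i) * v .H + (v .y * v .k + j))

lemma MatCtx.entry {E : Env} {k : ℕ} {m : ℕ → ℕ → Bool} {h : HS} (c : MatCtx E k m h)
    {a b : Expr} {i j : ℕ} (ha : Num E h a i) (hb : Num E h b j) (hi : i < k) (hj : j < k) :
    Num E h (entry a b) (m i j).toNat := by
  have hm := c.mem i hi j hj
  have hb' := c.bound i hi j hj
  have ha' := c.addr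
  have hH := c.hH
  have hk := c.hk
  generalize hX : h.var .x * k + i = X at hm hb'
  have h1 : X ≤ X * h.var .H := Nat.le_mul_of_pos_right _ hH
  unfold Num at *
  simp only [WordRAM.entry, ok_ld, val_ld, ok_ofNat, val_ofNat, ok_add, ok_mul, ok_v, val_add,
    val_mul, val_v, ha, hb, hk, hX, true_and]
  rw [hm]
  have h1w : 1 < 2 ^ E.w := by omega
  exact ⟨⟨h1w, ⟨by omega, by omega⟩, hb', by omega⟩, rfl⟩

lemma MatCtx.entry_is {E : Env} {k : ℕ} {m : ℕ → ℕ → Bool} {h : HS} (c : MatCtx E k m h)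
    {a b : Expr} {i j : ℕ} (ha : Num E h a i) (hb : Num E h b j) (hi : i < k) (hj : j < k) :
    Is E h (WordRAM.entry a b) (m i j = true) := by
  have := c.entry ha hb hi hj
  refine ⟨this.1, ?_⟩
  rw [this.2]; simp

/-- The expression decides whether two vertices are adjacent by the relation `rel`. -/
def Computes (e : ℕ) (rel : ℕ → (ℕ → ℕ → Bool) → ℕ → ℕ → Prop) (relE : Var → Var → Expr) : Prop :=
  ∀ (E : Env) (k : ℕ) (m : ℕ → ℕ → Bool) (h : HS), 1 ≤ k → MatCtx E k m h →
    2 ^ (e + 3) * k ^ 2 ≤ 2 ^ E.w → ∀ p q : Var, h.var p < 2 ^ e * k ^ 2 →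
    h.var q < 2 ^ e * k ^ 2 → Is E h (relE p q) (rel k m (h.var p) (h.var q))

open DynGraph

/-- The expression for a bipartite graph with additional edges. -/
def directE (extE : Var → Var → Expr) (p q : Var) : Expr :=
  or' (and' (lt' (v p) (v .k)) (and' (le' (v .k) (v q)) (and' (lt' (v q) (lit 2 * v .k))
    (entry (v p) (v q - v .k))))) (extE p q)

/-- The same for the additional edges, which do not depend on the matrix. -/
def ComputesExt (ext : ℕ → ℕ → ℕ → Prop) (extE : Var → Var → Expr) : Prop :=
  ∀ (E : Env) (k N : ℕ) (h : HS), 16 < 2 ^ E.w → 4 * k ≤ N → 8 * N ≤ 2 ^ E.w → h.var .k = k →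
    ∀ p q : Var, h.var p < N → h.var q < N → Is E h (extE p q) (ext k (h.var p) (h.var q))

lemma four_mul_le {e k : ℕ} (he : 2 ≤ e) (hk : 1 ≤ k) : 4 * k ≤ 2 ^ e * k ^ 2 := by
  have h1 : 2 ^ 2 ≤ 2 ^ e := Nat.pow_le_pow_right (by norm_num) he
  nlinarith [Nat.mul_le_mul_right (k ^ 2) h1]

lemma computes_direct {e : ℕ} (he : 2 ≤ e) {ext : ℕ → ℕ → ℕ → Prop} {extE : Var → Var → Expr}
    (hext : ComputesExt ext extE) : Computes e (directRel ext) (directE extE) := by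
  intro E k m h hk c hw p q hp hq
  have h8 : 8 * (2 ^ e * k ^ 2) ≤ 2 ^ E.w := by rw [pow_add] at hw; linarith
  have h4 := four_mul_le he hk
  have hkk : Num E h (v .k) k := ⟨trivial, c.hk⟩
  have h2k : Num E h (lit 2 * v .k) (2 * k) := (Num.lit (by omega)).mul hkk (by omega)
  refine Is.or (by omega) ?_ (fun _ => hext E k _ h (by omega) h4 h8 c.hk p q hp hq)
  refine Is.and (Is.lt (.var p) hkk) fun h1 => ?_
  refine Is.and (Is.le (by omega) hkk (.var q)) fun h2 => ?_
  refine Is.and (Is.lt (.var q) h2k) fun h3 => ?_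
  exact c.entry_is (.var p) ((Num.var q).sub hkk h2) h1 (by omega)

/-- The expression for `noExt`. -/
def noE (_ _ : Var) : Expr := lit 0
/-- The expression for `pawExt`. -/
def pawE (p q : Var) : Expr :=
  and' (eq' (v p) (lit 2 * v .k)) (eq' (v q) (lit 2 * v .k + lit 1))
/-- The expression for `diamondExt`. -/
def diamondE (p q : Var) : Expr :=
  or' (and' (lt' (v p) (v .k)) (eq' (v q) (lit 2 * v .k + lit 1 + v p)))
    (and' (le' (lit 2 * v .k + lit 1) (v p)) (and' (lt' (v p) (lit 3 * v .k + lit 1))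
      (eq' (v q) (lit 2 * v .k))))
/-- The expression for `cliqueExt`. -/
def cliqueE (p q : Var) : Expr :=
  and' (le' (v p) (lit 2 * v .k)) (eq' (v q) (lit 2 * v .k + lit 1))

lemma computes_no : ComputesExt noExt noE := by
  intro E k N h hw _ _ _ p q _ _
  exact ⟨show 0 < 2 ^ E.w by omega, by simp [noE, noExt]⟩

lemma computes_paw : ComputesExt pawExt pawE := by
  intro E k N h hw h4 h8 hk p q hp hq
  have hkk : Num E h (v .k) k := ⟨trivial, hk⟩
  have h2k : Num E h (lit 2 * v .k) (2 * k) := (Num.lit (by omega)).mul hkk (by omega)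
  have h2k1 := h2k.add (Num.lit (u := 1) (by omega)) (by omega)
  exact Is.and (Is.eq (.var p) h2k) fun _ => Is.eq (.var q) h2k1

lemma computes_diamond : ComputesExt diamondExt diamondE := by
  intro E k N h hw h4 h8 hk p q hp hq
  have hkk : Num E h (v .k) k := ⟨trivial, hk⟩
  have h2k : Num E h (lit 2 * v .k) (2 * k) := (Num.lit (by omega)).mul hkk (by omega)
  have h3k : Num E h (lit 3 * v .k) (3 * k) := (Num.lit (by omega)).mul hkk (by omega)
  have h2k1 := h2k.add (Num.lit (u := 1) (by omega)) (by omega)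
  have h3k1 := h3k.add (Num.lit (u := 1) (by omega)) (by omega)
  refine Is.or (by omega) (Is.and (Is.lt (.var p) hkk) fun h1 =>
    Is.eq (.var q) (h2k1.add (.var p) (by omega))) fun _ => ?_
  exact Is.and (Is.le (by omega) h2k1 (.var p)) fun _ => Is.and (Is.lt (.var p) h3k1) fun _ =>
    Is.eq (.var q) h2k

lemma computes_clique : ComputesExt cliqueExt cliqueE := by
  intro E k N h hw h4 h8 hk p q hp hq
  have hkk : Num E h (v .k) k := ⟨trivial, hk⟩
  have h2k : Num E h (lit 2 * v .k) (2 * k) := (Num.lit (by omega)).mul hkk (by omega)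
  have h2k1 := h2k.add (Num.lit (u := 1) (by omega)) (by omega)
  exact Is.and (Is.le (by omega) (.var p) h2k) fun _ => Is.eq (.var q) h2k1

/-- The expression for the graph of long cycles. -/
def pathE (d : ℕ) (p q : Var) : Expr :=
  let c := lit 2 * v .k + lit 1
  let K := v .k * v .k
  or' (and' (le' c (v q)) (and' (lt' (v q) (c + K)) (eq' (v p) ((v q - c) / v .k))))
    (or' (and' (le' c (v p)) (and' (eq' (v q) (v p + K)) (lt' (v q) (c + lit (d - 1) * K))))
      (and' (le' (c + lit (d - 2) * K) (v p)) (and' (lt' (v p) (c + lit (d - 1) * K))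
        (and' (eq' (v q) (v .k + (v p - (c + lit (d - 2) * K)) % v .k))
          (entry ((v p - (c + lit (d - 2) * K)) / v .k)
            ((v p - (c + lit (d - 2) * K)) % v .k))))))

/-- The intermediate values in `pathE` are smaller than `8` times the number of vertices, so no
overflow occurs. -/
lemma computes_path {d : ℕ} (hd : 2 ≤ d) : Computes (d + 3) (pathRel d) (pathE d) := by
  intro E k m h hk c hw p q hp hq
  have h8 : 8 * (2 ^ (d + 3) * k ^ 2) ≤ 2 ^ E.w := by
    rw [pow_add _ (d + 3)] at hw; linarith
  have hd3 : d + 3 < 2 ^ (d + 3) := Nat.lt_two_pow_self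
  have hdk : (d + 3) * k ^ 2 ≤ 2 ^ (d + 3) * k ^ 2 := Nat.mul_le_mul_right _ hd3.le
  have hkk2 : k ≤ k ^ 2 := Nat.le_self_pow (by norm_num) k
  have h1k : 2 ^ (d + 3) ≤ 2 ^ (d + 3) * k ^ 2 := Nat.le_mul_of_pos_right _ (by positivity)
  have m1 : (d - 1) * k ^ 2 ≤ (d + 3) * k ^ 2 := Nat.mul_le_mul_right _ (by omega)
  have m2 : (d - 2) * k ^ 2 ≤ (d - 1) * k ^ 2 := Nat.mul_le_mul_right _ (by omega)
  have m3 : (d - 2) * k ^ 2 + k ^ 2 = (d - 1) * k ^ 2 := by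
    rw [← Nat.succ_mul]; congr 1; omega
  have m4 : (d + 3) * k ^ 2 = d * k ^ 2 + 3 * k ^ 2 := by ring
  generalize hNN : 2 ^ (d + 3) * k ^ 2 = N at *
  have hk' : Num E h (v .k) k := ⟨trivial, c.hk⟩
  have hc := ((Num.lit (E := E) (h := h) (u := 2) (by omega)).mul hk' (by omega)).add
    (Num.lit (u := 1) (by omega)) (by omega)
  have hK : Num E h (v .k * v .k) (k ^ 2) := by
    rw [pow_two] at *; exact hk'.mul hk' (by omega)
  have c1 := hc.add ((Num.lit (E := E) (h := h) (u := d - 1) (by omega)).mul hK (by omega))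
    (by omega)
  have c2 := hc.add ((Num.lit (E := E) (h := h) (u := d - 2) (by omega)).mul hK (by omega))
    (by omega)
  refine Is.or (by omega) (Is.and (Is.le (by omega) hc (.var q)) fun h1 =>
    Is.and (Is.lt (.var q) (hc.add hK (by omega))) fun _ =>
      Is.eq (.var p) (((Num.var q).sub hc h1).div hk')) fun _ => ?_
  refine Is.or (by omega) (Is.and (Is.le (by omega) hc (.var p)) fun h1 =>
    Is.and (Is.eq (.var q) ((Num.var p).add hK (by omega))) fun _ =>
      Is.lt (.var q) c1) fun _ => ?_
  refine Is.and (Is.le (by omega) c2 (.var p)) fun h1 => Is.and (Is.lt (.var p) c1) fun h2 => ?_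
  have hs := (Num.var (E := E) p).sub c2 h1
  have hmod := Nat.mod_lt (h.var p - (2 * k + 1 + (d - 2) * k ^ 2)) (show k > 0 by omega)
  refine Is.and (Is.eq (.var q) (hk'.add (hs.mod hk') (by omega))) fun _ => ?_
  refine c.entry_is (hs.div hk') (hs.mod hk') ?_ hmod
  rw [Nat.div_lt_iff_lt_mul (by omega), ← pow_two]
  omega

end WordRAM

namespace DynGraph

open WordRAM

/-! ### The gadgets of the problems -/

lemma slotFree_direct {ext : ℕ → ℕ → ℕ → Prop} {τ k : ℕ} (hτ : τ ≤ 1) (m : ℕ → ℕ → Bool)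
    (h : ∀ p < 2 * k, ¬ ext k (hub k τ p) p ∧ ¬ ext k p (hub k τ p)) :
    SlotFree k τ (directRel ext k m) := by
  intro p hp
  have hb := hub_bounds (k := k) hτ p
  refine ⟨?_, ?_⟩
  · rintro (h' | h')
    · omega
    · exact (h p hp).1 h'
  · rintro (h' | h')
    · omega
    · exact (h p hp).2 h'

lemma hit_mask {k : ℕ} {m : ℕ → ℕ → Bool} {b : ℕ → Bool} {x y : Bool}
    (hxy : x = false ∨ y = false) :
    ¬ Hit k m (mask k x y b) := by
  rintro ⟨i, hi, j, hj, h1, -, h2⟩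
  rcases hxy with rfl | rfl
  · simp [mask, hi] at h1
  · simp [mask] at h2

lemma detection_answer {c N : ℕ} (P : SimpleGraph (Fin c)) (G : SimpleGraph (Fin N))
    [Decidable (P.IsContained G)] :
    (detection P).answer G () = if P.IsContained G then 1 else 0 := by
  simp only [detection, SimpleGraph.copyCount_pos]

lemma detectionAt_answer {c N : ℕ} (P : SimpleGraph (Fin c)) (G : SimpleGraph (Fin N))
    (s : Fin N) [Decidable (∃ f : SimpleGraph.Copy P G, ∃ x, f x = s)] :
    (detectionAt P).answer G s =
      if ∃ f : SimpleGraph.Copy P G, ∃ x, f x = s then 1 else 0 := by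
  suffices key : 0 < copyCountAt G P s ↔ ∃ f : SimpleGraph.Copy P G, ∃ x, f x = s by
    simp only [detectionAt, key]
  rw [copyCountAt_eq_ncard, Set.ncard_pos (Set.toFinite _)]
  constructor
  · rintro ⟨x, ⟨f, hf, ⟨a, ha⟩, rfl⟩, hx⟩
    exact ⟨⟨⟨f, fun {u v} h => hx _ _ ⟨u, v, h, rfl, rfl⟩⟩, hf⟩, a, ha⟩
  · rintro ⟨f, x, hx⟩
    refine ⟨_, ⟨f, f.injective, ⟨x, hx⟩, rfl⟩, ?_⟩
    rintro u v ⟨a, b, hab, rfl, rfl⟩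
    exact f.toHom.map_adj hab

/-- The shape of a gadget with one hub. -/
structure Shape (e D : ℕ) (rel : ℕ → (ℕ → ℕ → Bool) → ℕ → ℕ → Prop) : Prop where
  e_ge : 2 ≤ e
  free : ∀ k m, SlotFree k 0 (rel k m)
  D_ge : 4 ≤ D
  cover : ∀ k, 1 ≤ k → ∃ f₁ f₂ g : ℕ → ℕ, ∀ m u v, rel k m u v →
    (u < D * k ∧ v < D * k) ∨ v = f₁ u ∨ v = f₂ u ∨ u = g v

section
variable {c e D : ℕ} {rel : ℕ → (ℕ → ℕ → Bool) → ℕ → ℕ → Prop} {P : SimpleGraph (Fin c)}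

/-- Detection decides the product. Of the four answers, only the one for both vectors can be one. -/
def Detects.gadget (h : Detects P e rel) (s : Shape e D rel) : Gadget (detection P) where
  e := e
  τ := 0
  cm := 0
  D := D
  rel := rel
  param _ _ _ _ := ()
  param_code _ _ _ _ := by simp [detection]
  e_ge := s.e_ge
  τ_le := by norm_num
  free := s.free
  D_ge := s.D_ge
  cover := s.cover
  spec k N m b hk hN := by
    classical
    have key : ∀ b, P.IsContained (slotGraph N k 0 (rel k m) b) ↔ Hit k m b := fun b =>
      ⟨(h k N m b hk hN).1, fun hh => let ⟨f, _⟩ := (h k N m b hk hN).2 hh; ⟨f⟩⟩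
    simp only [detection_answer, key]
    rw [if_neg (hit_mask (.inl rfl)), if_neg (hit_mask (.inr rfl)), if_neg (hit_mask (.inl rfl))]
    simp

/-- Detection at the hub. -/
def Detects.gadgetAt (h : Detects P e rel) (s : Shape e D rel) : Gadget (detectionAt P) where
  e := e
  τ := 0
  cm := 2
  D := D
  rel := rel
  param k N hk hN := ⟨2 * k, by
    have h1 : 2 ^ 2 ≤ 2 ^ e := Nat.pow_le_pow_right (by norm_num) s.e_ge
    subst hN
    nlinarith [Nat.mul_le_mul_right (k ^ 2) h1]⟩
  param_code _ _ _ _ := rfl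
  e_ge := s.e_ge
  τ_le := by norm_num
  free := s.free
  D_ge := s.D_ge
  cover := s.cover
  spec k N m b hk hN := by
    classical
    have key : ∀ b (hs : 2 * k < N), (∃ f : SimpleGraph.Copy P (slotGraph N k 0 (rel k m) b),
        ∃ x, f x = (⟨2 * k, hs⟩ : Fin N)) ↔ Hit k m b := fun b hs =>
      ⟨fun ⟨f, _⟩ => (h k N m b hk hN).1 ⟨f⟩, fun hh => by
        obtain ⟨f, x, hx⟩ := (h k N m b hk hN).2 hh
        exact ⟨f, x, Fin.ext hx⟩⟩
    simp only [detectionAt_answer, key]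
    rw [if_neg (hit_mask (.inl rfl)), if_neg (hit_mask (.inr rfl)), if_neg (hit_mask (.inl rfl))]
    simp

end

/-- Counting paths of length three. -/
def pathGadget : Gadget (counting path3) where
  e := 2
  τ := 1
  cm := 0
  D := 4
  rel := directRel noExt
  param _ _ _ _ := ()
  param_code _ _ _ _ := by simp [counting]
  e_ge := le_rfl
  τ_le := le_rfl
  free k m := slotFree_direct le_rfl m fun _ _ => ⟨fun h => h, fun h => h⟩
  D_ge := le_rfl
  cover k hk := ⟨id, id, id, fun m u v h => by
    rcases h with h | h
    · omega
    · exact h.elim⟩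
  spec k N m b hk hN := by
    simp only [counting, copyCount_eq_ncard]
    exact path3_unbalanced hk hN m b _ fun _ _ => trivial

/-- Counting paths of length three that contain the hub of the left vector. -/
def pathGadgetAt : Gadget (countingAt path3) where
  e := 2
  τ := 1
  cm := 2
  D := 4
  rel := directRel noExt
  param k N hk hN := ⟨2 * k, by subst hN; nlinarith⟩
  param_code _ _ _ _ := rfl
  e_ge := le_rfl
  τ_le := le_rfl
  free k m := slotFree_direct le_rfl m fun _ _ => ⟨fun h => h, fun h => h⟩
  D_ge := le_rfl
  cover k hk := ⟨id, id, id, fun m u v h => by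
    rcases h with h | h
    · omega
    · exact h.elim⟩
  spec k N m b hk hN := by
    simp only [countingAt, copyCountAt_eq_ncard]
    refine path3_unbalanced hk hN m b _ ?_
    rintro S ⟨s, hs, h⟩
    rwa [show s = ⟨2 * k, by subst hN; nlinarith⟩ from Fin.ext h] at hs

lemma shape_direct {ext : ℕ → ℕ → ℕ → Prop}
    (h : ∀ k, ∀ p < 2 * k, ¬ ext k (2 * k) p ∧ ¬ ext k p (2 * k))
    (hb : ∀ k u v, 1 ≤ k → ext k u v → u < 4 * k ∧ v < 4 * k) : Shape 2 4 (directRel ext) where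
  e_ge := le_rfl
  free k m := slotFree_direct (by norm_num) m fun p hp => by simpa [hub_zero] using h k p hp
  D_ge := le_rfl
  cover k hk := ⟨id, id, id, fun m u v h' => by
    rcases h' with h' | h'
    · left; omega
    · exact .inl (hb k u v hk h')⟩

lemma shape_path {d : ℕ} (hd : 2 ≤ d) : Shape (d + 3) 4 (pathRel d) where
  e_ge := by omega
  free k m p hp := by
    rw [hub_zero]
    refine ⟨?_, ?_⟩
    · rintro (h | h | h) <;> omega
    · rintro (h | h | h) <;> omega
  D_ge := le_rfl
  cover k hk := ⟨fun u => u + k ^ 2, fun u => k + (u - (2 * k + 1 + (d - 2) * k ^ 2)) % k,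
    fun v => (v - (2 * k + 1)) / k, fun m u v h => by
      rcases h with h | h | h
      · exact .inr (.inr (.inr h.2.2))
      · exact .inr (.inl h.2.1)
      · exact .inr (.inr (.inl h.2.2.1))⟩

lemma shape_no : Shape 2 4 (directRel noExt) :=
  shape_direct (fun _ _ _ => ⟨fun h => h, fun h => h⟩) fun _ _ _ _ h => h.elim
lemma shape_paw : Shape 2 4 (directRel pawExt) :=
  shape_direct (fun _ _ _ => ⟨fun h => by unfold pawExt at h; omega,
    fun h => by unfold pawExt at h; omega⟩) fun _ _ _ _ h => by unfold pawExt at h; omega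
lemma shape_diamond : Shape 2 4 (directRel diamondExt) :=
  shape_direct (fun _ _ _ => ⟨fun h => by unfold diamondExt at h; omega,
    fun h => by unfold diamondExt at h; omega⟩) fun _ _ _ _ h => by unfold diamondExt at h; omega
lemma shape_clique : Shape 2 4 (directRel cliqueExt) :=
  shape_direct (fun _ _ _ => ⟨fun h => by unfold cliqueExt at h; omega,
    fun h => by unfold cliqueExt at h; omega⟩) fun _ _ _ _ h => by unfold cliqueExt at h; omega

end DynGraph

namespace WordRAM

open WordRAM.Expr DynGraph

/-! ### Rules with evaluated expressions -/

section
variable {E : Env} {h : HS} {z a e : Expr} {u i x' : ℕ} {x : Var} {p q : Prog} {c : Prop}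
  {Q : HS → ℕ → Prop}

lemma Num.ld (hz : Num E h z i) (ha : Num E h a u) (hu : u < E.W) (hw : i * E.W + u < 2 ^ E.w) :
    Num E h (ld z a) (h.mem i u) := by
  unfold Num at *; simp [hz, ha, hu, hw]

lemma WP.asgN (he : Num E h e u) (hQ : Q (h.set x u) (e.cost + 1)) : WP E (WordRAM.asg x e) h Q :=
  WP.asg he.1 (by rw [he.2]; exact hQ)

lemma WP.stoN (hz : Num E h z i) (ha : Num E h a u) (he : Num E h e x') (hu : u < E.W)
    (hw : i * E.W + u < 2 ^ E.w) (hQ : Q (h.put i u x') (z.cost + a.cost + e.cost + 3)) :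
    WP E (WordRAM.sto z a e) h Q :=
  WP.sto hz.1 ha.1 he.1 (by rwa [ha.2]) (by rwa [hz.2, ha.2]) (by rwa [hz.2, ha.2, he.2])

lemma WP.ifI (he : Is E h e c) (hp : c → WP E p h fun h' t => Q h' (t + e.cost + 1))
    (hq : ¬ c → WP E q h fun h' t => Q h' (t + e.cost + 1)) : WP E (WordRAM.iff e p q) h Q :=
  WP.iff he.1 (fun h0 => hp (he.2.1 h0)) fun h0 => hq fun hc => he.2.2 hc h0

end

/-! ### One question to one machine -/

lemma Exec.out_lt {w : ℕ} {ω : ℕ → Fin (2 ^ w)} {inp : ℕ → ℕ} {p : Prog} {σ σ' : State} {t : ℕ}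
    (h : Exec w ω inp p σ σ' t) (hσ : σ.Bdd w) (ho : ∀ a, σ.out a < 2 ^ w) :
    ∀ a, σ'.out a < 2 ^ w := by
  induction h with
  | write σ x y =>
    intro a
    by_cases ha : a = σ.reg x
    · simpa [ha] using hσ.1 y
    · simpa [ha] using ho a
  | seq e _ ih ih' => exact ih' (e.bdd hσ) (ih hσ ho)
  | ite_pos _ _ ih => exact ih hσ ho
  | ite_neg _ _ ih => exact ih hσ ho
  | loop_step _ e _ ih ih' => exact ih' (e.bdd hσ) (ih hσ ho)
  | _ => exact ho

lemma Steps.out_lt {w : ℕ} {ω : ℕ → Fin (2 ^ w)} {l : List Request} {s s' : State} {t : ℕ}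
    (h : Steps w ω l s s' t) (hσ : s.Bdd w) (ho : ∀ a, s.out a < 2 ^ w) :
    ∀ a, s'.out a < 2 ^ w := by
  induction l generalizing s t with
  | nil => rw [h.1]; exact ho
  | cons q l ih =>
    obtain ⟨s₁, t₁, t₂, e, h1, rfl⟩ := h
    exact ih h1 (e.bdd hσ) (e.out_lt hσ ho)

lemma State.zero_bdd (w : ℕ) : State.zero.Bdd w ∧ ∀ a, State.zero.out a < 2 ^ w := by
  have : 0 < 2 ^ w := by positivity
  exact ⟨⟨fun _ => this, fun _ => this⟩, fun _ => this⟩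

/-- The states of a service are bounded, and at most one random word is drawn in each step. -/
lemma Service.good {M : Machine} {w k : ℕ} {hub : ℕ → ℕ} {inp : ℕ → ℕ} {f : (ℕ → Bool) → ℕ}
    {P V : ℕ} (s : Service M w k hub inp f P V) (ω : ℕ → Fin (2 ^ w)) (bs : List (ℕ → Bool)) :
    (s.S ω bs).Bdd w ∧ (∀ a, (s.S ω bs).out a < 2 ^ w) ∧ (s.S ω bs).pos ≤ s.tm ω bs := by
  induction bs using List.reverseRecOn with
  | nil =>
    have e := s.prep ω
    have z := State.zero_bdd w
    refine ⟨e.bdd z.1, e.out_lt z.1 z.2, ?_⟩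
    have := e.pos_le
    simpa [State.zero] using this
  | append_singleton bs b ih =>
    obtain ⟨t₁, t₂, h1, h2, h3, h4⟩ := s.round ω bs b
    rcases hd : M.dir with _ | _
    · obtain ⟨h5, -⟩ := h3 hd
      rw [h5]
      exact ⟨ih.1, ih.2.1, by omega⟩
    · have h2 := h2 hd
      have := h1.pos_le
      have := h2.pos_le
      exact ⟨h2.bdd (h1.bdd ih.1), h2.out_lt (h1.bdd ih.1) (h1.out_lt ih.1 ih.2.1), by omega⟩

/-- The data of the reduction for one input: `n` is the size of the matrix `mat`, which is divided
into blocks of size `k`, with `B` blocks in each row; block number `blk` belongs to the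
vector-matrix-vector products given by `f blk`, which `r` copies of the machine `mach` on words of
length `w'` compute. The machine works on a graph with `N` vertices, its registers are below `R`,
and each copy has `T` random words; `P` and `V` bound the time of its preprocessing and of a
question. -/
structure Setup where
  (n k B H N w' r T R τ P V : ℕ)
  mach : Machine
  mat : ℕ → ℕ → Bool
  inp : ℕ → ℕ → ℕ
  f : ℕ → (ℕ → Bool) → ℕ
  sv : ∀ blk, Service mach w' k (hub k τ) (inp blk) (f blk) P V

/-- The words and the memory areas are large enough. -/
structure Setup.Fits (X : Setup) (E : Env) : Prop where
  hk : 1 ≤ X.k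
  hB : X.B * X.k = X.H
  hn : X.n ≤ X.H
  hr : 1 ≤ X.r
  hτ : X.τ ≤ 1
  upd : X.mach.upd.Below X.R
  qry : X.mach.qry.Below X.R
  und : X.mach.und.Below X.R
  prep : X.mach.prep.Below X.R
  hw : X.w' < E.w
  sim : X.R + 2 + 2 ^ X.w' ≤ E.W
  H2 : X.H * X.H ≤ E.W
  H4 : 4 * X.H + 16 ≤ E.W
  N2 : X.N * X.N + 2 ≤ E.W
  r2 : 2 * X.r ≤ E.W
  T2 : X.T * X.r ≤ E.W
  area : (13 + 3 * (X.B * X.B * X.r)) * E.W ≤ 2 ^ E.w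
  ph : 4 * X.r * (X.n * (X.B * X.B)) + 8 ≤ 2 ^ E.w
  time : X.P + X.V * (4 * X.n) ≤ X.T

/-- What all parts of the program rely on. The memory areas are: `0` the random words, `1` the
matrix, `2` the current vector, `3` the marks of rows, `4` the bits of the current question, `5` the
input of an update, `6` the empty input of a query, `7` the initial graph of a block, `8` the
answers of the copies, and three areas for each copy of the machine of each block from `9` on. -/
structure Setup.Static (X : Setup) (E : Env) (h : HS) : Prop where
  n : h.var .n = X.n
  k : h.var .k = X.k
  B : h.var .B = X.B
  H : h.var .H = X.H
  N : h.var .N = X.N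
  msk : h.var .msk = 2 ^ X.w'
  r : h.var .r = X.r
  T : h.var .T = X.T
  coin : ∀ i < X.T * X.r, h.mem 0 i = E.ω i % 2 ^ X.w'
  mat : ∀ a < X.H, ∀ b < X.H, h.mem 1 (a * X.H + b) = (X.mat a b).toNat
  edge : ∀ a, 2 ≤ a → h.mem 5 a = 0
  zero : ∀ a, h.mem 6 a = 0

section
variable {X : Setup} {E : Env} {h h' : HS}

lemma Setup.Static.frame (s : X.Static E h) {l : ℕ} {S : Set ℕ} (f : Frame l S h h') (hl : 1 ≤ l)
    (h0 : 0 ∉ S) (h1 : 1 ∉ S) (h6 : 6 ∉ S) (h5 : ∀ a, 2 ≤ a → h'.mem 5 a = h.mem 5 a) :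
    X.Static E h' := by
  have hv : ∀ x : Var, x.lev = 0 → h'.var x = h.var x := fun x hx => f.var x (by omega)
  refine ⟨?_, ?_, ?_, ?_, ?_, ?_, ?_, ?_, ?_, ?_, fun a ha => (h5 a ha).trans (s.edge a ha), ?_⟩
  · rw [hv _ rfl, s.n]
  · rw [hv _ rfl, s.k]
  · rw [hv _ rfl, s.B]
  · rw [hv _ rfl, s.H]
  · rw [hv _ rfl, s.N]
  · rw [hv _ rfl, s.msk]
  · rw [hv _ rfl, s.r]
  · rw [hv _ rfl, s.T]
  · rw [f.mem 0 h0]; exact s.coin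
  · rw [f.mem 1 h1]; exact s.mat
  · rw [f.mem 6 h6]; exact s.zero

lemma Setup.Fits.addr (F : X.Fits E) {z a : ℕ} (hz : z < 12) (ha : a < E.W) :
    z * E.W + a < 2 ^ E.w := by
  calc z * E.W + a < (z + 1) * E.W := by rw [add_one_mul]; omega
    _ ≤ (13 + 3 * (X.B * X.B * X.r)) * E.W := Nat.mul_le_mul_right _ (by omega)
    _ ≤ _ := F.area

lemma Setup.Fits.lt_pow (F : X.Fits E) {a : ℕ} (ha : a ≤ 12 * E.W) : a < 2 ^ E.w := by
  have h1 : 13 * E.W ≤ 2 ^ E.w := (Nat.mul_le_mul_right _ (by omega)).trans F.area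
  have h2 := F.H4
  omega

/-- The random words of copy `j`. -/
noncomputable def Setup.str (X : Setup) (E : Env) (j : ℕ) : ℕ → Fin (2 ^ X.w') :=
  stream X.w' X.r E.ω j

/-- The machine at area `Z` has been in the state `s` when the clock was last advanced. -/
structure InstRep (R w' : ℕ) (h : HS) (Z : ℕ) (s : State) : Prop where
  rep : ∀ q < R + 2 + 2 ^ w', h.mem Z q = s.enc R q
  bdd : s.Bdd w'
  stamp : ∀ q, h.mem (Z + 2) q ≤ h.var .PH

/-- The first area of copy `j` of the machine of block `blk`. -/
def Setup.Z (X : Setup) (blk j : ℕ) : ℕ := 9 + 3 * (blk * X.r + j)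

lemma Setup.Fits.Z_addr (F : X.Fits E) {blk j : ℕ} (hb : blk < X.B * X.B) (hj : j < X.r) :
    (X.Z blk j + 3) * E.W ≤ 2 ^ E.w := by
  refine (Nat.mul_le_mul_right _ ?_).trans F.area
  have : blk * X.r + j + 1 ≤ X.B * X.B * X.r := by
    calc blk * X.r + j + 1 ≤ blk * X.r + X.r := by omega
      _ = (blk + 1) * X.r := by ring
      _ ≤ _ := Nat.mul_le_mul_right _ hb
  unfold Setup.Z
  omega

/-- The changes that are made while a question is answered. -/
structure QFrame (dir : Bool) (h h' : HS) : Prop extends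
    Frame 5 {5, h.var .Z, h.var .Z + 1, h.var .Z + 2} h h' where
  ph : h'.var .PH = h.var .PH
  zz : h'.var .Z = h.var .Z
  edge : ∀ a, 2 ≤ a → h'.mem 5 a = h.mem 5 a
  direct : dir → h'.mem (h.var .Z + 1) = h.mem (h.var .Z + 1) ∧
    h'.mem (h.var .Z + 2) = h.mem (h.var .Z + 2)
  stamped : dir = false → h'.mem (h.var .Z) = h.mem (h.var .Z) ∧
    ∀ q, h'.mem (h.var .Z + 2) q = h.mem (h.var .Z + 2) q ∨
      h'.mem (h.var .Z + 2) q = h.var .PH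

lemma QFrame.trans {dir : Bool} {h'' : HS} (a : QFrame dir h h') (b : QFrame dir h' h'') :
    QFrame dir h h'' := by
  have bd := b.direct
  have bs := b.stamped
  have bf := b.toFrame
  rw [a.zz] at bd bs bf
  rw [a.ph] at bs
  refine ⟨a.toFrame.trans bf, b.ph.trans a.ph, b.zz.trans a.zz,
    fun q hq => (b.edge q hq).trans (a.edge q hq), fun hd => ⟨(bd hd).1.trans (a.direct hd).1,
    (bd hd).2.trans (a.direct hd).2⟩, fun hd => ⟨(bs hd).1.trans (a.stamped hd).1, fun q => ?_⟩⟩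
  rcases (bs hd).2 q with h1 | h1
  · rw [h1]; exact (a.stamped hd).2 q
  · exact .inr h1

lemma SimFrame.qframe {dir : Bool} (f : SimFrame dir h h') (hZ : 9 ≤ h.var .Z) :
    QFrame dir h h' :=
  ⟨f.toFrame.weaken (by norm_num) (by intro x hx; exact .inr hx), f.var .PH (by decide),
    f.var .Z (by decide), fun a _ => by rw [f.mem 5 (by simp; omega)], f.direct, f.stamped⟩

lemma QFrame.set {dir : Bool} {x : Var} (hx : x = .p ∨ x = .inA) (u : ℕ) :
    QFrame dir h (h.set x u) := by
  refine ⟨.set (by rcases hx with rfl | rfl <;> decide) _, ?_, ?_, fun _ _ => rfl,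
    fun _ => ⟨rfl, rfl⟩, fun _ => ⟨rfl, fun _ => .inl rfl⟩⟩ <;>
  rcases hx with rfl | rfl <;> simp

lemma SimRep.set5 {dir : Bool} {R w' : ℕ} {s : State} (hr : SimRep dir R w' h s) {x : Var}
    (hx : x = .p ∨ x = .inA) (u : ℕ) : SimRep dir R w' (h.set x u) s := by
  have h1 : Var.Z ≠ x := by rcases hx with rfl | rfl <;> simp
  have h2 : Var.PH ≠ x := by rcases hx with rfl | rfl <;> simp
  refine ⟨?_, hr.bdd, ?_⟩
  · have : view (h.set x u) = view h := by funext q; simp [view, h1, h2]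
    rw [this]; exact hr.rep
  · simpa [h1, h2] using hr.stamp

/-- The expression for the vertex to which slot `x` is attached. -/
def hubE (x : Var) (τ : ℕ) : Expr :=
  .ite (lt' (v x) (v .k)) (lit 2 * v .k) (lit 2 * v .k + lit τ)

lemma num_hub (F : X.Fits E) (s : X.Static E h) (hk : X.k ≤ X.H) {x : Var} {p : ℕ}
    (hp : Num E h (v x) p) : Num E h (hubE x X.τ) (hub X.k X.τ p) := by
  have hτ := F.hτ
  have hH4 := F.H4
  have hsm : ∀ {u : ℕ}, u ≤ E.W → u < 2 ^ E.w := fun hu => F.lt_pow (by omega)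
  have hk : Num E h (v .k) X.k := ⟨trivial, s.k⟩
  have h2k := (Num.lit (E := E) (h := h) (u := 2) (hsm (by omega))).mul hk (hsm (by omega))
  have h2kt := h2k.add (Num.lit (u := X.τ) (hsm (by omega))) (hsm (by omega))
  have hl := Is.lt hp hk
  unfold Num Is hubE hub at *
  simp only [ok_ite, val_ite, hl.2]
  split_ifs with hc
  · exact ⟨⟨hl.1, fun _ => h2k.1, fun h0 => absurd h0 (hl.2.2 hc)⟩, h2k.2⟩
  · exact ⟨⟨hl.1, fun h0 => absurd h0 hc, fun _ => h2kt.1⟩, h2kt.2⟩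

/-- The requests for the bits of a question, which are in area `4`. -/
def bitLoop (dir pol : Bool) (R τ : ℕ) (P : Prog) : Prog :=
  for' .p (lit 2 * v .k) (iff (eq' (ld (lit 4) (v .p)) (lit pol.toNat))
    (sto (lit 5) (lit 0) (hubE .p τ) ;; sto (lit 5) (lit 1) (v .p) ;; asg .inA (lit 5) ;;
      sim dir R P)
    .skip)

lemma Steps.bitReqs_prefix {w : ℕ} {ω : ℕ → Fin (2 ^ w)} {P : Prog} {pol : Bool} {hub : ℕ → ℕ}
    {b : ℕ → Bool} {s s' : State} {n t : ℕ} (h : Steps w ω (bitReqs P pol hub b n) s s' t) :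
    ∀ p ≤ n, ∃ s₁ t₁, Steps w ω (bitReqs P pol hub b p) s s₁ t₁ ∧ t₁ ≤ t := by
  induction n generalizing s' t with
  | zero => intro p hp; obtain rfl : p = 0 := by omega
            exact ⟨_, _, h, le_rfl⟩
  | succ n ih =>
    intro p hp
    rcases Nat.lt_or_ge p (n + 1) with h1 | h1
    · rw [bitReqs_succ, append_iff] at h
      obtain ⟨s₁, t₁, t₂, h2, -, rfl⟩ := h
      obtain ⟨s₂, t₃, h3, h4⟩ := ih h2 p (by omega)
      exact ⟨s₂, t₃, h3, by omega⟩
    · obtain rfl : p = n + 1 := by omega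
      exact ⟨_, _, h, le_rfl⟩

/-- The surroundings of a question to copy `j` of the machine of block `blk`. -/
structure Setup.Asking (X : Setup) (E : Env) (blk j : ℕ) (b : ℕ → Bool) (h : HS) : Prop where
  static : X.Static E h
  hb : blk < X.B * X.B
  hj : j < X.r
  jv : h.var .j = j
  Z : h.var .Z = X.Z blk j
  bits : ∀ p < 2 * X.k, h.mem 4 p = (b p).toNat

lemma Setup.Asking.qframe {blk j : ℕ} {b : ℕ → Bool} {dir : Bool} (a : X.Asking E blk j b h)
    (f : QFrame dir h h') : X.Asking E blk j b h' := by
  have hZ : 9 ≤ h.var .Z := by rw [a.Z, Setup.Z]; omega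
  have m4 : h'.mem 4 = h.mem 4 := f.mem 4 (by simp; omega)
  refine ⟨a.static.frame f.toFrame (by norm_num) (by simp; omega) (by simp; omega)
    (by simp; omega) f.edge, a.hb, a.hj, (f.var .j (by decide)).trans a.jv, f.zz.trans a.Z, ?_⟩
  rw [m4]; exact a.bits

lemma Setup.Asking.simCtx {blk j : ℕ} {b : ℕ → Bool} (a : X.Asking E blk j b h) (F : X.Fits E)
    {inp' : ℕ → ℕ} (hA : h.var .inA < 9)
    (hi : ∀ q, h.mem (h.var .inA) q % 2 ^ X.w' = inp' q % 2 ^ X.w') :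
    SimCtx E X.R X.w' X.T (X.str E j) inp' h := by
  have s := a.static
  refine ⟨s.msk, F.hw, F.sim, by rw [s.r]; exact F.T2, by rw [s.r, a.jv]; exact a.hj, ?_,
    fun q _ => hi q, hA, by rw [a.Z, Setup.Z]; omega, by rw [a.Z]; exact F.Z_addr a.hb a.hj⟩
  intro i hi
  rw [s.r, a.jv, s.coin]
  · rfl
  · calc i * X.r + j < i * X.r + X.r := by have := a.hj; omega
      _ = (i + 1) * X.r := by ring
      _ ≤ _ := Nat.mul_le_mul_right _ hi

/-- The loop simulates the requests for all bits, so that its time is that of the machine, apart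
from `O(k)` steps for the loop itself. -/
lemma wp_bitLoop {blk j : ℕ} {b : ℕ → Bool} {dir pol : Bool} {P : Prog} (F : X.Fits E)
    (a : X.Asking E blk j b h) (hP : P.Below X.R) {s s' : State} {t₀ : ℕ}
    (hs : Steps X.w' (X.str E j) (bitReqs P pol (hub X.k X.τ) b (2 * X.k)) s s' t₀)
    (hT : s.pos + t₀ ≤ X.T) (hr : SimRep dir X.R X.w' h s) :
    WP E (bitLoop dir pol X.R X.τ P) h fun h' t => t ≤ 200 * t₀ + 100 * X.k + 10 ∧
      QFrame dir h h' ∧ SimRep dir X.R X.w' h' s' := by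
  have hH : X.k ≤ X.H := by
    rcases Nat.eq_zero_or_pos X.B with h0 | h0
    · have := a.hb; simp [h0] at this
    · have := F.hB; have := Nat.le_mul_of_pos_left X.k h0; omega
  have hH4 := F.H4
  have hsm : ∀ {u : ℕ}, u ≤ E.W → u < 2 ^ E.w := fun hu => F.lt_pow (by omega)
  refine WP.for' (N := 2 * X.k) (fun p h₁ t => h₁.var .p = p ∧ p ≤ 2 * X.k ∧ QFrame dir h h₁ ∧
    ∃ s₁ t₁, Steps X.w' (X.str E j) (bitReqs P pol (hub X.k X.τ) b p) s s₁ t₁ ∧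
      SimRep dir X.R X.w' h₁ s₁ ∧ t ≤ 200 * t₁ + 50 * p + 10) ?_ ?_ ?_ ?_
  · refine ⟨by simp, by omega, .set (.inl rfl) _, s, 0, ⟨rfl, rfl⟩, hr.set5 (.inl rfl) _, ?_⟩
    simp
  · rintro p h₁ t ⟨hp, hp', f, -⟩
    have hk : Num E h₁ (v .k) X.k := ⟨trivial, (a.qframe f).static.k⟩
    have h2k := (Num.lit (E := E) (h := h₁) (u := 2) (hsm (by omega))).mul hk (hsm (by omega))
    exact ⟨hp, hp', h2k.1, h2k.2⟩
  · rintro p hp h₁ t ⟨hpv, -, f, s₁, t₁, hs₁, hr₁, ht⟩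
    have a₁ := a.qframe f
    have hpn : Num E h₁ (v .p) p := ⟨trivial, hpv⟩
    have hZ : 9 ≤ h.var .Z := by rw [a.Z, Setup.Z]; omega
    have bit : Num E h₁ (ld (lit 4) (v .p)) (b p).toNat := by
      rw [← a₁.bits p hp]
      exact (Num.lit (hsm (by omega))).ld hpn (by omega) (F.addr (by norm_num) (by omega))
    obtain ⟨s₂, t₂, hs₂, l₂⟩ := hs.bitReqs_prefix (p + 1) (by omega)
    have hsuc := hs₂
    rw [bitReqs_succ, Steps.append_iff] at hs₂
    obtain ⟨s₃, t₃, t₄, h3, h4, rfl⟩ := hs₂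
    obtain ⟨rfl, rfl⟩ := h3.det hs₁
    have hpos := h3.pos_le
    have hpol : pol.toNat ≤ 1 := by cases pol <;> simp
    refine WP.ifI (Is.eq bit (Num.lit (hsm (by omega)))) (fun hb => ?_) fun hb => ?_
    · have hbp : b p = pol := by revert hb; cases b p <;> cases pol <;> simp
      rw [if_pos hbp, Steps.single_iff] at h4
      have hub_num := num_hub F a₁.static hH (p := p) hpn
      have n5 : ∀ {h : HS}, Num E h (lit 5) 5 := Num.lit (hsm (by omega))
      refine WP.seq (WP.stoN n5 (Num.lit (u := 0) (hsm (by omega))) hub_num (by omega)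
        (F.addr (by norm_num) (by omega)) ?_)
      refine WP.seq (WP.stoN (i := 5) (u := 1) (x' := p) n5 (Num.lit (hsm (by omega)))
        ⟨trivial, by simpa using hpv⟩ (by omega) (F.addr (by norm_num) (by omega)) ?_)
      refine WP.seq (WP.asgN n5 ?_)
      set h₂ := (((h₁.put 5 0 (hub X.k X.τ p)).put 5 1 p).set .inA 5) with eh₂
      have f₂ : QFrame dir h₁ h₂ := by
        rw [← f.zz] at hZ
        refine QFrame.trans ?_ (.set (.inr rfl) _)
        refine ⟨(Frame.put (by simp)).trans (Frame.put (by simp)), rfl, rfl, fun q hq => ?_,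
          fun _ => ⟨?_, ?_⟩, fun _ => ⟨?_, fun q => .inl ?_⟩⟩
        · rw [HS.put_mem, HS.put_mem, if_neg (by omega), if_neg (by omega)]
        all_goals rw [HS.put_mem_ne _ (by omega), HS.put_mem_ne _ (by omega)]
      have r₂ : SimRep dir X.R X.w' h₂ s₃ := by
        refine SimRep.set5 ?_ (.inr rfl) _
        rw [← f.zz] at hZ
        refine ⟨fun q hq => ?_, hr₁.bdd, fun hd q => ?_⟩
        · rw [← hr₁.rep q hq]
          simp only [view, HS.put_var]
          simp only [HS.put_mem_ne _ (show h₁.var .Z ≠ 5 by omega),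
            HS.put_mem_ne _ (show h₁.var .Z + 1 ≠ 5 by omega),
            HS.put_mem_ne _ (show h₁.var .Z + 2 ≠ 5 by omega)]
        · simp only [HS.put_var, HS.put_mem_ne _ (show h₁.var .Z + 2 ≠ 5 by omega)]
          exact hr₁.stamp hd q
      have c₂ : SimCtx E X.R X.w' X.T (X.str E j) (pairInp (hub X.k X.τ p) p) h₂ := by
        refine (a₁.qframe f₂).simCtx F (by simp [eh₂]) fun q => ?_
        have : h₂.var .inA = 5 := by simp [eh₂]
        rw [this]
        congr 1
        simp only [eh₂, HS.set_mem, HS.put_mem, true_and, pairInp]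
        by_cases q1 : q = 1
        · simp [q1]
        · by_cases q0 : q = 0
          · simp [q0]
          · simp [q1, q0, a₁.static.edge q (by omega)]
      refine (wp_sim hP h4 (by omega) c₂ r₂).mono ?_
      rintro h₃ t' ⟨l', f', r'⟩
      have hZ₂ : 9 ≤ h₂.var .Z := by rw [f₂.zz, f.zz]; exact hZ
      have f3 := (f.trans f₂).trans (f'.qframe hZ₂)
      refine ⟨?_, by simp, by omega, f3.trans (.set (.inl rfl) _), s₂, _, hsuc,
        r'.set5 (.inl rfl) _, ?_⟩
      · rw [f'.var .p (by decide)]; simpa [eh₂] using hpv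
      · simp [hubE]; omega
    · have hbp : b p ≠ pol := by rintro rfl; exact hb rfl
      rw [if_neg hbp] at h4
      obtain ⟨rfl, rfl⟩ := h4
      refine WP.skip ⟨hpv, by simp, by omega, f.trans (.set (.inl rfl) _), _, _, hsuc,
        hr₁.set5 (.inl rfl) _, ?_⟩
      simp; omega
  · rintro h₁ t ⟨-, -, f, s₁, t₁, hs₁, hr₁, ht⟩
    obtain ⟨rfl, rfl⟩ := hs.det hs₁
    exact ⟨by omega, f, hr₁⟩

end

/-! ### One question -/

/-- A question to the copy `j` of the machine of the current block; the answer is stored in cell `j`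
of area `8`. -/
def questionProg (M : Machine) (R τ : ℕ) : Prog :=
  asg .PH (v .PH + lit 1) ;; asg .Z (lit 9 + lit 3 * (v .i * v .r + v .j)) ;;
  bitLoop M.dir M.pol R τ M.upd ;; asg .inA (lit 6) ;; sim M.dir R M.qry ;;
  sto (lit 8) (v .j) (rd (lit R)) ;; if M.dir then bitLoop M.dir M.pol R τ M.und else .skip

section
variable {X : Setup} {E : Env} {h h' : HS} {blk j : ℕ} {b : ℕ → Bool}

lemma Setup.Fits.kH (F : X.Fits E) (hb : blk < X.B * X.B) : X.k ≤ X.H := by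
  rcases Nat.eq_zero_or_pos X.B with h0 | h0
  · simp [h0] at hb
  · have := F.hB; have := Nat.le_mul_of_pos_left X.k h0; omega

/-- The state of copy `j` of the machine of block `blk` after the questions `bs`. -/
noncomputable def Setup.S (X : Setup) (E : Env) (blk j : ℕ) (bs : List (ℕ → Bool)) : State :=
  (X.sv blk).S (X.str E j) bs

/-- The time that copy `j` of the machine of block `blk` needs for the questions `bs`. -/
noncomputable def Setup.tm (X : Setup) (E : Env) (blk j : ℕ) (bs : List (ℕ → Bool)) : ℕ :=
  (X.sv blk).tm (X.str E j) bs

/-- The answer of copy `j` of the machine of block `blk` to the question `b` after the questions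
`bs`. -/
noncomputable def Setup.answer (X : Setup) (E : Env) (blk j : ℕ) (bs : List (ℕ → Bool))
    (b : ℕ → Bool) : ℕ :=
  ((X.sv blk).ask (X.str E j) bs b).out 0

lemma Setup.answer_lt (bs : List (ℕ → Bool)) : X.answer E blk j bs b < 2 ^ X.w' := by
  obtain ⟨h1, h2, -⟩ := (X.sv blk).good (X.str E j) bs
  obtain ⟨t₁, t₂, h3, -⟩ := (X.sv blk).round (X.str E j) bs b
  exact h3.out_lt h1 h2 0

lemma InstRep.keep {R w' Z : ℕ} {s : State} (i : InstRep R w' h Z s) (h0 : h'.mem Z = h.mem Z)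
    (h2 : h'.mem (Z + 2) = h.mem (Z + 2)) (hp : h.var .PH ≤ h'.var .PH) :
    InstRep R w' h' Z s :=
  ⟨by rw [h0]; exact i.rep, i.bdd, fun q => by rw [h2]; exact (i.stamp q).trans hp⟩

/-- A question takes the machine to its next state. Advancing the clock at the beginning makes the
temporary changes of the previous question invisible. The time is stated as a difference of total
times of the machine, since its bounds may be amortized. -/
lemma wp_question (F : X.Fits E) (s : X.Static E h) (hb : blk < X.B * X.B) (hj : j < X.r)
    (iv : h.var .i = blk) (jv : h.var .j = j) (bits : ∀ p < 2 * X.k, h.mem 4 p = (b p).toNat)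
    {bs : List (ℕ → Bool)} (inst : InstRep X.R X.w' h (X.Z blk j) (X.S E blk j bs))
    (hPH : h.var .PH + 1 < 2 ^ E.w) (hT : X.tm E blk j (bs ++ [b]) ≤ X.T) :
    WP E (questionProg X.mach X.R X.τ) h fun h' t =>
      t + 200 * X.tm E blk j bs ≤ 200 * X.tm E blk j (bs ++ [b]) + 200 * X.k + 200 ∧
      Frame 5 {5, 8, X.Z blk j, X.Z blk j + 1, X.Z blk j + 2} h h' ∧
      h'.var .PH = h.var .PH + 1 ∧ (∀ a, 2 ≤ a → h'.mem 5 a = h.mem 5 a) ∧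
      (∀ a, h'.mem 8 a = if a = j then X.answer E blk j bs b else h.mem 8 a) ∧
      InstRep X.R X.w' h' (X.Z blk j) (X.S E blk j (bs ++ [b])) := by
  have hkH := F.kH hb
  have hH4 := F.H4
  have hW : ∀ {u : ℕ}, u ≤ E.W → u < 2 ^ E.w := fun hu => F.lt_pow (by omega)
  have hsim := F.sim
  have hZ9 : 9 ≤ X.Z blk j := by unfold Setup.Z; omega
  obtain ⟨t₁, t₂, q1, q2, q3, q4⟩ := (X.sv blk).round (X.str E j) bs b
  obtain ⟨g1, g2, g3⟩ := (X.sv blk).good (X.str E j) bs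
  rw [Steps.append_iff] at q1
  obtain ⟨s₁, u₁, u₂, r1, r2, rfl⟩ := q1
  rw [Steps.single_iff] at r2
  have p1 := r1.pos_le
  have p2 := r2.pos_le
  have hT' : (X.sv blk).tm (X.str E j) bs + (u₁ + u₂) + t₂ ≤ X.T := by rw [← q4]; exact hT
  unfold questionProg
  have hone : ∀ {h : HS}, Num E h (lit 1) 1 := Num.lit (hW (by omega))
  refine WP.seq (WP.asgN ((Num.var .PH).add hone hPH) ?_)
  have hZv : 9 + 3 * (blk * X.r + j) < 2 ^ E.w := by
    have := F.Z_addr hb hj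
    unfold Setup.Z at this
    have h1 : 9 + 3 * (blk * X.r + j) + 3 ≤ (9 + 3 * (blk * X.r + j) + 3) * E.W :=
      Nat.le_mul_of_pos_right _ (by omega)
    omega
  refine WP.seq (WP.asgN (u := X.Z blk j) ?_ ?_)
  · have hi : Num E (h.set .PH (h.var .PH + 1)) (v .i) blk := ⟨trivial, by simpa using iv⟩
    have hr : Num E (h.set .PH (h.var .PH + 1)) (v .r) X.r := ⟨trivial, by simpa using s.r⟩
    have hj' : Num E (h.set .PH (h.var .PH + 1)) (v .j) j := ⟨trivial, by simpa using jv⟩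
    exact (Num.lit (hW (by omega))).add ((Num.lit (hW (by omega))).mul
      ((hi.mul hr (by omega)).add hj' (by omega)) (by omega)) (by omega)
  set h₁ := (h.set .PH (h.var .PH + 1)).set .Z (X.Z blk j) with e₁
  have f₁ : Frame 5 {5, 8, X.Z blk j, X.Z blk j + 1, X.Z blk j + 2} h h₁ :=
    (Frame.set (by decide) _).trans (.set (by decide) _)
  have hph₁ : h₁.var .PH = h.var .PH + 1 := by simp [e₁]
  have hz₁ : h₁.var .Z = X.Z blk j := by simp [e₁]
  have m₁ : h₁.mem = h.mem := rfl
  have a₁ : X.Asking E blk j b h₁ :=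
    ⟨s.frame f₁ (by norm_num) (by simp; omega) (by simp; omega) (by simp; omega) (fun _ _ => rfl),
      hb, hj, by simpa [e₁] using jv, hz₁, bits⟩
  have hst : ∀ q, h₁.mem (h₁.var .Z + 2) q ≠ h₁.var .PH := by
    intro q
    have := inst.stamp q
    rw [hz₁, hph₁, m₁]
    omega
  have r₁ : SimRep X.mach.dir X.R X.w' h₁ (X.S E blk j bs) := by
    refine ⟨fun q hq => ?_, inst.bdd, fun _ => hst⟩
    rw [← inst.rep q hq, view, if_neg (hst q), hz₁, m₁]
  refine WP.seq ((wp_bitLoop F a₁ F.upd r1 (by omega) r₁).mono ?_)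
  rintro h₂ c₂ ⟨l₂, f₂, r₂⟩
  refine WP.seq (WP.asgN (u := 6) (Num.lit (hW (by omega))) ?_)
  have a₂ := a₁.qframe f₂
  set h₃ := h₂.set .inA 6 with e₃
  have f₃ : QFrame X.mach.dir h₂ h₃ := .set (.inr rfl) _
  have a₃ := a₂.qframe f₃
  have r₃ := r₂.set5 (x := .inA) (.inr rfl) 6
  have c₃ : SimCtx E X.R X.w' X.T (X.str E j) (fun _ => 0) h₃ :=
    a₃.simCtx F (by simp [e₃]) fun q => by
      have : h₃.var .inA = 6 := by simp [e₃]
      rw [this, a₃.static.zero q]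
  refine WP.seq ((wp_sim F.qry r2 (by omega) c₃ r₃).mono ?_)
  rintro h₄ c₄ ⟨l₄, g₄, r₄⟩
  have f₄ := g₄.qframe (by rw [a₃.Z]; exact hZ9)
  have iA : h₄.var .inA = 6 := by rw [g₄.var .inA (by decide)]; simp [e₃]
  have f₂₄ := (f₂.trans f₃).trans f₄
  have a₄ := a₃.qframe f₄
  have c₅ : SimCtx E X.R X.w' X.T (X.str E j) (fun _ => 0) h₄ :=
    a₄.simCtx F (by rw [iA]; norm_num) fun q => by rw [iA, a₄.static.zero q]
  have hrW := F.r2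
  refine WP.seq (WP.stoN (i := 8) (u := j) (x' := X.answer E blk j bs b)
    (Num.lit (hW (by omega))) ⟨trivial, a₄.jv⟩ ⟨rd_lit_ok c₅ (by omega), ?_⟩ (by omega)
    (F.addr (by norm_num) (by omega)) ?_)
  · rw [r₄.rd_lit (by omega)]
    simp [State.enc, Setup.answer]
  set h₅ := h₄.put 8 j (X.answer E blk j bs b) with e₅
  have m₅ : ∀ z, z ≠ 8 → h₅.mem z = h₄.mem z := fun z hz => HS.put_mem_ne _ hz
  have hZ₁ : h₁.var .Z = X.Z blk j := hz₁
  have f₁₅ : Frame 5 {5, 8, X.Z blk j, X.Z blk j + 1, X.Z blk j + 2} h₁ h₅ := by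
    refine (f₂₄.toFrame.weaken le_rfl ?_).trans (.put (by simp))
    rw [hZ₁]
    intro z hz
    simp only [Set.mem_insert_iff, Set.mem_singleton_iff] at hz ⊢
    tauto
  have m8 : ∀ a, h₅.mem 8 a = if a = j then X.answer E blk j bs b else h.mem 8 a := by
    intro a
    have : h₄.mem 8 = h.mem 8 := by
      rw [f₂₄.mem 8 (by rw [hZ₁]; simp; omega), m₁]
    rw [e₅, HS.put_mem, this]
    simp
  have a₅ : X.Asking E blk j b h₅ :=
    ⟨a₄.static.frame (l := 5) (S := {8}) (.put (by simp)) (by norm_num) (by simp) (by simp)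
      (by simp) (fun a _ => by rw [m₅ 5 (by norm_num)]), hb, hj, a₄.jv, a₄.Z,
      by rw [m₅ 4 (by norm_num)]; exact a₄.bits⟩
  have z₅ : h₅.var .Z = X.Z blk j := a₅.Z
  have ph₅ : h₅.var .PH = h.var .PH + 1 := by
    rw [e₅, HS.put_var, f₂₄.ph, hph₁]
  have ed₅ : ∀ a, 2 ≤ a → h₅.mem 5 a = h.mem 5 a := fun a ha => by
    rw [m₅ 5 (by norm_num), f₂₄.edge a ha, m₁]
  by_cases hd : X.mach.dir = true
  · rw [if_pos hd]
    have r₅ : SimRep X.mach.dir X.R X.w' h₅ ((X.sv blk).ask (X.str E j) bs b) := by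
      have hz4 := a₄.Z
      refine ⟨fun q hq => ?_, r₄.bdd, fun hd q => ?_⟩
      · rw [← r₄.rep q hq]
        simp only [view, z₅, hz4, m₅ (X.Z blk j) (by omega), m₅ (X.Z blk j + 1) (by omega),
          m₅ (X.Z blk j + 2) (by omega)]
        rfl
      · have := r₄.stamp hd q
        rw [hz4] at this
        rw [z₅, m₅ _ (by omega)]
        exact this
    have p4 := (q2 hd).pos_le
    refine (wp_bitLoop F a₅ F.und (q2 hd) (by omega) r₅).mono ?_
    rintro h₆ c₆ ⟨l₆, f₆, r₆⟩
    refine ⟨?_, (f₁.trans f₁₅).trans (f₆.toFrame.weaken le_rfl ?_), by rw [f₆.ph, ph₅],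
      fun a ha => by rw [f₆.edge a ha, ed₅ a ha],
      fun a => by rw [f₆.mem 8 (by rw [z₅]; simp; omega)]; exact m8 a, ?_, r₆.bdd, ?_⟩
    · unfold Setup.tm
      rw [q4]
      simp only [Expr.cost_add, Expr.cost_mul, Expr.cost_v, Expr.cost_lit, rd_cost]
      omega
    · rw [z₅]
      intro z hz
      simp only [Set.mem_insert_iff, Set.mem_singleton_iff] at hz ⊢
      tauto
    · intro q hq
      have := r₆.rep q hq
      rw [view, if_neg (r₆.stamp hd q), f₆.zz, z₅] at this
      exact this
    · intro q
      have h1 := (f₆.direct hd).2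
      have h2 := (f₂₄.direct hd).2
      rw [z₅] at h1
      rw [hZ₁] at h2
      rw [h1, m₅ _ (by omega), h2, m₁, f₆.ph, ph₅]
      exact (inst.stamp q).trans (by omega)
  · rw [if_neg hd]
    have hd' : X.mach.dir = false := by simpa using hd
    obtain ⟨q5, q6⟩ := q3 hd'
    refine WP.skip ⟨?_, f₁.trans f₁₅, ph₅, ed₅, m8, ?_⟩
    · unfold Setup.tm
      rw [q4]
      simp only [Expr.cost_add, Expr.cost_mul, Expr.cost_v, Expr.cost_lit, rd_cost]
      omega
    · have h1 := f₂₄.stamped hd'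
      rw [hZ₁, m₁, hph₁] at h1
      unfold Setup.S
      rw [q5]
      refine ⟨fun q hq => ?_, inst.bdd, fun q => ?_⟩
      · rw [m₅ _ (by omega), h1.1]
        exact inst.rep q hq
      · rw [m₅ _ (by omega), ph₅]
        rcases h1.2 q with h2 | h2
        · rw [h2]; exact (inst.stamp q).trans (by omega)
        · exact h2.le

end

/-! ### The evaluation of a bilinear question -/

/-- The majority of the first `r` cells of area `8`, if there is one. -/
def majority : Prog :=
  asg .ans0 (lit 0) ;; for' .j (v .r)
    (asg .cnt (lit 0) ;;
      for' .j' (v .r) (iff (eq' (ld (lit 8) (v .j')) (ld (lit 8) (v .j)))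
        (asg .cnt (v .cnt + lit 1)) .skip) ;;
      iff (lt' (v .r) (lit 2 * v .cnt)) (asg .ans0 (ld (lit 8) (v .j))) .skip)

/-- The bits of the current vectors: the rows of block row `x` that are still to be found, and the
part of the current vector that belongs to block column `y`. -/
def fillBits (α β : Bool) : Prog :=
  for' .p (v .k)
    (sto (lit 4) (v .p) (if α then lit 1 - ld (lit 3) (v .x * v .k + v .p) else lit 0) ;;
      sto (lit 4) (v .k + v .p) (if β then ld (lit 2) (v .y * v .k + v .p) else lit 0))

/-- The value of the current block at the masked vectors. -/
def evalMask (M : Machine) (R τ : ℕ) (α β : Bool) : Prog :=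
  fillBits α β ;; for' .j (v .r) (questionProg M R τ) ;; majority

section
variable {X : Setup} {E : Env} {h h' : HS} {blk j : ℕ} {b : ℕ → Bool}

/-- An absolute majority is found. Without one, some of the answers is taken, which is still a short
word, so that later sums do not overflow. -/
lemma wp_majority {r m : ℕ} (hr : h.var .r = r) (h9 : 9 * E.W ≤ 2 ^ E.w)
    (hrW : r < E.W) (h8 : 8 < 2 ^ E.w) (hm : ∀ a < r, h.mem 8 a < m) (hm0 : 0 < m) :
    WP E majority h fun h' t => Frame 4 ∅ h h' ∧ h'.var .PH = h.var .PH ∧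
      t ≤ 50 * (r * r) + 50 * r + 50 ∧ h'.var .ans0 < m ∧
      ∀ u, r < 2 * ((Finset.range r).filter fun a => h.mem 8 a = u).card → h'.var .ans0 = u := by
  have addr : ∀ {a}, a < r → 8 * E.W + a < 2 ^ E.w := fun ha => by omega
  have l8 : ∀ {h : HS}, Num E h (lit 8) 8 := Num.lit h8
  refine WP.seq (WP.asgN (Num.lit (u := 0) (by omega)) ?_)
  refine WP.for' (N := r) (fun j h₁ t => h₁.var .j = j ∧ j ≤ r ∧ Frame 4 ∅ h h₁ ∧
    h₁.var .PH = h.var .PH ∧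
    h₁.var .ans0 < m ∧ (∀ u, r < 2 * ((Finset.range r).filter fun a => h.mem 8 a = u).card →
      (∃ i < j, h.mem 8 i = u) → h₁.var .ans0 = u) ∧ t ≤ j * (50 * r + 50) + 10) ?_ ?_ ?_ ?_
  · refine ⟨by simp, by omega, (Frame.set (by decide) _).trans (.set (by decide) _), by simp,
      by simpa, ?_, ?_⟩
    · rintro u - ⟨i, hi, -⟩; omega
    · simp
  · rintro j h₁ t ⟨h1, h2, f, -⟩
    exact ⟨h1, h2, trivial, by rw [Expr.val_v, f.var .r (by decide), hr]⟩
  · rintro j hj h₁ t ⟨h1, h2, f, hPH, h3, h4, h5⟩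
    refine WP.seq (WP.asgN (Num.lit (u := 0) (by omega)) ?_)
    have f₂ : Frame 4 ∅ h (h₁.set .cnt 0) := f.trans (.set (by decide) _)
    refine WP.seq (WP.mono (WP.for' (N := r) (fun i h₂ t => h₂.var .j' = i ∧ i ≤ r ∧
      Frame 4 ∅ h h₂ ∧ h₂.var .PH = h.var .PH ∧ h₂.var .j = j ∧ h₂.var .ans0 = h₁.var .ans0 ∧
      h₂.var .cnt = ((Finset.range i).filter fun a => h.mem 8 a = h.mem 8 j).card ∧
      t ≤ 35 * i + 10) (Q := fun h₂ t => Frame 4 ∅ h h₂ ∧ h₂.var .PH = h.var .PH ∧ h₂.var .j = j ∧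
      h₂.var .ans0 = h₁.var .ans0 ∧ h₂.var .cnt = ((Finset.range r).filter
        fun a => h.mem 8 a = h.mem 8 j).card ∧ t ≤ 35 * r + 10) ?_ ?_ ?_ ?_) ?_)
    · exact ⟨by simp, by omega, f₂.trans (.set (by decide) _), by simpa using hPH,
        by simpa using h1, by simp, by simp,
        by simp⟩
    · rintro i h₂ t ⟨g1, g2, f, -⟩
      exact ⟨g1, g2, trivial, by rw [Expr.val_v, f.var .r (by decide), hr]⟩
    · rintro i hi h₂ t ⟨g1, g2, f, g0, g3, g4, g5, g6⟩
      have m8 : h₂.mem 8 = h.mem 8 := f.mem 8 (by simp)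
      have n1 : Num E h₂ (ld (lit 8) (v .j')) (h.mem 8 i) := by
        rw [← m8]; exact l8.ld ⟨trivial, g1⟩ (by omega) (addr hi)
      have n2 : Num E h₂ (ld (lit 8) (v .j)) (h.mem 8 j) := by
        rw [← m8]; exact l8.ld ⟨trivial, g3⟩ (by omega) (addr hj)
      have hcard : ((Finset.range i).filter fun a => h.mem 8 a = h.mem 8 j).card ≤ i := by
        simpa using Finset.card_filter_le (Finset.range i) fun a => h.mem 8 a = h.mem 8 j
      refine WP.ifI (Is.eq n1 n2) (fun hc => ?_) fun hc => ?_
      · refine WP.asgN ((Num.var .cnt).add (Num.lit (by omega)) (by rw [g5]; omega)) ?_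
        refine ⟨by simpa using g1, by simp, by omega, (f.trans (.set (by decide) _)).trans
          (.set (by decide) _), by simpa using g0, by simpa using g3, by simpa using g4, ?_, ?_⟩
        · rw [Finset.range_add_one, Finset.filter_insert, if_pos hc, Finset.card_insert_of_notMem
            (by simp)]
          simpa using g5
        · simp; omega
      · refine WP.skip ⟨g1, by simp, by omega, f.trans (.set (by decide) _), by simpa using g0,
          by simpa using g3, by simpa using g4, ?_, ?_⟩
        · rw [Finset.range_add_one, Finset.filter_insert, if_neg hc]
          simpa using g5
        · simp; omega
    · rintro h₂ t ⟨-, -, f, g0, g3, g4, g5, g6⟩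
      exact ⟨f, g0, g3, g4, g5, g6⟩
    · rintro h₂ t₂ ⟨f, g0, g3, g4, g5, g6⟩
      have m8 : h₂.mem 8 = h.mem 8 := f.mem 8 (by simp)
      have hcard : ((Finset.range r).filter fun a => h.mem 8 a = h.mem 8 j).card ≤ r := by
        simpa using Finset.card_filter_le (Finset.range r) fun a => h.mem 8 a = h.mem 8 j
      have hr₂ : Num E h₂ (v .r) r := ⟨trivial, by rw [Expr.val_v, f.var .r (by decide), hr]⟩
      refine WP.ifI (Is.lt hr₂ ((Num.lit (u := 2) (by omega)).mul ⟨trivial, g5⟩ (by omega)))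
        (fun hc => ?_) fun hc => ?_
      · refine WP.asgN (u := h.mem 8 j) (by
          rw [← m8]; exact l8.ld ⟨trivial, g3⟩ (by omega) (addr hj)) ?_
        refine ⟨by simpa using g3, by simp, by omega, (f.trans (.set (by decide) _)).trans
          (.set (by decide) _), by simpa using g0, by simpa using hm j hj, ?_, ?_⟩
        · rintro u hu -
          simp only [HS.set_var, reduceCtorEq, if_false, if_true]
          by_contra hne
          have hdis : Disjoint ((Finset.range r).filter fun a => h.mem 8 a = h.mem 8 j)
              ((Finset.range r).filter fun a => h.mem 8 a = u) := by
            rw [Finset.disjoint_filter]; intro a _ h1 h2; exact hne (h1.symm.trans h2)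
          have := Finset.card_le_card (Finset.union_subset (Finset.filter_subset
            (fun a => h.mem 8 a = h.mem 8 j) (Finset.range r))
            (Finset.filter_subset (fun a => h.mem 8 a = u) (Finset.range r)))
          rw [Finset.card_union_of_disjoint hdis, Finset.card_range] at this
          omega
        · simp [add_one_mul]; omega
      · refine WP.skip ⟨g3, by simp, by omega, f.trans (.set (by decide) _),
          by simpa using g0, by simpa [g4] using h3, ?_, ?_⟩
        · rintro u hu ⟨i, hi, hiu⟩
          rcases Nat.lt_succ_iff_lt_or_eq.1 hi with h1 | rfl
          · simpa [g4] using h4 u hu ⟨i, h1, hiu⟩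
          · subst hiu; exact absurd hu hc
        · simp [add_one_mul]; omega
  · rintro h₁ t ⟨-, -, f, hPH, h3, h4, h5⟩
    refine ⟨f, hPH, ?_, h3, fun u hu => h4 u hu ?_⟩
    · simp only [Expr.cost_lit]; rw [mul_add] at h5; nlinarith
    · have : 0 < ((Finset.range r).filter fun a => h.mem 8 a = u).card := by omega
      obtain ⟨i, hi⟩ := Finset.card_pos.1 this
      simp only [Finset.mem_filter, Finset.mem_range] at hi
      exact ⟨i, hi⟩

/-- The areas that change when questions are answered. -/
def evalAreas : Set ℕ := {z | z = 4 ∨ z = 5 ∨ z = 8 ∨ 9 ≤ z}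

/-- The situation between questions: `hs blk` are the questions about block `blk` so far. -/
structure Setup.Inv (X : Setup) (E : Env) (hs : ℕ → List (ℕ → Bool)) (h : HS) : Prop where
  static : X.Static E h
  inst : ∀ blk < X.B * X.B, ∀ j < X.r,
    InstRep X.R X.w' h (X.Z blk j) (X.S E blk j (hs blk))
  len : ∀ blk < X.B * X.B, (hs blk).length ≤ 4 * X.n
  ph : h.var .PH ≤ 1 + X.r * ∑ blk ∈ Finset.range (X.B * X.B), (hs blk).length

/-- The total time of all copies of the machines. -/
noncomputable def Setup.total (X : Setup) (E : Env) (hs : ℕ → List (ℕ → Bool)) : ℕ :=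
  ∑ blk ∈ Finset.range (X.B * X.B), ∑ j ∈ Finset.range X.r, X.tm E blk j (hs blk)

lemma Setup.Inv.frame {hs : ℕ → List (ℕ → Bool)} (I : X.Inv E hs h) {l : ℕ} {S : Set ℕ}
    (f : Frame l S h h') (hl : 1 ≤ l) (hS : S ⊆ {2, 3, 4, 8}) (hp : h'.var .PH = h.var .PH) :
    X.Inv E hs h' := by
  have hm : ∀ z, z ≠ 2 → z ≠ 3 → z ≠ 4 → z ≠ 8 → h'.mem z = h.mem z := fun z h2 h3 h4 h8 =>
    f.mem z fun hz => by have := hS hz; simp [h2, h3, h4, h8] at this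
  have hn : ∀ z, z ≠ 2 → z ≠ 3 → z ≠ 4 → z ≠ 8 → z ∉ S := fun z h2 h3 h4 h8 hz => by
    have := hS hz; simp [h2, h3, h4, h8] at this
  refine ⟨I.static.frame f hl (hn _ (by norm_num) (by norm_num) (by norm_num) (by norm_num))
    (hn _ (by norm_num) (by norm_num) (by norm_num) (by norm_num))
    (hn _ (by norm_num) (by norm_num) (by norm_num) (by norm_num))
    (fun a _ => by rw [hm 5 (by norm_num) (by norm_num) (by norm_num) (by norm_num)]),
    fun blk hb j hj => (I.inst blk hb j hj).keep ?_ ?_ hp.ge, I.len, by rw [hp]; exact I.ph⟩ <;>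
  exact hm _ (by unfold Setup.Z; omega) (by unfold Setup.Z; omega) (by unfold Setup.Z; omega)
    (by unfold Setup.Z; omega)

lemma Setup.Z_inj {blk blk' j j' : ℕ} (hj : j < X.r) (hj' : j' < X.r) {c c' : ℕ} (hc : c < 3)
    (hc' : c' < 3) (h : X.Z blk j + c = X.Z blk' j' + c') : blk = blk' ∧ j = j' := by
  unfold Setup.Z at h
  have h1 : X.r * blk + j = X.r * blk' + j' := by rw [mul_comm X.r, mul_comm X.r]; omega
  have h2 := congrArg (· / X.r) h1
  have h3 := congrArg (· % X.r) h1
  have pr : 0 < X.r := by omega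
  simp only [Nat.mul_add_div pr, Nat.mul_add_mod, Nat.div_eq_of_lt hj, Nat.mod_eq_of_lt hj,
    Nat.div_eq_of_lt hj', Nat.mod_eq_of_lt hj'] at h2 h3
  omega

lemma Setup.tm_le (F : X.Fits E) {bs : List (ℕ → Bool)} (hl : bs.length ≤ 4 * X.n) :
    X.tm E blk j bs ≤ X.T :=
  ((X.sv blk).time _ _).trans ((Nat.add_le_add_left (Nat.mul_le_mul_left _ hl) _).trans F.time)

/-- All copies of the machine of a block are asked the same question. -/
lemma wp_questions (F : X.Fits E) {hs : ℕ → List (ℕ → Bool)} (I : X.Inv E hs h)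
    (hb : blk < X.B * X.B) (iv : h.var .i = blk)
    (bits : ∀ p < 2 * X.k, h.mem 4 p = (b p).toNat) (hl : (hs blk).length < 4 * X.n) :
    WP E (for' .j (v .r) (questionProg X.mach X.R X.τ)) h fun h' t =>
      t + 200 * X.total E hs ≤ 200 * X.total E (Function.update hs blk (hs blk ++ [b])) +
        X.r * (200 * X.k + 210) + 10 ∧
      Frame 4 evalAreas h h' ∧ X.Inv E (Function.update hs blk (hs blk ++ [b])) h' ∧
      ∀ a < X.r, h'.mem 8 a = X.answer E blk a (hs blk) b := by
  set hs' := Function.update hs blk (hs blk ++ [b]) with e'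
  have hs'b : hs' blk = hs blk ++ [b] := by simp [e']
  have hs'n : ∀ blk', blk' ≠ blk → hs' blk' = hs blk' := fun blk' hn => by simp [e', hn]
  have hlen : ∀ blk' < X.B * X.B, (hs' blk').length ≤ 4 * X.n := by
    intro blk' hb'
    by_cases hn : blk' = blk
    · rw [hn, hs'b, List.length_append, List.length_singleton]; omega
    · rw [hs'n _ hn]; exact I.len _ hb'
  have hsum : ∀ (g : ℕ → List (ℕ → Bool) → ℕ),
      ∑ c ∈ Finset.range (X.B * X.B), g c (hs' c) + g blk (hs blk)
        = ∑ c ∈ Finset.range (X.B * X.B), g c (hs c) + g blk (hs blk ++ [b]) := by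
    intro g
    rw [← Finset.add_sum_erase _ _ (Finset.mem_range.2 hb),
      ← Finset.add_sum_erase _ (fun c => g c (hs c)) (Finset.mem_range.2 hb), hs'b,
      Finset.sum_congr rfl fun c hc => by rw [hs'n c (Finset.ne_of_mem_erase hc)]]
    ring
  have hph' : ∑ c ∈ Finset.range (X.B * X.B), (hs' c).length
      = ∑ c ∈ Finset.range (X.B * X.B), (hs c).length + 1 := by
    have := hsum fun _ l => l.length
    simp only [List.length_append, List.length_singleton] at this
    omega
  have hphw : 1 + X.r * ∑ c ∈ Finset.range (X.B * X.B), (hs' c).length < 2 ^ E.w := by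
    have h1 : ∑ c ∈ Finset.range (X.B * X.B), (hs' c).length ≤ X.B * X.B * (4 * X.n) := by
      simpa using Finset.sum_le_card_nsmul _ _ _ fun c hc => hlen c (Finset.mem_range.1 hc)
    have h2 := Nat.mul_le_mul_left X.r h1
    have h3 := F.ph
    have h4 : X.r * (X.B * X.B * (4 * X.n)) = 4 * X.r * (X.n * (X.B * X.B)) := by ring
    omega
  have hph0 := I.ph
  rw [hph', mul_add] at hphw
  refine WP.for' (N := X.r) (fun j h₁ t => h₁.var .j = j ∧ j ≤ X.r ∧ Frame 4 evalAreas h h₁ ∧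
    h₁.var .PH = h.var .PH + j ∧ (∀ a, 2 ≤ a → h₁.mem 5 a = h.mem 5 a) ∧
    (∀ z, z < 9 → z ≠ 5 → z ≠ 8 → h₁.mem z = h.mem z) ∧
    (∀ a < j, h₁.mem 8 a = X.answer E blk a (hs blk) b) ∧
    (∀ blk' < X.B * X.B, ∀ j' < X.r, InstRep X.R X.w' h₁ (X.Z blk' j')
      (X.S E blk' j' (if blk' = blk ∧ j' < j then hs blk ++ [b] else hs blk'))) ∧
    t + 200 * ∑ i ∈ Finset.range j, X.tm E blk i (hs blk) ≤
      200 * ∑ i ∈ Finset.range j, X.tm E blk i (hs blk ++ [b]) + j * (200 * X.k + 210) + 10)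
    ?_ ?_ ?_ ?_
  · refine ⟨by simp, by omega, .set (by decide) _, by simp, fun _ _ => rfl, fun _ _ _ _ => rfl,
      fun _ h0 => by omega, ?_, by simp⟩
    intro blk' hb' j' hj'
    simp only [not_lt_zero, and_false, if_false]
    exact (I.inst _ hb' _ hj').keep rfl rfl (by simp)
  · rintro j h₁ t ⟨h1, h2, f, -⟩
    exact ⟨h1, h2, trivial, by rw [Expr.val_v, f.var .r (by decide), I.static.r]⟩
  · rintro j hj h₁ t ⟨h1, h2, f, h3, h4, h5, h6, h7, h8⟩
    have st : X.Static E h₁ := by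
      refine I.static.frame (l := 4) (S := {z | z = 5 ∨ z = 8 ∨ 9 ≤ z}) ⟨f.var, fun z hz => ?_,
        f.out, f.pos⟩ (by norm_num) (by simp) (by simp) (by simp) h4
      simp only [Set.mem_ofPred_eq, not_or, not_le] at hz
      exact h5 z hz.2.2 hz.1 hz.2.1
    have inst := h7 blk hb j hj
    simp only [lt_irrefl, and_false, if_false] at inst
    have htm : X.tm E blk j (hs blk ++ [b]) ≤ X.T :=
      X.tm_le F (by simp; omega)
    refine (wp_question F st hb hj ((f.var .i (by decide)).trans iv) h1
      (by rw [h5 4 (by norm_num) (by norm_num) (by norm_num)]; exact bits) inst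
      (by omega) htm).mono ?_
    rintro h₂ t₂ ⟨g1, g2, g3, g4, g5, g6⟩
    refine ⟨(g2.var .j (by decide)).trans h1, by simp, by omega, (f.trans (g2.weaken (by norm_num)
      ?_)).trans (.set (by decide) _), by simp [g3, h3]; omega,
      fun a ha => (g4 a ha).trans (h4 a ha), fun z z1 z2 z3 => ?_, fun a ha => ?_, ?_, ?_⟩
    · intro z hz
      have : 9 ≤ X.Z blk j := by unfold Setup.Z; omega
      simp only [Set.mem_insert_iff, Set.mem_singleton_iff] at hz
      simp only [evalAreas, Set.mem_ofPred_eq]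
      omega
    · rw [HS.set_mem, g2.mem z, h5 z z1 z2 z3]
      have : 9 ≤ X.Z blk j := by unfold Setup.Z; omega
      simp only [Set.mem_insert_iff, Set.mem_singleton_iff]
      omega
    · rw [HS.set_mem, g5]
      split_ifs with hc
      · rw [hc]
      · exact h6 a (by omega)
    · intro blk' hb' j' hj'
      by_cases hc : blk' = blk ∧ j' = j
      · obtain ⟨rfl, rfl⟩ := hc
        simp only [true_and, lt_add_iff_pos_right, zero_lt_one, if_true]
        exact g6.keep rfl rfl (by simp)
      · have h9 := h7 blk' hb' j' hj'
        have : (blk' = blk ∧ j' < j + 1) ↔ (blk' = blk ∧ j' < j) := by omega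
        simp only [this]
        have hz : ∀ c < 3, h₂.mem (X.Z blk' j' + c) = h₁.mem (X.Z blk' j' + c) := by
          intro c hc3
          refine g2.mem _ fun hz => ?_
          have : 9 ≤ X.Z blk' j' := by unfold Setup.Z; omega
          simp only [Set.mem_insert_iff, Set.mem_singleton_iff] at hz
          have : ∃ c' < 3, X.Z blk' j' + c = X.Z blk j + c' := by
            rcases hz with hz | hz | hz | hz | hz
            · omega
            · omega
            · exact ⟨0, by norm_num, by omega⟩
            · exact ⟨1, by norm_num, by omega⟩
            · exact ⟨2, by norm_num, by omega⟩
          obtain ⟨c', hc', h10⟩ := this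
          exact hc (Setup.Z_inj hj' hj hc3 hc' h10)
        exact h9.keep (hz 0 (by norm_num)) (hz 2 (by norm_num)) (by simp [g3])
    · rw [Finset.sum_range_succ, Finset.sum_range_succ, add_one_mul]
      simp only [Expr.cost_v]
      omega
  · rintro h₁ t ⟨-, -, f, h3, h4, h5, h6, h7, h8⟩
    refine ⟨?_, f, ⟨?_, ?_, hlen, ?_⟩, h6⟩
    · have := hsum fun c l => ∑ j ∈ Finset.range X.r, X.tm E c j l
      unfold Setup.total
      omega
    · refine I.static.frame (l := 4) (S := {z | z = 5 ∨ z = 8 ∨ 9 ≤ z}) ⟨f.var, fun z hz => ?_,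
        f.out, f.pos⟩ (by norm_num) (by simp) (by simp) (by simp) h4
      simp only [Set.mem_ofPred_eq, not_or, not_le] at hz
      exact h5 z hz.2.2 hz.1 hz.2.1
    · intro blk' hb' j' hj'
      have h9 := h7 blk' hb' j' hj'
      by_cases hc : blk' = blk
      · simp only [hc, hj', and_self, if_true] at h9 ⊢
        rw [hs'b]; exact h9
      · simp only [hc, false_and, if_false] at h9
        rw [hs'n _ hc]; exact h9
    · rw [h3, hph', mul_add]; omega

end

/-- The current vector is in area `2`, and the rows of the matrix in which a common one with the
vector has been found are marked in area `3`. -/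
structure Setup.Vec (X : Setup) (vec fnd : ℕ → Bool) (h : HS) : Prop where
  vec : ∀ c < X.H, h.mem 2 c = (vec c).toNat
  fnd : ∀ a < X.H, h.mem 3 a = (fnd a).toNat

/-- The vectors for block `blk`: the rows that are still to be found, and a part of the current
vector. -/
def Setup.bits (X : Setup) (vec fnd : ℕ → Bool) (blk p : ℕ) : Bool :=
  if p < X.k then !fnd (blk / X.B * X.k + p) else vec (blk % X.B * X.k + (p - X.k))

/-- The entries of block number `blk`. -/
def Setup.block (X : Setup) (blk i j : ℕ) : Bool :=
  X.mat (blk / X.B * X.k + i) (blk % X.B * X.k + j)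

section
variable {X : Setup} {E : Env} {h h' : HS} {blk j : ℕ} {b : ℕ → Bool} {vec fnd : ℕ → Bool}

lemma Setup.Vec.frame (V : X.Vec vec fnd h) {l : ℕ} {S : Set ℕ} (f : Frame l S h h') (h2 : 2 ∉ S)
    (h3 : 3 ∉ S) : X.Vec vec fnd h' :=
  ⟨by rw [f.mem 2 h2]; exact V.vec, by rw [f.mem 3 h3]; exact V.fnd⟩

lemma Setup.Fits.index (F : X.Fits E) {x i : ℕ} (hx : x < X.B) (hi : i < X.k) :
    x * X.k + i < X.H := by
  calc x * X.k + i < (x + 1) * X.k := by rw [add_one_mul]; omega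
    _ ≤ X.B * X.k := Nat.mul_le_mul_right _ hx
    _ = X.H := F.hB

lemma Setup.div_lt (hb : blk < X.B * X.B) : blk / X.B < X.B := Nat.div_lt_of_lt_mul hb

lemma Setup.mod_lt (hb : blk < X.B * X.B) : blk % X.B < X.B :=
  Nat.mod_lt _ (Nat.pos_of_ne_zero fun h => by simp [h] at hb)

/-- The variables that describe the current block. -/
structure Setup.At (X : Setup) (blk : ℕ) (h : HS) : Prop where
  hb : blk < X.B * X.B
  i : h.var .i = blk
  x : h.var .x = blk / X.B
  y : h.var .y = blk % X.B

lemma Setup.At.frame (a : X.At blk h) {l : ℕ} {S : Set ℕ} (f : Frame l S h h') (hl : 3 ≤ l) :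
    X.At blk h' :=
  ⟨a.hb, (f.var .i (by simp [Var.lev]; omega)).trans a.i,
    (f.var .x (by simp [Var.lev]; omega)).trans a.x,
    (f.var .y (by simp [Var.lev]; omega)).trans a.y⟩

lemma wp_fillBits (F : X.Fits E) (A : X.At blk h) (hk : h.var .k = X.k) (V : X.Vec vec fnd h)
    (α β : Bool) :
    WP E (fillBits α β) h fun h' t => t ≤ 60 * X.k + 10 ∧ Frame 5 {4} h h' ∧
      h'.var .PH = h.var .PH ∧
      ∀ p < 2 * X.k, h'.mem 4 p = (mask X.k α β (X.bits vec fnd blk) p).toNat := by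
  have hH := F.H4
  have hkH := F.kH A.hb
  have hW : ∀ {u : ℕ}, u ≤ E.W → u < 2 ^ E.w := fun hu => F.lt_pow (by omega)
  have hx := Setup.div_lt A.hb
  have hy := Setup.mod_lt A.hb
  refine WP.for' (N := X.k) (fun p h₁ t => h₁.var .p = p ∧ p ≤ X.k ∧ Frame 5 {4} h h₁ ∧
    h₁.var .PH = h.var .PH ∧
    (∀ q < p, h₁.mem 4 q = (mask X.k α β (X.bits vec fnd blk) q).toNat ∧
      h₁.mem 4 (X.k + q) = (mask X.k α β (X.bits vec fnd blk) (X.k + q)).toNat) ∧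
    t ≤ 60 * p + 10) ?_ ?_ ?_ ?_
  · exact ⟨by simp, by omega, .set (by decide) _, by simp, fun q h0 => by omega, by simp⟩
  · rintro p h₁ t ⟨h1, h2, f, -⟩
    exact ⟨h1, h2, trivial, by rw [Expr.val_v, f.var .k (by decide), hk]⟩
  · rintro p hp h₁ t ⟨h1, h2, f, hPH, h3, h4⟩
    have step : ∀ {h₂ : HS}, Frame 5 {4} h h₂ → h₂.var .p = p →
        Num E h₂ (if α then lit 1 - ld (lit 3) (v .x * v .k + v .p) else lit 0)
          (mask X.k α β (X.bits vec fnd blk) p).toNat ∧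
        Num E h₂ (if β then ld (lit 2) (v .y * v .k + v .p) else lit 0)
          (mask X.k α β (X.bits vec fnd blk) (X.k + p)).toNat := by
      intro h₂ f hpv
      have A₂ := A.frame f (by norm_num)
      have V₂ := V.frame f (by simp) (by simp)
      have nk : Num E h₂ (v .k) X.k := ⟨trivial, by rw [Expr.val_v, f.var .k (by decide), hk]⟩
      have np : Num E h₂ (v .p) p := ⟨trivial, hpv⟩
      have nx : Num E h₂ (v .x) (blk / X.B) := ⟨trivial, A₂.x⟩
      have ny : Num E h₂ (v .y) (blk % X.B) := ⟨trivial, A₂.y⟩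
      have ix := F.index hx hp
      have iy := F.index hy hp
      have n0 : Num E h₂ (lit 0) 0 := Num.lit (hW (by omega))
      have n3 := (Num.lit (E := E) (h := h₂) (u := 3) (hW (by omega))).ld
        ((nx.mul nk (hW (by omega))).add np (hW (by omega))) (by omega)
        (F.addr (by norm_num) (by omega))
      rw [V₂.fnd _ ix] at n3
      have n2 := (Num.lit (E := E) (h := h₂) (u := 2) (hW (by omega))).ld
        ((ny.mul nk (hW (by omega))).add np (hW (by omega))) (by omega)
        (F.addr (by norm_num) (by omega))
      rw [V₂.vec _ iy] at n2
      constructor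
      · cases α
        · simpa [mask, hp] using n0
        · have := (Num.lit (E := E) (h := h₂) (u := 1) (hW (by omega))).sub n3
            (by cases fnd (blk / X.B * X.k + p) <;> simp)
          simp only [mask, hp, if_true, Setup.bits]
          convert this using 1
          cases fnd (blk / X.B * X.k + p) <;> rfl
      · cases β
        · simpa [mask] using n0
        · simpa [mask, Setup.bits] using n2
    have np : Num E h₁ (v .p) p := ⟨trivial, h1⟩
    refine WP.seq (WP.stoN (Num.lit (hW (by omega))) np (step f h1).1 (by omega)
      (F.addr (by norm_num) (by omega)) ?_)
    set h₂ := h₁.put 4 p _ with e₂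
    have f₂ : Frame 5 {4} h h₂ := f.trans (.put (by simp))
    have h1' : h₂.var .p = p := h1
    have nk : Num E h₂ (v .k) X.k := ⟨trivial, by rw [Expr.val_v, f₂.var .k (by decide), hk]⟩
    refine WP.stoN (Num.lit (hW (by omega))) (nk.add ⟨trivial, h1'⟩ (hW (by omega)))
      (step f₂ h1').2 (by omega) (F.addr (by norm_num) (by omega)) ?_
    refine ⟨h1', by simp, by omega, (f₂.trans (.put (by simp))).trans (.set (by decide) _),
      by simpa [e₂] using hPH, ?_, ?_⟩
    · intro q hq
      simp only [HS.set_mem, HS.put_mem, e₂, true_and]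
      rcases Nat.lt_succ_iff_lt_or_eq.1 hq with hq | rfl
      · rw [if_neg (by omega), if_neg (by omega), if_neg (by omega), if_neg (by omega)]
        exact h3 q hq
      · rw [if_neg (by omega), if_pos rfl, if_pos rfl]
        exact ⟨rfl, rfl⟩
    · cases α <;> cases β <;> simp <;> omega
  · rintro h₁ t ⟨-, -, f, hPH, h3, h4⟩
    refine ⟨h4, f, hPH, fun p hp => ?_⟩
    rcases Nat.lt_or_ge p X.k with h5 | h5
    · exact (h3 p h5).1
    · have := (h3 (p - X.k) (by omega)).2
      rwa [Nat.add_sub_cancel' h5] at this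

/-- More than half of the copies answer correctly. -/
def Setup.Right (X : Setup) (E : Env) (blk : ℕ) (bs : List (ℕ → Bool)) (b : ℕ → Bool) : Prop :=
  X.r < 2 * ((Finset.range X.r).filter fun a => X.answer E blk a bs b = X.f blk b).card

/-- One question about a block: all copies answer it, and the majority is correct if more than half
of them are. -/
lemma wp_evalMask (F : X.Fits E) {hs : ℕ → List (ℕ → Bool)} (I : X.Inv E hs h)
    (A : X.At blk h) (V : X.Vec vec fnd h) (hl : (hs blk).length < 4 * X.n) (α β : Bool) {b}
    (hbe : b = mask X.k α β (X.bits vec fnd blk)) :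
    WP E (evalMask X.mach X.R X.τ α β) h fun h' t =>
      t + 200 * X.total E hs ≤ 200 * X.total E (Function.update hs blk (hs blk ++ [b])) +
        1000 * (X.r * (X.r + X.k)) ∧
      Frame 4 evalAreas h h' ∧ X.Inv E (Function.update hs blk (hs blk ++ [b])) h' ∧
      h'.var .ans0 < 2 ^ X.w' ∧ (X.Right E blk (hs blk) b → h'.var .ans0 = X.f blk b) := by
  have hH := F.H4
  have hr2 := F.r2
  have hW : ∀ {u : ℕ}, u ≤ E.W → u < 2 ^ E.w := fun hu => F.lt_pow (by omega)
  refine WP.seq ((wp_fillBits F A I.static.k V α β).mono ?_)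
  rintro h₁ t₁ ⟨l₁, f₁, p₁, m₁⟩
  rw [← hbe] at m₁
  have I₁ := I.frame f₁ (by norm_num) (by simp) p₁
  refine WP.seq ((wp_questions F I₁ A.hb ((f₁.var .i (by decide)).trans A.i) m₁ hl).mono ?_)
  rintro h₂ t₂ ⟨l₂, f₂, I₂, m₂⟩
  refine (wp_majority (r := X.r) (m := 2 ^ X.w') I₂.static.r ?_ ?_ (hW (by omega)) ?_
    (by positivity)).mono ?_
  · exact (Nat.mul_le_mul_right _ (by omega)).trans F.area
  · have := F.hr; omega
  · intro a ha
    rw [m₂ a ha]; exact Setup.answer_lt _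
  rintro h₃ t₃ ⟨f₃, p₃, l₃, m₃, u₃⟩
  refine ⟨?_, ((f₁.weaken (by norm_num) (by simp [evalAreas])).trans f₂).trans
    (f₃.weaken le_rfl (by simp)), I₂.frame f₃ (by norm_num) (by simp) p₃, m₃, ?_⟩
  · have h1 := F.hr
    have h2 := F.hk
    have h3 : X.r * X.r + X.r * X.k = X.r * (X.r + X.k) := by ring
    have h4 : X.r * (200 * X.k + 210) = 200 * (X.r * X.k) + 210 * X.r := by ring
    have h5 : X.r ≤ X.r * X.r := Nat.le_mul_of_pos_left _ h1
    have h6 : X.k ≤ X.r * X.k := Nat.le_mul_of_pos_left _ h1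
    omega
  · intro hR
    refine u₃ _ ?_
    rw [Finset.filter_congr fun a ha => by rw [m₂ a (Finset.mem_range.1 ha)]]
    exact hR

end

/-! ### One block of the matrix -/

/-- The rows of block row `x` that have a common one with the current vector in block column `y`
are marked; if this marks no further row, something has gone wrong, and the flag `dead` is set. -/
def brute : Prog :=
  asg .fl (lit 0) ;;
  for' .a (v .k) (iff (ld (lit 3) (v .x * v .k + v .a)) .skip
    (for' .b (v .k) (iff (and' (ld (lit 2) (v .y * v .k + v .b)) (entry (v .a) (v .b)))
      (sto (lit 3) (v .x * v .k + v .a) (lit 1) ;; asg .fl (lit 1)) .skip))) ;;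
  iff (v .fl) .skip (asg .dead (lit 1))

/-- Row `z` has a common one with the vector in the block column of block `blk`. -/
def Setup.Common (X : Setup) (vec : ℕ → Bool) (blk z m : ℕ) : Prop :=
  ∃ c < m, X.mat z (blk % X.B * X.k + c) = true ∧ vec (blk % X.B * X.k + c) = true

open Classical in
/-- The marked rows after block `blk`. -/
noncomputable def Setup.step (X : Setup) (vec fnd : ℕ → Bool) (blk z : ℕ) : Bool :=
  fnd z || decide ((∃ i < X.k, z = blk / X.B * X.k + i) ∧ X.Common vec blk z X.k)

section
variable {X : Setup} {E : Env} {h h' : HS} {blk j : ℕ} {b : ℕ → Bool} {vec fnd : ℕ → Bool}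

lemma Setup.step_iff {z : ℕ} : X.step vec fnd blk z = true ↔
    fnd z = true ∨ ((∃ i < X.k, z = blk / X.B * X.k + i) ∧ X.Common vec blk z X.k) := by
  simp [Setup.step]

lemma Num.is {e : Expr} {c : Bool} (hn : Num E h e c.toNat) : Is E h e (c = true) :=
  ⟨hn.1, by rw [hn.2]; simp⟩

lemma Setup.matCtx (F : X.Fits E) (A : X.At blk h) (s : X.Static E h) :
    MatCtx E X.k (X.block blk) h := by
  have hx := Setup.div_lt A.hb
  have hy := Setup.mod_lt A.hb
  refine ⟨s.k, fun i hi j hj => ?_, fun i hi j hj => ?_, ?_, ?_⟩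
  · rw [A.x, A.y, s.H]
    exact s.mat _ (F.index hx hi) _ (F.index hy hj)
  · rw [A.x, A.y, s.H]
    have h1 := F.index hx hi
    have h2 := F.index hy hj
    calc _ < (blk / X.B * X.k + i) * X.H + X.H := by omega
      _ = (blk / X.B * X.k + i + 1) * X.H := by ring
      _ ≤ X.H * X.H := Nat.mul_le_mul_right _ h1
      _ ≤ _ := F.H2
  · rw [s.H]; have := F.kH A.hb; have := F.hk; omega
  · exact (Nat.mul_le_mul_right _ (by omega)).trans F.area

/-- The inspection of a block takes `O(k ^ 2)` steps; it either marks a new row or sets the flag. -/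
lemma wp_brute (F : X.Fits E) (A : X.At blk h) (s : X.Static E h) (V : X.Vec vec fnd h) :
    WP E brute h fun h' t => t ≤ 400 * (X.k * X.k) ∧ Frame 3 {3} h h' ∧
      h'.var .PH = h.var .PH ∧ X.Vec vec (X.step vec fnd blk) h' ∧
      ((∃ z, X.step vec fnd blk z = true ∧ fnd z = false) → h'.var .dead = h.var .dead) ∧
      ((¬ ∃ z, X.step vec fnd blk z = true ∧ fnd z = false) → h'.var .dead = 1) := by
  have hH := F.H4
  have hkH := F.kH A.hb
  have hk1 := F.hk
  have hW : ∀ {u : ℕ}, u ≤ E.W → u < 2 ^ E.w := fun hu => F.lt_pow (by omega)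
  have hx := Setup.div_lt A.hb
  have hy := Setup.mod_lt A.hb
  set x := blk / X.B with ex
  set y := blk % X.B with ey
  have st : ∀ {h₁ : HS}, Frame 3 {3} h h₁ → X.Static E h₁ := fun f =>
    s.frame f (by norm_num) (by simp) (by simp) (by simp) fun a _ => by rw [f.mem 5 (by simp)]
  have nk : ∀ {h₁ : HS}, Frame 3 {3} h h₁ → Num E h₁ (v .k) X.k := fun f => ⟨trivial, (st f).k⟩
  -- the address of row `a` of the block row
  have row : ∀ {h₁ : HS} {a : ℕ}, Frame 3 {3} h h₁ → h₁.var .a = a → a < X.k →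
      Num E h₁ (v .x * v .k + v .a) (x * X.k + a) := fun {h₁ a} f ha hak => by
    have := F.index hx hak
    have nx : Num E h₁ (v .x) x := ⟨trivial, (A.frame f le_rfl).x⟩
    exact (nx.mul (nk f) (hW (by omega))).add ⟨trivial, ha⟩ (hW (by omega))
  refine WP.seq (WP.asgN (Num.lit (u := 0) (hW (by omega))) ?_)
  have f₀ : Frame 3 {3} h (h.set .fl 0) := .set (by decide) _
  refine WP.seq (WP.mono (WP.for' (N := X.k) (fun a h₁ t => h₁.var .a = a ∧ a ≤ X.k ∧
    Frame 3 {3} h h₁ ∧ h₁.var .PH = h.var .PH ∧ h₁.var .dead = h.var .dead ∧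
    (∃ g, X.Vec vec g h₁ ∧ (∀ z, g z = true ↔ fnd z = true ∨
      ((∃ i < a, z = x * X.k + i) ∧ X.Common vec blk z X.k)) ∧
      (h₁.var .fl ≠ 0 ↔ ∃ z, g z = true ∧ fnd z = false)) ∧ t ≤ a * (70 * X.k + 50) + 10)
    (Q := fun h₁ t => Frame 3 {3} h h₁ ∧ h₁.var .PH = h.var .PH ∧
      h₁.var .dead = h.var .dead ∧ X.Vec vec (X.step vec fnd blk) h₁ ∧
      (h₁.var .fl ≠ 0 ↔ ∃ z, X.step vec fnd blk z = true ∧ fnd z = false) ∧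
      t ≤ X.k * (70 * X.k + 50) + 10) ?_ ?_ ?_ ?_) ?_)
  · refine ⟨by simp, by omega, f₀.trans (.set (by decide) _), by simp, by simp,
      ⟨fnd, ⟨V.vec, V.fnd⟩, fun z => by simp, by simp⟩, by simp⟩
  · rintro a h₁ t ⟨h1, h2, f, -⟩
    exact ⟨h1, h2, (nk f).1, (nk f).2⟩
  · rintro a ha h₁ t ⟨h1, h2, f, hPH, hd, ⟨g, Vg, hg, hfl⟩, ht⟩
    have ix := F.index hx ha
    have n3 := (Num.lit (E := E) (h := h₁) (u := 3) (hW (by omega))).ld (row f h1 ha) (by omega)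
      (F.addr (by norm_num) (by omega))
    rw [Vg.fnd _ ix] at n3
    have hfg : ∀ z, fnd z = true → g z = true := fun z hz => (hg z).2 (.inl hz)
    refine WP.ifI n3.is (fun hc => ?_) fun hc => ?_
    · refine WP.skip ⟨h1, by simp, by omega, f.trans (.set (by decide) _), by simpa using hPH,
        by simpa using hd, ⟨g, ⟨Vg.vec, Vg.fnd⟩, fun z => ?_, by simpa using hfl⟩, ?_⟩
      · rw [hg]
        constructor
        · rintro (h0 | ⟨⟨i, hi, e⟩, h0⟩)
          · exact .inl h0
          · exact .inr ⟨⟨i, by omega, e⟩, h0⟩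
        · rintro (h0 | ⟨⟨i, hi, e⟩, h0⟩)
          · exact .inl h0
          · rcases Nat.lt_succ_iff_lt_or_eq.1 hi with hi | rfl
            · exact .inr ⟨⟨i, hi, e⟩, h0⟩
            · subst e; exact (hg _).1 hc
      · simp [add_one_mul]; omega
    · have hc' : fnd (x * X.k + a) = false := by
        by_contra h0; exact hc (hfg _ (by simpa using h0))
      refine WP.mono (WP.for' (N := X.k) (fun c h₂ t => h₂.var .b = c ∧ c ≤ X.k ∧
        Frame 3 {3} h h₂ ∧ h₂.var .PH = h.var .PH ∧ h₂.var .dead = h.var .dead ∧ h₂.var .a = a ∧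
        (∃ g', X.Vec vec g' h₂ ∧ (∀ z, g' z = true ↔ g z = true ∨
          (z = x * X.k + a ∧ X.Common vec blk z c)) ∧
          (h₂.var .fl ≠ 0 ↔ ∃ z, g' z = true ∧ fnd z = false)) ∧ t ≤ c * 70 + 10)
        (Q := fun h₂ t => Frame 3 {3} h h₂ ∧ h₂.var .PH = h.var .PH ∧ h₂.var .dead = h.var .dead ∧
        h₂.var .a = a ∧
        (∃ g', X.Vec vec g' h₂ ∧ (∀ z, g' z = true ↔ g z = true ∨
          (z = x * X.k + a ∧ X.Common vec blk z X.k)) ∧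
          (h₂.var .fl ≠ 0 ↔ ∃ z, g' z = true ∧ fnd z = false)) ∧ t ≤ X.k * 70 + 10)
        ?_ ?_ ?_ ?_) ?_
      · refine ⟨by simp, by omega, f.trans (.set (by decide) _), by simpa using hPH,
          by simpa using hd, by simpa using h1, ⟨g, ⟨Vg.vec, Vg.fnd⟩, fun z => ?_,
            by simpa using hfl⟩, by simp⟩
        simp [Setup.Common]
      · rintro c h₂ t ⟨h1, h2, f, -⟩
        exact ⟨h1, h2, (nk f).1, (nk f).2⟩
      · rintro c hck h₂ t ⟨k1, k2, f, hPH, hd, k3, ⟨g', Vg', hg', hfl'⟩, k4⟩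
        have iy := F.index hy hck
        have A₂ := A.frame f le_rfl
        have ny : Num E h₂ (v .y) y := ⟨trivial, A₂.y⟩
        have nb : Num E h₂ (v .b) c := ⟨trivial, k1⟩
        have na : Num E h₂ (v .a) a := ⟨trivial, k3⟩
        have n2 := (Num.lit (E := E) (h := h₂) (u := 2) (hW (by omega))).ld
          ((ny.mul (nk f) (hW (by omega))).add nb (hW (by omega))) (by omega)
          (F.addr (by norm_num) (by omega))
        rw [Vg'.vec _ iy] at n2
        have ne := (Setup.matCtx F A₂ (st f)).entry_is na nb ha hck
        have hcom : ∀ z, X.Common vec blk z (c + 1) ↔ X.Common vec blk z c ∨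
            (X.mat z (y * X.k + c) = true ∧ vec (y * X.k + c) = true) := by
          intro z
          constructor
          · rintro ⟨d, hd, e⟩
            rcases Nat.lt_succ_iff_lt_or_eq.1 hd with hd | rfl
            · exact .inl ⟨d, hd, e⟩
            · exact .inr e
          · rintro (⟨d, hd, e⟩ | e)
            · exact ⟨d, by omega, e⟩
            · exact ⟨c, by omega, e⟩
        refine WP.ifI (n2.is.and fun _ => ne) (fun hc2 => ?_) fun hc2 => ?_
        · refine WP.seq (WP.stoN (Num.lit (hW (by omega))) (row f k3 ha)
            (Num.lit (u := 1) (hW (by omega))) (by omega) (F.addr (by norm_num) (by omega)) ?_)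
          refine WP.asgN (Num.lit (u := 1) (hW (by omega))) ?_
          refine ⟨by simpa using k1, by simp, by omega, ((f.trans (.put (by simp))).trans
            (.set (by decide) _)).trans (.set (by decide) _), by simpa using hPH,
            by simpa using hd, by simpa using k3,
            ⟨fun z => g' z || decide (z = x * X.k + a), ⟨?_, ?_⟩, fun z => ?_, ?_⟩, ?_⟩
          · intro d hd
            simpa using Vg'.vec d hd
          · intro d hd
            have := Vg'.fnd d hd
            by_cases h0 : d = x * X.k + a <;> simp [h0, this]
          · simp only [Bool.or_eq_true, decide_eq_true_eq, hg', hcom]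
            constructor
            · rintro ((h0 | h0) | h0)
              · exact .inl h0
              · exact .inr ⟨h0.1, .inl h0.2⟩
              · subst h0; exact .inr ⟨rfl, .inr ⟨hc2.2, hc2.1⟩⟩
            · rintro (h0 | h0)
              · exact .inl (.inl h0)
              · exact .inr h0.1
          · simp only [HS.set_var, HS.put_var]
            simp [hc']
          · simp [and', entry]; omega
        · refine WP.skip ⟨k1, by simp, by omega, f.trans (.set (by decide) _), by simpa using hPH,
            by simpa using hd, by simpa using k3, ⟨g', ⟨Vg'.vec, Vg'.fnd⟩, fun z => ?_,
            by simpa using hfl'⟩, ?_⟩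
          · rw [hg', hcom]
            constructor
            · rintro (h0 | h0)
              · exact .inl h0
              · exact .inr ⟨h0.1, .inl h0.2⟩
            · rintro (h0 | ⟨rfl, h0 | h0⟩)
              · exact .inl h0
              · exact .inr ⟨rfl, h0⟩
              · exact absurd ⟨h0.2, h0.1⟩ hc2
          · simp [and', entry]; omega
      · rintro h₂ t ⟨-, -, q⟩
        exact q
      · rintro h₂ t₂ ⟨f, hPH, hd, k3, ⟨g', Vg', hg', hfl'⟩, k4⟩
        refine ⟨k3, by simp, by omega, f.trans (.set (by decide) _), by simpa using hPH,
          by simpa using hd, ⟨g', ⟨Vg'.vec, Vg'.fnd⟩, fun z => ?_, by simpa using hfl'⟩, ?_⟩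
        · rw [hg', hg]
          constructor
          · rintro ((h0 | ⟨⟨i, hi, e⟩, h0⟩) | ⟨e, h0⟩)
            · exact .inl h0
            · exact .inr ⟨⟨i, by omega, e⟩, h0⟩
            · exact .inr ⟨⟨a, by omega, e⟩, h0⟩
          · rintro (h0 | ⟨⟨i, hi, e⟩, h0⟩)
            · exact .inl (.inl h0)
            · rcases Nat.lt_succ_iff_lt_or_eq.1 hi with hi | rfl
              · exact .inl (.inr ⟨⟨i, hi, e⟩, h0⟩)
              · exact .inr ⟨e, h0⟩
        · simp [add_one_mul]; omega
  · rintro h₁ t ⟨-, -, f, hPH, hd, ⟨g, Vg, hg, hfl⟩, ht⟩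
    have : g = X.step vec fnd blk := by
      funext z
      rw [Bool.eq_iff_iff, hg, Setup.step_iff]
    rw [← this]
    exact ⟨f, hPH, hd, Vg, hfl, ht⟩
  · rintro h₁ t ⟨f, hPH, hd, V₁, hfl, ht⟩
    have time : ∀ t' ≤ 5,
        (lit 0).cost + 1 + (t + (t' + (v Var.fl).cost + 1)) ≤ 400 * (X.k * X.k) := by
      intro t' ht'
      have h1 : X.k ≤ X.k * X.k := Nat.le_mul_of_pos_left _ hk1
      have h2 : X.k * (70 * X.k + 50) = 70 * (X.k * X.k) + 50 * X.k := by ring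
      simp only [Expr.cost_lit, Expr.cost_v]
      omega
    refine WP.iff trivial (fun hc => ?_) fun hc => ?_
    · exact WP.skip ⟨time _ (by norm_num), f, hPH, V₁, fun _ => hd, fun h0 => absurd (hfl.1 hc) h0⟩
    · refine WP.asgN (Num.lit (u := 1) (hW (by omega))) ⟨time _ (by simp), f.trans
        (.set (by decide) _), by simpa using hPH, ⟨V₁.vec, V₁.fnd⟩, fun h0 => ?_, fun _ => by simp⟩
      exact absurd hc (hfl.2 h0)

end

/-- The work on block number `i`: the answers to the four masked questions tell whether some row
that has not been found yet has a common one with the current vector, and in this case all those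
rows are found by inspection of the block. -/
def blockProg (M : Machine) (R τ : ℕ) : Prog :=
  asg .x (v .i / v .B) ;; asg .y (v .i % v .B) ;; iff (v .dead) .skip
    ((evalMask M R τ true true ;; asg .ans1 (v .ans0)) ;;
      (evalMask M R τ false false ;; asg .ans1 (v .ans1 + v .ans0)) ;;
      (evalMask M R τ true false ;; asg .ans2 (v .ans0)) ;;
      (evalMask M R τ false true ;; asg .ans2 (v .ans2 + v .ans0)) ;;
      iff (eq' (v .ans1) (v .ans2)) .skip brute)

/-- The answers are related to the matrix in the intended way. -/
structure Setup.Sound (X : Setup) : Prop where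
  spec : ∀ blk < X.B * X.B, ∀ b, X.f blk b + X.f blk (mask X.k false false b) ≠
    X.f blk (mask X.k true false b) + X.f blk (mask X.k false true b) ↔ Hit X.k (X.block blk) b
  mat0 : ∀ a c, X.mat a c = true → a < X.n ∧ c < X.n

/-- The four questions about a block. -/
def Setup.four (X : Setup) (vec fnd : ℕ → Bool) (blk : ℕ) : List (ℕ → Bool) :=
  [mask X.k true true (X.bits vec fnd blk), mask X.k false false (X.bits vec fnd blk),
    mask X.k true false (X.bits vec fnd blk), mask X.k false true (X.bits vec fnd blk)]

/-- The majority of the answers is correct for each of the questions `qs`, which are asked after the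
questions `bs`. -/
def Setup.AllRight (X : Setup) (E : Env) (blk : ℕ) : List (ℕ → Bool) → List (ℕ → Bool) → Prop
  | _, [] => True
  | bs, b :: qs => X.Right E blk bs b ∧ X.AllRight E blk (bs ++ [b]) qs

/-- The number of marked rows. -/
def Setup.count (X : Setup) (fnd : ℕ → Bool) : ℕ :=
  ((Finset.range X.H).filter fun a => fnd a = true).card

section
variable {X : Setup} {E : Env} {h h' : HS} {blk j : ℕ} {b : ℕ → Bool} {vec fnd : ℕ → Bool}

lemma Setup.step_eq (hh : ¬ Hit X.k (X.block blk) (X.bits vec fnd blk)) :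
    X.step vec fnd blk = fnd := by
  funext z
  rw [Bool.eq_iff_iff, Setup.step_iff]
  refine ⟨?_, .inl⟩
  rintro (h0 | ⟨⟨i, hi, rfl⟩, c, hc, h1, h2⟩)
  · exact h0
  · by_contra h0
    exact hh ⟨i, hi, c, hc, by simpa [Setup.bits, hi] using h0, h1, by simpa [Setup.bits] using h2⟩

lemma Setup.exists_new (hh : Hit X.k (X.block blk) (X.bits vec fnd blk)) :
    ∃ z, X.step vec fnd blk z = true ∧ fnd z = false := by
  obtain ⟨i, hi, c, hc, h0, h1, h2⟩ := hh
  exact ⟨blk / X.B * X.k + i, Setup.step_iff.2 (.inr ⟨⟨i, hi, rfl⟩, c, hc, h1,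
    by simpa [Setup.bits] using h2⟩), by simpa [Setup.bits, hi] using h0⟩

lemma Setup.count_step (F : X.Fits E) (hb : blk < X.B * X.B)
    (hn : ∃ z, X.step vec fnd blk z = true ∧ fnd z = false) :
    X.count fnd + 1 ≤ X.count (X.step vec fnd blk) := by
  obtain ⟨z, h1, h2⟩ := hn
  refine Finset.card_lt_card (Finset.ssubset_iff_of_subset ?_ |>.2 ⟨z, ?_, ?_⟩)
  · intro a ha
    simp only [Finset.mem_filter] at ha ⊢
    exact ⟨ha.1, Setup.step_iff.2 (.inl ha.2)⟩
  · simp only [Finset.mem_filter, Finset.mem_range, h1, and_true]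
    rcases Setup.step_iff.1 h1 with h0 | ⟨⟨i, hi, rfl⟩, -⟩
    · simp [h0] at h2
    · exact F.index (Setup.div_lt hb) hi
  · simp [h2]

lemma Setup.count_le_step : X.count fnd ≤ X.count (X.step vec fnd blk) := by
  refine Finset.card_le_card fun a ha => ?_
  simp only [Finset.mem_filter] at ha ⊢
  exact ⟨ha.1, Setup.step_iff.2 (.inl ha.2)⟩

lemma mask_self {k : ℕ} : mask k true true b = b := by
  funext p; simp [mask]

/-- The state after the work on a block. In `time`, the inspections of blocks are paid for by the
number of marked rows and the flag, and the questions by the total time of the machines. -/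
structure Setup.Worked (X : Setup) (E : Env) (blk : ℕ) (vec : ℕ → Bool)
    (hs : ℕ → List (ℕ → Bool)) (fnd : ℕ → Bool) (dd : Bool) (h : HS) (t : ℕ)
    (hs' : ℕ → List (ℕ → Bool)) (fnd' : ℕ → Bool) (dd' : Bool) : Prop where
  inv : X.Inv E hs' h
  vecs : X.Vec vec fnd' h
  dead : h.var .dead = dd'.toNat
  len : ∀ c, (hs' c).length ≤ (hs c).length + if c = blk then 4 else 0
  rows : fnd' = fnd ∨ fnd' = X.step vec fnd blk
  time : t + 200 * X.total E hs + 400 * (X.k * X.k) * (X.count fnd + dd.toNat) ≤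
    200 * X.total E hs' + 400 * (X.k * X.k) * (X.count fnd' + dd'.toNat) +
      5000 * (X.r * (X.r + X.k))
  good : dd = false → X.AllRight E blk (hs blk) (X.four vec fnd blk) →
    fnd' = X.step vec fnd blk ∧ dd' = false ∧
      hs' = Function.update hs blk (hs blk ++ X.four vec fnd blk)

/-- If all majorities are right, the rows with a common one in the block are marked. In any case,
the time bound holds, since a futile inspection is the last one for the vector. -/
lemma wp_block (F : X.Fits E) (S : X.Sound) {hs : ℕ → List (ℕ → Bool)} (I : X.Inv E hs h)
    (hb : blk < X.B * X.B) (iv : h.var .i = blk) (V : X.Vec vec fnd h) {dd : Bool}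
    (hd : h.var .dead = dd.toNat) (hl : (hs blk).length + 4 ≤ 4 * X.n) :
    WP E (blockProg X.mach X.R X.τ) h fun h' t => Frame 2 ({3} ∪ evalAreas) h h' ∧
      ∃ hs' fnd' dd', X.Worked E blk vec hs fnd dd h' t hs' fnd' dd' := by
  have hH := F.H4
  have hkH := F.kH hb
  have hk1 := F.hk
  have hr1 := F.hr
  have hrk : 2 ≤ X.r * (X.r + X.k) := by nlinarith
  have hW : ∀ {u : ℕ}, u ≤ E.W → u < 2 ^ E.w := fun hu => F.lt_pow (by omega)
  have ni : Num E h (v .i) blk := ⟨trivial, iv⟩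
  have nB : ∀ {h' : HS}, X.Static E h' → Num E h' (v .B) X.B := fun s => ⟨trivial, s.B⟩
  refine WP.seq (WP.asgN (ni.div (nB I.static)) ?_)
  have f₁ : Frame 2 ({3} ∪ evalAreas) h (h.set .x (blk / X.B)) := .set (by decide) _
  have I₁ := I.frame (l := 2) (S := ∅) (h' := h.set .x (blk / X.B)) (.set (by decide) _)
    (by norm_num) (by simp) (by simp)
  refine WP.seq (WP.asgN (u := blk % X.B)
    (Num.mod ⟨trivial, by simpa using iv⟩ (nB I₁.static)) ?_)
  set h₂ := (h.set .x (blk / X.B)).set .y (blk % X.B) with e₂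
  have f₂ : Frame 2 ({3} ∪ evalAreas) h h₂ := f₁.trans (.set (by decide) _)
  have I₂ := I₁.frame (l := 2) (S := ∅) (h' := h₂) (.set (by decide) _)
    (by norm_num) (by simp) (by simp [e₂])
  have V₂ : X.Vec vec fnd h₂ := ⟨V.vec, V.fnd⟩
  have A₂ : X.At blk h₂ := ⟨hb, by simpa [e₂] using iv, by simp [e₂], by simp [e₂]⟩
  have hd₂ : h₂.var .dead = dd.toNat := by simpa [e₂] using hd
  refine WP.iff trivial (fun hc => ?_) fun hc => ?_
  · refine WP.skip ⟨f₂, hs, fnd, dd, I₂, V₂, hd₂, fun c => by omega, .inl rfl, ?_, ?_⟩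
    · simp; omega
    · rw [Expr.val_v, hd₂] at hc
      rintro rfl
      exact absurd rfl hc
  obtain rfl : dd = false := by
    rw [Expr.val_v, hd₂] at hc
    cases dd <;> simp_all
  -- one evaluation, and saving of its result
  have hw2 : 2 ^ X.w' + 2 ^ X.w' ≤ 2 ^ E.w := by
    rw [← two_mul, ← pow_succ']
    exact Nat.pow_le_pow_right (by norm_num) F.hw
  have ask : ∀ {h₁ : HS} {bs : List (ℕ → Bool)} (_ : X.Inv E (Function.update hs blk bs) h₁)
      (_ : X.At blk h₁) (_ : X.Vec vec fnd h₁) (_ : bs.length < 4 * X.n) (α β : Bool)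
      {b : ℕ → Bool} (_ : b = mask X.k α β (X.bits vec fnd blk)) (x : Var) (e : Expr) (u₀ : ℕ)
      (_ : x.lev = 3) (_ : x ≠ .dead) (_ : u₀ < 2 ^ X.w')
      (_ : ∀ (h₂ : HS) (u : ℕ), Frame 4 evalAreas h₁ h₂ → h₂.var .ans0 = u → u < 2 ^ X.w' →
        Num E h₂ e (u₀ + u)) (_ : e.cost ≤ 3),
      WP E (evalMask X.mach X.R X.τ α β ;; asg x e) h₁ fun h₂ t =>
        t + 200 * X.total E (Function.update hs blk bs) ≤
          200 * X.total E (Function.update hs blk (bs ++ [b])) + 1000 * (X.r * (X.r + X.k)) + 4 ∧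
        Frame 2 ({3} ∪ evalAreas) h₁ h₂ ∧ X.Inv E (Function.update hs blk (bs ++ [b])) h₂ ∧
        X.At blk h₂ ∧ X.Vec vec fnd h₂ ∧ (∀ y : Var, y.lev = 3 → y ≠ x → h₂.var y = h₁.var y) ∧
        ∃ u < 2 ^ X.w', h₂.var x = u₀ + u ∧ (X.Right E blk bs b → u = X.f blk b) := by
    intro h₁ bs I A V hl α β b hbe x e u₀ hx hxd hu he hec
    refine WP.seq ((wp_evalMask F I A V (by simpa using hl) α β hbe).mono ?_)
    simp only [Function.update_self, Function.update_idem]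
    rintro h₃ t ⟨l, f, I', a1, a2⟩
    refine WP.asgN (he h₃ _ f rfl a1) ?_
    have f' := f.weaken (l' := 2) (S' := {3} ∪ evalAreas) (by norm_num) (by simp)
    have g' : Frame 3 ({3} ∪ evalAreas) h₁ (h₃.set x (u₀ + h₃.var .ans0)) :=
      (f.weaken (by norm_num) (by simp)).trans (.set (by omega) _)
    refine ⟨by omega, g'.weaken (by norm_num) le_rfl, I'.frame (l := 2) (S := ∅)
      (.set (by omega) _) (by norm_num) (by simp) ?_, A.frame g' le_rfl, ?_, ?_, _, a1, by simp, a2⟩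
    · simp only [HS.set_var]
      rw [if_neg]; rintro rfl; simp [Var.lev] at hx
    · have := V.frame f (by simp [evalAreas]) (by simp [evalAreas])
      exact ⟨this.vec, this.fnd⟩
    · intro y hy hyx
      rw [HS.set_var, if_neg hyx, f.var y (by omega)]
  have p0 : 0 < 2 ^ X.w' := by positivity
  set q1 := mask X.k true true (X.bits vec fnd blk) with eq1
  set q2 := mask X.k false false (X.bits vec fnd blk) with eq2
  set q3 := mask X.k true false (X.bits vec fnd blk) with eq3
  set q4 := mask X.k false true (X.bits vec fnd blk) with eq4
  have first : ∀ {h₁ : HS} (h₂ : HS) (u : ℕ), Frame 4 evalAreas h₁ h₂ → h₂.var .ans0 = u →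
      u < 2 ^ X.w' → Num E h₂ (v .ans0) (0 + u) := fun h₂ u _ hu _ => ⟨trivial, by simpa using hu⟩
  rw [← Function.update_eq_self blk hs] at I₂
  refine WP.seq ((ask I₂ A₂ V₂ (by omega) true true eq1 .ans1 _ 0 rfl (by simp) p0 first
    (by simp)).mono ?_)
  rintro h₃ t₃ ⟨l₃, f₃, I₃, A₃, V₃, y₃, u₁, b₁, x₁, r₁⟩
  rw [zero_add] at x₁
  refine WP.seq ((ask I₃ A₃ V₃ (by simp; omega) false false eq2 .ans1
    (v .ans1 + v .ans0) u₁ rfl (by simp) b₁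
    (fun h' u f hu hu' => Num.add ⟨trivial, (f.var .ans1 (by decide)).trans x₁⟩ ⟨trivial, hu⟩
      (by omega)) (by simp)).mono ?_)
  rintro h₄ t₄ ⟨l₄, f₄, I₄, A₄, V₄, y₄, u₂, b₂, x₂, r₂⟩
  refine WP.seq ((ask I₄ A₄ V₄ (by simp; omega) true false eq3 .ans2 _ 0 rfl (by simp) p0 first
    (by simp)).mono ?_)
  rintro h₅ t₅ ⟨l₅, f₅, I₅, A₅, V₅, y₅, u₃, b₃, x₃, r₃⟩
  rw [zero_add] at x₃
  refine WP.seq ((ask I₅ A₅ V₅ (by simp; omega) false true eq4 .ans2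
    (v .ans2 + v .ans0) u₃ rfl (by simp) b₃
    (fun h' u f hu hu' => Num.add ⟨trivial, (f.var .ans2 (by decide)).trans x₃⟩ ⟨trivial, hu⟩
      (by omega)) (by simp)).mono ?_)
  rintro h₆ t₆ ⟨l₆, f₆, I₆, A₆, V₆, y₆, u₄, b₄, x₄, r₄⟩
  have f₂₆ := (((f₂.trans f₃).trans f₄).trans f₅).trans f₆
  have hd₆ : h₆.var .dead = 0 := by
    rw [y₆ _ rfl (by simp), y₅ _ rfl (by simp), y₄ _ rfl (by simp), y₃ _ rfl (by simp), hd₂]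
    rfl
  have x₂' : h₆.var .ans1 = u₁ + u₂ := by
    rw [y₆ _ rfl (by simp), y₅ _ rfl (by simp), x₂]
  rw [Function.update_eq_self] at l₃
  set hs' := Function.update hs blk (hs blk ++ [q1] ++ [q2] ++ [q3] ++ [q4]) with ehs
  have ehs' : hs' = Function.update hs blk (hs blk ++ X.four vec fnd blk) := by
    simp [ehs, Setup.four, eq1, eq2, eq3, eq4]
  have hlen : ∀ c, (hs' c).length ≤ (hs c).length + if c = blk then 4 else 0 := by
    intro c
    by_cases hc : c = blk
    · subst hc; simp [ehs]
    · simp [ehs, hc]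
  have hgood : X.AllRight E blk (hs blk) (X.four vec fnd blk) →
      (u₁ + u₂ ≠ u₃ + u₄ ↔ Hit X.k (X.block blk) (X.bits vec fnd blk)) := by
    rintro ⟨g1, g2, g3, g4, -⟩
    rw [← S.spec blk hb, r₁ g1, r₂ g2, r₃ g3, r₄ g4, eq1, mask_self]
  refine WP.ifI (Is.eq ⟨trivial, x₂'⟩ ⟨trivial, x₄⟩) (fun he => ?_) fun he => ?_
  · refine WP.skip ⟨f₂₆, hs', fnd, false, I₆, V₆, hd₆, hlen, .inl rfl, ?_, fun _ hr => ?_⟩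
    · simp; omega
    · refine ⟨(Setup.step_eq fun hh => (hgood hr).2 hh he).symm, rfl, ehs'⟩
  · refine (wp_brute F A₆ I₆.static V₆).mono ?_
    rintro h₇ t₇ ⟨l₇, f₇, p₇, V₇, n₇, o₇⟩
    have I₇ := I₆.frame f₇ (by norm_num) (by simp) p₇
    have f₂₇ := f₂₆.trans (f₇.weaken (l' := 2) (S' := {3} ∪ evalAreas) (by norm_num) (by simp))
    by_cases hn : ∃ z, X.step vec fnd blk z = true ∧ fnd z = false
    · refine ⟨f₂₇, hs', _, false, I₇, V₇, (n₇ hn).trans hd₆, hlen, .inr rfl, ?_,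
        fun _ _ => ⟨rfl, rfl, ehs'⟩⟩
      have h1 := Nat.mul_le_mul_left (400 * (X.k * X.k)) (Setup.count_step F hb hn)
      rw [mul_add] at h1
      simp
      omega
    · refine ⟨f₂₇, hs', _, true, I₇, V₇, o₇ hn, hlen, .inr rfl, ?_, fun _ hr => ?_⟩
      · have h1 := Nat.mul_le_mul_left (400 * (X.k * X.k))
          (Setup.count_le_step (X := X) (vec := vec) (fnd := fnd) (blk := blk))
        generalize X.r * (X.r + X.k) = rk at *
        simp [mul_add]
        omega
      · exact absurd (Setup.exists_new ((hgood hr).1 he)) hn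

end

/-! ### One vector -/

/-- The program that multiplies the matrix by a vector. -/
def mulProg (M : Machine) (R τ : ℕ) : Prog :=
  for' .j (v .H) (sto (lit 2) (v .j) (inp (v .j)) ;; sto (lit 3) (v .j) (lit 0)) ;;
  asg .dead (lit 0) ;;
  for' .i (v .B * v .B) (blockProg M R τ) ;;
  for' .j (v .n) (outp (v .j) (ld (lit 3) (v .j)))

/-- The rows that are marked before block `m` if all answers are correct. -/
noncomputable def Setup.ideal (X : Setup) (vec : ℕ → Bool) : ℕ → ℕ → Bool
  | 0 => fun _ => false
  | m + 1 => X.step vec (X.ideal vec m) m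

/-- The questions about block `blk` for the vector `vec` if all answers are correct. -/
noncomputable def Setup.idealFour (X : Setup) (vec : ℕ → Bool) (blk : ℕ) : List (ℕ → Bool) :=
  X.four vec (X.ideal vec blk) blk

section
variable {X : Setup} {E : Env} {h h' : HS} {blk j : ℕ} {b : ℕ → Bool} {vec fnd : ℕ → Bool}

lemma Setup.ideal_iff {m z : ℕ} : X.ideal vec m z = true ↔
    ∃ blk < m, (∃ i < X.k, z = blk / X.B * X.k + i) ∧ X.Common vec blk z X.k := by
  induction m with
  | zero => simp [Setup.ideal]
  | succ m ih =>
    rw [Setup.ideal, Setup.step_iff, ih]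
    constructor
    · rintro (⟨blk, hb, q⟩ | q)
      · exact ⟨blk, by omega, q⟩
      · exact ⟨m, by omega, q⟩
    · rintro ⟨blk, hb, q⟩
      rcases Nat.lt_succ_iff_lt_or_eq.1 hb with hb | rfl
      · exact .inl ⟨blk, hb, q⟩
      · exact .inr q

/-- With correct answers, the marked rows are those with a one in the product. -/
lemma Setup.ideal_all (F : X.Fits E) (S : X.Sound) {z : ℕ} (hz : z < X.n) :
    X.ideal vec (X.B * X.B) z = true ↔ ∃ c < X.n, X.mat z c = true ∧ vec c = true := by
  have hk := F.hk
  have hB := F.hB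
  have hn := F.hn
  rw [Setup.ideal_iff]
  constructor
  · rintro ⟨blk, hb, -, c, hc, h1, h2⟩
    exact ⟨_, (S.mat0 _ _ h1).2, h1, h2⟩
  · rintro ⟨c, hc, h1, h2⟩
    have zB : z / X.k < X.B := Nat.div_lt_of_lt_mul (by rw [mul_comm]; omega)
    have cB : c / X.k < X.B := Nat.div_lt_of_lt_mul (by rw [mul_comm]; omega)
    have e1 : (z / X.k * X.B + c / X.k) / X.B = z / X.k := by
      rw [mul_comm, Nat.mul_add_div (Nat.zero_lt_of_lt cB), Nat.div_eq_of_lt cB, add_zero]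
    have e2 : (z / X.k * X.B + c / X.k) % X.B = c / X.k := by
      rw [mul_comm, Nat.mul_add_mod, Nat.mod_eq_of_lt cB]
    have e3 : c / X.k * X.k + c % X.k = c := Nat.div_add_mod' c X.k
    refine ⟨z / X.k * X.B + c / X.k, ?_, ⟨z % X.k, Nat.mod_lt _ hk, ?_⟩, c % X.k, Nat.mod_lt _ hk,
      ?_, ?_⟩
    · calc z / X.k * X.B + c / X.k < (z / X.k + 1) * X.B := by rw [add_one_mul]; omega
        _ ≤ _ := Nat.mul_le_mul_right _ zB
    · rw [e1, Nat.div_add_mod']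
    · rw [e2, e3]; exact h1
    · rw [e2, e3]; exact h2

lemma Setup.Static.io (s : X.Static E h) (a o : ℕ → ℕ) :
    X.Static { E with inp := a } { h with out := o } :=
  ⟨s.n, s.k, s.B, s.H, s.N, s.msk, s.r, s.T, s.coin, s.mat, s.edge, s.zero⟩

/-- The input and the output do not matter between questions. -/
lemma Setup.Inv.io {hs : ℕ → List (ℕ → Bool)} (I : X.Inv E hs h) (a o : ℕ → ℕ) :
    X.Inv { E with inp := a } hs { h with out := o } :=
  ⟨I.static.io a o, fun blk hb j hj => ⟨(I.inst blk hb j hj).rep, (I.inst blk hb j hj).bdd,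
    (I.inst blk hb j hj).stamp⟩, I.len, I.ph⟩

lemma Setup.count_le (hf : ∀ a, fnd a = true → a < X.n) : X.count fnd ≤ X.n := by
  calc X.count fnd ≤ (Finset.range X.n).card := Finset.card_le_card fun a ha => by
        simp only [Finset.mem_filter] at ha
        exact Finset.mem_range.2 (hf a ha.2)
    _ = _ := Finset.card_range _

/-- The multiplication by a vector. There are at most `n + 1` inspections of blocks, because each
one marks a new row or sets the flag. -/
lemma wp_mul (F : X.Fits E) (S : X.Sound) {hs : ℕ → List (ℕ → Bool)} (I : X.Inv E hs h)
    (hE : E.inp = fun a => (vec a).toNat)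
    (hl : ∀ c < X.B * X.B, (hs c).length + 4 ≤ 4 * X.n) :
    WP E (mulProg X.mach X.R X.τ) h fun h' t => ∃ hs', X.Inv E hs' h' ∧
      (∀ c < X.B * X.B, (hs' c).length ≤ (hs c).length + 4) ∧
      t + 200 * X.total E hs ≤ 200 * X.total E hs' +
        X.B * X.B * (5000 * (X.r * (X.r + X.k)) + 50) + 400 * (X.k * X.k) * (X.n + 1) +
          100 * X.H + 100 ∧
      ((∀ c < X.B * X.B, X.AllRight E c (hs c) (X.idealFour vec c)) →
        (∀ a < X.n, h'.out a = (decide (∃ c < X.n, X.mat a c = true ∧ vec c = true)).toNat) ∧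
        ∀ c < X.B * X.B, hs' c = hs c ++ X.idealFour vec c) := by
  have hH := F.H4
  have hn := F.hn
  have hk1 := F.hk
  have hr1 := F.hr
  have hW : ∀ {u : ℕ}, u ≤ E.W → u < 2 ^ E.w := fun hu => F.lt_pow (by omega)
  have l0 : ∀ {h' : HS}, Num E h' (lit 0) 0 := Num.lit (hW (by omega))
  -- reading the vector
  refine WP.seq (WP.mono (WP.for' (N := X.H) (fun j h₁ t => h₁.var .j = j ∧ j ≤ X.H ∧
    Frame 4 {2, 3} h h₁ ∧ h₁.var .PH = h.var .PH ∧
    (∀ c < j, h₁.mem 2 c = (vec c).toNat ∧ h₁.mem 3 c = 0) ∧ t ≤ 40 * j + 10)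
    (Q := fun h₁ t => X.Inv E hs h₁ ∧ X.Vec vec (fun _ => false) h₁ ∧ t ≤ 40 * X.H + 10)
    ?_ ?_ ?_ ?_) ?_)
  · exact ⟨by simp, by omega, .set (by decide) _, by simp, fun c h0 => by omega, by simp⟩
  · rintro j h₁ t ⟨h1, h2, f, -⟩
    exact ⟨h1, h2, trivial, by rw [Expr.val_v, f.var .H (by decide), I.static.H]⟩
  · rintro j hj h₁ t ⟨h1, h2, f, hPH, h3, h4⟩
    have nj : Num E h₁ (v .j) j := ⟨trivial, h1⟩
    have ni : Num E h₁ (inp (v .j)) (vec j).toNat := by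
      refine ⟨trivial, ?_⟩
      rw [Expr.val_inp, Expr.val_v, h1, hE]
      have : (vec j).toNat ≤ 1 := Bool.toNat_le _
      exact Nat.mod_eq_of_lt (hW (u := (vec j).toNat) (by omega))
    refine WP.seq (WP.stoN (Num.lit (hW (by omega))) nj ni (by omega)
      (F.addr (by norm_num) (by omega)) ?_)
    refine WP.stoN (i := 3) (u := j) (Num.lit (hW (by omega))) ⟨trivial, h1⟩ l0 (by omega)
      (F.addr (by norm_num) (by omega)) ?_
    refine ⟨h1, by simp, by omega, ((f.trans (.put (by simp))).trans (.put (by simp))).trans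
      (.set (by decide) _), by simpa using hPH, fun c hc => ?_, ?_⟩
    · simp only [HS.set_mem, HS.put_mem]
      rcases Nat.lt_succ_iff_lt_or_eq.1 hc with hc | rfl
      · simpa [hc.ne] using h3 c hc
      · simp
    · simp; omega
  · rintro h₁ t ⟨-, -, f, hPH, h3, h4⟩
    exact ⟨I.frame f (by norm_num) (by intro z; simp; tauto) hPH,
      ⟨fun c hc => (h3 c hc).1, fun c hc => by simpa using (h3 c hc).2⟩, h4⟩
  rintro h₁ t₁ ⟨I₁, V₁, l₁⟩
  refine WP.seq (WP.asgN l0 ?_)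
  have I₂ := I₁.frame (l := 3) (S := ∅) (h' := h₁.set .dead 0) (.set (by decide) _)
    (by norm_num) (by simp) (by simp)
  -- the blocks
  have hBB : X.B * X.B < 2 ^ E.w := by
    refine lt_of_lt_of_le ?_ F.area
    have h2 : X.B * X.B ≤ X.B * X.B * X.r := Nat.le_mul_of_pos_right _ hr1
    calc X.B * X.B < 13 + 3 * (X.B * X.B * X.r) := by omega
      _ ≤ _ := Nat.le_mul_of_pos_right _ (by omega)
  refine WP.seq (WP.mono (WP.for' (N := X.B * X.B) (fun i h₂ t => h₂.var .i = i ∧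
    i ≤ X.B * X.B ∧ ∃ hs' fnd dd, X.Inv E hs' h₂ ∧ X.Vec vec fnd h₂ ∧
    h₂.var .dead = Bool.toNat dd ∧ (∀ c, (hs' c).length ≤ (hs c).length + if c < i then 4 else 0) ∧
    (∀ a, fnd a = true → a < X.n) ∧
    t + 200 * X.total E hs ≤ 200 * X.total E hs' +
      400 * (X.k * X.k) * (X.count fnd + dd.toNat) +
        i * (5000 * (X.r * (X.r + X.k)) + 50) + 10 ∧
    ((∀ c < i, X.AllRight E c (hs c) (X.idealFour vec c)) → fnd = X.ideal vec i ∧ dd = false ∧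
      ∀ c, hs' c = if c < i then hs c ++ X.idealFour vec c else hs c))
    (Q := fun h₂ t => ∃ hs' fnd, X.Inv E hs' h₂ ∧ X.Vec vec fnd h₂ ∧
      (∀ c < X.B * X.B, (hs' c).length ≤ (hs c).length + 4) ∧
      t + 200 * X.total E hs ≤ 200 * X.total E hs' + 400 * (X.k * X.k) * (X.n + 1) +
        X.B * X.B * (5000 * (X.r * (X.r + X.k)) + 50) + 10 ∧
      ((∀ c < X.B * X.B, X.AllRight E c (hs c) (X.idealFour vec c)) →
        fnd = X.ideal vec (X.B * X.B) ∧
        ∀ c < X.B * X.B, hs' c = hs c ++ X.idealFour vec c)) ?_ ?_ ?_ ?_) ?_)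
  · refine ⟨by simp, by omega, hs, fun _ => false, false, I₂.frame (l := 1) (S := ∅)
      (.set (by decide) _) le_rfl (by simp) (by simp), ⟨V₁.vec, V₁.fnd⟩, by simp, by simp, by simp,
      by simp; omega, fun _ => ⟨rfl, rfl, by simp⟩⟩
  · rintro i h₂ t ⟨h1, h2, hs', fnd, dd, I, -⟩
    exact ⟨h1, h2, ⟨trivial, trivial, by
      show h₂.var .B * h₂.var .B < _; rw [I.static.B]; exact hBB⟩, by simp [I.static.B]⟩
  · rintro i hi h₂ t ⟨h1, h2, hs', fnd, dd, I, V, hd, hlen, hf, ht, hg⟩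
    have hli := hlen i
    simp only [lt_irrefl, if_false] at hli
    have := hl i hi
    refine (wp_block F S I hi h1 V hd (by omega)).mono ?_
    rintro h₃ t₃ ⟨f, hs'', fnd', dd', w⟩
    refine ⟨(f.var .i (by decide)).trans h1, by simp, by omega, hs'', fnd', dd',
      w.inv.frame (l := 1) (S := ∅) (.set (by decide) _) le_rfl (by simp) (by simp),
      ⟨w.vecs.vec, w.vecs.fnd⟩, by simpa using w.dead, fun c => ?_, ?_, ?_, fun hc => ?_⟩
    · have h5 := w.len c
      have h6 := hlen c
      by_cases hci : c = i
      · subst hci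
        simp at h5 h6 ⊢; omega
      · rw [if_neg hci] at h5
        have : c < i + 1 ↔ c < i := by omega
        simp only [this]; omega
    · rcases w.rows with h5 | h5 <;> rw [h5]
      · exact hf
      · intro a ha
        rcases Setup.step_iff.1 ha with h6 | ⟨-, c, -, h6, -⟩
        · exact hf a h6
        · exact (S.mat0 _ _ h6).1
    · have h5 := w.time
      rw [add_one_mul]
      simp only [Expr.cost_mul, Expr.cost_v]
      omega
    · obtain ⟨g1, g2, g3⟩ := hg fun c hci => hc c (by omega)
      have hsi := g3 i
      rw [if_neg (lt_irrefl i)] at hsi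
      have hci := hc i (by omega)
      obtain ⟨q1, q2, q3⟩ := w.good g2 (by rw [hsi, g1]; exact hci)
      refine ⟨by rw [q1, g1]; rfl, q2, fun c => ?_⟩
      rw [q3]
      by_cases hce : c = i
      · subst hce
        simp [hsi, g1, Setup.idealFour]
      · rw [Function.update_of_ne hce, g3 c]
        have : c < i + 1 ↔ c < i := by omega
        simp only [this]
  · rintro h₂ t ⟨-, -, hs', fnd, dd, I, V, hd, hlen, hf, ht, hg⟩
    refine ⟨hs', fnd, I, V, fun c hc => by have := hlen c; rwa [if_pos hc] at this, ?_,
      fun hc => ?_⟩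
    · have h5 : X.count fnd + dd.toNat ≤ X.n + 1 := by
        have := Setup.count_le hf
        cases dd <;> simp <;> omega
      have := Nat.mul_le_mul_left (400 * (X.k * X.k)) h5
      omega
    · obtain ⟨g1, g2, g3⟩ := hg hc
      exact ⟨g1, fun c hc => by rw [g3, if_pos hc]⟩
  -- the output
  rintro h₂ t₂ ⟨hs', fnd, I₃, V₃, hlen, ht₂, hg⟩
  refine WP.for' (N := X.n) (fun j h₃ t => h₃.var .j = j ∧ j ≤ X.n ∧ X.Inv E hs' h₃ ∧
    X.Vec vec fnd h₃ ∧ (∀ a < j, h₃.out a = (fnd a).toNat) ∧ t ≤ 30 * j + 10) ?_ ?_ ?_ ?_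
  · exact ⟨by simp, by omega, I₃.frame (l := 1) (S := ∅) (.set (by decide) _) le_rfl (by simp)
      (by simp), ⟨V₃.vec, V₃.fnd⟩, fun c h0 => by omega, by simp⟩
  · rintro j h₁ t ⟨h1, h2, I, -⟩
    exact ⟨h1, h2, trivial, I.static.n⟩
  · rintro j hj h₃ t ⟨h1, h2, I, V, h3, h4⟩
    have n3 := (Num.lit (E := E) (h := h₃) (u := 3) (hW (by omega))).ld
      (a := v .j) (u := j) ⟨trivial, h1⟩ (by omega) (F.addr (by norm_num) (by omega))
    rw [V.fnd j (by omega)] at n3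
    refine WP.outp trivial n3.1 ?_
    rw [n3.2, Expr.val_v, h1]
    refine ⟨by simp, by simp, by omega, (I.io E.inp _).frame (l := 1) (S := ∅) (.set (by decide) _)
      le_rfl (by simp) (by simp), ⟨V.vec, V.fnd⟩, fun a ha => ?_, ?_⟩
    · simp only [HS.set_out, Function.update_apply]
      split_ifs with hc
      · rw [hc]
      · exact h3 a (by omega)
    · simp; omega
  · rintro h₃ t ⟨-, -, I, V, h3, h4⟩
    refine ⟨hs', I, hlen, ?_, fun hc => ?_⟩
    · simp only [Expr.cost_lit]
      omega
    · obtain ⟨g1, g2⟩ := hg hc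
      refine ⟨fun a ha => ?_, g2⟩
      rw [h3 a ha, g1]
      congr 1
      rw [Bool.eq_iff_iff, decide_eq_true_eq]
      exact Setup.ideal_all F S ha

end

/-! ### The preprocessing -/

/-- The expression for the presence of the edge between slot `x` and vertex `y` in the initial
graph. -/
def slotE (pol : Bool) (τ : ℕ) (x y : Var) : Expr :=
  if pol then lit 0 else and' (lt' (v x) (lit 2 * v .k)) (eq' (v y) (hubE x τ))

/-- The expression for the adjacency of the vertices `a` and `b` in the initial graph. -/
def adjE (relE : Var → Var → Expr) (pol : Bool) (τ : ℕ) : Expr :=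
  .ite (eq' (v .a) (v .b)) (lit 0) (.ite
    (or' (or' (relE .a .b) (slotE pol τ .a .b)) (or' (relE .b .a) (slotE pol τ .b .a)))
    (lit 1) (lit 0))

/-- The initial graph of the machines of block `i`, as an input array in area `7`. -/
def graphProg (relE : Var → Var → Expr) (pol : Bool) (τ cm : ℕ) : Prog :=
  sto (lit 7) (lit 0) (v .N) ;; sto (lit 7) (lit 1) (lit cm * v .k) ;;
  for' .j (v .N * v .N) (asg .a (v .j / v .N) ;; asg .b (v .j % v .N) ;;
    sto (lit 7) (lit 2 + v .j) (adjE relE pol τ))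

/-- The adjacency matrix in the input array, indexed by quotient and remainder. -/
lemma graphInput_adj {N : ℕ} (G : SimpleGraph (Fin N)) (s : ℕ) (f : ℕ → ℕ → Prop)
    (hf : ∀ u v : Fin N, G.Adj u v ↔ f u v) {j : ℕ} (hj : j < N * N)
    [Decidable (f (j / N) (j % N))] :
    graphInput G s (2 + j) = if f (j / N) (j % N) then 1 else 0 := by
  have hN : 0 < N := Nat.pos_of_ne_zero fun h => by simp [h] at hj
  have h1 : j / N < N := Nat.div_lt_of_lt_mul hj
  have h2 : j % N < N := Nat.mod_lt _ hN
  have key : (∃ u v : Fin N, 2 + j = 2 + u * N + v ∧ G.Adj u v) ↔ f (j / N) (j % N) := by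
    constructor
    · rintro ⟨u, v, e, h⟩
      have e' : j = N * u + v := by rw [mul_comm N]; omega
      have e1 : j / N = u := by rw [e', Nat.mul_add_div hN, Nat.div_eq_of_lt v.2, add_zero]
      have e2 : j % N = v := by rw [e', Nat.mul_add_mod, Nat.mod_eq_of_lt v.2]
      rw [e1, e2]
      exact (hf u v).1 h
    · intro h
      refine ⟨⟨_, h1⟩, ⟨_, h2⟩, ?_, (hf _ _).2 h⟩
      have := Nat.div_add_mod' j N
      simp only; omega
  unfold graphInput
  rw [if_neg (by omega), if_neg (by omega)]
  by_cases h : f (j / N) (j % N)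
  · rw [if_pos (key.2 h), if_pos h]
  · rw [if_neg (mt key.1 h), if_neg h]

lemma graphInput_large {N : ℕ} (G : SimpleGraph (Fin N)) (s : ℕ) {a : ℕ} (h2 : 2 ≤ a)
    (ha : 2 + N * N ≤ a) : graphInput G s a = 0 := by
  unfold graphInput
  rw [if_neg (by omega), if_neg (by omega), if_neg]
  rintro ⟨u, v, e, -⟩
  have : (u : ℕ) * N + v < N * N := by
    calc (u : ℕ) * N + v < u * N + N := by omega
      _ = (u + 1) * N := by ring
      _ ≤ N * N := Nat.mul_le_mul_right _ u.2
  omega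

section
variable {X : Setup} {E : Env} {h h' : HS} {blk j : ℕ}

lemma Num.ite {c a b : Expr} {p : Prop} [Decidable p] {u u' : ℕ} (hc : Is E h c p)
    (ha : p → Num E h a u) (hb : ¬ p → Num E h b u') :
    Num E h (.ite c a b) (if p then u else u') := by
  unfold Num Is at *
  simp only [ok_ite, val_ite, hc.2, hc.1, true_and]
  refine ⟨⟨fun hp => (ha hp).1, fun h0 => (hb fun hp => hc.2.2 hp h0).1⟩, ?_⟩
  split_ifs with hp
  · exact (ha hp).2
  · exact (hb hp).2

/-- The input of the machines is a graph that is computed by `relE`. -/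
structure Setup.Input (X : Setup) (e cm : ℕ) (rel : ℕ → (ℕ → ℕ → Bool) → ℕ → ℕ → Prop)
    (relE : Var → Var → Expr) : Prop where
  N : X.N = 2 ^ e * X.k ^ 2
  inp : ∀ blk, X.inp blk =
    graphInput (slotGraph X.N X.k X.τ (rel X.k (X.block blk)) fun _ => !X.mach.pol) (cm * X.k)
  rel : Computes e rel relE

lemma slotE_is (F : X.Fits E) (s : X.Static E h) (hk : X.k ≤ X.H) (pol : Bool) (x y : Var)
    {p q : ℕ} (hp : Num E h (v x) p) (hq : Num E h (v y) q) :
    Is E h (slotE pol X.τ x y) (p < 2 * X.k ∧ (!pol) = true ∧ q = hub X.k X.τ p) := by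
  have hH4 := F.H4
  have hW : ∀ {u : ℕ}, u ≤ E.W → u < 2 ^ E.w := fun hu => F.lt_pow (by omega)
  cases pol
  · have nk : Num E h (v .k) X.k := ⟨trivial, s.k⟩
    have h2k := (Num.lit (E := E) (h := h) (u := 2) (hW (by omega))).mul nk (hW (by omega))
    have := (Is.lt hp h2k).and fun _ => Is.eq hq (num_hub F s hk hp)
    simpa [slotE] using this
  · exact ⟨(Num.lit (u := 0) (hW (by omega))).1, by simp [slotE]⟩

/-- The initial graph is computed in time `O(N ^ 2)`. -/
lemma wp_graph {e cm : ℕ} {rel : ℕ → (ℕ → ℕ → Bool) → ℕ → ℕ → Prop} {relE : Var → Var → Expr}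
    (F : X.Fits E) (G : X.Input e cm rel relE) (hcm : cm * X.k ≤ E.W ∧ cm ≤ E.W) (A : X.At blk h)
    (s : X.Static E h) (h7 : ∀ a, 2 + X.N * X.N ≤ a → h.mem 7 a = 0) :
    WP E (graphProg relE X.mach.pol X.τ cm) h fun h' t =>
      t ≤ X.N * X.N * ((adjE relE X.mach.pol X.τ).cost + 40) + 50 ∧ Frame 4 {7} h h' ∧
      h'.var .PH = h.var .PH ∧ ∀ a, h'.mem 7 a = X.inp blk a := by
  classical
  have hH := F.H4
  have hN2 := F.N2
  have hkH := F.kH A.hb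
  have hk1 := F.hk
  have hW : ∀ {u : ℕ}, u ≤ E.W → u < 2 ^ E.w := fun hu => F.lt_pow (by omega)
  have hN0 : 0 < X.N := by rw [G.N]; positivity
  have hNN : X.N ≤ X.N * X.N := Nat.le_mul_of_pos_left _ hN0
  have l7 : ∀ {h' : HS}, Num E h' (lit 7) 7 := Num.lit (hW (by omega))
  refine WP.seq (WP.stoN l7 (Num.lit (u := 0) (hW (by omega))) ⟨trivial, s.N⟩ (by omega)
    (F.addr (by norm_num) (by omega)) ?_)
  have nk : Num E (h.put 7 0 X.N) (v .k) X.k := ⟨trivial, s.k⟩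
  refine WP.seq (WP.stoN l7 (Num.lit (u := 1) (hW (by omega)))
    ((Num.lit (hW hcm.2)).mul nk (hW hcm.1)) (by omega) (F.addr (by norm_num) (by omega)) ?_)
  set h₂ := (h.put 7 0 X.N).put 7 1 (cm * X.k) with e₂
  have f₂ : Frame 4 {7} h h₂ := (Frame.put (by simp)).trans (.put (by simp))
  have st : ∀ {h₁ : HS}, Frame 4 {7} h h₁ → X.Static E h₁ := fun f =>
    s.frame f (by norm_num) (by simp) (by simp) (by simp) fun a _ => by rw [f.mem 5 (by simp)]
  refine WP.for' (N := X.N * X.N) (fun i h₁ t => h₁.var .j = i ∧ i ≤ X.N * X.N ∧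
    Frame 4 {7} h h₁ ∧ h₁.var .PH = h.var .PH ∧
    (∀ a, a < 2 + i ∨ 2 + X.N * X.N ≤ a → h₁.mem 7 a = X.inp blk a) ∧
    t ≤ i * ((adjE relE X.mach.pol X.τ).cost + 40) + 15) ?_ ?_ ?_ ?_
  · refine ⟨by simp, by omega, f₂.trans (.set (by decide) _), by simp [e₂], ?_, by simp⟩
    rintro a ha
    simp only [e₂, HS.set_mem, HS.put_mem, true_and]
    rcases ha with ha | ha
    · interval_cases a <;> simp [G.inp, graphInput]
    · rw [if_neg (by omega), if_neg (by omega), h7 a ha, G.inp,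
        graphInput_large _ _ (by omega) ha]
  · rintro i h₁ t ⟨h1, h2, f, -⟩
    have nN : Num E h₁ (v .N) X.N := ⟨trivial, (st f).N⟩
    have := nN.mul nN (hW (by omega))
    exact ⟨h1, h2, this.1, this.2⟩
  · rintro i hi h₁ t ⟨h1, h2, f, hPH, h3, h4⟩
    have nN : ∀ {h₁ : HS}, Frame 4 {7} h h₁ → Num E h₁ (v .N) X.N := fun f => ⟨trivial, (st f).N⟩
    refine WP.seq (WP.asgN (Num.div ⟨trivial, h1⟩ (nN f)) ?_)
    have f₃ : Frame 4 {7} h (h₁.set .a (i / X.N)) := f.trans (.set (by decide) _)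
    refine WP.seq (WP.asgN (u := i % X.N) (Num.mod ⟨trivial, by simpa using h1⟩ (nN f₃)) ?_)
    set h₄ := (h₁.set .a (i / X.N)).set .b (i % X.N) with e₄
    have f₄ : Frame 4 {7} h h₄ := f₃.trans (.set (by decide) _)
    have s₄ := st f₄
    have M₄ := Setup.matCtx F (A.frame f₄ (by norm_num)) s₄
    have uN : i / X.N < X.N := Nat.div_lt_of_lt_mul hi
    have vN : i % X.N < X.N := Nat.mod_lt _ hN0
    have va : h₄.var .a = i / X.N := by simp [e₄]
    have vb : h₄.var .b = i % X.N := by simp [e₄]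
    have na : Num E h₄ (v .a) (i / X.N) := ⟨trivial, va⟩
    have nb : Num E h₄ (v .b) (i % X.N) := ⟨trivial, vb⟩
    have big : 2 ^ (e + 3) * X.k ^ 2 ≤ 2 ^ E.w := by
      have : 2 ^ (e + 3) * X.k ^ 2 = 8 * X.N := by rw [G.N]; ring
      rw [this]
      exact (F.lt_pow (a := 8 * X.N) (by omega)).le
    have h1w : 1 < 2 ^ E.w := hW (by omega)
    have r1 := G.rel E X.k _ h₄ hk1 M₄ big .a .b (by rw [va, ← G.N]; exact uN)
      (by rw [vb, ← G.N]; exact vN)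
    have r2 := G.rel E X.k _ h₄ hk1 M₄ big .b .a (by rw [vb, ← G.N]; exact vN)
      (by rw [va, ← G.N]; exact uN)
    rw [va, vb] at r1 r2
    have s1 := slotE_is F s₄ hkH X.mach.pol .a .b na nb
    have s2 := slotE_is F s₄ hkH X.mach.pol .b .a nb na
    have n0 : Num E h₄ (lit 0) 0 := Num.lit (hW (by omega))
    have n1 : Num E h₄ (lit 1) 1 := Num.lit (hW (by omega))
    have nE := Num.ite (Is.eq na nb) (fun _ => n0) fun _ =>
      Num.ite (Is.or h1w (Is.or h1w r1 fun _ => s1) fun _ => Is.or h1w r2 fun _ => s2)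
        (fun _ => n1) fun _ => n0
    refine WP.stoN l7 ((Num.lit (u := 2) (hW (by omega))).add (b := v .j) (v := i)
      ⟨trivial, by simpa [e₄] using h1⟩ (hW (by omega))) nE (by omega)
      (F.addr (by norm_num) (by omega)) ?_
    refine ⟨by simpa [e₄] using h1, by simp, by omega, (f₄.trans (.put (by simp))).trans
      (.set (by decide) _), by simpa [e₄] using hPH, fun a ha => ?_, ?_⟩
    · rw [HS.set_mem, HS.put_mem]
      by_cases hai : a = 2 + i
      · subst hai
        rw [if_pos ⟨rfl, rfl⟩, G.inp, graphInput_adj _ _ (fun u v => u ≠ v ∧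
          ((rel X.k (X.block blk) u v ∨ (u < 2 * X.k ∧ (!X.mach.pol) = true ∧ v = hub X.k X.τ u)) ∨
          (rel X.k (X.block blk) v u ∨ (v < 2 * X.k ∧ (!X.mach.pol) = true ∧
            u = hub X.k X.τ v)))) (fun u v => by rw [slotGraph_adj, Ne, Fin.ext_iff]) hi]
        by_cases hne : i / X.N = i % X.N
        · simp [hne]
        · simp only [hne, ne_eq, not_false_eq_true, true_and, if_false]
      · rw [if_neg (by simpa using hai)]
        exact h3 a (by omega)
    · rw [add_one_mul]
      simp [adjE] at h4 ⊢
      omega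
  · rintro h₁ t ⟨-, -, f, hPH, h3, h4⟩
    exact ⟨by simp only [Expr.cost_lit, Expr.cost_v, Expr.cost_mul]; omega, f, hPH,
      fun a => h3 a (by omega)⟩

end

/-- The preprocessing of the machines of block `i`. -/
def startProg (M : Machine) (R : ℕ) : Prog :=
  for' .j (v .r) (asg .Z (lit 9 + lit 3 * (v .i * v .r + v .j)) ;; asg .inA (lit 7) ;;
    sim true R M.prep)

/-- The preprocessing when the parameters are known: a table of random words, the matrix, and the
machines. -/
def buildProg (relE : Var → Var → Expr) (M : Machine) (R τ cm : ℕ) : Prog :=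
  for' .i (v .T * v .r) (rnd .t1 ;; sto (lit 0) (v .i) (v .t1 % v .msk)) ;;
  for' .i (v .n * v .n)
    (sto (lit 1) (v .i / v .n * v .H + v .i % v .n) (inp (lit 1 + v .i))) ;;
  asg .PH (lit 1) ;;
  for' .i (v .B * v .B) (asg .x (v .i / v .B) ;; asg .y (v .i % v .B) ;;
    graphProg relE M.pol τ cm ;; startProg M R)

/-- The parameters are known. -/
structure Setup.Vars (X : Setup) (h : HS) : Prop where
  n : h.var .n = X.n
  k : h.var .k = X.k
  B : h.var .B = X.B
  H : h.var .H = X.H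
  N : h.var .N = X.N
  msk : h.var .msk = 2 ^ X.w'
  r : h.var .r = X.r
  T : h.var .T = X.T

section
variable {X : Setup} {E : Env} {h h' : HS} {blk j : ℕ}

lemma Setup.Vars.keep (v : X.Vars h) (hv : ∀ x : Var, x.lev = 0 → h'.var x = h.var x) :
    X.Vars h' := by
  refine ⟨?_, ?_, ?_, ?_, ?_, ?_, ?_, ?_⟩ <;> rw [hv _ rfl]
  exacts [v.n, v.k, v.B, v.H, v.N, v.msk, v.r, v.T]

/-- All random words are drawn in advance. Word `i * r + j` becomes word `i` of copy `j`, so that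
the copies are independent and each of them sees the same words in every round. -/
lemma wp_coins (F : X.Fits E) (V : X.Vars h) (hpos : h.pos = 0) :
    WP E (for' .i (v .T * v .r) (rnd .t1 ;; sto (lit 0) (v .i) (v .t1 % v .msk))) h fun h' t =>
      t ≤ 30 * (X.T * X.r) + 10 ∧ X.Vars h' ∧ (∀ z, z ≠ 0 → h'.mem z = h.mem z) ∧
      ∀ i < X.T * X.r, h'.mem 0 i = E.ω i % 2 ^ X.w' := by
  have hH := F.H4
  have hT := F.T2
  have hW : ∀ {u : ℕ}, u ≤ E.W → u < 2 ^ E.w := fun hu => F.lt_pow (by omega)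
  refine WP.for' (N := X.T * X.r) (fun i h₁ t => h₁.var .i = i ∧ i ≤ X.T * X.r ∧ h₁.pos = i ∧
    X.Vars h₁ ∧ (∀ z, z ≠ 0 → h₁.mem z = h.mem z) ∧
    (∀ a < i, h₁.mem 0 a = E.ω a % 2 ^ X.w') ∧ t ≤ 30 * i + 10) ?_ ?_ ?_ ?_
  · exact ⟨by simp, by omega, by simpa using hpos, V.keep fun x hx => by
      rw [HS.set_var, if_neg]; rintro rfl; simp [Var.lev] at hx, fun _ _ => rfl,
      fun a h0 => by omega, by simp⟩
  · rintro i h₁ t ⟨h1, h2, -, V, -⟩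
    have nT : Num E h₁ (v .T) X.T := ⟨trivial, V.T⟩
    have := nT.mul (b := v .r) ⟨trivial, V.r⟩ (hW hT)
    exact ⟨h1, h2, this.1, this.2⟩
  · rintro i hi h₁ t ⟨h1, h2, hp, V, h3, h4, h5⟩
    refine WP.seq (WP.rnd ?_)
    set h₂ : HS := { h₁.set .t1 (E.ω h₁.pos) with pos := h₁.pos + 1 } with e₂
    have v₂ : ∀ x, h₂.var x = if x = .t1 then (E.ω h₁.pos : ℕ) else h₁.var x := fun x => by
      simp [e₂]
    refine WP.stoN (i := 0) (u := i) (x' := E.ω i % 2 ^ X.w') (Num.lit (hW (by omega)))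
      ⟨trivial, by rw [Expr.val_v, v₂]; simpa using h1⟩
      (Num.mod ⟨trivial, by rw [Expr.val_v, v₂, hp]; simp⟩
        ⟨trivial, by rw [Expr.val_v, v₂]; simpa using V.msk⟩) (by omega)
      (F.addr (by norm_num) (by omega)) ?_
    refine ⟨by rw [HS.put_var, v₂]; simpa using h1, by simp, by omega, by simp [e₂, hp],
      V.keep fun x hx => ?_,
      fun z hz => ?_, fun a ha => ?_, ?_⟩
    · rw [HS.set_var, if_neg (by rintro rfl; simp [Var.lev] at hx), HS.put_var, v₂,
        if_neg (by rintro rfl; simp [Var.lev] at hx)]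
    · rw [HS.set_mem, HS.put_mem_ne _ hz]; exact h3 z hz
    · simp only [HS.set_mem, HS.put_mem, true_and]
      split_ifs with hc
      · rw [hc]
      · exact h4 a (by omega)
    · simp; omega
  · rintro h₁ t ⟨-, -, -, V, h3, h4, h5⟩
    exact ⟨h5, V, h3, h4⟩

/-- The matrix is copied and extended by zeros to the size `H`. -/
lemma wp_matrix (F : X.Fits E) (S : X.Sound) (V : X.Vars h)
    (hE : ∀ i < X.n * X.n, E.inp (1 + i) = (X.mat (i / X.n) (i % X.n)).toNat)
    (hm : ∀ a, h.mem 1 a = 0) :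
    WP E (for' .i (v .n * v .n)
      (sto (lit 1) (v .i / v .n * v .H + v .i % v .n) (inp (lit 1 + v .i)))) h fun h' t =>
      t ≤ 40 * (X.n * X.n) + 10 ∧ Frame 1 {1} h h' ∧
      ∀ a < X.H, ∀ b < X.H, h'.mem 1 (a * X.H + b) = (X.mat a b).toNat := by
  have hH := F.H4
  have hn := F.hn
  have hH2 := F.H2
  have hnn : X.n * X.n ≤ X.H * X.H := Nat.mul_le_mul hn hn
  have hW : ∀ {u : ℕ}, u ≤ E.W → u < 2 ^ E.w := fun hu => F.lt_pow (by omega)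
  refine WP.for' (N := X.n * X.n) (fun i h₁ t => h₁.var .i = i ∧ i ≤ X.n * X.n ∧
    Frame 1 {1} h h₁ ∧ (∀ a < X.H, ∀ b < X.H, h₁.mem 1 (a * X.H + b) =
      if a < X.n ∧ b < X.n ∧ a * X.n + b < i then (X.mat a b).toNat else 0) ∧
    t ≤ 40 * i + 10) ?_ ?_ ?_ ?_
  · exact ⟨by simp, by omega, .set (by decide) _, fun a _ b _ => by simp [hm], by simp⟩
  · rintro i h₁ t ⟨h1, h2, f, -⟩
    have V₁ := V.keep fun x hx => f.var x (by omega)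
    have nn : Num E h₁ (v .n) X.n := ⟨trivial, V₁.n⟩
    have := nn.mul nn (hW (by omega))
    exact ⟨h1, h2, this.1, this.2⟩
  · rintro i hi h₁ t ⟨h1, h2, f, h3, h4⟩
    have V₁ := V.keep fun x hx => f.var x (by omega)
    have hn0 : 0 < X.n := Nat.pos_of_ne_zero fun h => by simp [h] at hi
    have nn : Num E h₁ (v .n) X.n := ⟨trivial, V₁.n⟩
    have ni : Num E h₁ (v .i) i := ⟨trivial, h1⟩
    have nH : Num E h₁ (v .H) X.H := ⟨trivial, V₁.H⟩
    have ud : i / X.n < X.n := Nat.div_lt_of_lt_mul hi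
    have um : i % X.n < X.n := Nat.mod_lt _ hn0
    have uW : i / X.n * X.H + i % X.n < X.H * X.H := by
      calc _ < i / X.n * X.H + X.H := by omega
        _ = (i / X.n + 1) * X.H := by ring
        _ ≤ _ := Nat.mul_le_mul_right _ (by omega)
    have hmat : (X.mat (i / X.n) (i % X.n)).toNat ≤ 1 := Bool.toNat_le _
    have ninp : Num E h₁ (inp (lit 1 + v .i)) (X.mat (i / X.n) (i % X.n)).toNat := by
      have := (Num.lit (E := E) (h := h₁) (u := 1) (hW (by omega))).add ni (hW (by omega))
      refine ⟨this.1, ?_⟩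
      rw [Expr.val_inp, this.2, hE i hi]
      exact Nat.mod_eq_of_lt (hW (by omega))
    refine WP.stoN (Num.lit (u := 1) (hW (by omega))) (((ni.div nn).mul nH (hW (by omega))).add
      (ni.mod nn) (hW (by omega))) ninp (by omega) (F.addr (by norm_num) (by omega)) ?_
    refine ⟨h1, by simp, by omega, (f.trans (.put (by simp))).trans (.set (by decide) _),
      fun a ha b hb => ?_, ?_⟩
    · simp only [HS.set_mem, HS.put_mem, true_and]
      have hi' := Nat.div_add_mod' i X.n
      by_cases hc : a = i / X.n ∧ b = i % X.n
      · obtain ⟨rfl, rfl⟩ := hc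
        rw [if_pos rfl, if_pos ⟨ud, um, by omega⟩]
      · have h5 : ¬ a * X.H + b = i / X.n * X.H + i % X.n := by
          intro e
          have e1 := congrArg (· / X.H) e
          have e2 := congrArg (· % X.H) e
          simp only [mul_comm _ X.H, Nat.mul_add_div (by omega : 0 < X.H), Nat.mul_add_mod,
            Nat.div_eq_of_lt hb, Nat.mod_eq_of_lt hb, Nat.div_eq_of_lt (um.trans_le hn),
            Nat.mod_eq_of_lt (um.trans_le hn)] at e1 e2
          exact hc ⟨by omega, e2⟩
        rw [if_neg h5, h3 a ha b hb]
        refine if_congr ?_ rfl rfl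
        refine and_congr_right fun han => and_congr_right fun hbn => ?_
        have h6 : a * X.n + b ≠ i := by
          intro e
          refine hc ⟨?_, ?_⟩ <;> rw [← e, mul_comm]
          · rw [Nat.mul_add_div hn0, Nat.div_eq_of_lt hbn, add_zero]
          · rw [Nat.mul_add_mod, Nat.mod_eq_of_lt hbn]
        omega
    · simp; omega
  · rintro h₁ t ⟨-, -, f, h3, h4⟩
    refine ⟨h4, f, fun a ha b hb => ?_⟩
    rw [h3 a ha b hb]
    split_ifs with hc
    · rfl
    · cases hab : X.mat a b
      · rfl
      · obtain ⟨h5, h6⟩ := S.mat0 _ _ hab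
        refine absurd ⟨h5, h6, ?_⟩ hc
        calc a * X.n + b < (a + 1) * X.n := by rw [add_one_mul]; omega
          _ ≤ _ := Nat.mul_le_mul_right _ h5

/-- The machines before copy `j` of block `blk` are ready, and the areas of the others are empty. -/
def Setup.Ready (X : Setup) (E : Env) (blk j : ℕ) (h : HS) : Prop :=
  ∀ c < X.B * X.B, ∀ d < X.r,
    (c < blk ∨ (c = blk ∧ d < j) → InstRep X.R X.w' h (X.Z c d) (X.S E c d [])) ∧
    (¬ (c < blk ∨ (c = blk ∧ d < j)) → ∀ q, h.mem (X.Z c d) q = 0 ∧ h.mem (X.Z c d + 2) q = 0)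

lemma Setup.Ready.frame (r : X.Ready E blk j h) {l : ℕ} {S : Set ℕ} (f : Frame l S h h')
    (hS : ∀ z ∈ S, z < 9) (hp : h'.var .PH = h.var .PH) : X.Ready E blk j h' := by
  intro c hc d hd
  have h1 : ∀ e, h'.mem (X.Z c d + e) = h.mem (X.Z c d + e) := fun e =>
    f.mem _ fun hz => by have := hS _ hz; unfold Setup.Z at this; omega
  refine ⟨fun q => ((r c hc d hd).1 q).keep (h1 0) (h1 2) hp.ge, fun q => ?_⟩
  rw [h1 2, show h'.mem (X.Z c d) = _ from h1 0]
  exact (r c hc d hd).2 q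

/-- The machines of a block are preprocessed with direct writes, which no rollback undoes. -/
lemma wp_start (F : X.Fits E) (s : X.Static E h) (hb : blk < X.B * X.B) (iv : h.var .i = blk)
    (hPH : h.var .PH = 1) (m4 : ∀ a, h.mem 4 a = 0) (m7 : ∀ a, h.mem 7 a = X.inp blk a)
    (hR : X.Ready E blk 0 h) :
    WP E (startProg X.mach X.R) h fun h' t =>
      t ≤ 200 * ∑ j ∈ Finset.range X.r, X.tm E blk j [] + 50 * X.r + 10 ∧
      Frame 4 {z | 9 ≤ z} h h' ∧ h'.var .PH = 1 ∧ X.Ready E blk X.r h' := by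
  have hH := F.H4
  have hr2 := F.r2
  have hW : ∀ {u : ℕ}, u ≤ E.W → u < 2 ^ E.w := fun hu => F.lt_pow (by omega)
  refine WP.for' (N := X.r) (fun j h₁ t => h₁.var .j = j ∧ j ≤ X.r ∧ Frame 4 {z | 9 ≤ z} h h₁ ∧
    h₁.var .PH = 1 ∧ X.Ready E blk j h₁ ∧
    t ≤ 200 * ∑ i ∈ Finset.range j, X.tm E blk i [] + 50 * j + 10) ?_ ?_ ?_ ?_
  · exact ⟨by simp, by omega, .set (by decide) _, by simpa using hPH,
      hR.frame (l := 4) (S := ∅) (.set (by decide) _) (by simp) (by simp), by simp⟩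
  · rintro j h₁ t ⟨h1, h2, f, -⟩
    exact ⟨h1, h2, trivial, by rw [Expr.val_v, f.var .r (by decide), s.r]⟩
  · rintro j hj h₁ t ⟨h1, h2, f, h3, h4, h5⟩
    have s₁ := s.frame f (by norm_num) (by simp) (by simp) (by simp)
      fun a _ => by rw [f.mem 5 (by simp)]
    have hZv : 9 + 3 * (blk * X.r + j) < 2 ^ E.w := by
      have := F.Z_addr hb hj
      unfold Setup.Z at this
      have h1 : 9 + 3 * (blk * X.r + j) + 3 ≤ (9 + 3 * (blk * X.r + j) + 3) * E.W :=
        Nat.le_mul_of_pos_right _ (by omega)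
      omega
    have hi : Num E h₁ (v .i) blk := ⟨trivial, (f.var .i (by decide)).trans iv⟩
    have hr : Num E h₁ (v .r) X.r := ⟨trivial, s₁.r⟩
    have hj' : Num E h₁ (v .j) j := ⟨trivial, h1⟩
    refine WP.seq (WP.asgN (u := X.Z blk j) ((Num.lit (hW (by omega))).add
      ((Num.lit (hW (by omega))).mul ((hi.mul hr (by omega)).add hj' (by omega)) (by omega))
      (by omega)) ?_)
    refine WP.seq (WP.asgN (u := 7) (Num.lit (hW (by omega))) ?_)
    set h₃ := (h₁.set .Z (X.Z blk j)).set .inA 7 with e₃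
    have f₃ : Frame 5 ∅ h₁ h₃ := (Frame.set (by decide) _).trans (.set (by decide) _)
    have a₃ : X.Asking E blk j (fun _ => false) h₃ :=
      ⟨s₁.frame f₃ (by norm_num) (by simp) (by simp) (by simp)
        fun a _ => by rw [f₃.mem 5 (by simp)],
        hb, hj, by simpa [e₃] using h1, by simp [e₃], fun p _ => by
          rw [f₃.mem 4 (by simp), f.mem 4 (by simp), m4]; rfl⟩
    have z₃ : h₃.var .Z = X.Z blk j := a₃.Z
    have ph₃ : h₃.var .PH = 1 := by simpa [e₃] using h3
    have i₃ : h₃.var .inA = 7 := by simp [e₃]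
    have c₃ : SimCtx E X.R X.w' X.T (X.str E j) (X.inp blk) h₃ :=
      a₃.simCtx F (by rw [i₃]; norm_num) fun q => by
        rw [i₃, f₃.mem 7 (by simp), f.mem 7 (by simp), m7]
    have z0 := (h4 blk hb j hj).2 (by omega)
    have r₃ : SimRep true X.R X.w' h₃ State.zero := by
      refine ⟨fun q hq => ?_, (State.zero_bdd _).1, fun _ q => ?_⟩
      · have e2 : h₃.mem (X.Z blk j + 2) q = 0 := (z0 q).2
        have e0 : h₃.mem (X.Z blk j) q = 0 := (z0 q).1
        rw [view, z₃, ph₃, e2, if_neg (by norm_num), e0]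
        simp [State.enc, State.zero]
      · have e2 : h₃.mem (X.Z blk j + 2) q = 0 := (z0 q).2
        rw [z₃, ph₃, e2]; norm_num
    have htm : X.tm E blk j [] ≤ X.T := X.tm_le F (by simp)
    refine (wp_sim F.prep ((X.sv blk).prep (X.str E j)) (by
      rw [State.zero, zero_add]; exact htm) c₃
      r₃).mono ?_
    rintro h₄ t₄ ⟨l₄, f₄, r₄⟩
    have g₄ := f₄.toFrame
    rw [z₃] at g₄
    have p₄ : h₄.var .PH = 1 := (g₄.var .PH (by decide)).trans ph₃
    have d₄ := (f₄.direct rfl).2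
    rw [z₃] at d₄
    have zz₄ : h₄.var .Z = X.Z blk j := (g₄.var .Z (by decide)).trans z₃
    refine ⟨(g₄.var .j (by decide)).trans a₃.jv, by simp, by omega,
      ((f.trans (f₃.weaken (by norm_num) (by simp))).trans (g₄.weaken (by norm_num) ?_)).trans
        (.set (by decide) _),
      by simpa using p₄, ?_, ?_⟩
    · intro z hz
      simp only [Set.mem_insert_iff, Set.mem_singleton_iff, Set.mem_ofPred_eq] at hz ⊢
      unfold Setup.Z at hz
      omega
    · intro c hc d hd
      by_cases hcd : c = blk ∧ d = j
      · obtain ⟨rfl, rfl⟩ := hcd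
        refine ⟨fun _ => ⟨fun q hq => ?_, r₄.bdd, fun q => ?_⟩,
          fun hn => absurd (.inr ⟨rfl, by omega⟩) hn⟩
        · have := r₄.rep q hq
          rw [view, if_neg (r₄.stamp rfl q), zz₄] at this
          exact this
        · have e2 : h₃.mem (X.Z c d + 2) q = 0 := (z0 q).2
          rw [HS.set_mem, d₄, e2]; omega
      · have hiff : (c < blk ∨ (c = blk ∧ d < j + 1)) ↔ (c < blk ∨ (c = blk ∧ d < j)) := by omega
        rw [hiff]
        have hz : ∀ e < 3, h₄.mem (X.Z c d + e) = h₁.mem (X.Z c d + e) := by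
          intro e he
          rw [g₄.mem _ fun hz => ?_, f₃.mem _ (by simp)]
          simp only [Set.mem_insert_iff, Set.mem_singleton_iff] at hz
          have : ∃ e' < 3, X.Z c d + e = X.Z blk j + e' := by
            rcases hz with hz | hz | hz
            exacts [⟨0, by norm_num, by omega⟩, ⟨1, by norm_num, by omega⟩,
              ⟨2, by norm_num, by omega⟩]
          obtain ⟨e', he', h10⟩ := this
          exact hcd (Setup.Z_inj hd hj he he' h10)
        have hz0 : h₄.mem (X.Z c d) = _ := hz 0 (by norm_num)
        refine ⟨fun q => ((h4 c hc d hd).1 q).keep hz0 (hz 2 (by norm_num)) ?_, fun q => ?_⟩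
        · simp [p₄, h3]
        · rw [HS.set_mem, hz0, hz 2 (by norm_num)]
          exact (h4 c hc d hd).2 q
    · rw [Finset.sum_range_succ]
      unfold Setup.tm at h5 ⊢
      simp
      omega
  · rintro h₁ t ⟨-, -, f, h3, h4, h5⟩
    exact ⟨h5, f, h3, h4⟩

end

section
variable {X : Setup} {E : Env} {h h' : HS} {blk j : ℕ}

/-- When the parameters are known, the rest of the preprocessing establishes the invariant. -/
lemma wp_build {e cm : ℕ} {rel : ℕ → (ℕ → ℕ → Bool) → ℕ → ℕ → Prop} {relE : Var → Var → Expr}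
    (F : X.Fits E) (S : X.Sound) (G : X.Input e cm rel relE) (hcm : cm * X.k ≤ E.W ∧ cm ≤ E.W)
    (V : X.Vars h) (hm : ∀ z a, h.mem z a = 0) (hpos : h.pos = 0)
    (hE : ∀ i < X.n * X.n, E.inp (1 + i) = (X.mat (i / X.n) (i % X.n)).toNat) :
    WP E (buildProg relE X.mach X.R X.τ cm) h fun h' t => X.Inv E (fun _ => []) h' ∧
      t ≤ 200 * X.total E (fun _ => []) + 30 * (X.T * X.r) + 40 * (X.n * X.n) +
        X.B * X.B * (X.N * X.N * ((adjE relE X.mach.pol X.τ).cost + 40) + 50 * X.r + 150) +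
          100 := by
  have hH := F.H4
  have hr1 := F.hr
  have hW : ∀ {u : ℕ}, u ≤ E.W → u < 2 ^ E.w := fun hu => F.lt_pow (by omega)
  refine WP.seq ((wp_coins F V hpos).mono ?_)
  rintro h₁ t₁ ⟨l₁, V₁, m₁, c₁⟩
  refine WP.seq ((wp_matrix F S V₁ hE fun a => by rw [m₁ 1 (by norm_num), hm]).mono ?_)
  rintro h₂ t₂ ⟨l₂, f₂, c₂⟩
  have V₂ := V₁.keep fun x hx => f₂.var x (by omega)
  have m₂ : ∀ z a, z ≠ 0 → z ≠ 1 → h₂.mem z a = 0 := fun z a h0 h1 => by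
    rw [f₂.mem z (by simpa using h1), m₁ z h0, hm]
  have s₂ : X.Static E h₂ := ⟨V₂.n, V₂.k, V₂.B, V₂.H, V₂.N, V₂.msk, V₂.r, V₂.T,
    by rw [f₂.mem 0 (by simp)]; exact c₁, c₂, fun a _ => m₂ 5 a (by norm_num) (by norm_num),
    fun a => m₂ 6 a (by norm_num) (by norm_num)⟩
  refine WP.seq (WP.asgN (u := 1) (Num.lit (hW (by omega))) ?_)
  have hBB : X.B * X.B < 2 ^ E.w := by
    refine lt_of_lt_of_le ?_ F.area
    have h2 : X.B * X.B ≤ X.B * X.B * X.r := Nat.le_mul_of_pos_right _ hr1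
    calc X.B * X.B < 13 + 3 * (X.B * X.B * X.r) := by omega
      _ ≤ _ := Nat.le_mul_of_pos_right _ (by omega)
  refine WP.for' (N := X.B * X.B) (fun i h₃ t => h₃.var .i = i ∧ i ≤ X.B * X.B ∧ X.Static E h₃ ∧
    h₃.var .PH = 1 ∧ X.Ready E i 0 h₃ ∧ (∀ a, h₃.mem 4 a = 0) ∧
    (∀ a, 2 + X.N * X.N ≤ a → h₃.mem 7 a = 0) ∧
    t ≤ 200 * ∑ c ∈ Finset.range i, ∑ j ∈ Finset.range X.r, X.tm E c j [] +
      i * (X.N * X.N * ((adjE relE X.mach.pol X.τ).cost + 40) + 50 * X.r + 150) + 20)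
    ?_ ?_ ?_ ?_
  · refine ⟨by simp, by omega, ?_, by simp, ?_, fun a => m₂ 4 a (by norm_num) (by norm_num),
      fun a _ => m₂ 7 a (by norm_num) (by norm_num), by simp⟩
    · exact (s₂.frame (l := 5) (S := ∅) (h' := h₂.set .PH 1) (.set (by decide) _) (by norm_num)
        (by simp) (by simp) (by simp) fun _ _ => rfl).frame (l := 1) (S := ∅) (.set (by decide) _)
        le_rfl (by simp) (by simp) (by simp) fun _ _ => rfl
    · intro c hc d hd
      exact ⟨fun hn => by omega, fun _ q => ⟨m₂ _ q (by unfold Setup.Z; omega)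
        (by unfold Setup.Z; omega), m₂ _ q (by unfold Setup.Z; omega) (by unfold Setup.Z; omega)⟩⟩
  · rintro i h₃ t ⟨h1, h2, s, -⟩
    exact ⟨h1, h2, ⟨trivial, trivial, by
      show h₃.var .B * h₃.var .B < _; rw [s.B]; exact hBB⟩, by simp [s.B]⟩
  · rintro i hi h₃ t ⟨h1, h2, s, hPH, hR, m4, m7, ht⟩
    have nB : Num E h₃ (v .B) X.B := ⟨trivial, s.B⟩
    refine WP.seq (WP.asgN (Num.div ⟨trivial, h1⟩ nB) ?_)
    refine WP.seq (WP.asgN (u := i % X.B) (Num.mod ⟨trivial, by simpa using h1⟩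
      ⟨trivial, by simpa using s.B⟩) ?_)
    set h₄ := (h₃.set .x (i / X.B)).set .y (i % X.B) with e₄
    have f₄ : Frame 2 ∅ h₃ h₄ := (Frame.set (by decide) _).trans (.set (by decide) _)
    have A₄ : X.At i h₄ := ⟨hi, by simpa [e₄] using h1, by simp [e₄], by simp [e₄]⟩
    have s₄ := s.frame f₄ (by norm_num) (by simp) (by simp) (by simp) fun _ _ => rfl
    have p₄ : h₄.var .PH = 1 := by simpa [e₄] using hPH
    have R₄ := hR.frame f₄ (by simp) (p₄.trans hPH.symm)
    refine WP.seq ((wp_graph F G hcm A₄ s₄ m7).mono ?_)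
    rintro h₅ t₅ ⟨l₅, f₅, p₅, c₅⟩
    have s₅ := s₄.frame f₅ (by norm_num) (by simp) (by simp) (by simp)
      fun a _ => by rw [f₅.mem 5 (by simp)]
    refine (wp_start F s₅ hi (A₄.frame f₅ (by norm_num)).i (p₅.trans p₄)
      (fun a => by rw [f₅.mem 4 (by simp)]; exact m4 a) c₅
      (R₄.frame f₅ (by simp) p₅)).mono ?_
    rintro h₆ t₆ ⟨l₆, f₆, p₆, R₆⟩
    have s₆ := s₅.frame f₆ (by norm_num) (by simp) (by simp) (by simp)
      fun a _ => by rw [f₆.mem 5 (by simp)]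
    refine ⟨(f₆.var .i (by decide)).trans (A₄.frame f₅ (by norm_num)).i, by simp, by omega,
      s₆.frame (l := 1) (S := ∅) (.set (by decide) _) le_rfl (by simp) (by simp) (by simp)
        fun _ _ => rfl, by simpa using p₆, ?_, fun a => ?_, fun a ha => ?_, ?_⟩
    · have R₇ : X.Ready E (i + 1) 0 h₆ := by
        intro c hc d hd
        have hiff : (c < i + 1 ∨ (c = i + 1 ∧ d < 0)) ↔ (c < i ∨ (c = i ∧ d < X.r)) := by omega
        rw [hiff]
        exact R₆ c hc d hd
      exact R₇.frame (l := 1) (S := ∅) (.set (by decide) _) (by simp) (by simp)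
    · rw [HS.set_mem, f₆.mem 4 (by simp), f₅.mem 4 (by simp)]; exact m4 a
    · rw [HS.set_mem, f₆.mem 7 (by simp), c₅, G.inp, graphInput_large _ _ (by omega) ha]
    · rw [Finset.sum_range_succ, add_one_mul]
      simp only [Expr.cost_v, Expr.cost_mul, Expr.cost_div, Expr.cost_mod]
      omega
  · rintro h₃ t ⟨-, -, s, hPH, hR, m4, m7, ht⟩
    refine ⟨⟨s, fun c hc d hd => (hR c hc d hd).1 (.inl hc), by simp, by simp [hPH]⟩, ?_⟩
    have e : X.total E (fun _ => []) = ∑ c ∈ Finset.range (X.B * X.B), ∑ j ∈ Finset.range X.r,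
        X.tm E c j [] := rfl
    rw [e]
    simp only [Expr.cost_lit]
    omega

lemma Num.pow2 {b : Expr} {x : ℕ} (hb : Num E h b x) (hx : x < E.w) :
    Num E h (Expr.shl (Expr.lit 1) b) (2 ^ x) := by
  have h1 : 1 < 2 ^ E.w := Nat.one_lt_two_pow (by omega)
  have h2 : 2 ^ x < 2 ^ E.w := Nat.pow_lt_pow_right (by norm_num) hx
  unfold Num at *
  simp [hb, h1, h2]

end

/-- The computation of the parameters from the size of the matrix. -/
def paramProg (q e cw g₁ g₂ sW : ℕ) : Prog :=
  asg .n (inp (lit 0)) ;; asg .t1 (v .n) ;; asg .L (lit 0) ;;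
  whl (v .t1) (asg .t1 (v .t1 / lit 2) ;; asg .L (v .L + lit 1)) ;;
  asg .kap (v .L / lit q) ;; asg .k (shl (lit 1) (v .kap)) ;;
  asg .B (shl (lit 1) (v .L - v .kap)) ;; asg .H (shl (lit 1) (v .L)) ;;
  asg .N (shl (lit 1) (lit 2 * v .kap + lit e)) ;;
  asg .msk (shl (lit 1) (lit cw * (lit 2 * v .kap + lit (e + 1)))) ;;
  asg .r (lit 120 * v .L) ;; asg .T (shl (lit 1) (v .L + (lit g₁ * v .kap + lit g₂))) ;;
  asg .W (shl (lit 1) (lit sW * v .L))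

/-- The values that `paramProg` computes, where `L` is the length of the binary expansion of the
size `n` of the matrix. -/
structure Params (q e cw g₁ g₂ sW n L : ℕ) (h : HS) : Prop where
  n : h.var .n = n
  k : h.var .k = 2 ^ (L / q)
  B : h.var .B = 2 ^ (L - L / q)
  H : h.var .H = 2 ^ L
  N : h.var .N = 2 ^ (2 * (L / q) + e)
  msk : h.var .msk = 2 ^ (cw * (2 * (L / q) + (e + 1)))
  r : h.var .r = 120 * L
  T : h.var .T = 2 ^ (L + (g₁ * (L / q) + g₂))
  W : h.var .W = 2 ^ (sW * L)

/-- The parameters are powers of two, which makes them computable by shifts. -/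
lemma wp_param {q e cw g₁ g₂ sW n L : ℕ} {E : Env} {h : HS} (hn : 1 ≤ n)
    (hL : L = Nat.log 2 n + 1) (hin : E.inp 0 = n) (hnw : n < 2 ^ E.w)
    (hlit : q + e + cw + g₁ + g₂ + sW + 120 * L + 200 < 2 ^ E.w)
    (hN : 2 * (L / q) + e < E.w) (hmsk : cw * (2 * (L / q) + (e + 1)) < E.w)
    (hT : L + (g₁ * (L / q) + g₂) < E.w) (hW : sW * L < E.w) :
    WP E (paramProg q e cw g₁ g₂ sW) h fun h' t => Params q e cw g₁ g₂ sW n L h' ∧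
      h'.mem = h.mem ∧ h'.pos = h.pos ∧ t ≤ 20 * L + 200 := by
  have hw : E.w < 2 ^ E.w := Nat.lt_two_pow_self
  have hkL : L / q ≤ L := Nat.div_le_self _ _
  have num : ∀ {h : HS} {x : Var} {u : ℕ}, h.var x = u → Num E h (v x) u :=
    fun h => ⟨trivial, h⟩
  have lt : ∀ {h : HS} {u : ℕ}, u ≤ q + e + cw + g₁ + g₂ + sW + 120 * L + 200 →
    Num E h (lit u) u := fun hu => Num.lit (by omega)
  refine WP.seq (WP.asgN (u := n) ⟨show 0 < _ by omega, ?_⟩ ?_)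
  · show E.inp 0 % _ = n
    rw [hin, Nat.mod_eq_of_lt hnw]
  refine WP.seq (WP.asgN (u := n) (num (by simp)) ?_)
  refine WP.seq (WP.asgN (lt (u := 0) (by omega)) ?_)
  refine WP.seq (WP.mono (WP.whl (N := L) (fun i h₁ t => i ≤ L ∧ h₁.var .n = n ∧ h₁.var .L = i ∧
    h₁.var .t1 = n / 2 ^ i ∧ h₁.mem = h.mem ∧ h₁.pos = h.pos ∧ t ≤ 15 * i + 5)
    (Q := fun h₁ t => h₁.var .n = n ∧ h₁.var .L = L ∧ h₁.mem = h.mem ∧ h₁.pos = h.pos ∧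
      t ≤ 15 * L + 5) ?_ ?_ ?_ ?_) ?_)
  · simp
  · rintro i h₁ t ⟨h0, h1, h2, h3, -⟩
    refine ⟨h0, trivial, ?_⟩
    rw [Expr.val_v, h3, hL, Nat.lt_succ_iff, Nat.le_log_iff_pow_le (by norm_num) (by omega), Ne,
      Nat.div_eq_zero_iff_lt (by positivity), not_lt]
  · rintro i hi h₁ t ⟨h0, h1, h2, h3, h4, h5, h6⟩
    refine WP.seq (WP.asgN ((num h3).div (lt (u := 2) (by omega))) ?_)
    refine WP.asgN ((num (u := i) (by simpa using h2)).add (lt (u := 1) (by omega)) (by omega)) ?_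
    refine ⟨by omega, by simpa using h1, by simp, ?_, h4, h5, ?_⟩
    · simp [Nat.div_div_eq_div_mul, pow_succ]
    · simp; omega
  · rintro h₁ t ⟨-, h1, h2, -, h4, h5, h6⟩
    exact ⟨h1, h2, h4, h5, h6⟩
  rintro h₁ t₁ ⟨h1, h2, h4, h5, h6⟩
  have hgk : g₁ * (L / q) ≤ L + (g₁ * (L / q) + g₂) := by omega
  refine WP.seq (WP.asgN ((num h2).div (lt (u := q) (by omega))) ?_)
  refine WP.seq (WP.asgN (Num.pow2 (num (u := L / q) (by simp)) (by omega)) ?_)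
  refine WP.seq (WP.asgN (Num.pow2 ((num (u := L) (by simpa using h2)).sub
    (num (u := L / q) (by simp)) hkL) (by omega)) ?_)
  refine WP.seq (WP.asgN (Num.pow2 (num (u := L) (by simpa using h2)) (by omega)) ?_)
  refine WP.seq (WP.asgN (Num.pow2 (((lt (u := 2) (by omega)).mul (num (u := L / q) (by simp))
    (by omega)).add (lt (u := e) (by omega)) (by omega)) hN) ?_)
  refine WP.seq (WP.asgN (Num.pow2 ((lt (u := cw) (by omega)).mul
    (((lt (u := 2) (by omega)).mul (num (u := L / q) (by simp)) (by omega)).add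
      (lt (u := e + 1) (by omega)) (by omega)) (by omega)) hmsk) ?_)
  refine WP.seq (WP.asgN ((lt (u := 120) (by omega)).mul (num (u := L) (by simpa using h2))
    (by omega)) ?_)
  refine WP.seq (WP.asgN (Num.pow2 ((num (u := L) (by simpa using h2)).add
    (((lt (u := g₁) (by omega)).mul (num (u := L / q) (by simp)) (by omega)).add
      (lt (u := g₂) (by omega)) (by omega)) (by omega)) hT) ?_)
  refine WP.asgN (Num.pow2 ((lt (u := sW) (by omega)).mul (num (u := L) (by simpa using h2))
    (by omega)) hW) ?_
  refine ⟨⟨by simpa using h1, by simp, by simp, by simp, by simp, by simp, by simp, by simp,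
    by simp⟩, h4, h5, ?_⟩
  simp
  omega

/-- The whole preprocessing. Register `1` first holds the value `1` as the size of the memory areas,
until this size is known. -/
def prepProg (q e cw g₁ g₂ sW : ℕ) (relE : Var → Var → Expr) (M : Machine) (R τ cm : ℕ) : Prog :=
  .const 1 1 ;; paramProg q e cw g₁ g₂ sW ;;
    .bin .or 1 (2 * Var.W.ctorIdx) (2 * Var.W.ctorIdx) ;; buildProg relE M R τ cm

/-- The preprocessing, starting from the empty memory. -/
lemma exec_prep {X : Setup} {E : Env} {q e cw g₁ g₂ sW cm : ℕ}
    {rel : ℕ → (ℕ → ℕ → Bool) → ℕ → ℕ → Prop} {relE : Var → Var → Expr} {t₀ : ℕ}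
    (hp : ∀ h, WP { E with W := 1 } (paramProg q e cw g₁ g₂ sW) h fun h' t => X.Vars h' ∧
      h'.var .W = E.W ∧ h'.mem = h.mem ∧ h'.pos = h.pos ∧ t ≤ t₀)
    (F : X.Fits E) (S : X.Sound) (G : X.Input e cm rel relE) (hcm : cm * X.k ≤ E.W ∧ cm ≤ E.W)
    (hE : ∀ i < X.n * X.n, E.inp (1 + i) = (X.mat (i / X.n) (i % X.n)).toNat) :
    ∃ σ h' t, Exec E.w E.ω E.inp (prepProg q e cw g₁ g₂ sW relE X.mach X.R X.τ cm) State.zero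
      σ t ∧ Rel E σ h' ∧ X.Inv E (fun _ => []) h' ∧
      t ≤ t₀ + 200 * X.total E (fun _ => []) + 30 * (X.T * X.r) + 40 * (X.n * X.n) +
        X.B * X.B * (X.N * X.N * ((adjE relE X.mach.pol X.τ).cost + 40) + 50 * X.r + 150) +
          110 := by
  have hw := F.hw
  have h1w : 1 < 2 ^ E.w := Nat.one_lt_two_pow (by omega)
  set h₀ : HS := ⟨fun _ => 0, fun _ _ => 0, fun _ => 0, 0⟩ with e₀
  have z := State.zero_bdd E.w
  have r₀ : Rel { E with W := 1 } (State.zero.setReg 1 (1 % 2 ^ E.w)) h₀ := by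
    refine ⟨h1w, z.1.setReg (Nat.mod_lt _ (by omega)), fun x => ?_, ?_, fun _ _ _ => rfl, rfl, rfl⟩
    · have : 2 * x.ctorIdx ≠ 1 := by omega
      simp [State.setReg, this, State.zero, e₀]
    · simp [State.setReg, Nat.mod_eq_of_lt h1w]
  obtain ⟨σ₁, h₁, t₁, t₁', x₁, l₁, r₁, V₁, w₁, m₁, p₁, b₁⟩ := hp h₀ _ r₀
  have hv : BinOp.or.eval E.w (σ₁.reg (2 * Var.W.ctorIdx)) (σ₁.reg (2 * Var.W.ctorIdx)) = E.W := by
    simp only [BinOp.eval, Nat.or_self]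
    rw [Nat.mod_eq_of_lt (r₁.bdd.1 _), r₁.var, w₁]
  have r₂ : Rel E (σ₁.setReg 1 (BinOp.or.eval E.w (σ₁.reg (2 * Var.W.ctorIdx))
      (σ₁.reg (2 * Var.W.ctorIdx)))) h₁ := by
    refine ⟨h1w, r₁.bdd.setReg (BinOp.eval_lt _ _ _ _), fun x => ?_, ?_, fun z a _ => ?_, r₁.out,
      r₁.pos⟩
    · have : 2 * x.ctorIdx ≠ 1 := by omega
      simp only [State.setReg, Function.update_of_ne this]
      exact r₁.var x
    · rw [hv]; simp [State.setReg]
    · have := r₁.mem (z * E.W + a) 0 Nat.one_pos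
      rw [mul_one, add_zero, m₁] at this
      rw [m₁]
      exact this
  obtain ⟨σ₃, h₃, t₃, t₃', x₃, l₃, r₃, I₃, b₃⟩ := wp_build F S G hcm V₁ (fun z a => by rw [m₁])
    (by rw [p₁]) hE _ r₂
  exact ⟨σ₃, h₃, _, .seq (.const _ _ _) (.seq x₁ (.seq (.bin _ _ _ _ _) x₃)), r₃, I₃, by omega⟩

end WordRAM

namespace WordRAM

open DynGraph

/-! ### The whole computation -/

/-- A sequence of states that is extended step by step. -/
lemma exists_sequence {α : Type*} {J : ℕ → α → Prop} {R : ℕ → α → α → Prop} {n : ℕ} {a : α}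
    (h0 : J 0 a) (hs : ∀ i < n, ∀ x, J i x → ∃ y, J (i + 1) y ∧ R i x y) :
    ∃ f : ℕ → α, f 0 = a ∧ (∀ i ≤ n, J i (f i)) ∧ ∀ i < n, R i (f i) (f (i + 1)) := by
  have hs' : ∀ i x, ∃ y, i < n → J i x → J (i + 1) y ∧ R i x y := by
    intro i x
    by_cases h : i < n ∧ J i x
    · obtain ⟨y, hy⟩ := hs i h.1 x h.2
      exact ⟨y, fun _ _ => hy⟩
    · exact ⟨x, fun h1 h2 => absurd ⟨h1, h2⟩ h⟩
  choose F hF using hs'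
  let f : ℕ → α := fun i => Nat.rec a F i
  have hJ : ∀ i ≤ n, J i (f i) := by
    intro i
    induction i with
    | zero => intro _; exact h0
    | succ i ih => intro hi; exact (hF i _ (by omega) (ih (by omega))).1
  exact ⟨f, rfl, hJ, fun i hi => (hF i _ hi (hJ i hi.le)).2⟩

/-- A matrix, extended by zeros. -/
def extMat {n : ℕ} (M : Fin n → Fin n → Bool) (a c : ℕ) : Bool :=
  if h : a < n ∧ c < n then M ⟨a, h.1⟩ ⟨c, h.2⟩ else false

/-- A vector, extended by zeros. -/
def extVec {n : ℕ} (v : Fin n → Bool) (a : ℕ) : Bool := if h : a < n then v ⟨a, h⟩ else false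

lemma vectorInput_eq {n : ℕ} (v : Fin n → Bool) :
    OMv.vectorInput v = fun a => (extVec v a).toNat := by
  funext a
  unfold OMv.vectorInput extVec
  split_ifs <;> rfl

lemma matrixInput_eq {n : ℕ} (M : Fin n → Fin n → Bool) {i : ℕ} (hi : i < n * n) :
    OMv.matrixInput M (1 + i) = (extMat M (i / n) (i % n)).toNat := by
  have hn : 0 < n := Nat.pos_of_ne_zero fun h => by simp [h] at hi
  have h1 : i / n < n := Nat.div_lt_of_lt_mul hi
  have h2 : i % n < n := Nat.mod_lt _ hn
  have key : (∃ u v : Fin n, 1 + i = 1 + u * n + v ∧ M u v = true) ↔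
      M ⟨i / n, h1⟩ ⟨i % n, h2⟩ = true := by
    constructor
    · rintro ⟨u, v, e, h⟩
      have e' : i = n * u + v := by rw [mul_comm n]; omega
      have e1 : (⟨i / n, h1⟩ : Fin n) = u := by
        ext; simp only; rw [e', Nat.mul_add_div hn, Nat.div_eq_of_lt v.2, add_zero]
      have e2 : (⟨i % n, h2⟩ : Fin n) = v := by
        ext; simp only; rw [e', Nat.mul_add_mod, Nat.mod_eq_of_lt v.2]
      rw [e1, e2]; exact h
    · intro h
      refine ⟨_, _, ?_, h⟩
      have := Nat.div_add_mod' i n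
      simp only; omega
  unfold OMv.matrixInput extMat
  rw [if_neg (by omega), dif_pos ⟨h1, h2⟩]
  by_cases h : M ⟨i / n, h1⟩ ⟨i % n, h2⟩ = true
  · rw [if_pos (key.2 h), h]; rfl
  · rw [if_neg (mt key.1 h), Bool.eq_false_iff.2 h]; rfl

section
variable {X : Setup} {E : Env}

lemma Setup.allRight_inp (a : ℕ → ℕ) (blk : ℕ) (bs qs : List (ℕ → Bool)) :
    X.AllRight { E with inp := a } blk bs qs ↔ X.AllRight E blk bs qs := by
  induction qs generalizing bs with
  | nil => exact Iff.rfl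
  | cons b qs ih => exact and_congr Iff.rfl (ih _)

/-- The questions about block `blk` before vector number `i` if all answers are correct. -/
noncomputable def Setup.hist (X : Setup) (vec : ℕ → ℕ → Bool) (i blk : ℕ) : List (ℕ → Bool) :=
  (List.range i).flatMap fun j => X.idealFour (vec j) blk

lemma Setup.hist_succ (vec : ℕ → ℕ → Bool) (i blk : ℕ) :
    X.hist vec (i + 1) blk = X.hist vec i blk ++ X.idealFour (vec i) blk := by
  simp [Setup.hist, List.range_succ]

/-- All majority votes yield the correct answers. By induction, the questions that are asked are
then the ideal ones. -/
def Setup.Good (X : Setup) (E : Env) (vec : ℕ → ℕ → Bool) : Prop :=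
  ∀ i < X.n, ∀ blk < X.B * X.B, X.AllRight E blk (X.hist vec i blk) (X.idealFour (vec i) blk)

lemma Setup.total_le {hs : ℕ → List (ℕ → Bool)} {l : ℕ}
    (hl : ∀ blk < X.B * X.B, (hs blk).length ≤ l) :
    X.total E hs ≤ X.B * X.B * (X.r * (X.P + X.V * l)) := by
  unfold Setup.total
  refine (Finset.sum_le_card_nsmul _ _ (X.r * (X.P + X.V * l)) fun blk hb => ?_).trans (by simp)
  refine (Finset.sum_le_card_nsmul _ _ (X.P + X.V * l) fun j _ => ?_).trans (by simp)
  exact ((X.sv blk).time _ _).trans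
    (Nat.add_le_add_left (Nat.mul_le_mul_left _ (hl blk (Finset.mem_range.1 hb))) _)

/-- The bound for the time of one product, apart from the time of the simulated machines. -/
def Setup.mulTime (X : Setup) : ℕ :=
  X.B * X.B * (5000 * (X.r * (X.r + X.k)) + 50) + 400 * (X.k * X.k) * (X.n + 1) + 100 * X.H + 100

/-- The products are computed one after the other. -/
theorem Setup.exists_serves {X : Setup} {E : Env} (F : X.Fits E) (S : X.Sound)
    {A : OMv.Algorithm} (hA : A.mul = mulProg X.mach X.R X.τ) {n : ℕ} (hn : X.n = n)
    {M : Fin n → Fin n → Bool} {v : Fin n → Fin n → Bool} (hM : X.mat = extMat M)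
    {vec : ℕ → ℕ → Bool} (hv : ∀ i : Fin n, vec i = extVec (v i)) {σ₀ : State} {h₀ : HS}
    {t₀ b₀ : ℕ}
    (e₀ : Exec E.w E.ω (OMv.matrixInput M) A.prep State.zero σ₀ t₀) (r₀ : Rel E σ₀ h₀)
    (I₀ : X.Inv E (fun _ => []) h₀) (l₀ : t₀ ≤ b₀ + 200 * X.total E fun _ => []) :
    ∃ σ t, Serves E.w E.ω (A.requests M v) σ t ∧
      ∑ i ∈ Finset.range (n + 1), t i ≤
        b₀ + 200 * (X.B * X.B * (X.r * (X.P + X.V * (4 * n)))) + n * X.mulTime ∧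
      (X.Good E vec → ∀ r i : Fin n, (σ (r + 2)).out i = (OMv.boolMulVec M (v r) i).toNat) := by
  -- the state, and the total time so far
  obtain ⟨f, f0, fJ, fR⟩ := exists_sequence (α := State × ℕ) (n := n) (a := (σ₀, t₀))
    (J := fun i p => ∃ h hs, Rel E p.1 h ∧ X.Inv E hs h ∧
      (∀ c < X.B * X.B, (hs c).length ≤ 4 * i) ∧ p.2 ≤ b₀ + 200 * X.total E hs + i * X.mulTime ∧
      (X.Good E vec → ∀ c < X.B * X.B, hs c = X.hist vec i c))
    (R := fun i p q => ∃ t, Exec E.w E.ω (fun a => (vec i a).toNat) A.mul p.1 q.1 t ∧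
      q.2 = p.2 + t ∧ (X.Good E vec → ∀ a < n,
        q.1.out a = (decide (∃ c < n, X.mat a c = true ∧ vec i c = true)).toNat))
    ⟨h₀, fun _ => [], r₀, I₀, by simp, by simpa using l₀, fun _ c _ => rfl⟩ (by
      rintro i hi ⟨σ, T⟩ ⟨h, hs, r, I, hl, hT, hg⟩
      have F' : X.Fits { E with inp := fun a => (vec i a).toNat } := ⟨F.hk, F.hB, F.hn, F.hr, F.hτ,
        F.upd, F.qry, F.und, F.prep, F.hw, F.sim, F.H2, F.H4, F.N2, F.r2, F.T2, F.area, F.ph,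
        F.time⟩
      obtain ⟨σ', h', t, t', x, lt, r', ⟨hs', I', hl', ht', hg'⟩⟩ :=
        wp_mul (vec := vec i) F' S (I.io _ h.out) rfl (fun c hc => by have := hl c hc; omega) σ
          ⟨r.two, r.bdd, r.var, r.W, r.mem, r.out, r.pos⟩
      refine ⟨(σ', T + t'), ⟨h', hs', ⟨r'.two, r'.bdd, r'.var, r'.W, r'.mem, r'.out, r'.pos⟩,
        I'.io E.inp h'.out, fun c hc => ?_, ?_, fun G c hc => ?_⟩, t', by rw [hA]; exact x, rfl,
        fun G a ha => ?_⟩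
      · have := hl c hc
        have := hl' c hc
        omega
      · change t + 200 * X.total E hs ≤ 200 * X.total E hs' + _ + _ + _ + _ at ht'
        have e : X.mulTime = X.B * X.B * (5000 * (X.r * (X.r + X.k)) + 50) +
          400 * (X.k * X.k) * (X.n + 1) + 100 * X.H + 100 := rfl
        rw [add_one_mul]
        simp only at hT ⊢
        omega
      · have q := hg' fun c hc => (Setup.allRight_inp _ _ _ _).2 (by
          rw [hg G c hc]; exact G i (by omega) c hc)
        rw [q.2 c hc, hg G c hc, Setup.hist_succ]
      · have q := hg' fun c hc => (Setup.allRight_inp _ _ _ _).2 (by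
          rw [hg G c hc]; exact G i (by omega) c hc)
        have := q.1 a (by omega)
        rw [hn] at this
        rw [← this]
        exact congrFun r'.out a)
  refine ⟨fun i => if i = 0 then State.zero else (f (i - 1)).1,
    fun i => if i = 0 then t₀ else (f i).2 - (f (i - 1)).2, ⟨rfl, ?_⟩, ?_, ?_⟩
  · intro i hi
    rcases i with _ | i
    · simpa [OMv.Algorithm.requests, f0] using e₀
    · have hi' : i < n := by simpa [OMv.Algorithm.requests] using hi
      obtain ⟨t, x, e, -⟩ := fR i hi'
      have := hv ⟨i, hi'⟩
      simp only at this
      rw [this] at x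
      simpa [OMv.Algorithm.requests, vectorInput_eq, e] using x
  · have hsum : ∀ m ≤ n, ∑ i ∈ Finset.range (m + 1),
        (if i = 0 then t₀ else (f i).2 - (f (i - 1)).2) = (f m).2 := by
      intro m
      induction m with
      | zero => intro _; simp [f0]
      | succ m ih =>
        intro hm
        obtain ⟨t, -, e, -⟩ := fR m hm
        rw [Finset.sum_range_succ, ih (by omega)]
        simp [e]
    rw [hsum n le_rfl]
    obtain ⟨h, hs, -, I, hl, hT, -⟩ := fJ n le_rfl
    have := Setup.total_le (E := E) hl
    omega
  · intro G r i
    obtain ⟨t, -, -, q⟩ := fR r r.2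
    have := q G i i.2
    beta_reduce
    rw [if_neg (by omega)]
    simp only [show (r : ℕ) + 2 - 1 = r + 1 by omega]
    rw [this, OMv.boolMulVec]
    congr 1
    rw [decide_eq_decide, hM, hv]
    constructor
    · rintro ⟨c, hc, h1, h2⟩
      refine ⟨⟨c, hc⟩, ?_, ?_⟩
      · simpa [extMat, hc] using h1
      · simpa [extVec, hc] using h2
    · rintro ⟨c, h1, h2⟩
      exact ⟨c, c.2, by simpa [extMat] using h1, by simpa [extVec] using h2⟩

end

/-! ### The probability of an error -/

open MeasureTheory
open scoped ENNReal

section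
variable {X : Setup}

/-- A majority vote of `2 * s` copies is wrong with probability at most `(8/9) ^ s`. -/
lemma Setup.not_right {s w W : ℕ} {ip : ℕ → ℕ} (hw : X.w' ≤ w) (hr : X.r = 2 * s) (blk : ℕ)
    (bs : List (ℕ → Bool)) (b : ℕ → Bool) :
    coins w {ω | ¬ X.Right ⟨w, W, ω, ip⟩ blk bs b} ≤ ENNReal.ofReal ((8 / 9) ^ s) := by
  refine (measure_mono fun ω h => ?_).trans
    (coins_majority hw s {ω | ((X.sv blk).ask ω bs b).out 0 ≠ X.f blk b}
      ((X.sv blk).correct bs b))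
  simp only [Set.mem_ofPred_eq, Setup.Right, not_lt] at h ⊢
  refine ⟨(Finset.range X.r).filter fun a => ¬ X.answer ⟨w, W, ω, ip⟩ blk a bs b = X.f blk b,
    fun j hj => ?_, ?_⟩
  · rw [Finset.mem_filter, Finset.mem_range, hr] at hj
    refine ⟨hj.1, ?_⟩
    have := hj.2
    simp only [Setup.answer, Setup.str, hr] at this
    exact this
  · have := Finset.card_filter_add_card_filter_not (s := Finset.range X.r)
      fun a => X.answer ⟨w, W, ω, ip⟩ blk a bs b = X.f blk b
    rw [Finset.card_range] at this
    omega

lemma Setup.not_allRight {s w W : ℕ} {ip : ℕ → ℕ} (hw : X.w' ≤ w) (hr : X.r = 2 * s) (blk : ℕ)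
    (bs qs : List (ℕ → Bool)) :
    coins w {ω | ¬ X.AllRight ⟨w, W, ω, ip⟩ blk bs qs} ≤
      qs.length * ENNReal.ofReal ((8 / 9) ^ s) := by
  induction qs generalizing bs with
  | nil => simp [Setup.AllRight]
  | cons b qs ih =>
    calc coins w {ω | ¬ X.AllRight ⟨w, W, ω, ip⟩ blk bs (b :: qs)}
        ≤ coins w ({ω | ¬ X.Right ⟨w, W, ω, ip⟩ blk bs b} ∪
            {ω | ¬ X.AllRight ⟨w, W, ω, ip⟩ blk (bs ++ [b]) qs}) :=
          measure_mono fun ω h => by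
            simp only [Setup.AllRight, Set.mem_ofPred_eq, Set.mem_union] at h ⊢
            tauto
      _ ≤ _ := (measure_union_le _ _).trans
          (add_le_add (Setup.not_right hw hr blk bs b) (ih _))
      _ = _ := by rw [List.length_cons]; push_cast; ring

/-- The questions in the event `Good` do not depend on the random words, since they are those of the
correct computation. So the error probabilities of the votes simply add up. -/
lemma Setup.not_good {s w W : ℕ} {ip : ℕ → ℕ} (hw : X.w' ≤ w) (hr : X.r = 2 * s)
    (vec : ℕ → ℕ → Bool) :
    coins w {ω | ¬ X.Good ⟨w, W, ω, ip⟩ vec} ≤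
      (X.n * (X.B * X.B) * 4 : ℕ) * ENNReal.ofReal ((8 / 9) ^ s) := by
  calc coins w {ω | ¬ X.Good ⟨w, W, ω, ip⟩ vec}
      ≤ coins w (⋃ p ∈ Finset.range X.n ×ˢ Finset.range (X.B * X.B),
          {ω | ¬ X.AllRight ⟨w, W, ω, ip⟩ p.2 (X.hist vec p.1 p.2)
            (X.idealFour (vec p.1) p.2)}) :=
        measure_mono fun ω h => by
          simp only [Setup.Good, Set.mem_ofPred_eq, not_forall] at h
          obtain ⟨i, hi, c, hc, h⟩ := h
          simp only [Set.mem_iUnion, Finset.mem_product, Finset.mem_range]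
          exact ⟨(i, c), ⟨hi, hc⟩, h⟩
    _ ≤ ∑ p ∈ Finset.range X.n ×ˢ Finset.range (X.B * X.B),
          (4 : ℕ) * ENNReal.ofReal ((8 / 9) ^ s) :=
        (measure_biUnion_finset_le _ _).trans
          (Finset.sum_le_sum fun p _ => Setup.not_allRight hw hr _ _ _)
    _ = _ := by
        rw [Finset.sum_const, Finset.card_product, Finset.card_range, Finset.card_range,
          nsmul_eq_mul]
        push_cast; ring

end

/-- With `120 L` copies, where `L` bounds the logarithm of the size, errors are unlikely. -/
lemma error_le {L a : ℕ} (hL : 1 ≤ L) (ha : a ≤ 2 ^ (3 * L + 2)) :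
    (a : ℝ≥0∞) * ENNReal.ofReal ((8 / 9) ^ (60 * L)) ≤ 1 / 3 := by
  have h1 : ((8 : ℝ) / 9) ^ 60 ≤ (1 / 2) ^ 10 := by norm_num
  have h2 : ((8 : ℝ) / 9) ^ (60 * L) ≤ (1 / 2) ^ (10 * L) := by
    rw [pow_mul, pow_mul]
    exact pow_le_pow_left₀ (by positivity) h1 _
  have h3 : (a : ℝ) * (8 / 9) ^ (60 * L) ≤ 1 / 3 := by
    calc (a : ℝ) * (8 / 9) ^ (60 * L) ≤ 2 ^ (3 * L + 2) * (1 / 2) ^ (10 * L) := by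
          refine mul_le_mul (by exact_mod_cast ha) h2 (by positivity) (by positivity)
      _ = 2 ^ (3 * L + 2) * (1 / 2) ^ (3 * L + 2) * (1 / 2) ^ (7 * L - 2) := by
          rw [mul_assoc, ← pow_add]
          congr 2
          omega
      _ = (1 / 2) ^ (7 * L - 2) := by rw [← mul_pow]; norm_num
      _ ≤ (1 / 2) ^ 2 := pow_le_pow_of_le_one (by norm_num) (by norm_num) (by omega)
      _ ≤ 1 / 3 := by norm_num
  have h4 : (1 / 3 : ℝ≥0∞) = ENNReal.ofReal (1 / 3) := by
    rw [ENNReal.ofReal_div_of_pos (by norm_num)]; norm_num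
  rw [h4, ← ENNReal.ofReal_natCast, ← ENNReal.ofReal_mul (by positivity)]
  exact ENNReal.ofReal_le_ofReal h3

end WordRAM

namespace WordRAM

open DynGraph

/-! ### The choice of the parameters -/

/-- The dimensions for a matrix of size `n`, where `L` is the length of the binary expansion of
`n`. -/
structure Setup.Scale (X : Setup) (q e c g₁ g₂ L : ℕ) : Prop where
  n_pos : 1 ≤ X.n
  L_eq : L = Nat.log 2 X.n + 1
  k : X.k = 2 ^ (L / q)
  B : X.B = 2 ^ (L - L / q)
  H : X.H = 2 ^ L
  N : X.N = 2 ^ (2 * (L / q) + e)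
  w' : X.w' = c * (2 * (L / q) + (e + 1))
  r : X.r = 120 * L
  T : X.T = 2 ^ (L + (g₁ * (L / q) + g₂))

namespace Setup.Scale
variable {X : Setup} {q e c g₁ g₂ L : ℕ}

lemma n_lt (s : X.Scale q e c g₁ g₂ L) : X.n < 2 ^ L := by
  rw [s.L_eq]
  exact Nat.lt_pow_succ_log_self (by norm_num) _

lemma pow_le (s : X.Scale q e c g₁ g₂ L) : 2 ^ L ≤ 2 * X.n := by
  rw [s.L_eq, pow_succ, mul_comm]
  exact Nat.mul_le_mul_left _ (Nat.pow_log_le_self 2 (by have := s.n_pos; omega))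

lemma L_pos (s : X.Scale q e c g₁ g₂ L) : 1 ≤ L := by rw [s.L_eq]; omega

lemma Bk (s : X.Scale q e c g₁ g₂ L) : X.B * X.k = 2 ^ L := by
  rw [s.B, s.k, ← pow_add, Nat.sub_add_cancel (Nat.div_le_self _ _)]

lemma k_pow (s : X.Scale q e c g₁ g₂ L) : X.k ^ q ≤ 2 ^ L := by
  rw [s.k, ← pow_mul]
  exact Nat.pow_le_pow_right (by norm_num) (Nat.div_mul_le_self _ _)

/-- A sufficiently large constant factor in the word length makes everything fit. -/
lemma fits (s : X.Scale q e c g₁ g₂ L) {E : Env} {cm sW cw : ℕ}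
    (hsW : sW = c * (e + 3) + X.R + 2 * e + g₁ + g₂ + cm + 20)
    (hcw : cw = sW + q + e + c + g₁ + g₂ + 400) (hw : E.w = cw * L) (hW : E.W = 2 ^ (sW * L))
    (hτ : X.τ ≤ 1) (upd : X.mach.upd.Below X.R) (qry : X.mach.qry.Below X.R)
    (und : X.mach.und.Below X.R) (prep : X.mach.prep.Below X.R)
    (time : X.P + X.V * (4 * X.n) ≤ X.T) :
    X.Fits E ∧ (cm * X.k ≤ E.W ∧ cm ≤ E.W) ∧
      q + e + c + g₁ + g₂ + sW + 120 * L + 200 < 2 ^ E.w ∧ 2 * (L / q) + e < E.w ∧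
      c * (2 * (L / q) + (e + 1)) < E.w ∧ L + (g₁ * (L / q) + g₂) < E.w ∧ sW * L < E.w ∧
      X.n < 2 ^ E.w := by
  have hL := s.L_pos
  have hn := s.n_lt
  have hk : L / q ≤ L := Nat.div_le_self _ _
  have hL2 : L < 2 ^ L := Nat.lt_two_pow_self
  have up : ∀ u, u ≤ u * L := fun u => Nat.le_mul_of_pos_right _ hL
  have hg : g₁ * (L / q) ≤ g₁ * L := Nat.mul_le_mul_left _ hk
  have hc : c * (2 * (L / q) + (e + 1)) ≤ c * (e + 3) * L := by
    rw [mul_assoc]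
    refine Nat.mul_le_mul_left _ ?_
    have := up e
    rw [add_mul]; omega
  have eW : sW * L = c * (e + 3) * L + X.R * L + 2 * (e * L) + g₁ * L + g₂ * L + cm * L +
      20 * L := by rw [hsW]; ring
  have ew : E.w = sW * L + q * L + e * L + c * L + g₁ * L + g₂ * L + 400 * L := by
    rw [hw, hcw]; ring
  have hq := up q; have he := up e; have hcc := up c; have hg1 := up g₁; have hg2 := up g₂
  have hR := up X.R; have hcm := up cm; have hs := up sW
  -- a sum of two powers with small exponents
  have p2 : ∀ {a b m : ℕ}, a < m → b < m → 2 ^ a + 2 ^ b ≤ 2 ^ m := by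
    intro a b m ha hb
    obtain ⟨m, rfl⟩ : ∃ m', m = m' + 1 := ⟨m - 1, by omega⟩
    have h1 : 2 ^ a ≤ 2 ^ m := Nat.pow_le_pow_right (by norm_num) (by omega)
    have h2 : 2 ^ b ≤ 2 ^ m := Nat.pow_le_pow_right (by norm_num) (by omega)
    rw [pow_succ]; omega
  have le : ∀ {a m : ℕ}, a ≤ m → 2 ^ a ≤ 2 ^ m := Nat.pow_le_pow_right (by norm_num)
  have hr : 120 * L ≤ 2 ^ (L + 7) := by rw [pow_add]; omega
  have hBB : X.B * X.B ≤ 2 ^ (2 * L) := by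
    have := Nat.sub_le L (L / q)
    rw [s.B, ← pow_add]; exact le (by omega)
  have hBr : X.B * X.B * X.r ≤ 2 ^ (3 * L + 7) := by
    calc X.B * X.B * X.r ≤ 2 ^ (2 * L) * 2 ^ (L + 7) := Nat.mul_le_mul hBB (by rw [s.r]; exact hr)
      _ = _ := by rw [← pow_add]; congr 1; omega
  refine ⟨⟨by rw [s.k]; exact Nat.one_le_two_pow, by rw [s.Bk, s.H], by rw [s.H]; exact hn.le,
    by rw [s.r]; omega, hτ, upd, qry, und, prep, by rw [s.w']; omega, ?_, ?_, ?_, ?_, ?_, ?_, ?_,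
    ?_, time⟩, ⟨?_, ?_⟩, ?_, by omega, by omega, by omega, by omega, ?_⟩
  · have h1 : X.R + 2 < 2 ^ (X.R + 2) := Nat.lt_two_pow_self
    have := p2 (a := X.R + 2) (b := X.w') (m := sW * L) (by omega) (by rw [s.w']; omega)
    rw [hW]; omega
  · rw [s.H, hW, ← pow_add]; exact le (by omega)
  · have := p2 (a := L + 2) (b := 4) (m := sW * L) (by omega) (by omega)
    rw [s.H, hW]; rw [pow_add] at this; omega
  · have := p2 (a := 2 * (2 * (L / q) + e)) (b := 1) (m := sW * L) (by omega) (by omega)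
    rw [s.N, hW, ← pow_add, ← two_mul]; omega
  · have := le (a := L + 8) (m := sW * L) (by omega)
    rw [s.r, hW]; rw [pow_add] at this hr; omega
  · rw [s.T, s.r, hW]
    calc _ ≤ 2 ^ (L + (g₁ * (L / q) + g₂)) * 2 ^ (L + 7) := Nat.mul_le_mul_left _ hr
      _ ≤ _ := by rw [← pow_add]; exact le (by omega)
  · have h1 := p2 (a := 4) (b := 3 * L + 9) (m := 13 * L) (by omega) (by omega)
    have h2 : (2 : ℕ) ^ (3 * L + 9) = 4 * 2 ^ (3 * L + 7) := by rw [pow_add, pow_add]; omega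
    calc _ ≤ 2 ^ (13 * L) * E.W := Nat.mul_le_mul_right _ (by omega)
      _ ≤ _ := by rw [hW, ← pow_add]; exact le (by omega)
  · have h1 := p2 (a := 4 * L + 9) (b := 3) (m := E.w) (by omega) (by omega)
    have h2 : 4 * X.r * (X.n * (X.B * X.B)) ≤ 2 ^ (4 * L + 9) := by
      calc 4 * X.r * (X.n * (X.B * X.B)) = 4 * X.n * (X.B * X.B * X.r) := by ring
        _ ≤ 4 * 2 ^ L * 2 ^ (3 * L + 7) := Nat.mul_le_mul (by omega) hBr
        _ = _ := by rw [show 4 * L + 9 = 2 + L + (3 * L + 7) by omega, pow_add _ (2 + L),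
            pow_add _ 2]; rfl
    omega
  · have h1 : cm ≤ 2 ^ cm := Nat.lt_two_pow_self.le
    calc cm * X.k ≤ 2 ^ cm * 2 ^ (L / q) := by rw [s.k]; exact Nat.mul_le_mul_right _ h1
      _ ≤ _ := by rw [hW, ← pow_add]; exact le (by omega)
  · exact (Nat.lt_two_pow_self.le).trans (by rw [hW]; exact le (by omega))
  · have : E.w < 2 ^ E.w := Nat.lt_two_pow_self
    omega
  · exact hn.trans_le (le (by omega))

/-- All contributions to the running time are small, except for the time of the queries to the
machines. -/
lemma time_le (s : X.Scale q e c g₁ g₂ L) {cP p a : ℕ} (hP : X.P ≤ cP * X.k ^ p) (hp : p ≤ q)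
    (hg : g₁ + 1 ≤ q) (hq : 3 ≤ q) :
    20 * L + 200 + 30 * (X.T * X.r) + 40 * (X.n * X.n) +
        X.B * X.B * (X.N * X.N * (a + 40) + 50 * X.r + 150) + 110 +
        200 * (X.B * X.B * (X.r * (X.P + X.V * (4 * X.n)))) + X.n * X.mulTime ≤
      (72610000 + 3600 * 2 ^ g₂ + (a + 40) * 4 ^ e + 24000 * cP) *
        (L * L * (2 ^ L * 2 ^ L) * X.B) + 96000 * (L * (X.B * X.B) * X.V * 2 ^ L) := by
  have hL := s.L_pos
  have hn := s.n_lt.le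
  have hn1 := s.n_pos
  have hLL : L ≤ L * L := Nat.le_mul_of_pos_right _ hL
  have hBk := s.Bk
  have hkq := s.k_pow
  have hk1 : 1 ≤ X.k := by rw [s.k]; exact Nat.one_le_two_pow
  have hB1 : 1 ≤ X.B := by rw [s.B]; exact Nat.one_le_two_pow
  have hr := s.r
  have hNN : X.N * X.N = 4 ^ e * X.k ^ 4 := by
    rw [s.N, s.k, show (4 : ℕ) = 2 ^ 2 by norm_num, ← pow_mul, ← pow_mul, ← pow_add, ← pow_add]
    congr 1; omega
  have hT : X.T = 2 ^ g₂ * (2 ^ L * X.k ^ g₁) := by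
    rw [s.T, s.k, ← pow_mul, ← pow_add, ← pow_add]
    congr 1; rw [mul_comm g₁]; omega
  have hH := s.H
  set x := 2 ^ L with hx
  have hx1 : 1 ≤ x := Nat.one_le_two_pow
  have hBx : X.B ≤ x := by rw [← hBk]; exact Nat.le_mul_of_pos_right _ hk1
  have kp : ∀ {j}, j ≤ q → X.k ^ j ≤ x := fun hj => (Nat.pow_le_pow_right hk1 hj).trans hkq
  have kB : ∀ {j}, j + 1 ≤ q → X.k ^ j ≤ X.B := fun {j} hj => by
    have h1 := kp hj
    rw [pow_succ, ← hBk] at h1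
    exact Nat.le_of_mul_le_mul_right h1 hk1
  have hxx : x ≤ x * x := Nat.le_mul_of_pos_right _ hx1
  set U := L * L * (x * x) * X.B with hU
  -- every contribution is a product of three factors that are bounded by those of `U`
  have unit : ∀ {u v z : ℕ}, u ≤ L * L → v ≤ x * x → z ≤ X.B → u * v * z ≤ U :=
    fun h1 h2 h3 => Nat.mul_le_mul (Nat.mul_le_mul h1 h2) h3
  have t1 : L * 1 * 1 ≤ U := unit hLL (by omega) hB1
  have t3 : L * x * X.k ^ g₁ ≤ U := unit hLL hxx (kB hg)
  have t4 : 1 * (X.n * X.n) * 1 ≤ U := unit (by omega) (Nat.mul_le_mul hn hn) hB1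
  have t5 : 1 * (X.B * X.k ^ 4) * X.B ≤ U := by
    refine unit (by omega) ?_ le_rfl
    calc X.B * X.k ^ 4 = (X.B * X.k) * X.k ^ 3 := by ring
      _ ≤ x * x := Nat.mul_le_mul hBk.le (kp hq)
  have t6 : L * X.B * X.B ≤ U := unit hLL (by omega) le_rfl
  have t7 : L * (X.B * X.k ^ p) * X.B ≤ U := unit hLL (Nat.mul_le_mul hBx (kp hp)) le_rfl
  have t8 : L * L * (X.n * (X.B * X.k)) * X.B ≤ U :=
    unit le_rfl (Nat.mul_le_mul hn hBk.le) le_rfl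
  have t9 : 1 * (X.n * X.n) * X.k ^ 2 ≤ U := unit (by omega) (Nat.mul_le_mul hn hn) (kB hq)
  have t10 : 1 * (X.n * x) * 1 ≤ U := unit (by omega) (Nat.mul_le_mul hn le_rfl) hB1
  have t11 : 1 * (X.n * X.B) * X.B ≤ U := unit (by omega) (Nat.mul_le_mul hn hBx) le_rfl
  have a1 : X.B * X.B ≤ L * X.B * X.B := by
    rw [mul_assoc]; exact Nat.le_mul_of_pos_left _ hL
  have a2 : X.n ≤ X.n * X.n := Nat.le_mul_of_pos_left _ hn1
  have b1 : 30 * (X.T * X.r) = 3600 * 2 ^ g₂ * (L * x * X.k ^ g₁) := by rw [hT, hr]; ring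
  have b2 : X.B * X.B * (X.N * X.N * (a + 40) + 50 * X.r + 150) =
      (a + 40) * 4 ^ e * (1 * (X.B * X.k ^ 4) * X.B) + 6000 * (L * X.B * X.B) +
        150 * (X.B * X.B) := by rw [hNN, hr]; ring
  have b3 : 200 * (X.B * X.B * (X.r * (X.P + X.V * (4 * X.n)))) ≤
      24000 * cP * (L * (X.B * X.k ^ p) * X.B) + 96000 * (L * (X.B * X.B) * X.V * x) := by
    calc 200 * (X.B * X.B * (X.r * (X.P + X.V * (4 * X.n))))
        ≤ 200 * (X.B * X.B * (X.r * (cP * X.k ^ p + X.V * (4 * x)))) := by gcongr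
      _ = _ := by rw [hr]; ring
  have b4 : X.n * X.mulTime ≤ 72600000 * (L * L * (X.n * (X.B * X.k)) * X.B) +
      50 * (1 * (X.n * X.B) * X.B) + 800 * (1 * (X.n * X.n) * X.k ^ 2) +
        100 * (1 * (X.n * x) * 1) + 100 * X.n := by
    have h1 : X.r + X.k ≤ 121 * (L * X.k) := by
      have := Nat.le_mul_of_pos_right L hk1
      have := Nat.le_mul_of_pos_left X.k hL
      omega
    unfold Setup.mulTime
    rw [hH]
    calc _ ≤ X.n * (X.B * X.B * (5000 * (120 * L * (121 * (L * X.k))) + 50) +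
          400 * (X.k * X.k) * (2 * X.n) + 100 * x + 100) := by
          rw [← hr]; gcongr; omega
      _ = _ := by ring
  have c1 := Nat.mul_le_mul_left (3600 * 2 ^ g₂) t3
  have c2 := Nat.mul_le_mul_left ((a + 40) * 4 ^ e) t5
  have c3 := Nat.mul_le_mul_left (24000 * cP) t7
  simp only [add_mul (72610000 + 3600 * 2 ^ g₂ + (a + 40) * 4 ^ e),
    add_mul (72610000 + 3600 * 2 ^ g₂), add_mul 72610000]
  omega

end Setup.Scale

/-! ### Asymptotic bounds -/

/-- Logarithmic factors are absorbed by any power. -/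
lemma exists_sq_le {r : ℝ} (hr : 1 < r) : ∃ C : ℝ, 0 ≤ C ∧ ∀ L : ℕ, (L : ℝ) ^ 2 ≤ C * r ^ L := by
  obtain ⟨C, hC⟩ := (tendsto_pow_const_div_const_pow_of_one_lt 2 hr).bddAbove_range
  have h0 : ∀ L : ℕ, (L : ℝ) ^ 2 / r ^ L ≤ C := fun L => hC ⟨L, rfl⟩
  refine ⟨C, by simpa using h0 0, fun L => ?_⟩
  have : 0 < r ^ L := by positivity
  exact (div_le_iff₀ this).1 (h0 L)

/-- The time bound is truly subcubic. -/
lemma exists_subcubic {q : ℕ} (hq : 1 ≤ q) {ε c₀ c₁ c₂ : ℝ} (hε : 0 < ε) (h1 : ε ≤ 1)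
    (hc₀ : 0 ≤ c₀) (hc₁ : 0 ≤ c₁) : ∃ δ : ℝ, 0 < δ ∧ ∃ C : ℝ,
    ∀ (L n B k t V : ℕ), k = 2 ^ (L / q) → B * k = 2 ^ L → 2 ^ L ≤ 2 * n →
      (V : ℝ) ≤ c₂ * (k : ℝ) ^ (2 - ε) →
      (t : ℝ) ≤ c₀ * (L * L * (2 ^ L * 2 ^ L) * B) + c₁ * (L * (B * B) * V * 2 ^ L) →
      (t : ℝ) ≤ C * (n : ℝ) ^ (3 - δ) := by
  have hq0 : (0 : ℝ) < q := by exact_mod_cast hq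
  -- with `k` about `n ^ (1 / q)`, the saving `k ^ (-ε)` is about `n ^ (-2 * η)`, and a factor
  -- `n ^ η` of it pays for the logarithms
  set η := ε / (2 * q) with hη
  have hη0 : 0 < η := by positivity
  have hη1 : η ≤ 1 := by
    rw [hη, div_le_one (by positivity)]
    have : (1 : ℝ) ≤ q := by exact_mod_cast hq
    linarith
  have hηε : 2 * η * q = ε := by rw [hη]; field_simp
  obtain ⟨C, hC, hL2⟩ := exists_sq_le (r := (2 : ℝ) ^ η) (Real.one_lt_rpow (by norm_num) hη0)
  refine ⟨η, hη0, (c₀ + c₁ * |c₂|) * C * 16, ?_⟩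
  rintro L n B k t V hk hB hn hV ht
  have hkpos : (0 : ℝ) < k := by rw [hk]; positivity
  have hBr : (B : ℝ) = 2 ^ L / k := by
    rw [eq_div_iff hkpos.ne']; exact_mod_cast hB
  set x : ℝ := 2 ^ L with hx
  have hx0 : 0 < x := by positivity
  have hk1 : (1 : ℝ) ≤ k := by rw [hk]; exact_mod_cast Nat.one_le_two_pow
  -- the factor that is saved, up to logarithms, compared with the cubic time
  set z : ℝ := (k : ℝ) ^ (-ε) with hz
  have hz0 : 0 < z := by positivity
  have hkz : 1 / (k : ℝ) ≤ z := by
    rw [one_div, ← Real.rpow_neg_one]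
    exact Real.rpow_le_rpow_of_exponent_le hk1 (by linarith)
  have hzx : z ≤ 2 * ((2 : ℝ) ^ (-(2 * η) * L)) := by
    have h2 : (L : ℝ) ≤ (L / q : ℕ) * q + q := by
      have h3 := Nat.div_add_mod' L q
      have h4 := Nat.mod_lt L hq
      have : L ≤ L / q * q + q := by omega
      exact_mod_cast this
    calc z = (2 : ℝ) ^ (-(ε * (L / q : ℕ))) := by
          rw [hz, hk, Nat.cast_pow, ← Real.rpow_natCast, ← Real.rpow_mul (by norm_num)]
          push_cast
          ring_nf
      _ ≤ (2 : ℝ) ^ (1 + -(2 * η) * L) := by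
          refine Real.rpow_le_rpow_of_exponent_le (by norm_num) ?_
          have := mul_le_mul_of_nonneg_left h2 (by positivity : 0 ≤ 2 * η)
          nlinarith
      _ = _ := by rw [Real.rpow_add (by norm_num), Real.rpow_one]
  have hV' : (V : ℝ) ≤ |c₂| * (k ^ 2 * z) := by
    refine hV.trans ?_
    rw [sub_eq_add_neg, Real.rpow_add hkpos, Real.rpow_two]
    exact mul_le_mul_of_nonneg_right (le_abs_self _) (by positivity)
  have hLL : (L : ℝ) ≤ L ^ 2 := by exact_mod_cast Nat.le_self_pow (by norm_num) L
  have s0 : (L : ℝ) * L * (x * x) * B ≤ L ^ 2 * x ^ 3 * z := by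
    calc (L : ℝ) * L * (x * x) * B = L ^ 2 * x ^ 3 * (1 / k) := by rw [hBr]; field_simp
      _ ≤ _ := by gcongr
  have s1 : (L : ℝ) * (B * B) * V * x ≤ |c₂| * (L ^ 2 * x ^ 3 * z) := by
    calc (L : ℝ) * (B * B) * V * x ≤ L ^ 2 * (B * B) * (|c₂| * (k ^ 2 * z)) * x := by gcongr
      _ = _ := by rw [hBr]; field_simp
  have hlast : (L : ℝ) ^ 2 * x ^ 3 * z ≤ C * 16 * (n : ℝ) ^ (3 - η) := by
    have e1 : ((2 : ℝ) ^ η) ^ L = (2 : ℝ) ^ (η * L) := by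
      rw [← Real.rpow_natCast, ← Real.rpow_mul (by norm_num)]
    have e2 : x = (2 : ℝ) ^ (L : ℝ) := by rw [hx, Real.rpow_natCast]
    have h3 := hL2 L
    rw [e1] at h3
    have hxn : x ≤ 2 * n := by rw [hx]; exact_mod_cast hn
    calc (L : ℝ) ^ 2 * x ^ 3 * z
        ≤ (C * 2 ^ (η * L)) * x ^ 3 * (2 * ((2 : ℝ) ^ (-(2 * η) * L))) := by gcongr
      _ = C * 2 * x ^ (3 - η) := by
          have e3 : x ^ 3 = (2 : ℝ) ^ (3 * (L : ℝ)) := by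
            rw [e2, ← Real.rpow_natCast, ← Real.rpow_mul (by norm_num)]
            push_cast; ring_nf
          have e4 : x ^ (3 - η) = (2 : ℝ) ^ (η * L) * 2 ^ (3 * (L : ℝ)) * 2 ^ (-(2 * η) * L) := by
            rw [e2, ← Real.rpow_mul (by norm_num), ← Real.rpow_add (by norm_num),
              ← Real.rpow_add (by norm_num)]
            ring_nf
          rw [e4, e3]; ring
      _ ≤ C * 2 * (2 * n) ^ (3 - η) := by
          have : x ^ (3 - η) ≤ (2 * n : ℝ) ^ (3 - η) :=
            Real.rpow_le_rpow hx0.le hxn (by linarith)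
          gcongr
      _ = C * 2 * (2 : ℝ) ^ (3 - η) * (n : ℝ) ^ (3 - η) := by
          rw [Real.mul_rpow (by norm_num) (by positivity)]; ring
      _ ≤ C * 2 * 8 * (n : ℝ) ^ (3 - η) := by
          have : (2 : ℝ) ^ (3 - η) ≤ 8 := by
            calc (2 : ℝ) ^ (3 - η) ≤ (2 : ℝ) ^ (3 : ℝ) :=
                  Real.rpow_le_rpow_of_exponent_le (by norm_num) (by linarith)
              _ = 8 := by norm_num
          gcongr
      _ = _ := by ring
  calc (t : ℝ) ≤ c₀ * (L ^ 2 * x ^ 3 * z) + c₁ * (|c₂| * (L ^ 2 * x ^ 3 * z)) := by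
        refine ht.trans ?_
        gcongr
    _ = (c₀ + c₁ * |c₂|) * (L ^ 2 * x ^ 3 * z) := by ring
    _ ≤ (c₀ + c₁ * |c₂|) * (C * 16 * (n : ℝ) ^ (3 - η)) := by gcongr
    _ = _ := by ring

/-- The bounds for updates and queries imply that the time of a question about vectors of length `k`
is at most `k ^ (2 - ε)`, up to a constant factor. -/
lemma exists_bounds (C : ℝ) {δ : ℝ} (hδ : 0 < δ) (D : ℕ) : ∃ ε c₂ : ℝ, 0 < ε ∧ ε ≤ 1 ∧
    ∀ k : ℕ, 1 ≤ k → ∃ U V : ℕ, Bounds C (1 / 2 - δ) (1 - δ) (D * k ^ 2) U V ∧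
      ((4 * k * U + V : ℕ) : ℝ) ≤ c₂ * (k : ℝ) ^ (2 - ε) := by
  -- a smaller `δ` keeps the exponents nonnegative
  set d := min δ (1 / 4) with hd
  have hd0 : 0 < d := lt_min hδ (by norm_num)
  have hd4 : d ≤ 1 / 4 := min_le_right _ _
  have hdδ : d ≤ δ := min_le_left _ _
  refine ⟨2 * d, 5 * (|C| * (D + 1)) + 5, by positivity, by linarith, fun k hk => ?_⟩
  have hk1 : (1 : ℝ) ≤ k := by exact_mod_cast hk
  have hk0 : (0 : ℝ) ≤ k := by positivity
  set c := |C| * (D + 1) with hc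
  have hc0 : 0 ≤ c := by positivity
  have key : ∀ (a s : ℝ), 0 ≤ s → s ≤ 1 → a ≤ s → ∀ x : ℝ, 1 ≤ x → x ≤ (D * k ^ 2 : ℕ) →
      C * x ^ a ≤ c * (k : ℝ) ^ (2 * s) := by
    intro a s hs0 hs1 has x hx1 hx2
    have hx0 : 0 ≤ x := by linarith
    push_cast at hx2
    calc C * x ^ a ≤ |C| * x ^ s := by
          refine mul_le_mul (le_abs_self _) (Real.rpow_le_rpow_of_exponent_le hx1 has)
            (by positivity) (abs_nonneg _)
      _ ≤ |C| * ((D + 1) * k ^ 2 : ℝ) ^ s := by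
          refine mul_le_mul_of_nonneg_left (Real.rpow_le_rpow hx0 (hx2.trans ?_) hs0)
            (abs_nonneg _)
          gcongr; linarith
      _ = |C| * ((D + 1 : ℝ) ^ s * (k : ℝ) ^ (2 * s)) := by
          rw [Real.mul_rpow (by positivity) (by positivity), Real.rpow_mul hk0, Real.rpow_two]
      _ ≤ |C| * ((D + 1 : ℝ) * (k : ℝ) ^ (2 * s)) := by
          have : (D + 1 : ℝ) ^ s ≤ D + 1 := by
            conv_rhs => rw [← Real.rpow_one (D + 1 : ℝ)]
            exact Real.rpow_le_rpow_of_exponent_le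
              (by linarith [(Nat.cast_nonneg D : (0:ℝ) ≤ D)]) hs1
          gcongr
      _ = _ := by rw [hc]; ring
  refine ⟨⌈c * (k : ℝ) ^ (2 * (1 / 2 - d))⌉₊, ⌈c * (k : ℝ) ^ (2 * (1 - d))⌉₊,
    ⟨fun x h1 h2 => (key _ (1 / 2 - d) (by linarith) (by linarith) (by linarith) x h1 h2).trans
      (Nat.le_ceil _),
    fun x h1 h2 => (key _ (1 - d) (by linarith) (by linarith) (by linarith) x h1 h2).trans
      (Nat.le_ceil _)⟩, ?_⟩
  have u1 := (Nat.ceil_lt_add_one (a := c * (k : ℝ) ^ (2 * (1 / 2 - d))) (by positivity)).le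
  have u2 := (Nat.ceil_lt_add_one (a := c * (k : ℝ) ^ (2 * (1 - d))) (by positivity)).le
  have e1 : (k : ℝ) * (k : ℝ) ^ (2 * (1 / 2 - d)) = (k : ℝ) ^ (2 - 2 * d) := by
    conv_lhs => rw [← Real.rpow_one_add' hk0 (by linarith)]
    ring_nf
  have e2 : (2 : ℝ) * (1 - d) = 2 - 2 * d := by ring
  rw [e2] at u2
  have e3 : (k : ℝ) ≤ (k : ℝ) ^ (2 - 2 * d) := by
    conv_lhs => rw [← Real.rpow_one (k : ℝ)]
    exact Real.rpow_le_rpow_of_exponent_le hk1 (by linarith)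
  rw [e2]
  push_cast
  have u3 := mul_le_mul_of_nonneg_left u1 hk0
  have e4 : (k : ℝ) * (c * (k : ℝ) ^ (2 * (1 / 2 - d)) + 1) =
      c * (k : ℝ) ^ (2 - 2 * d) + k := by rw [← e1]; ring
  rw [e4] at u3
  have e5 : (5 * c + 5) * (k : ℝ) ^ (2 - 2 * d) =
      5 * (c * (k : ℝ) ^ (2 - 2 * d)) + 5 * (k : ℝ) ^ (2 - 2 * d) := by ring
  rw [e5]
  nlinarith

/-! ### The reduction -/

/-- Machines that answer questions in truly subquadratic time refute the conjecture. -/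
theorem not_conjecture {Q : Problem} (g : Gadget Q) {relE : Var → Var → Expr}
    (comp : Computes g.e g.rel relE) {A : Machine} {c K : ℕ} {C δ : ℝ} (hδ : 0 < δ)
    (sv : ∀ k N U V (hk : 1 ≤ k) (hN : N = 2 ^ g.e * k ^ 2),
      Bounds C (1 / 2 - δ) (1 - δ) ((g.D ^ 2 + 3 * 2 ^ g.e) * k ^ 2) U V → ∀ m,
      Nonempty (Service A (wordSize c N) k (hub k g.τ)
        (graphInput (slotGraph N k g.τ (g.rel k m) fun _ => !A.pol) (g.cm * k))
        (fun b => Q.answer (slotGraph N k g.τ (g.rel k m) b) (g.param k N hk hN))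
        (K * (N + 1) ^ K) (4 * k * U + V))) : ¬ OMv.Conjecture := by
  intro omv
  obtain ⟨ε, c₂, hε, hε1, hb⟩ := exists_bounds C hδ (g.D ^ 2 + 3 * 2 ^ g.e)
  obtain ⟨R, upd, qry, und, prep⟩ : ∃ R, A.upd.Below R ∧ A.qry.Below R ∧ A.und.Below R ∧
      A.prep.Below R := by
    obtain ⟨R₁, h1⟩ := A.upd.exists_below
    obtain ⟨R₂, h2⟩ := A.qry.exists_below
    obtain ⟨R₃, h3⟩ := A.und.exists_below
    obtain ⟨R₄, h4⟩ := A.prep.exists_below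
    exact ⟨R₁ + R₂ + R₃ + R₄, h1.mono (by omega), h2.mono (by omega), h3.mono (by omega),
      h4.mono (by omega)⟩
  set e := g.e with he
  set cP := K * (2 * 2 ^ e) ^ K with hcP
  set cV := ⌈|c₂|⌉₊ with hcV
  set g₁ := 2 * K + 2 with hg₁
  set g₂ := cP + 4 * cV with hg₂
  -- the blocks are so small that the preprocessing, polynomial in `k`, is cheap
  set q := 2 * K + 5 with hq
  set sW := c * (e + 3) + R + 2 * e + g₁ + g₂ + g.cm + 20 with hsW
  set cw := sW + q + e + c + g₁ + g₂ + 400 with hcw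
  set a := (adjE relE A.pol g.τ).cost with ha
  set c₀ := 72610000 + 3600 * 2 ^ g₂ + (a + 40) * 4 ^ e + 24000 * cP with hc₀
  obtain ⟨δ', hδ', C', hC'⟩ := exists_subcubic (q := q) (c₀ := c₀) (c₁ := 96000) (c₂ := c₂)
    (by omega) hε hε1 (by positivity) (by norm_num)
  refine omv δ' hδ' ⟨⟨prepProg q e c g₁ g₂ sW relE A R g.τ g.cm, mulProg A R g.τ⟩, cw, C', ?_⟩
  intro n hn M v
  set L := Nat.log 2 n + 1 with hL
  set k := 2 ^ (L / q) with hk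
  set N := 2 ^ (2 * (L / q) + e) with hNdef
  have hk1 : 1 ≤ k := Nat.one_le_two_pow
  have hN : N = 2 ^ e * k ^ 2 := by
    rw [hNdef, hk, pow_add, mul_comm (2 ^ (2 * (L / q))), mul_comm 2, pow_mul]
  obtain ⟨U, V, hUV, hV⟩ := hb k hk1
  let bl : ℕ → ℕ → ℕ → Bool := fun blk i j =>
    extMat M (blk / 2 ^ (L - L / q) * k + i) (blk % 2 ^ (L - L / q) * k + j)
  let X : Setup :=
    { n := n, k := k, B := 2 ^ (L - L / q), H := 2 ^ L, N := N, w' := wordSize c N, r := 120 * L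
      T := 2 ^ (L + (g₁ * (L / q) + g₂)), R := R, τ := g.τ, P := K * (N + 1) ^ K
      V := 4 * k * U + V, mach := A, mat := extMat M
      inp := fun blk =>
        graphInput (slotGraph N k g.τ (g.rel k (bl blk)) fun _ => !A.pol) (g.cm * k)
      f := fun blk b => Q.answer (slotGraph N k g.τ (g.rel k (bl blk)) b) (g.param k N hk1 hN)
      sv := fun blk => Classical.choice (sv k N U V hk1 hN hUV (bl blk)) }
  have s : X.Scale q e c g₁ g₂ L := ⟨hn, rfl, rfl, rfl, rfl, rfl, by
    show c * (Nat.log 2 N + 1) = _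
    rw [hNdef, Nat.log_pow (by norm_num)]
    ring, rfl, rfl⟩
  have S : X.Sound := ⟨fun blk _ b => g.spec k N (bl blk) b hk1 hN, fun a c h => by
    by_contra h'
    simp only [X, extMat, dif_neg h', Bool.false_eq_true] at h⟩
  have G : X.Input e g.cm g.rel relE := ⟨hN, fun blk => rfl, comp⟩
  have hP : X.P ≤ cP * k ^ (2 * K) := by
    have h1 : N + 1 ≤ 2 * N := by have : 0 < N := by positivity
                                  omega
    calc K * (N + 1) ^ K ≤ K * (2 * N) ^ K := by gcongr
      _ = _ := by rw [hN, hcP, pow_mul k, ← mul_assoc 2, mul_pow]; ring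
  have hVn : X.V ≤ cV * k ^ 2 := by
    have h2 : ((X.V : ℕ) : ℝ) ≤ (cV * k ^ 2 : ℕ) := by
      have h3 : (1 : ℝ) ≤ k := by exact_mod_cast hk1
      push_cast
      calc ((X.V : ℕ) : ℝ) ≤ c₂ * (k : ℝ) ^ (2 - ε) := hV
        _ ≤ |c₂| * (k : ℝ) ^ (2 : ℝ) := by
            refine mul_le_mul (le_abs_self _)
              (Real.rpow_le_rpow_of_exponent_le h3 (by linarith)) (by positivity) (abs_nonneg _)
        _ ≤ _ := by
            rw [Real.rpow_two]
            exact mul_le_mul_of_nonneg_right (Nat.le_ceil _) (by positivity)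
    exact_mod_cast h2
  have hT : X.P + X.V * (4 * X.n) ≤ X.T := by
    have h1 : k ^ (2 * K) ≤ k ^ g₁ := Nat.pow_le_pow_right hk1 (by omega)
    have h2 : k ^ 2 ≤ k ^ g₁ := Nat.pow_le_pow_right hk1 (by omega)
    have h3 : n ≤ 2 ^ L := s.n_lt.le
    have h4 : 1 ≤ 2 ^ L := Nat.one_le_two_pow
    calc X.P + X.V * (4 * n) ≤ cP * k ^ g₁ * 2 ^ L + cV * k ^ g₁ * (4 * 2 ^ L) := by
          refine Nat.add_le_add (hP.trans ?_) (Nat.mul_le_mul (hVn.trans ?_) (by omega))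
          · calc cP * k ^ (2 * K) ≤ cP * k ^ g₁ := Nat.mul_le_mul_left _ h1
              _ ≤ _ := Nat.le_mul_of_pos_right _ h4
          · exact Nat.mul_le_mul_left _ h2
      _ = g₂ * (k ^ g₁ * 2 ^ L) := by rw [hg₂]; ring
      _ ≤ 2 ^ g₂ * (k ^ g₁ * 2 ^ L) := Nat.mul_le_mul_right _ Nat.lt_two_pow_self.le
      _ = 2 ^ (L + (g₁ * (L / q) + g₂)) := by
          rw [hk, ← pow_mul, ← pow_add, ← pow_add]; congr 1; rw [mul_comm g₁]; omega
  let E : (ℕ → Fin (2 ^ wordSize cw n)) → Env := fun ω =>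
    ⟨wordSize cw n, 2 ^ (sW * L), ω, OMv.matrixInput M⟩
  have fits := fun ω => s.fits (E := E ω) (cm := g.cm) hsW hcw rfl rfl g.τ_le upd qry und prep hT
  let vec : ℕ → ℕ → Bool := fun i => if h : i < n then extVec (v ⟨i, h⟩) else fun _ => false
  have run : ∀ ω, ∃ σ t, Serves (wordSize cw n) ω (OMv.Algorithm.requests
      ⟨prepProg q e c g₁ g₂ sW relE A R g.τ g.cm, mulProg A R g.τ⟩ M v) σ t ∧
      ((∑ i ∈ Finset.range (n + 1), t i : ℕ) : ℝ) ≤ C' * (n : ℝ) ^ (3 - δ') ∧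
      (X.Good (E ω) vec → ∀ r i : Fin n, (σ (r + 2)).out i = (OMv.boolMulVec M (v r) i).toNat) := by
    intro ω
    obtain ⟨F, hcm, hlit, w1, w2, w3, w4, w5⟩ := fits ω
    have hp : ∀ h, WP { E ω with W := 1 } (paramProg q e c g₁ g₂ sW) h fun h' t => X.Vars h' ∧
        h'.var .W = (E ω).W ∧ h'.mem = h.mem ∧ h'.pos = h.pos ∧ t ≤ 20 * L + 200 := by
      intro h
      refine (wp_param (E := { E ω with W := 1 }) (h := h) hn hL (by simp [E, OMv.matrixInput]) w5
        hlit w1 w2 w3 w4).mono ?_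
      rintro h' t ⟨p, h1, h2, h3⟩
      exact ⟨⟨p.n, p.k, p.B, p.H, p.N, by rw [p.msk, s.w'], p.r, p.T⟩, p.W, h1, h2, h3⟩
    obtain ⟨σ₀, h₀, t₀, x₀, r₀, I₀, l₀⟩ := exec_prep hp F S G hcm
      fun i hi => matrixInput_eq M hi
    obtain ⟨σ, t, h1, h2, h3⟩ := Setup.exists_serves F S
      (A := ⟨prepProg q e c g₁ g₂ sW relE A R g.τ g.cm, mulProg A R g.τ⟩) rfl (n := n) rfl
      (M := M) (v := v) rfl (vec := vec) (fun i => by simp [vec]) x₀ r₀ I₀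
      (b₀ := 20 * L + 200 + 30 * (X.T * X.r) + 40 * (X.n * X.n) +
        X.B * X.B * (X.N * X.N * (a + 40) + 50 * X.r + 150) + 110)
      (by
        have e1 : a = (adjE relE X.mach.pol X.τ).cost := rfl
        rw [e1]
        omega)
    refine ⟨σ, t, h1, ?_, h3⟩
    have h4 := s.time_le (a := a) hP (by omega) (by omega) (by omega)
    refine hC' L n X.B k _ X.V rfl s.Bk s.pow_le hV ?_
    have h5 := h2.trans h4
    calc ((∑ i ∈ Finset.range (n + 1), t i : ℕ) : ℝ)
        ≤ ((c₀ * (L * L * (2 ^ L * 2 ^ L) * X.B) +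
          96000 * (L * (X.B * X.B) * X.V * 2 ^ L) : ℕ) : ℝ) := Nat.cast_le.2 h5
      _ = _ := by push_cast; ring
  refine ⟨fun ω => ?_, ?_⟩
  · obtain ⟨σ, t, h1, h2, -⟩ := run ω
    exact ⟨σ, t, h1, h2⟩
  · obtain ⟨F, -⟩ := fits fun _ => ⟨0, by positivity⟩
    refine (MeasureTheory.measure_mono (t := {ω | ¬ X.Good (E ω) vec}) fun ω h => ?_).trans
      ((Setup.not_good (s := 60 * L) F.hw.le
        (by show 120 * L = _; ring) vec).trans (error_le s.L_pos ?_))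
    · intro hgood
      obtain ⟨σ, t, h1, -, h3⟩ := run ω
      exact h ⟨σ, t, h1, h3 hgood⟩
    · calc X.n * (X.B * X.B) * 4 ≤ 2 ^ L * (2 ^ L * 2 ^ L) * 4 := by
            have h1 : X.B ≤ 2 ^ L := by
              rw [← s.Bk]; exact Nat.le_mul_of_pos_right _ hk1
            have := s.n_lt.le
            gcongr
        _ = _ := by rw [show 3 * L + 2 = L + (L + L) + 2 by omega, pow_add _ (L + (L + L)),
            pow_add _ L (L + L), pow_add _ L L]; rfl

/-- A gadget whose edges are computable by an expression makes the problem hard in all three models.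
-/
theorem hard_of_gadget {Q : Problem} (g : Gadget Q) {relE : Var → Var → Expr}
    (comp : Computes g.e g.rel relE) (omv : OMv.Conjecture) : Hard Q := by
  intro δ hδ
  refine ⟨?_, ?_, ?_⟩
  · rintro ⟨A, c, K, C, hC, hA⟩
    exact not_conjecture g comp hδ (fun k N U V hk hN hB m =>
      exists_service_partial g true (by simp) hC hA hk hN hB m) omv
  · rintro ⟨A, c, K, C, hC, hA⟩
    exact not_conjecture g comp hδ (fun k N U V hk hN hB m =>
      exists_service_partial g false (by simp) hC hA hk hN hB m) omv
  · rintro ⟨A, c, K, C, hC, hA⟩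
    exact not_conjecture g comp hδ (fun k N U V hk hN hB m =>
      exists_service_full g hC hA hk hN hB m) omv

end WordRAM

/-! ### The problems of the theorem -/

theorem mainTheorem2 (omv : OMv.Conjecture) :
    (DynGraph.Hard (DynGraph.detection DynGraph.paw) ∧
      DynGraph.Hard (DynGraph.detection DynGraph.diamond) ∧
      DynGraph.Hard (DynGraph.detection DynGraph.clique4) ∧
      ∀ k : ℕ, 3 ≤ k → DynGraph.Hard (DynGraph.detection (SimpleGraph.cycleGraph k))) ∧
    (DynGraph.Hard (DynGraph.detectionAt DynGraph.paw) ∧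
      DynGraph.Hard (DynGraph.detectionAt DynGraph.diamond) ∧
      DynGraph.Hard (DynGraph.detectionAt DynGraph.clique4) ∧
      ∀ k : ℕ, 3 ≤ k → Odd k → DynGraph.Hard (DynGraph.detectionAt (SimpleGraph.cycleGraph k))) ∧
    DynGraph.Hard (DynGraph.counting DynGraph.path3) ∧
    DynGraph.Hard (DynGraph.countingAt DynGraph.path3) := by
  have hard : ∀ {c e : ℕ} {P : SimpleGraph (Fin c)} {rel : ℕ → (ℕ → ℕ → Bool) → ℕ → ℕ → Prop}
      {relE : WordRAM.Var → WordRAM.Var → WordRAM.Expr}, DynGraph.Detects P e rel →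
      DynGraph.Shape e 4 rel → WordRAM.Computes e rel relE →
      DynGraph.Hard (DynGraph.detection P) ∧ DynGraph.Hard (DynGraph.detectionAt P) :=
    fun d s comp => ⟨WordRAM.hard_of_gadget (d.gadget s) comp omv,
      WordRAM.hard_of_gadget (d.gadgetAt s) comp omv⟩
  have direct : ∀ {c : ℕ} {P : SimpleGraph (Fin c)} {ext : ℕ → ℕ → ℕ → Prop}
      {extE : WordRAM.Var → WordRAM.Var → WordRAM.Expr},
      DynGraph.Detects P 2 (DynGraph.directRel ext) → DynGraph.Shape 2 4 (DynGraph.directRel ext) →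
      WordRAM.ComputesExt ext extE →
      DynGraph.Hard (DynGraph.detection P) ∧ DynGraph.Hard (DynGraph.detectionAt P) :=
    fun d s comp => hard d s (WordRAM.computes_direct le_rfl comp)
  have paw := direct DynGraph.detects_paw DynGraph.shape_paw WordRAM.computes_paw
  have diamond := direct DynGraph.detects_diamond DynGraph.shape_diamond WordRAM.computes_diamond
  have clique := direct DynGraph.detects_clique4 DynGraph.shape_clique WordRAM.computes_clique
  have cycle : ∀ k : ℕ, 3 ≤ k → DynGraph.Hard (DynGraph.detection (SimpleGraph.cycleGraph k)) ∧
      DynGraph.Hard (DynGraph.detectionAt (SimpleGraph.cycleGraph k)) := by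
    intro k hk
    rcases hk.eq_or_lt with rfl | hk
    · exact direct DynGraph.detects_triangle DynGraph.shape_no WordRAM.computes_no
    · obtain ⟨d, rfl⟩ : ∃ d, k = d + 2 := ⟨k - 2, by omega⟩
      exact hard (DynGraph.detects_cycle d (by omega)) (DynGraph.shape_path (by omega))
        (WordRAM.computes_path (by omega))
  exact ⟨⟨paw.1, diamond.1, clique.1, fun k hk => (cycle k hk).1⟩,
    ⟨paw.2, diamond.2, clique.2, fun k hk _ => (cycle k hk).2⟩,
    WordRAM.hard_of_gadget DynGraph.pathGadget
      (WordRAM.computes_direct le_rfl WordRAM.computes_no) omv,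
    WordRAM.hard_of_gadget DynGraph.pathGadgetAt
      (WordRAM.computes_direct le_rfl WordRAM.computes_no) omv⟩
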